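/- **Notation.** Functions on $\mathbb R^2$ are real- or complex-valued, and functions equal a.e. are identified. $\mathcal D$ is the set of dyadic intervals $I=[m2^{-k},(m+1)2^{-k})$, $k,m\in\mathbb Z$, and $\mathcal R=\mathcal D\times\mathcal D$ the set of dyadic rectangles of $\mathbb R^2$. For $I\in\mathcal D$ with left and right halves $I^-,I^+$ put $h_I=h_I^0=|I|^{-1/2}(\chi_{I^+}-\chi_{I^-})$ and $h_I^1=\chi_I/|I|$; for $R=I\times J$ and $\vec\varepsilon\in\{0,1\}^2$ put $h_R^{\vec\varepsilon}(s,t)=h_I^{\varepsilon_1}(s)h_J^{\varepsilon_2}(t)$, $h_R=h_R^{(0,0)}$ and $f_R=\langle f,h_R\rangle=\int f h_R$. $\mathrm{BMO}^d(\mathbb R^2)$ is the space of locally square integrable $f$ with $$\|f\|_{\mathrm{BMO}^d}^2=\sup_{\Omega}\frac1{|\Omega|}\sum_{R\in\mathcal R,\,R\subseteq\Omega}|f_R|^2<\infty,$$ the supremum being over open $\Omega\subset\mathbb R^2$ with $0<|\Omega|<\infty$, and $\mathrm{BMO}^d([0,1]^2)$ is the subspace of the $f$ with $\operatorname{supp}f\subseteq[0,1]^2$,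 with the same norm. $L^2_0([0,1]^2)$ is the space of $f\in L^2(\mathbb R^2)$ with $\operatorname{supp} f\subseteq[0,1]^2$, $\int f(s,t)\,dt=0$ for a.e. $s$ and $\int f(s,t)\,ds=0$ for a.e. $t$. For $\vec\beta\in\{0,1\}^2$ and $\vec k\in\mathbb N_0^2$ let $Q^{\vec\beta}_{\vec k}f=\sum f_{I\times J}\,h_{I\times J}$, the sum being over the $I\times J\in\mathcal R$ with $|I|\le 2^{-k_1}$ if $\beta_1=0$ and $|J|\le 2^{-k_2}$ if $\beta_2=0$ (no condition in a variable with $\beta_j=1$). Then $f\in\mathrm{LMO}^d_{\vec\beta}([0,1]^2)$ means that $f\in\mathrm{BMO}^d([0,1]^2)$ and there is a finite $C$ with $$\|Q^{\vec\beta}_{\vec k}f\|_{\mathrm{BMO}^d(\mathbb R^2)}\le C\prod_{j:\,\beta_j=0}\frac1{k_j+1}\qquad(\vec k\in\mathbb N_0^2);$$ the infimum of such $C$ is $\|f\|_{\mathrm{LMO}^d_{\vec\beta}([0,1]^2)}$. Write $\mathrm{LMO}^d=\mathrm{LMO}^d_{(0,0)}$. For $\vec\beta\in\{0,1\}^2$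 let $\delta_j=1-\beta_j$ and $$\Pi^{\vec\beta}_\phi b=\sum_{R\in\mathcal R}\phi_R\,\langle b,h_R^{\vec\delta}\rangle\,h_R^{\vec\beta},\qquad \Pi_\phi=\Pi_\phi^{(0,0)},\quad \Delta_\phi=\Pi_\phi^{(1,1)},$$ where $\Pi^{\vec\beta}_\phi b$ is the function $g\in L^2(\mathbb R^2)$ such that for every $Q\in\mathcal R$ the series tested against $h_Q$ converges unconditionally to $\langle g,h_Q\rangle$. That $\Pi^{\vec\beta}_\phi$ is bounded from $\mathrm{BMO}^d([0,1]^2)$ to $\mathrm{BMO}^d(\mathbb R^2)$ means that there is a finite $C$ such that for every $b\in\mathrm{BMO}^d([0,1]^2)$ this $g$ exists, lies in $\mathrm{BMO}^d(\mathbb R^2)$ and satisfies $\|g\|_{\mathrm{BMO}^d}\le C\|b\|_{\mathrm{BMO}^d}$; the infimum of such $C$ ($+\infty$ if there is none) is the operator norm $\|\Pi^{\vec\beta}_\phi\|$. **Theorem 5.1.** There is an absolute constant $C>0$ such that the following holds for every $\phi\in L^2_0([0,1]^2)$. 1. $\Pi_\phi:\mathrm{BMO}^d([0,1]^2)\to\mathrm{BMO}^d(\mathbb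 R^2)$ is bounded if and only if $\phi\in\mathrm{LMO}^d([0,1]^2)$. Moreover $C^{-1}\|\phi\|_{\mathrm{LMO}^d([0,1]^2)}\le\|\Pi_\phi\|\le C\|\phi\|_{\mathrm{LMO}^d([0,1]^2)}$. 2. $\Delta_\phi:\mathrm{BMO}^d([0,1]^2)\to\mathrm{BMO}^d(\mathbb R^2)$ is bounded if and only if $\phi\in\mathrm{BMO}^d([0,1]^2)$. Moreover $C^{-1}\|\phi\|_{\mathrm{BMO}^d}\le\|\Delta_\phi\|\le C\|\phi\|_{\mathrm{BMO}^d}$. 3. For $\vec\beta\in\{(0,1),(1,0)\}$, if $\phi\in\mathrm{LMO}^d_{\vec\beta}([0,1]^2)$, then $\Pi^{\vec\beta}_\phi:\mathrm{BMO}^d([0,1]^2)\to\mathrm{BMO}^d(\mathbb R^2)$ is bounded, and $\|\Pi^{\vec\beta}_\phi\|\le C\|\phi\|_{\mathrm{LMO}^d_{\vec\beta}([0,1]^2)}$. -/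

import Mathlib

open MeasureTheory
open scoped ENNReal NNReal

namespace DyadicParaproduct

noncomputable section

/-- A dyadic interval of the real line: the pair `(k, m)` of integers stands for
`[m 2⁻ᵏ, (m + 1) 2⁻ᵏ)`. -/
abbrev DyadicInterval : Type := ℤ × ℤ

namespace DyadicInterval

/-- The generation `k` of an interval of length `2⁻ᵏ`. -/
def gen (I : DyadicInterval) : ℤ := I.1

/-- The length `|I| = 2⁻ᵏ`. -/
def length (I : DyadicInterval) : ℝ := (2 : ℝ) ^ (-I.1)

/-- The interval as a set of reals. -/
def toSet (I : DyadicInterval) : Set ℝ :=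
  Set.Ico ((I.2 : ℝ) * I.length) (((I.2 : ℝ) + 1) * I.length)

/-- The left half of `I`. -/
def leftHalf (I : DyadicInterval) : DyadicInterval := (I.1 + 1, 2 * I.2)

/-- The right half of `I`. -/
def rightHalf (I : DyadicInterval) : DyadicInterval := (I.1 + 1, 2 * I.2 + 1)

/-- The Haar function `h_I = |I|^(-1/2) (χ_{I⁺} - χ_{I⁻})`, where `I⁺`, `I⁻` are the right and the
left half of `I`. -/
def haar (I : DyadicInterval) (x : ℝ) : ℝ :=
  (Real.sqrt I.length)⁻¹ *
    (I.rightHalf.toSet.indicator 1 x - I.leftHalf.toSet.indicator 1 x)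

/-- `h_I^0 = h_I` and `h_I^1 = |I|^(-1/2) |h_I|` (which is `χ_I / |I|`). -/
def haarType (e : Fin 2) (I : DyadicInterval) (x : ℝ) : ℝ :=
  if e = 0 then I.haar x else (Real.sqrt I.length)⁻¹ * |I.haar x|

end DyadicInterval

/-- A dyadic rectangle `R = I × J` of the plane. -/
abbrev DyadicRect : Type := DyadicInterval × DyadicInterval

/-- The rectangle as a subset of the plane. -/
def DyadicRect.toSet (R : DyadicRect) : Set (ℝ × ℝ) :=
  DyadicInterval.toSet R.1 ×ˢ DyadicInterval.toSet R.2

/-- `h_R^e (s, t) = h_I^{e₁}(s) h_J^{e₂}(t)` for `R = I × J` and `e = (e₁, e₂)`. -/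
def DyadicRect.haarType (e : Fin 2 × Fin 2) (R : DyadicRect) (x : ℝ × ℝ) : ℝ :=
  DyadicInterval.haarType e.1 R.1 x.1 * DyadicInterval.haarType e.2 R.2 x.2

variable {𝕜 : Type*} [RCLike 𝕜]

/-- The pairing `⟨f, h_R^e⟩`. For `e = (0, 0)` it is the Haar coefficient `f_R`; for `e = (1, 1)` it
is the mean `m_R f`. -/
def pairing (e : Fin 2 × Fin 2) (f : ℝ × ℝ → 𝕜) (R : DyadicRect) : 𝕜 :=
  ∫ x, f x * ((R.haarType e x : ℝ) : 𝕜)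

/-- The Haar coefficient `f_R = ⟨f, h_R⟩`. -/
def haarCoeff (f : ℝ × ℝ → 𝕜) (R : DyadicRect) : 𝕜 := pairing (0, 0) f R

/-- The dyadic product BMO norm of a (formal) Haar series `∑ c_R h_R`:
the square root of the supremum of `|Ω|⁻¹ ∑_{R ⊆ Ω} |c_R|²` over the open sets `Ω` of the plane with
`0 < |Ω| < ∞`. -/
def seqBMONorm (c : DyadicRect → 𝕜) : ℝ≥0∞ :=
  (⨆ (Ω : Set (ℝ × ℝ)) (_ : IsOpen Ω) (_ : 0 < volume Ω) (_ : volume Ω < ∞),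
    (volume Ω)⁻¹ * ∑' R : {R : DyadicRect // R.toSet ⊆ Ω}, ‖c R.1‖ₑ ^ 2) ^ (1 / 2 : ℝ)

/-- The norm of `BMO^d(ℝ²)`. -/
def bmoNorm (f : ℝ × ℝ → 𝕜) : ℝ≥0∞ := seqBMONorm (haarCoeff f)

/-- `f ∈ BMO^d(ℝ²)`: `f` is locally square integrable and its dyadic product BMO norm is finite. -/
def MemBMO (f : ℝ × ℝ → 𝕜) : Prop :=
  (∀ K : Set (ℝ × ℝ), IsCompact K → MemLp f 2 (volume.restrict K)) ∧ bmoNorm f < ∞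

/-- `supp f ⊆ [0,1]²`, for functions up to almost everywhere equality. -/
def SupportedInUnitSquare (f : ℝ × ℝ → 𝕜) : Prop :=
  ∀ᵐ x : ℝ × ℝ, x ∉ Set.Icc (0 : ℝ) 1 ×ˢ Set.Icc (0 : ℝ) 1 → f x = 0

/-- `f ∈ BMO^d([0,1]²)`. -/
def MemBMOUnit (f : ℝ × ℝ → 𝕜) : Prop := MemBMO f ∧ SupportedInUnitSquare f

/-- `f ∈ L²₀([0,1]²)`: `f` is square integrable, supported in `[0,1]²`, and its integral in each
variable vanishes for almost every value of the other one. -/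
def MemL20Unit (f : ℝ × ℝ → 𝕜) : Prop :=
  MemLp f 2 volume ∧ SupportedInUnitSquare f ∧
    (∀ᵐ s : ℝ, ∫ t : ℝ, f (s, t) = 0) ∧ (∀ᵐ t : ℝ, ∫ s : ℝ, f (s, t) = 0)

/-- The Haar coefficients of the projection `Q^β_k f`, the part of the Haar expansion of `f` over the
rectangles `I × J` with `|I| ≤ 2^(-k₁)` if `β₁ = 0` and `|J| ≤ 2^(-k₂)` if `β₂ = 0` (there is no
restriction in the variables with `β_j = 1`). Thus `β = (0,0)` gives `Q_k`, `β = (0,1)` gives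
`Q^{(1)}_{k₁}` and `β = (1,0)` gives `Q^{(2)}_{k₂}`. -/
def projCoeff (β : Fin 2 × Fin 2) (k : ℕ × ℕ) (f : ℝ × ℝ → 𝕜) (R : DyadicRect) : 𝕜 :=
  open Classical in
  if (β.1 = 0 → (k.1 : ℤ) ≤ DyadicInterval.gen R.1) ∧
      (β.2 = 0 → (k.2 : ℤ) ≤ DyadicInterval.gen R.2)
  then haarCoeff f R else 0

/-- The product of the numbers `k_j + 1` over those `j` with `β_j = 0`. -/
def lmoWeight (β : Fin 2 × Fin 2) (k : ℕ × ℕ) : ℝ≥0 :=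
  (if β.1 = 0 then (k.1 : ℝ≥0) + 1 else 1) * (if β.2 = 0 then (k.2 : ℝ≥0) + 1 else 1)

/-- `‖Q^β_k f‖_{BMO^d(ℝ²)} ≤ C / ∏_{β_j = 0} (k_j + 1)` for all `k`. -/
def LMOBound (β : Fin 2 × Fin 2) (f : ℝ × ℝ → 𝕜) (C : ℝ≥0) : Prop :=
  ∀ k : ℕ × ℕ, seqBMONorm (projCoeff β k f) ≤ ((C / lmoWeight β k : ℝ≥0) : ℝ≥0∞)

/-- `f ∈ LMO^d_β([0,1]²)`; for `β = (0,0)` this is `LMO^d([0,1]²)`. -/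
def MemLMOUnit (β : Fin 2 × Fin 2) (f : ℝ × ℝ → 𝕜) : Prop :=
  MemBMOUnit f ∧ ∃ C : ℝ≥0, LMOBound β f C

/-- The infimum of the constants in the definition of `LMO^d_β([0,1]²)` (infinite if there are
none). -/
def lmoNorm (β : Fin 2 × Fin 2) (f : ℝ × ℝ → 𝕜) : ℝ≥0∞ :=
  ⨅ (C : ℝ≥0) (_ : LMOBound β f C), (C : ℝ≥0∞)

/-- The type `δ` with `δ_j = 1` if `β_j = 0` and `δ_j = 0` if `β_j = 1`. -/
def dualType (β : Fin 2 × Fin 2) : Fin 2 × Fin 2 :=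
  (if β.1 = 0 then 1 else 0, if β.2 = 0 then 1 else 0)

/-- `g = Π^β_φ b = ∑_R φ_R ⟨b, h_R^δ⟩ h_R^β` (sum over all dyadic rectangles of the plane, `δ` the
type dual to `β`): `g` is in `L²(ℝ²)` and the series, tested against each Haar function `h_Q`,
converges unconditionally to `⟨g, h_Q⟩`. As the Haar functions are complete in `L²(ℝ²)`, there is at
most one such `g` up to almost everywhere equality. -/
def IsParaproduct (β : Fin 2 × Fin 2) (φ b g : ℝ × ℝ → 𝕜) : Prop :=
  MemLp g 2 volume ∧
    ∀ Q : DyadicRect,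
      HasSum
        (fun R : DyadicRect =>
          haarCoeff φ R * pairing (dualType β) b R *
            haarCoeff (fun x => ((R.haarType β x : ℝ) : 𝕜)) Q)
        (haarCoeff g Q)

/-- `Π^β_φ` maps `BMO^d([0,1]²)` to `BMO^d(ℝ²)` with
`‖Π^β_φ b‖_{BMO^d(ℝ²)} ≤ C ‖b‖_{BMO^d(ℝ²)}`. -/
def ParaproductBound (β : Fin 2 × Fin 2) (φ : ℝ × ℝ → 𝕜) (C : ℝ≥0) : Prop :=
  ∀ b : ℝ × ℝ → 𝕜, MemBMOUnit b →
    ∃ g : ℝ × ℝ → 𝕜, IsParaproduct β φ b g ∧ MemBMO g ∧ bmoNorm g ≤ C * bmoNorm b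

/-- `Π^β_φ : BMO^d([0,1]²) → BMO^d(ℝ²)` is bounded. -/
def ParaproductBounded (β : Fin 2 × Fin 2) (φ : ℝ × ℝ → 𝕜) : Prop :=
  ∃ C : ℝ≥0, ParaproductBound β φ C

/-- The operator norm of `Π^β_φ : BMO^d([0,1]²) → BMO^d(ℝ²)` (infinite if it is not bounded). -/
def paraproductNorm (β : Fin 2 × Fin 2) (φ : ℝ × ℝ → 𝕜) : ℝ≥0∞ :=
  ⨅ (C : ℝ≥0) (_ : ParaproductBound β φ C), (C : ℝ≥0∞)

end

end DyadicParaproduct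

set_option linter.unusedSectionVars false

/-! All bounds are proved in a finite model: the leaves of two binary trees of height `N` stand for
small dyadic squares, conditional averages (`EE`) for means over rectangles, and products of
martingale differences (`D1`, `D2`) for Haar coefficients. Product BMO becomes a Carleson condition
(`Carl` on the trees, `SeqCarl` in the plane), and every estimate is independent of `N`.

Upper bound for $\Pi_\phi$. The point is $\sum_{R\subseteq\Omega}|\phi_R|^2|m_Rb|^2\lesssim|\Omega|$
(`sum_mul_EE_sq_le`). Through a point of a set $A$ draw the maximal horizontal and vertical segments
in $A$. Call the point bad if the rectangle they span leaves the enlargement $B$ of $A$ by the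
one-variable maximal function. A covering argument in the spirit of Journé's lemma (`E_bad_le`)
shows that bad points have density at most $\delta$. Rectangles inside the hull of the bad set are
handled by iteration, the hull having at most a quarter of the size of $A$ (`le_of_exceptional`).
Every other rectangle in $A$ has at least half of its points good. At a good point the mean of $b$
splits into a coarse mean, which grows like the product of the two generations, two double
differences living inside $B$, which are controlled by BMO and the strong maximal function, and two
terms that are coarse in one variable and local in the other (`abs_EE_le_majorant`). The last ones
grow linearly in the coarse generation (`sum_halfLocal_le`). Cutting the generations into blocks
$2^a\le i+1<2^{a+1}$, the LMO decay gives the block the Carleson constant $4^{-a_1-a_2}$, and these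
weights sum exactly against the growth (`sum_majorant_le`).

Mixed paraproducts. The bilinear form against $f\in L^2$ pairs $|\phi_R|$ with a product of a
coefficient of $b$ and one of $f$. The duality between Carleson families and integrable square
functions (`Carl.sum_mul_le`) reduces it to a square function. This function factorizes into a part
from $b$, treated with the same good points, and a part from $f$ bounded by maximal functions of
martingale differences (`sum_mul_abs_mul_abs_le`). For $\Delta_\phi$ the Carleson embedding theorem
applied to $f$ is enough. In all cases duality and the Riesz–Fischer theorem turn the bilinear
estimate into the existence of $g$ and its BMO bound (`exists_isParaproduct`).

Necessity of LMO. For a rectangle $S$ of generation $(k_1,k_2)$ the product of the sums of the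
indicators of all dyadic ancestors of its sides in $[0,1)$ has BMO norm at most $2$, and its mean
over every $R\subseteq S$ is $(k_1+1)(k_2+1)$ (`exists_test_function`). Since $(\Pi_\phi
b)_R=\phi_R\,m_Rb$, boundedness gives the required decay inside $S$, and the rectangles $S$ of one
generation are disjoint.

Necessity of BMO for $\Delta_\phi$. Among finite families of rectangles take one, $\mathcal S$,
maximizing $q=|U|^{-1}\sum_{R\in\mathcal S}|\phi_R|^2$, where $U$ is its union. Maximality gives
$b=\sum_{R\in\mathcal S}\overline{\phi_R}h_R$ norm at most $\sqrt q$, and $\Delta_\phi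
b=\sum_{R\in\mathcal S}|\phi_R|^2\chi_R/|R|$ is supported in $U$ with integral $q|U|$. A function
supported in $U$ is controlled in $L^2$ by its Haar coefficients in a twofold enlargement of $U$
(`sum_sq_le_of_support`). Hence $q|U|\lesssim\|\Delta_\phi\|\sqrt q\,|U|$, that is,
$q\lesssim\|\Delta_\phi\|^2$ (`ParaproductBound.sum_le_of_extremal`). -/

namespace DyadicParaproduct

noncomputable section

/-! ### Finite filtrations: conditional averages, martingale differences, Doob's inequality. -/

/-- A finite filtration of a finite set: `cell i x` is the atom of generation `i` containing `x`. -/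
structure CellFiltration (X : Type*) [Fintype X] where
  cell : ℕ → X → Finset X
  mem_cell : ∀ i x, x ∈ cell i x
  cell_eq : ∀ i x y, y ∈ cell i x → cell i y = cell i x
  cell_succ : ∀ i x, cell (i + 1) x ⊆ cell i x
  depth : ℕ
  cell_depth : ∀ x, cell depth x = {x}

/-- The indicator of a proposition. -/
def ind (p : Prop) : ℝ := open Classical in if p then 1 else 0

@[simp] lemma ind_true : ind True = 1 := by simp [ind]

@[simp] lemma ind_false : ind False = 0 := by simp [ind]

lemma ind_of {p : Prop} (h : p) : ind p = 1 := by simp [ind, h]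

lemma ind_of_not {p : Prop} (h : ¬ p) : ind p = 0 := by simp [ind, h]

lemma ind_nonneg (p : Prop) : 0 ≤ ind p := by unfold ind; split_ifs <;> simp

lemma ind_le_one (p : Prop) : ind p ≤ 1 := by unfold ind; split_ifs <;> simp

lemma ind_mono {p q : Prop} (h : p → q) : ind p ≤ ind q := by
  by_cases hp : p
  · simp [ind_of hp, ind_of (h hp)]
  · simp [ind_of_not hp, ind_nonneg]

lemma ind_and (p q : Prop) : ind (p ∧ q) = ind p * ind q := by
  by_cases hp : p <;> by_cases hq : q <;> simp [hp, hq]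

lemma ind_sq (p : Prop) : ind p ^ 2 = ind p := by
  by_cases hp : p <;> simp [hp]

namespace CellFiltration

variable {X : Type*} [Fintype X] (C : CellFiltration X)

lemma cell_anti {i j : ℕ} (h : i ≤ j) (x : X) : C.cell j x ⊆ C.cell i x := by
  induction h with
  | refl => exact subset_rfl
  | step _ ih => exact (C.cell_succ _ x).trans ih

lemma cell_of_depth_le {i : ℕ} (h : C.depth ≤ i) (x : X) : C.cell i x = {x} := by
  apply subset_antisymm
  · rw [← C.cell_depth x]; exact C.cell_anti h x
  · simpa using C.mem_cell i x

lemma mem_cell_comm {i : ℕ} {x y : X} : y ∈ C.cell i x ↔ x ∈ C.cell i y := by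
  constructor
  · intro h; rw [C.cell_eq i x y h]; exact C.mem_cell i x
  · intro h; rw [C.cell_eq i y x h]; exact C.mem_cell i y

lemma card_cell_pos (i : ℕ) (x : X) : (0 : ℝ) < (C.cell i x).card := by
  exact_mod_cast Finset.card_pos.mpr ⟨x, C.mem_cell i x⟩

/-- The average of `f` over the cell of generation `i` containing `x`. -/
def E (i : ℕ) (f : X → ℝ) (x : X) : ℝ := (∑ y ∈ C.cell i x, f y) / (C.cell i x).card

lemma E_eq_of_mem {i : ℕ} {x y : X} (h : y ∈ C.cell i x) (f : X → ℝ) : C.E i f y = C.E i f x := by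
  unfold E; rw [C.cell_eq i x y h]

lemma E_congr {i : ℕ} {x : X} {f g : X → ℝ} (h : ∀ y ∈ C.cell i x, f y = g y) :
    C.E i f x = C.E i g x := by
  unfold E; rw [Finset.sum_congr rfl h]

lemma E_mono {i : ℕ} {x : X} {f g : X → ℝ} (h : ∀ y ∈ C.cell i x, f y ≤ g y) :
    C.E i f x ≤ C.E i g x :=
  div_le_div_of_nonneg_right (Finset.sum_le_sum h) (C.card_cell_pos i x).le

lemma E_const (i : ℕ) (c : ℝ) (x : X) : C.E i (fun _ => c) x = c := by
  have := (C.card_cell_pos i x).ne'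
  simp only [E, Finset.sum_const, nsmul_eq_mul]; field_simp

lemma E_nonneg {i : ℕ} {x : X} {f : X → ℝ} (h : ∀ y ∈ C.cell i x, 0 ≤ f y) : 0 ≤ C.E i f x := by
  have := C.E_mono (i := i) (x := x) (f := fun _ => 0) (g := f) h
  rwa [E_const] at this

lemma E_add (i : ℕ) (f g : X → ℝ) (x : X) :
    C.E i (fun y => f y + g y) x = C.E i f x + C.E i g x := by
  simp only [E, Finset.sum_add_distrib, add_div]

lemma E_sub (i : ℕ) (f g : X → ℝ) (x : X) :
    C.E i (fun y => f y - g y) x = C.E i f x - C.E i g x := by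
  simp only [E, Finset.sum_sub_distrib, sub_div]

lemma E_sum {ι : Type*} (s : Finset ι) (i : ℕ) (f : ι → X → ℝ) (x : X) :
    C.E i (fun y => ∑ a ∈ s, f a y) x = ∑ a ∈ s, C.E i (f a) x := by
  simp only [E]; rw [Finset.sum_comm, Finset.sum_div]

lemma E_mul_of_const {i : ℕ} {x : X} {f g : X → ℝ} (h : ∀ y ∈ C.cell i x, g y = g x) :
    C.E i (fun y => g y * f y) x = g x * C.E i f x := by
  unfold E
  rw [← mul_div_assoc, Finset.mul_sum]
  congr 1
  exact Finset.sum_congr rfl fun y hy => by simp only [h y hy]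

lemma E_const_mul (i : ℕ) (c : ℝ) (f : X → ℝ) (x : X) :
    C.E i (fun y => c * f y) x = c * C.E i f x :=
  C.E_mul_of_const (g := fun _ => c) (fun _ _ => rfl)

lemma E_of_const {i : ℕ} {x : X} {f : X → ℝ} (h : ∀ y ∈ C.cell i x, f y = f x) :
    C.E i f x = f x := by
  rw [C.E_congr (g := fun _ => f x) h, E_const]

lemma abs_E_le (i : ℕ) (f : X → ℝ) (x : X) : |C.E i f x| ≤ C.E i (fun y => |f y|) x := by
  unfold E
  rw [abs_div, abs_of_pos (C.card_cell_pos i x)]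
  exact div_le_div_of_nonneg_right (Finset.abs_sum_le_sum_abs _ _) (C.card_cell_pos i x).le

lemma E_of_depth_le {i : ℕ} (h : C.depth ≤ i) (f : X → ℝ) (x : X) : C.E i f x = f x := by
  simp [E, C.cell_of_depth_le h]

/-- Averaging over the cells of a stopping time does not change the sum. -/
lemma sum_E_index (S : Finset X) (τ : X → ℕ) (hS : ∀ y ∈ S, C.cell (τ y) y ⊆ S)
    (hτ : ∀ y ∈ S, ∀ z ∈ C.cell (τ y) y, τ z = τ y) (f : X → ℝ) :
    ∑ y ∈ S, C.E (τ y) f y = ∑ y ∈ S, f y := by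
  classical
  -- The stopping time is constant on each of its cells, so membership in stopping cells is
  -- symmetric and the double sum below can be transposed.
  have key : ∀ y ∈ S, ∀ z ∈ S, (z ∈ C.cell (τ y) y ↔ y ∈ C.cell (τ z) z) := by
    intro y hy z hz
    constructor
    · intro h; rw [hτ y hy z h]; exact C.mem_cell_comm.mp h
    · intro h; rw [hτ z hz y h]; exact C.mem_cell_comm.mp h
  calc ∑ y ∈ S, C.E (τ y) f y
      = ∑ y ∈ S, ∑ z ∈ S, if z ∈ C.cell (τ y) y then f z / (C.cell (τ y) y).card else 0 := by
        refine Finset.sum_congr rfl fun y hy => ?_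
        rw [← Finset.sum_filter, E, Finset.sum_div]
        refine Finset.sum_congr ?_ fun _ _ => rfl
        ext z; simp only [Finset.mem_filter]
        exact ⟨fun h => ⟨hS y hy h, h⟩, fun h => h.2⟩
    _ = ∑ z ∈ S, ∑ y ∈ S, if y ∈ C.cell (τ z) z then f z / (C.cell (τ z) z).card else 0 := by
        rw [Finset.sum_comm]
        refine Finset.sum_congr rfl fun z hz => Finset.sum_congr rfl fun y hy => ?_
        by_cases h : z ∈ C.cell (τ y) y
        · rw [if_pos h, if_pos ((key y hy z hz).mp h), hτ y hy z h, C.cell_eq _ _ _ h]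
        · rw [if_neg h, if_neg (fun h' => h ((key y hy z hz).mpr h'))]
    _ = ∑ z ∈ S, f z := by
        refine Finset.sum_congr rfl fun z hz => ?_
        rw [← Finset.sum_filter]
        have : S.filter (fun y => y ∈ C.cell (τ z) z) = C.cell (τ z) z := by
          ext y; simp only [Finset.mem_filter]
          exact ⟨fun h => h.2, fun h => ⟨hS z hz h, h⟩⟩
        rw [this, Finset.sum_const, nsmul_eq_mul]
        have := (C.card_cell_pos (τ z) z).ne'
        field_simp

lemma sum_E_of_closed (S : Finset X) (i : ℕ) (hS : ∀ y ∈ S, C.cell i y ⊆ S) (f : X → ℝ) :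
    ∑ y ∈ S, C.E i f y = ∑ y ∈ S, f y :=
  C.sum_E_index S (fun _ => i) hS (fun _ _ _ _ => rfl) f

lemma sum_E (i : ℕ) (f : X → ℝ) : ∑ y, C.E i f y = ∑ y, f y :=
  C.sum_E_of_closed Finset.univ i (fun _ _ => Finset.subset_univ _) f

lemma E_E_of_le {i j : ℕ} (h : i ≤ j) (f : X → ℝ) (x : X) : C.E i (C.E j f) x = C.E i f x := by
  have := C.sum_E_of_closed (C.cell i x) j ?_ f
  · rw [E, this]; rfl
  · intro y hy
    rw [← C.cell_eq i x y hy]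
    exact C.cell_anti h y

lemma E_E_of_ge {i j : ℕ} (h : j ≤ i) (f : X → ℝ) (x : X) : C.E i (C.E j f) x = C.E j f x :=
  C.E_of_const fun _ hy => C.E_eq_of_mem (C.cell_anti h x hy) f

lemma sum_mul_E_of_closed (S : Finset X) (i : ℕ) (hS : ∀ y ∈ S, C.cell i y ⊆ S) (f g : X → ℝ)
    (hg : ∀ x ∈ S, ∀ y ∈ C.cell i x, g y = g x) :
    ∑ y ∈ S, g y * C.E i f y = ∑ y ∈ S, g y * f y := by
  rw [← C.sum_E_of_closed S i hS (fun y => g y * f y)]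
  exact Finset.sum_congr rfl fun x hx => (C.E_mul_of_const (hg x hx)).symm

/-- Both sides equal the sum of the product of the two averages. -/
lemma sum_mul_E_comm (i : ℕ) (f g : X → ℝ) : ∑ y, C.E i f y * g y = ∑ y, f y * C.E i g y := by
  have h1 := C.sum_mul_E_of_closed Finset.univ i (fun _ _ => Finset.subset_univ _) g (C.E i f)
    (fun x _ y hy => C.E_eq_of_mem hy f)
  have h2 := C.sum_mul_E_of_closed Finset.univ i (fun _ _ => Finset.subset_univ _) f (C.E i g)
    (fun x _ y hy => C.E_eq_of_mem hy g)
  rw [← h1]; simp only [mul_comm (f _)]; rw [← h2]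
  exact Finset.sum_congr rfl fun _ _ => mul_comm _ _

/-- Jensen's inequality. -/
lemma E_sq_le (i : ℕ) (f : X → ℝ) (x : X) : C.E i f x ^ 2 ≤ C.E i (fun y => f y ^ 2) x := by
  have h : 0 ≤ C.E i (fun y => (f y - C.E i f x) ^ 2) x := C.E_nonneg fun _ _ => sq_nonneg _
  have e : C.E i (fun y => (f y - C.E i f x) ^ 2) x
      = C.E i (fun y => f y ^ 2) x - C.E i f x ^ 2 := by
    have : (fun y => (f y - C.E i f x) ^ 2)
        = fun y => (f y ^ 2 - (2 * C.E i f x) * f y) + C.E i f x ^ 2 := by ext; ring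
    rw [this, E_add, E_sub, E_const_mul, E_const]; ring
  linarith

/-- The martingale differences, with `D 0 = E 0`. -/
def D (i : ℕ) (f : X → ℝ) (x : X) : ℝ :=
  match i with
  | 0 => C.E 0 f x
  | i + 1 => C.E (i + 1) f x - C.E i f x

lemma D_zero (f : X → ℝ) (x : X) : C.D 0 f x = C.E 0 f x := rfl

lemma D_succ (i : ℕ) (f : X → ℝ) (x : X) : C.D (i + 1) f x = C.E (i + 1) f x - C.E i f x := rfl

lemma sum_D (k : ℕ) (f : X → ℝ) (x : X) : ∑ i ∈ Finset.range (k + 1), C.D i f x = C.E k f x := by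
  induction k with
  | zero => simp [D_zero]
  | succ k ih => rw [Finset.sum_range_succ, ih, D_succ]; ring

lemma sum_Ico_D {k n : ℕ} (h : k ≤ n) (f : X → ℝ) (x : X) :
    ∑ i ∈ Finset.Ico k n, C.D (i + 1) f x = C.E n f x - C.E k f x := by
  induction n, h using Nat.le_induction with
  | base => simp
  | succ n hn ih => rw [Finset.sum_Ico_succ_top hn, ih, D_succ]; ring

lemma D_eq_of_mem {i : ℕ} {x y : X} (h : y ∈ C.cell i x) (f : X → ℝ) : C.D i f y = C.D i f x := by
  cases i with
  | zero => exact C.E_eq_of_mem h f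
  | succ i => rw [D_succ, D_succ, C.E_eq_of_mem h, C.E_eq_of_mem (C.cell_succ i x h)]

lemma D_congr_fun {i : ℕ} {f g : X → ℝ} (h : ∀ y, f y = g y) (x : X) : C.D i f x = C.D i g x := by
  rw [funext h]

lemma D_sub (i : ℕ) (f g : X → ℝ) (x : X) :
    C.D i (fun y => f y - g y) x = C.D i f x - C.D i g x := by
  cases i with
  | zero => exact C.E_sub 0 f g x
  | succ i => simp only [D_succ, E_sub]; ring

lemma D_sum {ι : Type*} (s : Finset ι) (i : ℕ) (f : ι → X → ℝ) (x : X) :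
    C.D i (fun y => ∑ a ∈ s, f a y) x = ∑ a ∈ s, C.D i (f a) x := by
  cases i with
  | zero => exact C.E_sum s 0 f x
  | succ i => simp only [D_succ, E_sum, Finset.sum_sub_distrib]

lemma E_D_succ_self (i : ℕ) (f : X → ℝ) (x : X) : C.E i (C.D (i + 1) f) x = 0 := by
  have : C.D (i + 1) f = fun y => C.E (i + 1) f y - C.E i f y := rfl
  rw [this, E_sub, C.E_E_of_le (Nat.le_succ i), C.E_E_of_le le_rfl, sub_self]

lemma E_D_of_ge {i k : ℕ} (h : i ≤ k) (f : X → ℝ) (x : X) : C.E k (C.D i f) x = C.D i f x :=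
  C.E_of_const fun _ hy => C.D_eq_of_mem (C.cell_anti h x hy) f

/-- `f` is a martingale difference of generation `i`. -/
def IsDiff (i : ℕ) (f : X → ℝ) : Prop := (∀ x, C.E (i + 1) f x = f x) ∧ ∀ x, C.E i f x = 0

lemma isDiff_D (i : ℕ) (f : X → ℝ) : C.IsDiff i (C.D (i + 1) f) :=
  ⟨fun x => C.E_D_of_ge le_rfl f x, fun x => C.E_D_succ_self i f x⟩

lemma IsDiff.E_of_gt {C : CellFiltration X} {i k : ℕ} {f : X → ℝ} (hf : C.IsDiff i f) (h : i < k)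
    (x : X) : C.E k f x = f x := by
  have e : f = C.E (i + 1) f := funext fun y => (hf.1 y).symm
  rw [e, C.E_E_of_ge h]

lemma IsDiff.E_of_le {C : CellFiltration X} {i k : ℕ} {f : X → ℝ} (hf : C.IsDiff i f) (h : k ≤ i)
    (x : X) : C.E k f x = 0 := by
  rw [← C.E_E_of_le h, show C.E i f = fun _ => 0 from funext hf.2, E_const]

lemma IsDiff.D_succ_self {C : CellFiltration X} {i : ℕ} {f : X → ℝ} (hf : C.IsDiff i f) (x : X) :
    C.D (i + 1) f x = f x := by
  rw [D_succ, hf.1, hf.2, sub_zero]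

lemma IsDiff.D_of_ne {C : CellFiltration X} {i k : ℕ} {f : X → ℝ} (hf : C.IsDiff i f)
    (h : k ≠ i + 1) (x : X) : C.D k f x = 0 := by
  cases k with
  | zero => exact hf.E_of_le (Nat.zero_le i) x
  | succ k =>
    rw [D_succ]
    rcases lt_or_gt_of_ne (show k ≠ i by omega) with hk | hk
    · rw [hf.E_of_le (by omega), hf.E_of_le hk.le, sub_zero]
    · rw [hf.E_of_gt (by omega), hf.E_of_gt hk, sub_self]

/-- A multiplier constant on the cells of generation `i` passes through both averages. It is used
with indicators that a cell of generation `i` lies in a given set, so that cutting down an expansion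
keeps it a martingale difference expansion. -/
lemma IsDiff.mul {C : CellFiltration X} {i : ℕ} {f g : X → ℝ} (hf : C.IsDiff i f)
    (hg : ∀ x, ∀ y ∈ C.cell i x, g y = g x) : C.IsDiff i (fun x => g x * f x) := by
  refine ⟨fun x => ?_, fun x => ?_⟩
  · rw [C.E_mul_of_const fun y hy => hg x y (C.cell_succ i x hy), hf.1]
  · rw [C.E_mul_of_const (hg x), hf.2, mul_zero]

/-- The difference averages to zero on cells of generation `j`, where the coarser average is
constant, so the cross term vanishes over any union of such cells. -/
lemma sum_sq_succ (S : Finset X) (j : ℕ) (hS : ∀ y ∈ S, C.cell j y ⊆ S) (u : X → ℝ) :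
    ∑ y ∈ S, C.E (j + 1) u y ^ 2 = ∑ y ∈ S, C.E j u y ^ 2 + ∑ y ∈ S, C.D (j + 1) u y ^ 2 := by
  have h0 : ∑ y ∈ S, C.E j u y * C.D (j + 1) u y = 0 := by
    rw [← C.sum_mul_E_of_closed S j hS _ _ fun x _ y hy => C.E_eq_of_mem hy u]
    exact Finset.sum_eq_zero fun y _ => by rw [C.E_D_succ_self, mul_zero]
  have : ∀ y, C.E (j + 1) u y ^ 2
      = C.E j u y ^ 2 + C.D (j + 1) u y ^ 2 + 2 * (C.E j u y * C.D (j + 1) u y) := by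
    intro y; rw [D_succ]; ring
  simp only [this, Finset.sum_add_distrib, ← Finset.mul_sum, h0]; ring

/-- Orthogonality of the martingale differences over a union of cells. -/
lemma sum_sq_E (S : Finset X) {q n : ℕ} (hqn : q ≤ n) (hS : ∀ y ∈ S, C.cell q y ⊆ S) (u : X → ℝ) :
    ∑ y ∈ S, C.E n u y ^ 2
      = ∑ y ∈ S, C.E q u y ^ 2 + ∑ j ∈ Finset.Ico q n, ∑ y ∈ S, C.D (j + 1) u y ^ 2 := by
  induction n, hqn using Nat.le_induction with
  | base => simp
  | succ n hn ih =>
    rw [Finset.sum_Ico_succ_top hn,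
      C.sum_sq_succ S n (fun y hy => (C.cell_anti hn y).trans (hS y hy)), ih]; ring

lemma sum_sq_sub_E (S : Finset X) {q n : ℕ} (hqn : q ≤ n) (hn : C.depth ≤ n)
    (hS : ∀ y ∈ S, C.cell q y ⊆ S) (u : X → ℝ) :
    ∑ y ∈ S, (u y - C.E q u y) ^ 2 = ∑ j ∈ Finset.Ico q n, ∑ y ∈ S, C.D (j + 1) u y ^ 2 := by
  have h := C.sum_sq_E S hqn hS (fun y => u y - C.E q u y)
  have e0 : ∀ y, C.E q (fun y => u y - C.E q u y) y = 0 := fun y => by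
    rw [E_sub, C.E_E_of_le le_rfl, sub_self]
  have e1 : ∀ j ∈ Finset.Ico q n, ∀ y, C.D (j + 1) (fun y => u y - C.E q u y) y
      = C.D (j + 1) u y := fun j hj y => by
    have hj' := (Finset.mem_Ico.mp hj).1
    rw [D_sub, D_succ (f := C.E q u), C.E_E_of_ge (by omega), C.E_E_of_ge hj', sub_self, sub_zero]
  simp only [C.E_of_depth_le hn] at h
  rw [h]
  simp only [e0]
  rw [Finset.sum_congr rfl fun j hj => Finset.sum_congr rfl fun y _ => by rw [e1 j hj y]]
  simp

lemma sum_sq_D {n : ℕ} (hn : C.depth ≤ n) (u : X → ℝ) :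
    ∑ y, u y ^ 2 = ∑ j ∈ Finset.range (n + 1), ∑ y, C.D j u y ^ 2 := by
  have h := C.sum_sq_E Finset.univ (Nat.zero_le n) (fun _ _ => Finset.subset_univ _) u
  simp only [C.E_of_depth_le hn] at h
  rw [h, Finset.sum_range_succ', add_comm, Finset.range_eq_Ico]
  rfl

/-- The running maximum of the averages. -/
def runMax (f : X → ℝ) : ℕ → X → ℝ
  | 0 => C.E 0 f
  | i + 1 => fun x => max (runMax f i x) (C.E (i + 1) f x)

/-- The maximal function. -/
def M (f : X → ℝ) (x : X) : ℝ := C.runMax f C.depth x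

lemma E_le_runMax {i n : ℕ} (h : i ≤ n) (f : X → ℝ) (x : X) : C.E i f x ≤ C.runMax f n x := by
  induction n with
  | zero => obtain rfl : i = 0 := by omega
            exact le_rfl
  | succ n ih =>
    rcases Nat.lt_or_ge n i with hn | hn
    · obtain rfl : i = n + 1 := by omega
      exact le_max_right _ _
    · exact (ih hn).trans (le_max_left _ _)

lemma E_le_M (i : ℕ) (f : X → ℝ) (x : X) : C.E i f x ≤ C.M f x := by
  rcases le_total i C.depth with h | h
  · exact C.E_le_runMax h f x
  · rw [C.E_of_depth_le h, ← C.E_of_depth_le le_rfl f]; exact C.E_le_runMax le_rfl f x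

lemma le_M (f : X → ℝ) (x : X) : f x ≤ C.M f x := by
  rw [← C.E_of_depth_le le_rfl f x]; exact C.E_le_M _ f x

lemma exists_runMax (f : X → ℝ) (n : ℕ) (x : X) : ∃ i, C.runMax f n x = C.E i f x := by
  induction n with
  | zero => exact ⟨0, rfl⟩
  | succ n ih =>
    rcases max_choice (C.runMax f n x) (C.E (n + 1) f x) with h | h
    · obtain ⟨i, hi⟩ := ih; exact ⟨i, by rw [← hi]; exact h⟩
    · exact ⟨n + 1, h⟩

lemma exists_M (f : X → ℝ) (x : X) : ∃ i, C.M f x = C.E i f x := C.exists_runMax f _ x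

lemma M_nonneg {f : X → ℝ} (h : ∀ x, 0 ≤ f x) (x : X) : 0 ≤ C.M f x := (h x).trans (C.le_M f x)

lemma M_le_M {f g : X → ℝ} (h : ∀ x, f x ≤ g x) (x : X) : C.M f x ≤ C.M g x := by
  obtain ⟨i, hi⟩ := C.exists_M f x
  rw [hi]; exact (C.E_mono fun y _ => h y).trans (C.E_le_M i g x)

lemma runMax_eq_of_mem {n : ℕ} {x y : X} (h : y ∈ C.cell n x) (f : X → ℝ) :
    C.runMax f n y = C.runMax f n x := by
  induction n with
  | zero => exact C.E_eq_of_mem h f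
  | succ n ih =>
    change max _ _ = max _ _
    rw [ih (C.cell_succ n x h), C.E_eq_of_mem h]

/-- The running maximum grows only where it equals the new average, so its square grows by at most
twice that average times the increment. The increment is constant on the new cells, which allows the
average to be replaced by `f`, and the bounds telescope. -/
lemma sum_runMax_sq_le (f : X → ℝ) (n : ℕ) :
    ∑ x, C.runMax f n x ^ 2 ≤ 2 * ∑ x, f x * C.runMax f n x := by
  have hE : ∀ i (g : X → ℝ), (∀ x, ∀ y ∈ C.cell i x, g y = g x) →
      ∑ x, C.E i f x * g x = ∑ x, f x * g x := fun i g hg => by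
    rw [C.sum_mul_E_comm]
    exact Finset.sum_congr rfl fun x _ => by rw [C.E_of_const (hg x)]
  induction n with
  | zero =>
    have h0 : ∑ x, C.runMax f 0 x ^ 2 = ∑ x, f x * C.runMax f 0 x := by
      rw [← hE 0 (C.runMax f 0) fun x y hy => C.runMax_eq_of_mem hy f]
      exact Finset.sum_congr rfl fun x _ => sq _
    have : 0 ≤ ∑ x, C.runMax f 0 x ^ 2 := Finset.sum_nonneg fun _ _ => sq_nonneg _
    linarith
  | succ n ih =>
    have hpt : ∀ x, C.runMax f (n + 1) x ^ 2 - C.runMax f n x ^ 2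
        ≤ 2 * (C.E (n + 1) f x * (C.runMax f (n + 1) x - C.runMax f n x)) := by
      intro x
      change max (C.runMax f n x) (C.E (n + 1) f x) ^ 2 - _ ≤ 2 * (_ * (max _ _ - _))
      rcases le_total (C.E (n + 1) f x) (C.runMax f n x) with h | h
      · rw [max_eq_left h]; simp
      · rw [max_eq_right h]; nlinarith [sq_nonneg (C.E (n + 1) f x - C.runMax f n x)]
    have hs := Finset.sum_le_sum fun x (_ : x ∈ Finset.univ) => hpt x
    rw [Finset.sum_sub_distrib, ← Finset.mul_sum,
      hE (n + 1) (fun x => C.runMax f (n + 1) x - C.runMax f n x) fun x y hy => by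
        simp only [C.runMax_eq_of_mem hy, C.runMax_eq_of_mem (C.cell_succ n x hy)]] at hs
    simp only [mul_sub, Finset.sum_sub_distrib] at hs
    linarith

/-- Doob's `L²` maximal inequality. -/
lemma sum_M_sq_le (f : X → ℝ) : ∑ x, C.M f x ^ 2 ≤ 4 * ∑ x, f x ^ 2 := by
  have h1 : ∑ x, C.M f x ^ 2 ≤ 2 * ∑ x, f x * C.M f x := C.sum_runMax_sq_le f C.depth
  -- The constant is chosen so that half of the left side is absorbed.
  have h2 : 2 * ∑ x, f x * C.M f x ≤ 2 * ∑ x, f x ^ 2 + (1 / 2) * ∑ x, C.M f x ^ 2 := by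
    rw [Finset.mul_sum, Finset.mul_sum, Finset.mul_sum, ← Finset.sum_add_distrib]
    refine Finset.sum_le_sum fun x _ => ?_
    nlinarith [sq_nonneg (2 * f x - C.M f x)]
  linarith

end CellFiltration

end

end DyadicParaproduct

/-! ### Two-parameter averages, the strong maximal function and the Carleson embedding. -/

namespace DyadicParaproduct

noncomputable section

namespace CellFiltration

variable {X Y : Type*} [Fintype X] [Fintype Y] (P : CellFiltration X) (Q : CellFiltration Y)

/-- Averaging in the first variable. -/
def E1 (i : ℕ) (f : X → Y → ℝ) (x : X) (y : Y) : ℝ := P.E i (fun x' => f x' y) x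

/-- Averaging in the second variable. -/
def E2 (j : ℕ) (f : X → Y → ℝ) (x : X) (y : Y) : ℝ := Q.E j (f x) y

/-- Martingale differences in the first variable. -/
def D1 (i : ℕ) (f : X → Y → ℝ) (x : X) (y : Y) : ℝ := P.D i (fun x' => f x' y) x

/-- Martingale differences in the second variable. -/
def D2 (j : ℕ) (f : X → Y → ℝ) (x : X) (y : Y) : ℝ := Q.D j (f x) y

/-- Maximal function in the first variable. -/
def M1 (f : X → Y → ℝ) (x : X) (y : Y) : ℝ := P.M (fun x' => f x' y) x

/-- Maximal function in the second variable. -/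
def M2 (f : X → Y → ℝ) (x : X) (y : Y) : ℝ := Q.M (f x) y

/-- Averaging over rectangles. -/
def EE (i j : ℕ) (f : X → Y → ℝ) : X → Y → ℝ := E1 P i (E2 Q j f)

/-- The strong maximal function. -/
def MS (f : X → Y → ℝ) : X → Y → ℝ := M1 P (M2 Q f)

/-- The number of points of `A`. -/
def size (A : Set (X × Y)) : ℝ := ∑ x, ∑ y, ind ((x, y) ∈ A)

/-- The rectangle of generation `(i, j)` containing `(x, y)` is contained in `A`. -/
def Sub (i j : ℕ) (x : X) (y : Y) (A : Set (X × Y)) : Prop :=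
  ∀ x' ∈ P.cell i x, ∀ y' ∈ Q.cell j y, (x', y') ∈ A

lemma size_nonneg (A : Set (X × Y)) : 0 ≤ size A :=
  Finset.sum_nonneg fun _ _ => Finset.sum_nonneg fun _ _ => ind_nonneg _

variable {P Q}

lemma Sub.anti {i j k l : ℕ} {x : X} {y : Y} {A : Set (X × Y)} (h : Sub P Q i j x y A) (hk : i ≤ k)
    (hl : j ≤ l) : Sub P Q k l x y A :=
  fun x' hx y' hy => h x' (P.cell_anti hk x hx) y' (Q.cell_anti hl y hy)

lemma Sub.mem {i j : ℕ} {x : X} {y : Y} {A : Set (X × Y)} (h : Sub P Q i j x y A) : (x, y) ∈ A :=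
  h x (P.mem_cell i x) y (Q.mem_cell j y)

lemma Sub.of_mem {i j : ℕ} {x x' : X} {y y' : Y} {A : Set (X × Y)} (h : Sub P Q i j x y A)
    (hx : x' ∈ P.cell i x) (hy : y' ∈ Q.cell j y) : Sub P Q i j x' y' A := by
  unfold Sub; rwa [P.cell_eq i x x' hx, Q.cell_eq j y y' hy]

lemma sub_iff_of_mem {i j : ℕ} {x x' : X} {y y' : Y} {A : Set (X × Y)}
    (hx : x' ∈ P.cell i x) (hy : y' ∈ Q.cell j y) :
    Sub P Q i j x' y' A ↔ Sub P Q i j x y A := by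
  unfold Sub; rw [P.cell_eq i x x' hx, Q.cell_eq j y y' hy]

variable (P Q)

lemma EE_comm (i j : ℕ) (f : X → Y → ℝ) (x : X) (y : Y) : E1 P i (E2 Q j f) x y
    = E2 Q j (E1 P i f) x y := by
  simp only [E1, E2, E, Finset.sum_div]
  rw [Finset.sum_comm]
  exact Finset.sum_congr rfl fun _ _ => Finset.sum_congr rfl fun _ _ => by ring

lemma D1_E2 (i j : ℕ) (f : X → Y → ℝ) (x : X) (y : Y) : D1 P i (E2 Q j f) x y
    = E2 Q j (D1 P i f) x y := by
  cases i with
  | zero => exact EE_comm P Q 0 j f x y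
  | succ i =>
    have h1 := EE_comm P Q (i + 1) j f x y
    have h2 := EE_comm P Q i j f x y
    have h3 := Q.E_sub j (E1 P (i + 1) f x) (E1 P i f x) y
    simp only [E1, E2] at h1 h2 h3
    simp only [D1, E2, D_succ]
    rw [h1, h2]
    exact h3.symm

lemma E1_D2 (i j : ℕ) (f : X → Y → ℝ) (x : X) (y : Y) : E1 P i (D2 Q j f) x y
    = D2 Q j (E1 P i f) x y :=
  (D1_E2 Q P j i (fun y x => f x y) y x).symm

lemma D1_D2 (i j : ℕ) (f : X → Y → ℝ) (x : X) (y : Y) : D1 P i (D2 Q j f) x y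
    = D2 Q j (D1 P i f) x y := by
  cases j with
  | zero => exact D1_E2 P Q i 0 f x y
  | succ j =>
    have h1 := D1_E2 P Q i (j + 1) f x y
    have h2 := D1_E2 P Q i j f x y
    have h3 := P.D_sub i (fun x' => E2 Q (j + 1) f x' y) (fun x' => E2 Q j f x' y) x
    simp only [D1, E2] at h1 h2 h3
    simp only [D1, D2, D_succ]
    rw [h3, h1, h2]

lemma EE_mono {i j : ℕ} {x : X} {y : Y} {f g : X → Y → ℝ}
    (h : ∀ x' ∈ P.cell i x, ∀ y' ∈ Q.cell j y, f x' y' ≤ g x' y') :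
    EE P Q i j f x y ≤ EE P Q i j g x y :=
  P.E_mono fun x' hx => Q.E_mono fun y' hy => h x' hx y' hy

lemma EE_eq_of_mem {i j : ℕ} {x x' : X} {y y' : Y} (hx : x' ∈ P.cell i x) (hy : y' ∈ Q.cell j y)
    (f : X → Y → ℝ) : EE P Q i j f x' y' = EE P Q i j f x y := by
  have h1 : EE P Q i j f x' y' = EE P Q i j f x y' := P.E_eq_of_mem hx _
  rw [h1]
  exact P.E_congr fun z _ => Q.E_eq_of_mem hy _

lemma EE_const (i j : ℕ) (c : ℝ) (x : X) (y : Y) : EE P Q i j (fun _ _ => c) x y = c := by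
  simp only [EE, E1, E2, E_const]

lemma EE_const_mul (i j : ℕ) (c : ℝ) (f : X → Y → ℝ) (x : X) (y : Y) :
    EE P Q i j (fun x y => c * f x y) x y = c * EE P Q i j f x y := by
  simp only [EE, E1, E2, E_const_mul]

lemma EE_add (i j : ℕ) (f g : X → Y → ℝ) (x : X) (y : Y) :
    EE P Q i j (fun x y => f x y + g x y) x y = EE P Q i j f x y + EE P Q i j g x y := by
  simp only [EE, E1, E2, E_add]

lemma abs_EE_le (i j : ℕ) (f : X → Y → ℝ) (x : X) (y : Y) :
    |EE P Q i j f x y| ≤ EE P Q i j (fun x y => |f x y|) x y :=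
  (P.abs_E_le _ _ _).trans (P.E_mono fun _ _ => Q.abs_E_le _ _ _)

lemma EE_le_MS (i j : ℕ) (f : X → Y → ℝ) (x : X) (y : Y) : EE P Q i j f x y ≤ MS P Q f x y :=
  (P.E_mono fun _ _ => Q.E_le_M _ _ _).trans (P.E_le_M _ _ _)

lemma abs_EE_le_MS (i j : ℕ) (f : X → Y → ℝ) (x : X) (y : Y) :
    |EE P Q i j f x y| ≤ MS P Q (fun x y => |f x y|) x y :=
  (abs_EE_le P Q i j f x y).trans (EE_le_MS P Q i j _ x y)

lemma sum_M1_sq_le (f : X → Y → ℝ) : ∑ x, ∑ y, M1 P f x y ^ 2 ≤ 4 * ∑ x, ∑ y, f x y ^ 2 := by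
  rw [Finset.sum_comm, Finset.sum_comm (f := fun x y => f x y ^ 2), Finset.mul_sum]
  exact Finset.sum_le_sum fun y _ => P.sum_M_sq_le fun x => f x y

lemma sum_M2_sq_le (f : X → Y → ℝ) : ∑ x, ∑ y, M2 Q f x y ^ 2 ≤ 4 * ∑ x, ∑ y, f x y ^ 2 := by
  rw [Finset.mul_sum]
  exact Finset.sum_le_sum fun x _ => Q.sum_M_sq_le (f x)

lemma sum_MS_sq_le (f : X → Y → ℝ) : ∑ x, ∑ y, MS P Q f x y ^ 2 ≤ 16 * ∑ x, ∑ y, f x y ^ 2 := by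
  have h1 := sum_M1_sq_le P (M2 Q f)
  have h2 := sum_M2_sq_le Q f
  unfold MS; linarith

/-- The Carleson condition with constant `K` for the family `ν`, over the generations in `s`. -/
def Carl (s : Finset (ℕ × ℕ)) (K : ℝ) (ν : ℕ → ℕ → X → Y → ℝ) : Prop :=
  ∀ A : Set (X × Y),
    ∑ x, ∑ y, ∑ p ∈ s, ind (Sub P Q p.1 p.2 x y A) * ν p.1 p.2 x y ≤ K * size A

/-- The layer cake formula for a single number, which converts the weights in a Carleson sum into
level sets. -/
lemma intervalIntegral_ind_lt {u B : ℝ} (h0 : 0 ≤ u) (hB : u ≤ B) :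
    IntervalIntegrable (fun t => ind (t < u)) volume 0 B ∧ ∫ t in (0 : ℝ)..B, ind (t < u) = u := by
  have e : (fun t => ind (t < u)) = (Set.Iio u).indicator (fun _ => (1 : ℝ)) := by
    ext t; by_cases h : t < u <;> simp [h, Set.indicator]
  constructor
  · rw [e, intervalIntegrable_iff_integrableOn_Ioc_of_le (h0.trans hB)]
    exact (integrableOn_const (by simp)).indicator measurableSet_Iio
  · rw [e, intervalIntegral.integral_of_le (h0.trans hB),
      MeasureTheory.integral_indicator measurableSet_Iio, Measure.restrict_restrict measurableSet_Iio]
    have : Set.Iio u ∩ Set.Ioc 0 B = Set.Ioo 0 u := by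
      ext t; simp only [Set.mem_inter_iff, Set.mem_Iio, Set.mem_Ioc, Set.mem_Ioo]
      constructor
      · rintro ⟨h1, h2, h3⟩; exact ⟨h2, h1⟩
      · rintro ⟨h1, h2⟩; exact ⟨h2, h1, by linarith⟩
    rw [this]; simp [h0]

/-- The layer cake form of the Carleson embedding. -/
lemma Carl.sum_le {P : CellFiltration X} {Q : CellFiltration Y} {s : Finset (ℕ × ℕ)} {K : ℝ}
    {ν : ℕ → ℕ → X → Y → ℝ} (h : Carl P Q s K ν)
    (hν : ∀ i j x y, 0 ≤ ν i j x y) (G : ℕ → ℕ → X → Y → ℝ) (hG0 : ∀ i j x y, 0 ≤ G i j x y)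
    (hG : ∀ i j x y, ∀ x' ∈ P.cell i x, ∀ y' ∈ Q.cell j y, G i j x' y' = G i j x y)
    (H : X → Y → ℝ) (hH0 : ∀ x y, 0 ≤ H x y) (hGH : ∀ i j x y, G i j x y ≤ H x y) :
    ∑ x, ∑ y, ∑ p ∈ s, ν p.1 p.2 x y * G p.1 p.2 x y ≤ K * ∑ x, ∑ y, H x y := by
  -- Only a common upper bound of `H` is needed as the end point of the layer cake integral; the
  -- total sum is one.
  set B : ℝ := ∑ x, ∑ y, H x y with hBdef
  have hHB : ∀ x y, H x y ≤ B := fun x y =>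
    (Finset.single_le_sum (f := fun y => H x y) (fun y _ => hH0 x y) (Finset.mem_univ y)).trans
      (Finset.single_le_sum (f := fun x => ∑ y, H x y)
        (fun x _ => Finset.sum_nonneg fun y _ => hH0 x y) (Finset.mem_univ x))
  have hB0 : 0 ≤ B := Finset.sum_nonneg fun x _ => Finset.sum_nonneg fun y _ => hH0 x y
  have i1 : ∀ x y (p : ℕ × ℕ), IntervalIntegrable
      (fun t => ν p.1 p.2 x y * ind (t < G p.1 p.2 x y)) volume 0 B := fun x y p =>
    (intervalIntegral_ind_lt (hG0 _ _ _ _) ((hGH _ _ x y).trans (hHB x y))).1.const_mul _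
  have i2 : ∀ x y, IntervalIntegrable (fun t => ind (t < H x y)) volume 0 B := fun x y =>
    (intervalIntegral_ind_lt (hH0 _ _) (hHB x y)).1
  have i1s : ∀ x y, IntervalIntegrable
      (fun t => ∑ p ∈ s, ν p.1 p.2 x y * ind (t < G p.1 p.2 x y)) volume 0 B := fun x y => by
    simpa only [Finset.sum_fn] using IntervalIntegrable.sum s (fun p _ => i1 x y p)
  have i1x : ∀ x, IntervalIntegrable
      (fun t => ∑ y, ∑ p ∈ s, ν p.1 p.2 x y * ind (t < G p.1 p.2 x y)) volume 0 B := fun x => by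
    simpa only [Finset.sum_fn] using IntervalIntegrable.sum Finset.univ (fun y _ => i1s x y)
  have i1f : IntervalIntegrable
      (fun t => ∑ x, ∑ y, ∑ p ∈ s, ν p.1 p.2 x y * ind (t < G p.1 p.2 x y)) volume 0 B := by
    simpa only [Finset.sum_fn] using IntervalIntegrable.sum Finset.univ (fun x _ => i1x x)
  have i2x : ∀ x, IntervalIntegrable (fun t => ∑ y, ind (t < H x y)) volume 0 B := fun x => by
    simpa only [Finset.sum_fn] using IntervalIntegrable.sum Finset.univ (fun y _ => i2 x y)
  have i2f : IntervalIntegrable (fun t => ∑ x, ∑ y, ind (t < H x y)) volume 0 B := by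
    simpa only [Finset.sum_fn] using IntervalIntegrable.sum Finset.univ (fun x _ => i2x x)
  have e1 : ∑ x, ∑ y, ∑ p ∈ s, ν p.1 p.2 x y * G p.1 p.2 x y
      = ∫ t in (0 : ℝ)..B, ∑ x, ∑ y, ∑ p ∈ s, ν p.1 p.2 x y * ind (t < G p.1 p.2 x y) := by
    rw [intervalIntegral.integral_finsetSum fun x _ => i1x x]
    refine Finset.sum_congr rfl fun x _ => ?_
    rw [intervalIntegral.integral_finsetSum fun y _ => i1s x y]
    refine Finset.sum_congr rfl fun y _ => ?_
    rw [intervalIntegral.integral_finsetSum fun p _ => i1 x y p]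
    refine Finset.sum_congr rfl fun p _ => ?_
    rw [intervalIntegral.integral_const_mul,
      (intervalIntegral_ind_lt (hG0 _ _ _ _) ((hGH _ _ x y).trans (hHB x y))).2]
  have e2 : B = ∫ t in (0 : ℝ)..B, ∑ x, ∑ y, ind (t < H x y) := by
    rw [intervalIntegral.integral_finsetSum fun x _ => i2x x]
    refine Finset.sum_congr rfl fun x _ => ?_
    rw [intervalIntegral.integral_finsetSum fun y _ => i2 x y]
    exact Finset.sum_congr rfl fun y _ => (intervalIntegral_ind_lt (hH0 _ _) (hHB x y)).2.symm
  rw [e1]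
  conv_rhs => rw [e2]
  rw [← intervalIntegral.integral_const_mul]
  refine intervalIntegral.integral_mono_on hB0 i1f (i2f.const_mul K) fun t _ => ?_
  -- At level `t`, a rectangle with `t < G` lies in the level set of `H`, because `G` is constant on
  -- the rectangle and below `H`. The Carleson condition for that level set bounds the slice.
  refine le_trans ?_ (h {z | t < H z.1 z.2})
  refine Finset.sum_le_sum fun x _ => Finset.sum_le_sum fun y _ => Finset.sum_le_sum fun p _ => ?_
  rw [mul_comm]
  refine mul_le_mul_of_nonneg_right (ind_mono fun hlt x' hx y' hy => ?_) (hν _ _ _ _)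
  change t < H x' y'
  rw [← hG _ _ x y x' hx y' hy] at hlt
  exact hlt.trans_le (hGH _ _ _ _)

/-- The Carleson embedding theorem. -/
lemma Carl.embed {P : CellFiltration X} {Q : CellFiltration Y} {s : Finset (ℕ × ℕ)} {K : ℝ}
    {ν : ℕ → ℕ → X → Y → ℝ} (h : Carl P Q s K ν) (hK : 0 ≤ K) (hν : ∀ i j x y, 0 ≤ ν i j x y)
    (f : X → Y → ℝ) :
    ∑ x, ∑ y, ∑ p ∈ s, ν p.1 p.2 x y * EE P Q p.1 p.2 f x y ^ 2
      ≤ 16 * K * ∑ x, ∑ y, f x y ^ 2 := by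
  -- The majorant is the square of the strong maximal function; Doob's constant 4 in each variable
  -- gives 16.
  have h1 := h.sum_le hν (fun i j x y => EE P Q i j f x y ^ 2) (fun _ _ _ _ => sq_nonneg _)
    (fun i j x y x' hx y' hy => by rw [EE_eq_of_mem P Q hx hy])
    (fun x y => MS P Q (fun x y => |f x y|) x y ^ 2) (fun _ _ => sq_nonneg _)
    (fun i j x y => sq_le_sq.mpr ((abs_EE_le_MS P Q i j f x y).trans (le_abs_self _)))
  have h2 := sum_MS_sq_le P Q (fun x y => |f x y|)
  simp only [sq_abs] at h2
  nlinarith [mul_le_mul_of_nonneg_left h2 hK]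

/-- The double difference of averages. -/
def dd (k i q j : ℕ) (f : X → Y → ℝ) (x : X) (y : Y) : ℝ :=
  EE P Q i j f x y - EE P Q i q f x y - EE P Q k j f x y + EE P Q k q f x y

/-- Telescoping in both variables. The double difference therefore sees only martingale differences
over subrectangles of the rectangle of generation `(k, q)`. -/
lemma dd_eq_sum {k i q j : ℕ} (hk : k ≤ i) (hq : q ≤ j) (f : X → Y → ℝ) (x : X) (y : Y) :
    dd P Q k i q j f x y
      = ∑ i' ∈ Finset.Ico k i, ∑ j' ∈ Finset.Ico q j, D1 P (i' + 1) (D2 Q (j' + 1) f) x y := by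
  have h2 : ∀ x', ∑ j' ∈ Finset.Ico q j, D2 Q (j' + 1) f x' y = E2 Q j f x' y - E2 Q q f x' y :=
    fun x' => Q.sum_Ico_D hq (f x') y
  have h3 : ∀ i', ∑ j' ∈ Finset.Ico q j, D1 P (i' + 1) (D2 Q (j' + 1) f) x y
      = P.D (i' + 1) (fun x' => E2 Q j f x' y - E2 Q q f x' y) x := fun i' => by
    rw [← funext h2, D_sum]; rfl
  simp only [h3]
  rw [P.sum_Ico_D hk, E_sub, E_sub]
  simp only [dd, EE, E1]; ring

lemma abs_dd_le (k i q j : ℕ) (f : X → Y → ℝ) (x : X) (y : Y) :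
    |dd P Q k i q j f x y| ≤ 4 * MS P Q (fun x y => |f x y|) x y := by
  have h1 := abs_le.mp (abs_EE_le_MS P Q i j f x y)
  have h2 := abs_le.mp (abs_EE_le_MS P Q i q f x y)
  have h3 := abs_le.mp (abs_EE_le_MS P Q k j f x y)
  have h4 := abs_le.mp (abs_EE_le_MS P Q k q f x y)
  unfold dd; rw [abs_le]; constructor <;> linarith [h1.1, h1.2, h2.1, h2.2, h3.1, h3.2, h4.1, h4.2]

/-- The part of the martingale difference expansion of `b` over the rectangles contained in `A`. -/
def projOn (n : ℕ) (A : Set (X × Y)) (b : X → Y → ℝ) (x : X) (y : Y) : ℝ :=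
  ∑ i ∈ Finset.range n, ∑ j ∈ Finset.range n,
    ind (Sub P Q i j x y A) * D1 P (i + 1) (D2 Q (j + 1) b) x y

/-- Whether the rectangle of generation `(i, j)` lies in `A` depends on `x` only through its cell of
generation `i`. -/
lemma isDiff_projOn_fst (i j : ℕ) (A : Set (X × Y)) (b : X → Y → ℝ) (y : Y) :
    P.IsDiff i fun x => ind (Sub P Q i j x y A) * D1 P (i + 1) (D2 Q (j + 1) b) x y :=
  (P.isDiff_D i fun x => D2 Q (j + 1) b x y).mul (g := fun x => ind (Sub P Q i j x y A))
    fun x x' hx => by simp only [sub_iff_of_mem hx (Q.mem_cell j y)]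

lemma isDiff_projOn_snd (i j : ℕ) (A : Set (X × Y)) (b : X → Y → ℝ) (x : X) :
    Q.IsDiff j fun y => ind (Sub P Q i j x y A) * D1 P (i + 1) (D2 Q (j + 1) b) x y := by
  simp only [D1_D2]
  exact (Q.isDiff_D j (D1 P (i + 1) b x)).mul (g := fun y => ind (Sub P Q i j x y A))
    fun y y' hy => by simp only [sub_iff_of_mem (P.mem_cell i x) hy]

lemma D2_succ_projOn {n j : ℕ} (hj : j < n) (A : Set (X × Y)) (b : X → Y → ℝ) (x : X) (y : Y) :
    D2 Q (j + 1) (projOn P Q n A b) x y = ∑ i ∈ Finset.range n,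
      ind (Sub P Q i j x y A) * D1 P (i + 1) (D2 Q (j + 1) b) x y := by
  have : projOn P Q n A b x = fun y => ∑ i ∈ Finset.range n, ∑ j ∈ Finset.range n,
    ind (Sub P Q i j x y A) * D1 P (i + 1) (D2 Q (j + 1) b) x y := rfl
  rw [D2, this, D_sum]
  refine Finset.sum_congr rfl fun i _ => ?_
  rw [D_sum, Finset.sum_eq_single j]
  · exact (isDiff_projOn_snd P Q i j A b x).D_succ_self y
  · exact fun j' _ hne => (isDiff_projOn_snd P Q i j' A b x).D_of_ne (by omega) y
  · exact fun h => absurd (Finset.mem_range.mpr hj) h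

lemma D2_zero_projOn (n : ℕ) (A : Set (X × Y)) (b : X → Y → ℝ) (x : X) (y : Y) :
    D2 Q 0 (projOn P Q n A b) x y = 0 := by
  have : projOn P Q n A b x = fun y => ∑ i ∈ Finset.range n, ∑ j ∈ Finset.range n,
    ind (Sub P Q i j x y A) * D1 P (i + 1) (D2 Q (j + 1) b) x y := rfl
  rw [D2, this, D_sum]
  refine Finset.sum_eq_zero fun i _ => ?_
  rw [D_sum]
  exact Finset.sum_eq_zero fun j _ => (isDiff_projOn_snd P Q i j A b x).D_of_ne (by omega) y

lemma D1_D2_projOn {n i j : ℕ} (hi : i < n) (hj : j < n) (A : Set (X × Y)) (b : X → Y → ℝ)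
    (x : X) (y : Y) : D1 P (i + 1) (D2 Q (j + 1) (projOn P Q n A b)) x y
      = ind (Sub P Q i j x y A) * D1 P (i + 1) (D2 Q (j + 1) b) x y := by
  rw [D1, funext fun x' => D2_succ_projOn P Q hj A b x' y, D_sum, Finset.sum_eq_single i]
  · exact (isDiff_projOn_fst P Q i j A b y).D_succ_self x
  · exact fun i' _ hne => (isDiff_projOn_fst P Q i' j A b y).D_of_ne (by omega) x
  · exact fun h => absurd (Finset.mem_range.mpr hi) h

lemma D1_zero_D2_projOn {n j : ℕ} (hj : j < n) (A : Set (X × Y)) (b : X → Y → ℝ)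
    (x : X) (y : Y) : D1 P 0 (D2 Q (j + 1) (projOn P Q n A b)) x y = 0 := by
  rw [D1, funext fun x' => D2_succ_projOn P Q hj A b x' y, D_sum]
  exact Finset.sum_eq_zero fun i' _ => (isDiff_projOn_fst P Q i' j A b y).D_of_ne (by omega) x

/-- Orthogonality of the martingale differences in two variables. -/
lemma sum_sq_D1_D2 {n : ℕ} (hP : P.depth ≤ n) (hQ : Q.depth ≤ n) (f : X → Y → ℝ) :
    ∑ x, ∑ y, f x y ^ 2 = ∑ k ∈ Finset.range (n + 1), ∑ l ∈ Finset.range (n + 1),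
      ∑ x, ∑ y, D1 P k (D2 Q l f) x y ^ 2 := by
  calc ∑ x, ∑ y, f x y ^ 2 = ∑ x, ∑ l ∈ Finset.range (n + 1), ∑ y, D2 Q l f x y ^ 2 :=
        Finset.sum_congr rfl fun x _ => Q.sum_sq_D hQ (f x)
    _ = ∑ l ∈ Finset.range (n + 1), ∑ y, ∑ x, D2 Q l f x y ^ 2 := by
        rw [Finset.sum_comm]; exact Finset.sum_congr rfl fun l _ => Finset.sum_comm
    _ = ∑ l ∈ Finset.range (n + 1), ∑ y, ∑ k ∈ Finset.range (n + 1),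
          ∑ x, D1 P k (D2 Q l f) x y ^ 2 :=
        Finset.sum_congr rfl fun l _ => Finset.sum_congr rfl fun y _ =>
          P.sum_sq_D hP fun x => D2 Q l f x y
    _ = _ := by
        rw [Finset.sum_comm (s := Finset.range (n + 1)) (t := Finset.range (n + 1))]
        refine Finset.sum_congr rfl fun l _ => ?_
        rw [Finset.sum_comm]
        exact Finset.sum_congr rfl fun k _ => Finset.sum_comm

lemma sum_sq_projOn {n : ℕ} (hP : P.depth ≤ n) (hQ : Q.depth ≤ n) (A : Set (X × Y))
    (b : X → Y → ℝ) : ∑ x, ∑ y, projOn P Q n A b x y ^ 2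
      = ∑ i ∈ Finset.range n, ∑ j ∈ Finset.range n,
        ∑ x, ∑ y, ind (Sub P Q i j x y A) * D1 P (i + 1) (D2 Q (j + 1) b) x y ^ 2 := by
  rw [sum_sq_D1_D2 P Q hP hQ, Finset.sum_range_succ', Finset.sum_eq_zero (s := Finset.range (n + 1))
    (f := fun l => ∑ x, ∑ y, D1 P 0 (D2 Q l (projOn P Q n A b)) x y ^ 2), add_zero]
  · refine Finset.sum_congr rfl fun i hi => ?_
    rw [Finset.sum_range_succ', Finset.sum_eq_zero (s := Finset.univ), add_zero]
    · refine Finset.sum_congr rfl fun j hj => Finset.sum_congr rfl fun x _ =>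
        Finset.sum_congr rfl fun y _ => ?_
      rw [D1_D2_projOn P Q (Finset.mem_range.mp hi) (Finset.mem_range.mp hj), mul_pow, ind_sq]
    · refine fun x _ => Finset.sum_eq_zero fun y _ => ?_
      have : D2 Q 0 (projOn P Q n A b) = fun x y => 0 :=
        funext fun x => funext fun y => D2_zero_projOn P Q n A b x y
      rw [this, D1, D_succ, E_const, E_const]; simp
  · intro l hl
    refine Finset.sum_eq_zero fun x _ => Finset.sum_eq_zero fun y _ => ?_
    rcases l with _ | l
    · have : D2 Q 0 (projOn P Q n A b) = fun x y => 0 :=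
        funext fun x => funext fun y => D2_zero_projOn P Q n A b x y
      rw [this, D1, D_zero, E_const]; simp
    · rw [D1_zero_D2_projOn P Q (by have := Finset.mem_range.mp hl; omega)]; simp

/-- All rectangles entering the double difference lie in the one of generation `(k, q)`, hence in
`A`, and the projection keeps their contributions. This localizes `b` to a set where the BMO
condition gives an `L²` bound. -/
lemma dd_projOn {n k i q j : ℕ} (hk : k ≤ i) (hi : i ≤ n) (hq : q ≤ j) (hj : j ≤ n)
    {A : Set (X × Y)} {x : X} {y : Y} (h : Sub P Q k q x y A) (b : X → Y → ℝ) :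
    dd P Q k i q j (projOn P Q n A b) x y = dd P Q k i q j b x y := by
  rw [dd_eq_sum P Q hk hq, dd_eq_sum P Q hk hq]
  refine Finset.sum_congr rfl fun i' hi' => Finset.sum_congr rfl fun j' hj' => ?_
  rw [Finset.mem_Ico] at hi' hj'
  rw [D1_D2_projOn P Q (by omega) (by omega), ind_of (h.anti hi'.1 hj'.1), one_mul]

end CellFiltration

end

end DyadicParaproduct

/-! ### Stopping segments, bad points and the removal of exceptional sets. -/

namespace DyadicParaproduct

noncomputable section

namespace CellFiltration

section Stop

variable {X : Type*} [Fintype X] (C : CellFiltration X)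

/-- The generation of the largest cell containing `x` and contained in `S`. -/
def stopIdx (S : Set X) (x : X) : ℕ := sInf {i | ∀ z ∈ C.cell i x, z ∈ S}

variable {C} {S : Set X} {x : X}

lemma stop_spec (hx : x ∈ S) : ∀ z ∈ C.cell (C.stopIdx S x) x, z ∈ S :=
  Nat.sInf_mem (s := {i | ∀ z ∈ C.cell i x, z ∈ S})
    ⟨C.depth, fun z hz => by rw [C.cell_depth, Finset.mem_singleton] at hz; rwa [hz]⟩

lemma stop_le {i : ℕ} (h : ∀ z ∈ C.cell i x, z ∈ S) : C.stopIdx S x ≤ i := Nat.sInf_le h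

/-- Maximal cells contained in `S` are equal or disjoint. -/
lemma stop_eq_of_mem (hx : x ∈ S) {z : X} (hz : z ∈ C.cell (C.stopIdx S x) x) :
    C.stopIdx S z = C.stopIdx S x := by
  have h1 : C.stopIdx S z ≤ C.stopIdx S x := stop_le (by rw [C.cell_eq _ _ _ hz]; exact stop_spec hx)
  have hzS := stop_spec hx z hz
  have hxz : x ∈ C.cell (C.stopIdx S z) z := C.cell_anti h1 z (C.mem_cell_comm.mp hz)
  exact le_antisymm h1 (stop_le (by rw [C.cell_eq _ _ _ hxz]; exact stop_spec hzS))

/-- The maximal cells contained in `S` partition it. -/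
lemma sum_ind_mul_E_stopIdx (S : Set X) (f : X → ℝ) :
    ∑ x, ind (x ∈ S) * C.E (C.stopIdx S x) f x = ∑ x, ind (x ∈ S) * f x := by
  classical
  have h := C.sum_E_index (Finset.univ.filter (· ∈ S)) (C.stopIdx S)
    (fun y hy z hz => by
      simp only [Finset.mem_filter, Finset.mem_univ, true_and] at hy ⊢
      exact stop_spec hy z hz)
    (fun y hy z hz => by
      simp only [Finset.mem_filter, Finset.mem_univ, true_and] at hy
      exact stop_eq_of_mem hy hz) f
  rw [Finset.sum_filter, Finset.sum_filter] at h
  simpa [ind] using h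

end Stop

variable {X Y : Type*} [Fintype X] [Fintype Y] (P : CellFiltration X) (Q : CellFiltration Y)

/-- The generation of the largest `I × {y} ⊆ A` with `x ∈ I`. -/
def stopX (A : Set (X × Y)) (x : X) (y : Y) : ℕ := P.stopIdx {x' | (x', y) ∈ A} x

/-- The generation of the largest `{x} × J ⊆ A` with `y ∈ J`. -/
def stopY (A : Set (X × Y)) (x : X) (y : Y) : ℕ := Q.stopIdx {y' | (x, y') ∈ A} y

/-- The enlargement of `A` by the maximal function in the first variable. -/
def enl (δ : ℝ) (A : Set (X × Y)) : Set (X × Y) :=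
  {z | δ < M1 P (fun x y => ind ((x, y) ∈ A)) z.1 z.2}

/-- The points of `A` whose maximal horizontal and vertical segments span a rectangle that is not
contained in the enlargement of `A`. -/
def bad (δ : ℝ) (A : Set (X × Y)) : Set (X × Y) :=
  {z | z ∈ A ∧ ¬ Sub P Q (stopX P A z.1 z.2) (stopY Q A z.1 z.2) z.1 z.2 (enl P δ A)}

/-- Chebyshev's inequality at level `δ` combined with Doob's constant 4. -/
lemma size_enl_le {δ : ℝ} (hδ : 0 < δ) (A : Set (X × Y)) :
    size (enl P δ A) ≤ 4 / δ ^ 2 * size A := by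
  have h1 := sum_M1_sq_le P (fun x y => ind ((x, y) ∈ A))
  have h2 : δ ^ 2 * size (enl P δ A) ≤ ∑ x, ∑ y, M1 P (fun x y => ind ((x, y) ∈ A)) x y ^ 2 := by
    rw [size, Finset.mul_sum]
    refine Finset.sum_le_sum fun x _ => ?_
    rw [Finset.mul_sum]
    refine Finset.sum_le_sum fun y _ => ?_
    by_cases h : (x, y) ∈ enl P δ A
    · rw [ind_of h, mul_one]
      exact pow_le_pow_left₀ hδ.le (le_of_lt h) 2
    · rw [ind_of_not h, mul_zero]; exact sq_nonneg _
  simp only [ind_sq] at h1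
  have h3 : δ ^ 2 * size (enl P δ A) ≤ 4 * size A := h2.trans h1
  rw [div_mul_eq_mul_div, le_div_iff₀ (by positivity)]; linarith

/-- The covering argument. On the maximal horizontal segment `I` of `A` through `(x, y)`, let `s` be
the bad point whose vertical segment `J` is shortest. Since `I × J` leaves the enlargement, some
height `t1` in `J` is such that `A` has density at most `δ` in `I × {t1}`. Every other bad point of
the segment has a vertical segment containing `J`, so the point of `A` at height `t1` above or below
it is available: bad points inject into `A` at that height. -/
lemma E_bad_le {δ : ℝ} (hδ : 0 < δ) (A : Set (X × Y)) {x : X} {y : Y} (hxy : (x, y) ∈ A) :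
    P.E (stopX P A x y) (fun x' => ind ((x', y) ∈ bad P Q δ A)) x ≤ δ := by
  classical
  set τ := stopX P A x y with hτ
  by_cases hne : ((P.cell τ x).filter fun z => (z, y) ∈ bad P Q δ A).Nonempty
  · obtain ⟨s, hs, hmax⟩ := Finset.exists_max_image _ (fun z => stopY Q A z y) hne
    rw [Finset.mem_filter] at hs
    obtain ⟨hsA, hsub⟩ := hs.2
    have hsτ : stopX P A s y = τ := stop_eq_of_mem (S := {x' | (x', y) ∈ A}) hxy hs.1
    simp only [hsτ] at hsub
    unfold Sub at hsub
    push Not at hsub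
    obtain ⟨s1, hs1, t1, ht1, hnot⟩ := hsub
    have hle : E1 P τ (fun x y => ind ((x, y) ∈ A)) s1 t1 ≤ δ :=
      (P.E_le_M _ _ _).trans (not_lt.mp hnot)
    have hs1x : s1 ∈ P.cell τ x := by rwa [P.cell_eq _ _ _ hs.1] at hs1
    rw [E1, P.E_eq_of_mem hs1x] at hle
    refine le_trans (P.E_mono fun z hz => ind_mono fun hzb => ?_) hle
    have h1 : stopY Q A z y ≤ stopY Q A s y := hmax z (Finset.mem_filter.mpr ⟨hz, hzb⟩)
    exact stop_spec (C := Q) (S := {y' | (z, y') ∈ A}) hzb.1 t1 (Q.cell_anti h1 y ht1)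
  · rw [Finset.not_nonempty_iff_eq_empty, Finset.filter_eq_empty_iff] at hne
    rw [P.E_congr (g := fun _ => 0) fun z hz => ind_of_not (hne hz), E_const]
    exact hδ.le

/-- Each row of `A` is the disjoint union of its maximal segments, on each of which the bad points
have density at most `δ`. -/
lemma size_bad_le {δ : ℝ} (hδ : 0 < δ) (A : Set (X × Y)) : size (bad P Q δ A) ≤ δ * size A := by
  unfold size
  rw [Finset.sum_comm, Finset.sum_comm (f := fun x y => ind ((x, y) ∈ A)), Finset.mul_sum]
  refine Finset.sum_le_sum fun y _ => ?_
  calc ∑ x, ind ((x, y) ∈ bad P Q δ A)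
      = ∑ x, ind (x ∈ {x' | (x', y) ∈ A}) * ind ((x, y) ∈ bad P Q δ A) := by
        refine Finset.sum_congr rfl fun x _ => ?_
        by_cases h : (x, y) ∈ bad P Q δ A
        · rw [ind_of h, ind_of (show x ∈ {x' | (x', y) ∈ A} from h.1), one_mul]
        · rw [ind_of_not h, mul_zero]
    _ = ∑ x, ind (x ∈ {x' | (x', y) ∈ A}) * P.E (P.stopIdx {x' | (x', y) ∈ A} x)
          (fun x => ind ((x, y) ∈ bad P Q δ A)) x := (sum_ind_mul_E_stopIdx _ _).symm
    _ ≤ ∑ x, δ * ind ((x, y) ∈ A) := by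
        refine Finset.sum_le_sum fun x _ => ?_
        by_cases h : (x, y) ∈ A
        · rw [ind_of (show x ∈ {x' | (x', y) ∈ A} from h), ind_of h, one_mul, mul_one]
          exact E_bad_le P Q hδ A h
        · rw [ind_of_not (show ¬ x ∈ {x' | (x', y) ∈ A} from h), ind_of_not h]; simp
    _ = δ * ∑ x, ind ((x, y) ∈ A) := by rw [Finset.mul_sum]

/-- The points of `A` around which the bad set has a large density. -/
def badHull (δ : ℝ) (A : Set (X × Y)) : Set (X × Y) :=
  {z | z ∈ A ∧ 1 / 2 < MS P Q (fun x y => ind ((x, y) ∈ bad P Q δ A)) z.1 z.2}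

/-- Chebyshev's inequality at level 1/2 contributes 4 and the strong maximal function 16. -/
lemma size_badHull_le {δ : ℝ} (hδ : 0 < δ) (A : Set (X × Y)) :
    size (badHull P Q δ A) ≤ 64 * δ * size A := by
  have h1 := sum_MS_sq_le P Q (fun x y => ind ((x, y) ∈ bad P Q δ A))
  have h2 : (1 / 4) * size (badHull P Q δ A)
      ≤ ∑ x, ∑ y, MS P Q (fun x y => ind ((x, y) ∈ bad P Q δ A)) x y ^ 2 := by
    rw [size, Finset.mul_sum]
    refine Finset.sum_le_sum fun x _ => ?_
    rw [Finset.mul_sum]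
    refine Finset.sum_le_sum fun y _ => ?_
    by_cases h : (x, y) ∈ badHull P Q δ A
    · rw [ind_of h, mul_one]
      have h' : 1 / 2 < MS P Q (fun x y => ind ((x, y) ∈ bad P Q δ A)) x y := h.2
      nlinarith
    · rw [ind_of_not h, mul_zero]; exact sq_nonneg _
  simp only [ind_sq] at h1
  have h3 := size_bad_le P Q hδ A
  unfold size at *
  linarith

/-- A rectangle in `A` that is not in the hull of the bad set has at least half of its points outside
the bad set. -/
lemma half_le_EE_good {δ : ℝ} {A : Set (X × Y)} {i j : ℕ} {x : X} {y : Y}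
    (hA : Sub P Q i j x y A) (hE : ¬ Sub P Q i j x y (badHull P Q δ A)) :
    1 / 2 ≤ EE P Q i j (fun x y => ind ((x, y) ∈ A \ bad P Q δ A)) x y := by
  unfold Sub at hE
  push Not at hE
  obtain ⟨x', hx, y', hy, hnot⟩ := hE
  -- One point of the rectangle outside the hull bounds the density of bad points in the whole
  -- rectangle.
  have h1 : MS P Q (fun x y => ind ((x, y) ∈ bad P Q δ A)) x' y' ≤ 1 / 2 := by
    by_contra hlt
    exact hnot ⟨hA x' hx y' hy, not_le.mp hlt⟩
  have h2 : EE P Q i j (fun x y => ind ((x, y) ∈ bad P Q δ A)) x y ≤ 1 / 2 := by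
    rw [← EE_eq_of_mem P Q hx hy]; exact (EE_le_MS P Q i j _ x' y').trans h1
  have h3 : EE P Q i j (fun x y => ind ((x, y) ∈ A \ bad P Q δ A)
      + ind ((x, y) ∈ bad P Q δ A)) x y = 1 := by
    rw [← EE_const P Q i j 1 x y]
    refine le_antisymm (EE_mono P Q fun z hz w hw => le_of_eq ?_)
      (EE_mono P Q fun z hz w hw => le_of_eq ?_) <;>
    · have hzw := hA z hz w hw
      by_cases hb : (z, w) ∈ bad P Q δ A
      · rw [ind_of hb, ind_of_not (fun h => h.2 hb)]; norm_num
      · rw [ind_of_not hb, ind_of (show (z, w) ∈ A \ bad P Q δ A from ⟨hzw, hb⟩)]; norm_num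
  rw [EE_add] at h3
  linarith

lemma size_eq_zero_of_lt_one {A : Set (X × Y)} (h : size A < 1) : A = ∅ := by
  by_contra hne
  obtain ⟨⟨x, y⟩, hxy⟩ := Set.nonempty_iff_ne_empty.mpr hne
  have : (1 : ℝ) ≤ size A := by
    rw [← ind_of hxy]
    exact (Finset.single_le_sum (f := fun y => ind ((x, y) ∈ A)) (fun _ _ => ind_nonneg _)
      (Finset.mem_univ y)).trans (Finset.single_le_sum (f := fun x => ∑ y, ind ((x, y) ∈ A))
        (fun _ _ => Finset.sum_nonneg fun _ _ => ind_nonneg _) (Finset.mem_univ x))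
  linarith

/-- Removal of exceptional subsets. -/
lemma le_of_exceptional (T : Set (X × Y) → ℝ) (B : Set (X × Y) → Set (X × Y))
    (hB : ∀ A, size (B A) ≤ size A / 4) (hT : T ∅ ≤ 0) (g : ℝ → ℝ) (hg : ∀ t, 0 ≤ g t)
    (hmono : Monotone g) (hg4 : ∀ t, g (t / 4) ≤ g t / 2) (c : ℝ) (hc : 0 ≤ c)
    (h : ∀ A, T A ≤ T (B A) + c * g (size A)) (A : Set (X × Y)) : T A ≤ 2 * c * g (size A) := by
  -- The exceptional set is four times smaller and the error `g` then halves, so the errors sum to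
  -- twice the first. The induction starts with the empty set, because a size below 1 is zero.
  have key : ∀ m : ℕ, ∀ A : Set (X × Y), size A ≤ 4 ^ m / 2 → T A ≤ 2 * c * g (size A) := by
    intro m
    induction m with
    | zero =>
      intro A hA
      rw [size_eq_zero_of_lt_one (A := A) (by norm_num at hA; linarith)]
      exact hT.trans (mul_nonneg (by positivity) (hg _))
    | succ m ih =>
      intro A hA
      have h1 := ih (B A) ((hB A).trans (by rw [pow_succ] at hA; linarith))
      have h2 := (hmono (hB A)).trans (hg4 _)
      have h3 := mul_le_mul_of_nonneg_left h2 (show 0 ≤ 2 * c by positivity)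
      linarith [h A]
  obtain ⟨m, hm⟩ := pow_unbounded_of_one_lt (2 * size A) (show (1 : ℝ) < 4 by norm_num)
  exact key m A (by linarith)

section Half

/-- The generation of the largest `I` with `I × J ⊆ B`, where `J ∋ y` is maximal with
`{x} × J ⊆ A`. -/
def stopK (A B : Set (X × Y)) (x : X) (y : Y) : ℕ :=
  sInf {k | Sub P Q k (stopY Q A x y) x y B}

/-- The part of `b` which is coarse in the first variable, and local in the second one. -/
def halfLocal (A B : Set (X × Y)) (b : X → Y → ℝ) (x : X) (y : Y) : ℝ :=
  E1 P (stopK P Q A B x y) b x y - EE P Q (stopK P Q A B x y) (stopY Q A x y) b x y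

variable {P Q} {A B : Set (X × Y)} {x : X} {y : Y}

lemma stopY_eq_of_mem (hA : (x, y) ∈ A) {y' : Y} (hy : y' ∈ Q.cell (stopY Q A x y) y) :
    stopY Q A x y' = stopY Q A x y :=
  stop_eq_of_mem (S := {y' | (x, y') ∈ A}) hA hy

lemma stopK_eq_of_mem (hA : (x, y) ∈ A) {y' : Y} (hy : y' ∈ Q.cell (stopY Q A x y) y) :
    stopK P Q A B x y' = stopK P Q A B x y := by
  unfold stopK
  rw [stopY_eq_of_mem hA hy]
  simp only [sub_iff_of_mem (P.mem_cell _ x) hy]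

lemma stopK_spec {k : ℕ} (h : Sub P Q k (stopY Q A x y) x y B) :
    Sub P Q (stopK P Q A B x y) (stopY Q A x y) x y B :=
  Nat.sInf_mem (s := {k | Sub P Q k (stopY Q A x y) x y B}) ⟨k, h⟩

lemma stopK_le {k : ℕ} (h : Sub P Q k (stopY Q A x y) x y B) : stopK P Q A B x y ≤ k :=
  Nat.sInf_le h

/-- On the maximal vertical segment through `(x, y)` the two stopping generations do not change, so
averaging over a finer vertical cell only averages the first term. Thus the increments of the coarse
mean of `b` in the second variable, for all fine `j` at once, are averages of a single function, to
which a maximal function applies. -/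
lemma E2_halfLocal (hA : (x, y) ∈ A) {j : ℕ} (hj : stopY Q A x y ≤ j) (b : X → Y → ℝ) (c : ℕ) :
    E2 Q j (fun x y => ind ((x, y) ∈ A ∧ stopK P Q A B x y + 1 < c) * halfLocal P Q A B b x y) x y
      = ind (stopK P Q A B x y + 1 < c) *
        (EE P Q (stopK P Q A B x y) j b x y
          - EE P Q (stopK P Q A B x y) (stopY Q A x y) b x y) := by
  have h1 : ∀ y' ∈ Q.cell j y,
      ind ((x, y') ∈ A ∧ stopK P Q A B x y' + 1 < c) * halfLocal P Q A B b x y'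
      = ind (stopK P Q A B x y + 1 < c) * (E1 P (stopK P Q A B x y) b x y'
          - EE P Q (stopK P Q A B x y) (stopY Q A x y) b x y) := by
    intro y' hy'
    have hy := Q.cell_anti hj y hy'
    have hA' : (x, y') ∈ A := stop_spec (C := Q) (S := {y' | (x, y') ∈ A}) hA y' hy
    rw [halfLocal, stopK_eq_of_mem hA hy, stopY_eq_of_mem hA hy, ind_and, ind_of hA', one_mul,
      EE_eq_of_mem P Q (P.mem_cell _ x) hy]
  rw [E2, Q.E_congr h1, E_const_mul, E_sub, E_const]
  congr 2
  exact (EE_comm P Q _ j b x y).symm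

/-- On a maximal vertical segment, where `k` and `q` are constant, the function is the sum over `i ≤
k` of the oscillations in `y` of the differences `D1 P i b`. The Cauchy–Schwarz inequality costs a
factor `k + 1`, and summing the `k + 1` one-variable BMO bounds costs another one; the weight `(k +
1)⁻²` compensates both. -/
lemma sum_halfLocal_le (b : X → Y → ℝ) {K : ℝ}
    (hb : ∀ (i q : ℕ) (x : X) (y : Y), ∑ y' ∈ Q.cell q y,
      (D1 P i b x y' - E2 Q q (D1 P i b) x y') ^ 2 ≤ K * (Q.cell q y).card) :
    ∑ x, ∑ y, ind ((x, y) ∈ A) *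
      (halfLocal P Q A B b x y ^ 2 / ((stopK P Q A B x y : ℝ) + 1) ^ 2) ≤ K * size A := by
  rw [size, Finset.mul_sum]
  refine Finset.sum_le_sum fun x _ => ?_
  have h0 := sum_ind_mul_E_stopIdx (C := Q) {y' | (x, y') ∈ A}
    (fun y => halfLocal P Q A B b x y ^ 2 / ((stopK P Q A B x y : ℝ) + 1) ^ 2)
  rw [show ∑ y, ind ((x, y) ∈ A) * (halfLocal P Q A B b x y ^ 2
      / ((stopK P Q A B x y : ℝ) + 1) ^ 2) = _ from h0.symm, Finset.mul_sum]
  refine Finset.sum_le_sum fun y _ => ?_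
  by_cases hA : (x, y) ∈ A
  swap
  · rw [ind_of_not (show ¬ y ∈ {y' | (x, y') ∈ A} from hA), ind_of_not hA]; simp
  rw [ind_of (show y ∈ {y' | (x, y') ∈ A} from hA), ind_of hA, one_mul, mul_one]
  change Q.E (stopY Q A x y) _ y ≤ K
  set q := stopY Q A x y with hq
  set k := stopK P Q A B x y with hk
  have h1 : ∀ y' ∈ Q.cell q y, halfLocal P Q A B b x y' ^ 2 / ((stopK P Q A B x y' : ℝ) + 1) ^ 2
      ≤ (∑ i ∈ Finset.range (k + 1), (D1 P i b x y' - E2 Q q (D1 P i b) x y') ^ 2) / (k + 1) := by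
    intro y' hy
    rw [halfLocal, stopK_eq_of_mem hA hy, stopY_eq_of_mem hA hy, ← hk, ← hq]
    have e : E1 P k b x y' - EE P Q k q b x y'
        = ∑ i ∈ Finset.range (k + 1), (D1 P i b x y' - E2 Q q (D1 P i b) x y') := by
      rw [Finset.sum_sub_distrib]
      congr 1
      · exact (P.sum_D k _ x).symm
      · rw [EE, E1, ← P.sum_D k]
        exact Finset.sum_congr rfl fun i _ => D1_E2 P Q i q b x y'
    rw [e, div_le_div_iff₀ (by positivity) (by positivity)]
    have h2 := sq_sum_le_card_mul_sum_sq (s := Finset.range (k + 1))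
      (f := fun i => D1 P i b x y' - E2 Q q (D1 P i b) x y')
    rw [Finset.card_range] at h2
    push_cast at h2
    have h3 : (0 : ℝ) < (k : ℝ) + 1 := by positivity
    calc _ ≤ _ := mul_le_mul_of_nonneg_right h2 h3.le
      _ = _ := by ring
  refine (Q.E_mono h1).trans ?_
  have hcard := Q.card_cell_pos q y
  rw [E, div_le_iff₀ hcard, ← Finset.sum_div, div_le_iff₀ (by positivity), Finset.sum_comm]
  calc _ ≤ ∑ i ∈ Finset.range (k + 1), K * (Q.cell q y).card :=
        Finset.sum_le_sum fun i _ => hb i q x y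
    _ = _ := by rw [Finset.sum_const, Finset.card_range, nsmul_eq_mul]; push_cast; ring

end Half

end CellFiltration

end

end DyadicParaproduct

/-! ### The pointwise majorant of the means, and logarithmic blocks of generations. -/

namespace DyadicParaproduct

noncomputable section

namespace CellFiltration

variable {X Y : Type*} [Fintype X] [Fintype Y] (P : CellFiltration X) (Q : CellFiltration Y)

/-- A subset of a product with the coordinates exchanged. -/
def swapSet {X Y : Type*} (A : Set (X × Y)) : Set (Y × X) := {z | (z.2, z.1) ∈ A}

lemma size_swapSet (A : Set (X × Y)) : size (swapSet A) = size A := by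
  unfold size; rw [Finset.sum_comm]; rfl

variable {P Q} in
lemma Sub.swap {i j : ℕ} {x : X} {y : Y} {A : Set (X × Y)} (h : Sub P Q i j x y A) :
    Sub Q P j i y x (swapSet A) := fun y' hy x' hx => h x' hx y' hy

lemma EE_swap (i j : ℕ) (b : X → Y → ℝ) (x : X) (y : Y) :
    EE Q P j i (fun y x => b x y) y x = EE P Q i j b x y := (EE_comm P Q i j b x y).symm

/-- The truncated half-local part of `b`. -/
def truncHalf (A B : Set (X × Y)) (b : X → Y → ℝ) (c : ℕ) (x : X) (y : Y) : ℝ :=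
  ind ((x, y) ∈ A ∧ stopK P Q A B x y + 1 < c) * halfLocal P Q A B b x y

/-- The pointwise majorant of the averages of `b` over the rectangles in `A`. -/
def majorant (n : ℕ) (κ : ℝ) (A B : Set (X × Y)) (b : X → Y → ℝ) (c₁ c₂ : ℕ) (x : X) (y : Y) : ℝ :=
  κ * ((ind (stopX P A x y + 1 < c₁) * (stopX P A x y + 1)) *
      (ind (stopY Q A x y + 1 < c₂) * (stopY Q A x y + 1)))
    + 8 * MS P Q (fun x y => |projOn P Q n B b x y|) x y
    + M2 Q (fun x y => |truncHalf P Q A B b c₁ x y|) x y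
    + M1 P (fun x y => |truncHalf Q P (swapSet A) (swapSet B) (fun y x => b x y) c₂ y x|) x y

lemma M2_nonneg {f : X → Y → ℝ} (hf : ∀ x y, 0 ≤ f x y) (x : X) (y : Y) : 0 ≤ M2 Q f x y :=
  Q.M_nonneg (hf x) y

lemma M1_nonneg {f : X → Y → ℝ} (hf : ∀ x y, 0 ≤ f x y) (x : X) (y : Y) : 0 ≤ M1 P f x y :=
  P.M_nonneg (fun x => hf x y) x

lemma MS_nonneg {f : X → Y → ℝ} (hf : ∀ x y, 0 ≤ f x y) (x : X) (y : Y) : 0 ≤ MS P Q f x y :=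
  M1_nonneg P (M2_nonneg Q hf) x y

lemma majorant_nonneg {n : ℕ} {κ : ℝ} (hκ : 0 ≤ κ) (A B : Set (X × Y)) (b : X → Y → ℝ)
    (c₁ c₂ : ℕ) (x : X) (y : Y) : 0 ≤ majorant P Q n κ A B b c₁ c₂ x y := by
  have h1 := MS_nonneg P Q (f := fun x y => |projOn P Q n B b x y|) (fun _ _ => abs_nonneg _) x y
  have h2 := M2_nonneg Q (f := fun x y => |truncHalf P Q A B b c₁ x y|) (fun _ _ => abs_nonneg _) x y
  have h3 := M1_nonneg P (f := fun x y => |truncHalf Q P (swapSet A) (swapSet B)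
    (fun y x => b x y) c₂ y x|) (fun _ _ => abs_nonneg _) x y
  have h4 := ind_nonneg (stopX P A x y + 1 < c₁)
  have h5 := ind_nonneg (stopY Q A x y + 1 < c₂)
  unfold majorant; positivity

lemma abs_halfLocal_le {A B : Set (X × Y)} {x : X} {y : Y} (hA : (x, y) ∈ A) {j : ℕ}
    (hj : stopY Q A x y ≤ j) (b : X → Y → ℝ) {c : ℕ} (hc : stopK P Q A B x y + 1 < c) :
    |EE P Q (stopK P Q A B x y) j b x y - EE P Q (stopK P Q A B x y) (stopY Q A x y) b x y|
      ≤ M2 Q (fun x y => |truncHalf P Q A B b c x y|) x y := by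
  have h := E2_halfLocal (P := P) (Q := Q) (B := B) hA hj b c
  rw [ind_of hc, one_mul] at h
  rw [← h]
  exact (Q.abs_E_le _ _ _).trans (Q.E_le_M _ _ _)

/-- At a good point the rectangle spanned by the maximal segments, of generation `(p, q)`, lies in
the enlargement. It can be lengthened inside the enlargement in either direction, to generation `(k,
q)` or `(p, l)`, and the mean is compared with the coarse mean along these rectangles. -/
lemma abs_EE_le_majorant {n : ℕ} {κ δ : ℝ} {A : Set (X × Y)} {b : X → Y → ℝ}
    (hb : ∀ i j x y, |EE P Q i j b x y| ≤ κ * ((i + 1) * (j + 1)))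
    {i j c₁ c₂ : ℕ} (hi : i ≤ n) (hj : j ≤ n) (hc₁ : i + 1 < c₁) (hc₂ : j + 1 < c₂)
    {x : X} {y : Y} (hA : Sub P Q i j x y A) (hbad : (x, y) ∉ bad P Q δ A) :
    |EE P Q i j b x y| ≤ majorant P Q n κ A (enl P δ A) b c₁ c₂ x y := by
  set B := enl P δ A with hB
  set p := stopX P A x y with hp
  set q := stopY Q A x y with hq
  have hxy : (x, y) ∈ A := hA.mem
  have hpq : Sub P Q p q x y B := by
    by_contra h; exact hbad ⟨hxy, h⟩
  have hpi : p ≤ i := stop_le (C := P) (S := {x' | (x', y) ∈ A})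
    fun z hz => hA z hz y (Q.mem_cell j y)
  have hqj : q ≤ j := stop_le (C := Q) (S := {y' | (x, y') ∈ A})
    fun z hz => hA x (P.mem_cell i x) z hz
  set k := stopK P Q A B x y with hk
  set l := stopK Q P (swapSet A) (swapSet B) y x with hl
  have hkB : Sub P Q k q x y B := stopK_spec hpq
  have hlB : Sub P Q p l x y B :=
    (stopK_spec (P := Q) (Q := P) (A := swapSet A) (B := swapSet B) (x := y) (y := x) hpq.swap).swap
  have hkp : k ≤ p := stopK_le hpq
  have hlq : l ≤ q :=
    stopK_le (P := Q) (Q := P) (A := swapSet A) (B := swapSet B) (x := y) (y := x) hpq.swap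
  -- The first double difference carries `(i, j)` back to `(i, q)` up to a term coarse in the first
  -- variable, and the second carries `(i, q)` back to `(p, q)` up to a term coarse in the second
  -- one.
  have e : EE P Q i j b x y = EE P Q p q b x y + dd P Q k i q j b x y
      + (EE P Q k j b x y - EE P Q k q b x y) + dd P Q p i l q b x y
      + (EE P Q i l b x y - EE P Q p l b x y) := by unfold dd; ring
  have t1 : |EE P Q p q b x y| ≤ κ * ((ind (p + 1 < c₁) * (p + 1)) * (ind (q + 1 < c₂) * (q + 1))) := by
    rw [ind_of (by omega : p + 1 < c₁), ind_of (by omega : q + 1 < c₂), one_mul, one_mul]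
    exact hb p q x y
  have t2 : |dd P Q k i q j b x y| ≤ 4 * MS P Q (fun x y => |projOn P Q n B b x y|) x y := by
    rw [← dd_projOn P Q (hkp.trans hpi) hi hqj hj hkB]; exact abs_dd_le P Q _ _ _ _ _ _ _
  have t3 : |dd P Q p i l q b x y| ≤ 4 * MS P Q (fun x y => |projOn P Q n B b x y|) x y := by
    rw [← dd_projOn P Q hpi hi hlq (hqj.trans hj) hlB]; exact abs_dd_le P Q _ _ _ _ _ _ _
  have t4 : |EE P Q k j b x y - EE P Q k q b x y|
      ≤ M2 Q (fun x y => |truncHalf P Q A B b c₁ x y|) x y :=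
    -- The truncation is inactive because `k ≤ p ≤ i` and `i + 1 < c₁`.
    abs_halfLocal_le P Q hxy hqj b (by omega)
  have t5 : |EE P Q i l b x y - EE P Q p l b x y|
      ≤ M1 P (fun x y => |truncHalf Q P (swapSet A) (swapSet B) (fun y x => b x y) c₂ y x|) x y := by
    have := abs_halfLocal_le Q P (A := swapSet A) (B := swapSet B) (x := y) (y := x) hxy hpi
      (fun y x => b x y) (c := c₂) (by omega)
    rw [← EE_swap P Q i l b x y, ← EE_swap P Q p l b x y]
    exact this
  have s1 := abs_add_le (EE P Q p q b x y + dd P Q k i q j b x y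
      + (EE P Q k j b x y - EE P Q k q b x y) + dd P Q p i l q b x y)
      (EE P Q i l b x y - EE P Q p l b x y)
  have s2 := abs_add_le (EE P Q p q b x y + dd P Q k i q j b x y
      + (EE P Q k j b x y - EE P Q k q b x y)) (dd P Q p i l q b x y)
  have s3 := abs_add_le (EE P Q p q b x y + dd P Q k i q j b x y)
      (EE P Q k j b x y - EE P Q k q b x y)
  have s4 := abs_add_le (EE P Q p q b x y) (dd P Q k i q j b x y)
  rw [e]
  unfold majorant
  linarith

lemma Carl.mono {P : CellFiltration X} {Q : CellFiltration Y} {s t : Finset (ℕ × ℕ)} {K : ℝ}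
    {ν : ℕ → ℕ → X → Y → ℝ} (h : Carl P Q s K ν) (hν : ∀ i j x y, 0 ≤ ν i j x y) (hts : t ⊆ s) :
    Carl P Q t K ν := fun A =>
  (Finset.sum_le_sum fun _ _ => Finset.sum_le_sum fun _ _ =>
    Finset.sum_le_sum_of_subset_of_nonneg hts fun _ _ _ =>
      mul_nonneg (ind_nonneg _) (hν _ _ _ _)).trans (h A)

lemma sum_quarter_pow_le (n T : ℕ) :
    ∑ a ∈ Finset.range n, (1 / 4 : ℝ) ^ a * ind (T ≤ a) ≤ 4 / 3 * (1 / 4) ^ T := by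
  have h : ∀ n : ℕ, T ≤ n → ∑ a ∈ Finset.range n, (1 / 4 : ℝ) ^ a * ind (T ≤ a)
      = 4 / 3 * ((1 / 4) ^ T - (1 / 4) ^ n) := by
    intro n hn
    induction n, hn using Nat.le_induction with
    | base =>
      rw [sub_self, mul_zero]
      exact Finset.sum_eq_zero fun a ha => by
        rw [ind_of_not (by have := Finset.mem_range.mp ha; omega), mul_zero]
    | succ n hn ih => rw [Finset.sum_range_succ, ih, ind_of hn, pow_succ]; ring
  rcases le_total T n with hn | hn
  · rw [h n hn]; nlinarith [pow_pos (show (0 : ℝ) < 1 / 4 by norm_num) n]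
  · rw [Finset.sum_eq_zero fun a ha => by
      rw [ind_of_not (by have := Finset.mem_range.mp ha; omega), mul_zero]]
    positivity

lemma sum_quarter_pow_le' (n : ℕ) : ∑ a ∈ Finset.range n, (1 / 4 : ℝ) ^ a ≤ 4 / 3 := by
  simpa using sum_quarter_pow_le n 0

/-- The sum over the scales `2^a` exceeding `m / 2`. -/
lemma sum_quarter_pow_mul_sq_le (n m : ℕ) :
    ∑ a ∈ Finset.range n, (1 / 4 : ℝ) ^ a * ind (m + 1 < 2 ^ (a + 1)) ≤ 16 / 3 / ((m : ℝ) + 1) ^ 2 := by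
  -- Only the indices `a ≥ T` contribute, and `2 ^ T` is comparable with `m + 1`: the geometric tail
  -- is of order `(m + 1)⁻²`.
  set T := Nat.log 2 (m + 1) with hT
  have h1 : m + 1 < 2 ^ (T + 1) := Nat.lt_pow_succ_log_self (by norm_num) _
  have h2 : ∀ a, ind (m + 1 < 2 ^ (a + 1)) ≤ ind (T ≤ a) := fun a => ind_mono fun h => by
    have h3 : 2 ^ T ≤ m + 1 := Nat.pow_log_le_self 2 (by omega)
    have := (Nat.pow_lt_pow_iff_right (a := 2) (by norm_num)).mp (h3.trans_lt h)
    omega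
  refine (Finset.sum_le_sum fun a _ => mul_le_mul_of_nonneg_left (h2 a) (by positivity)).trans
    ((sum_quarter_pow_le n T).trans ?_)
  rw [le_div_iff₀ (by positivity)]
  have h3 : ((m : ℝ) + 1) ≤ 2 * 2 ^ T := by
    have : ((m + 1 : ℕ) : ℝ) < ((2 ^ (T + 1) : ℕ) : ℝ) := by exact_mod_cast h1
    push_cast at this; rw [pow_succ] at this; linarith
  have h4 : ((m : ℝ) + 1) ^ 2 ≤ 4 * 4 ^ T := by
    have : (4 : ℝ) ^ T = (2 ^ T) ^ 2 := by rw [← pow_mul, mul_comm, pow_mul]; norm_num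
    rw [this]; nlinarith [show (0 : ℝ) ≤ m + 1 by positivity]
  have h5 : (1 / 4 : ℝ) ^ T * 4 ^ T = 1 := by rw [← mul_pow]; norm_num
  have h6 : (0 : ℝ) < (1 / 4) ^ T := by positivity
  nlinarith

/-- The indices of a logarithmic block. -/
def block (s : Finset (ℕ × ℕ)) (a : ℕ × ℕ) : Finset (ℕ × ℕ) :=
  s.filter fun p => (Nat.log 2 (p.1 + 1), Nat.log 2 (p.2 + 1)) = a

lemma sum_block {M : Type*} [AddCommMonoid M] {s : Finset (ℕ × ℕ)} {n : ℕ}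
    (hs : ∀ p ∈ s, p.1 ≤ n ∧ p.2 ≤ n) (f : ℕ × ℕ → M) :
    ∑ p ∈ s, f p = ∑ a ∈ Finset.range (n + 1), ∑ b ∈ Finset.range (n + 1),
      ∑ p ∈ block s (a, b), f p := by
  have hlog : ∀ m, m ≤ n → Nat.log 2 (m + 1) ∈ Finset.range (n + 1) := fun m hm => by
    rw [Finset.mem_range]
    have := Nat.log_lt_of_lt_pow (b := 2) (x := m + 1) (y := m + 1) (by omega) Nat.lt_two_pow_self
    omega
  rw [← Finset.sum_product', ← Finset.sum_fiberwise_of_maps_to (s := s)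
    (t := Finset.range (n + 1) ×ˢ Finset.range (n + 1))
    (g := fun p => (Nat.log 2 (p.1 + 1), Nat.log 2 (p.2 + 1)))
    (fun p hp => Finset.mk_mem_product (hlog _ (hs p hp).1) (hlog _ (hs p hp).2))]
  rfl

lemma block_mem {s : Finset (ℕ × ℕ)} {a b : ℕ} {p : ℕ × ℕ} (hp : p ∈ block s (a, b)) :
    p ∈ s ∧ (2 ^ a - 1 ≤ p.1 ∧ 2 ^ b - 1 ≤ p.2) ∧ p.1 + 1 < 2 ^ (a + 1) ∧ p.2 + 1 < 2 ^ (b + 1) := by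
  rw [block, Finset.mem_filter, Prod.mk.injEq] at hp
  obtain ⟨h0, h1, h2⟩ := hp
  have e1 : 2 ^ a ≤ p.1 + 1 := h1 ▸ Nat.pow_log_le_self 2 (by omega)
  have e2 : 2 ^ b ≤ p.2 + 1 := h2 ▸ Nat.pow_log_le_self 2 (by omega)
  exact ⟨h0, ⟨by omega, by omega⟩, h1 ▸ Nat.lt_pow_succ_log_self (by norm_num) _,
    h2 ▸ Nat.lt_pow_succ_log_self (by norm_num) _⟩

end CellFiltration

end

end DyadicParaproduct

/-! ### The Carleson estimate for the paraproduct of type (0, 0). -/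

namespace DyadicParaproduct

noncomputable section

namespace CellFiltration

variable {X Y : Type*} [Fintype X] [Fintype Y] (P : CellFiltration X) (Q : CellFiltration Y)

/-- The size conditions on `b` inherited from the dyadic product BMO norm. -/
structure BMOData (n : ℕ) (κ : ℝ) (b : X → Y → ℝ) : Prop where
  nonneg : 0 ≤ κ
  abs_le : ∀ i j x y, |EE P Q i j b x y| ≤ κ * ((i + 1) * (j + 1))
  sum_le : ∀ A : Set (X × Y), ∑ i ∈ Finset.range n, ∑ j ∈ Finset.range n,
    ∑ x, ∑ y, ind (Sub P Q i j x y A) * D1 P (i + 1) (D2 Q (j + 1) b) x y ^ 2 ≤ κ ^ 2 * size A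
  snd_le : ∀ (i q : ℕ) (x : X) (y : Y), ∑ y' ∈ Q.cell q y,
    (D1 P i b x y' - E2 Q q (D1 P i b) x y') ^ 2 ≤ κ ^ 2 * (Q.cell q y).card
  fst_le : ∀ (j p : ℕ) (y : Y) (x : X), ∑ x' ∈ P.cell p x,
    (D2 Q j b x' y - E1 P p (D2 Q j b) x' y) ^ 2 ≤ κ ^ 2 * (P.cell p x).card

variable {P Q}

lemma majorant_sq_le (n : ℕ) {κ : ℝ} {A B : Set (X × Y)} (b : X → Y → ℝ)
    (c₁ c₂ : ℕ) (x : X) (y : Y) :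
    (ind ((x, y) ∈ A) * majorant P Q n κ A B b c₁ c₂ x y) ^ 2
      ≤ 4 * (κ ^ 2 * (ind ((x, y) ∈ A) * ((ind (stopX P A x y + 1 < c₁) * (stopX P A x y + 1) ^ 2) *
          (ind (stopY Q A x y + 1 < c₂) * (stopY Q A x y + 1) ^ 2)))
        + 64 * MS P Q (fun x y => |projOn P Q n B b x y|) x y ^ 2
        + M2 Q (fun x y => |truncHalf P Q A B b c₁ x y|) x y ^ 2
        + M1 P (fun x y =>
          |truncHalf Q P (swapSet A) (swapSet B) (fun y x => b x y) c₂ y x|) x y ^ 2) := by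
  by_cases hA : (x, y) ∈ A
  swap
  · rw [ind_of_not hA]
    have : 0 ≤ M1 P (fun x y =>
          |truncHalf Q P (swapSet A) (swapSet B) (fun y x => b x y) c₂ y x|) x y ^ 2 := sq_nonneg _
    nlinarith [sq_nonneg (MS P Q (fun x y => |projOn P Q n B b x y|) x y),
      sq_nonneg (M2 Q (fun x y => |truncHalf P Q A B b c₁ x y|) x y)]
  rw [ind_of hA, one_mul, one_mul]
  unfold majorant
  generalize MS P Q (fun x y => |projOn P Q n B b x y|) x y = m
  generalize M2 Q (fun x y => |truncHalf P Q A B b c₁ x y|) x y = u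
  generalize M1 P (fun x y =>
    |truncHalf Q P (swapSet A) (swapSet B) (fun y x => b x y) c₂ y x|) x y = v
  have e1 := ind_sq (stopX P A x y + 1 < c₁)
  have e2 := ind_sq (stopY Q A x y + 1 < c₂)
  have e : κ ^ 2 * (ind (stopX P A x y + 1 < c₁) * ((stopX P A x y : ℝ) + 1) ^ 2 *
      (ind (stopY Q A x y + 1 < c₂) * ((stopY Q A x y : ℝ) + 1) ^ 2))
      = (κ * ((ind (stopX P A x y + 1 < c₁) * ((stopX P A x y : ℝ) + 1)) *
      (ind (stopY Q A x y + 1 < c₂) * (stopY Q A x y + 1)))) ^ 2 := by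
    rw [mul_pow, mul_pow, mul_pow, mul_pow, e1, e2]
  rw [e]
  generalize κ * ((ind (stopX P A x y + 1 < c₁) * ((stopX P A x y : ℝ) + 1)) *
      (ind (stopY Q A x y + 1 < c₂) * (stopY Q A x y + 1))) = t
  -- The Cauchy–Schwarz inequality for the four summands `t`, `8 * m`, `u`, `v`.
  nlinarith [sq_nonneg (t - 8 * m), sq_nonneg (t - u), sq_nonneg (t - v), sq_nonneg (8 * m - u),
    sq_nonneg (8 * m - v), sq_nonneg (u - v)]

/-- Exchanging the sums, each point receives the total weight of the scales `2 ^ (a + 1)` above its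
`k + 1`, which is at most `16 / 3 / (k + 1) ^ 2`. This is the weight under which `halfLocal` is
square summable. -/
lemma sum_truncHalf_le {A B : Set (X × Y)} (b : X → Y → ℝ) {K : ℝ}
    (hb : ∀ (i q : ℕ) (x : X) (y : Y), ∑ y' ∈ Q.cell q y,
      (D1 P i b x y' - E2 Q q (D1 P i b) x y') ^ 2 ≤ K * (Q.cell q y).card) (N : ℕ) :
    ∑ a ∈ Finset.range N, (1 / 4 : ℝ) ^ a *
      ∑ x, ∑ y, truncHalf P Q A B b (2 ^ (a + 1)) x y ^ 2 ≤ 16 / 3 * K * size A := by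
  have e : ∀ a ∈ Finset.range N, (1 / 4 : ℝ) ^ a *
      ∑ x, ∑ y, truncHalf P Q A B b (2 ^ (a + 1)) x y ^ 2
      = ∑ x, ∑ y, (ind ((x, y) ∈ A) * halfLocal P Q A B b x y ^ 2) *
        ((1 / 4 : ℝ) ^ a * ind (stopK P Q A B x y + 1 < 2 ^ (a + 1))) := by
    intro a _
    simp only [Finset.mul_sum]
    refine Finset.sum_congr rfl fun x _ => Finset.sum_congr rfl fun y _ => ?_
    rw [truncHalf, mul_pow, ind_sq, ind_and]; ring
  rw [Finset.sum_congr rfl e, Finset.sum_comm]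
  have e2 : ∀ x, ∑ a ∈ Finset.range N, ∑ y, (ind ((x, y) ∈ A) * halfLocal P Q A B b x y ^ 2) *
        ((1 / 4 : ℝ) ^ a * ind (stopK P Q A B x y + 1 < 2 ^ (a + 1)))
      ≤ ∑ y, 16 / 3 * (ind ((x, y) ∈ A) *
      (halfLocal P Q A B b x y ^ 2 / ((stopK P Q A B x y : ℝ) + 1) ^ 2)) := by
    intro x
    rw [Finset.sum_comm]
    refine Finset.sum_le_sum fun y _ => ?_
    rw [← Finset.mul_sum]
    refine (mul_le_mul_of_nonneg_left (sum_quarter_pow_mul_sq_le N (stopK P Q A B x y))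
      (mul_nonneg (ind_nonneg _) (sq_nonneg _))).trans (le_of_eq ?_)
    ring
  refine (Finset.sum_le_sum fun x _ => e2 x).trans ?_
  simp only [← Finset.mul_sum]
  have := sum_halfLocal_le (A := A) (B := B) b hb
  linarith

/-- The block `(a, b)` lies in the tail starting at `(2 ^ a - 1, 2 ^ b - 1)`, where `k + 1` is
exactly a power of two; this turns logarithmic decay in the generations into geometric decay in the
block index. -/
lemma Carl.block_of_tail {s : Finset (ℕ × ℕ)} {Λ : ℝ} {ν : ℕ → ℕ → X → Y → ℝ}
    (hν : ∀ i j x y, 0 ≤ ν i j x y)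
    (htail : ∀ k₁ k₂ : ℕ, Carl P Q (s.filter fun p => k₁ ≤ p.1 ∧ k₂ ≤ p.2)
      (Λ / (((k₁ + 1) * (k₂ + 1)) ^ 2)) ν) (a b : ℕ) :
    Carl P Q (block s (a, b)) (Λ * ((1 / 4) ^ a * (1 / 4) ^ b)) ν := by
  have h := (htail (2 ^ a - 1) (2 ^ b - 1)).mono hν (t := block s (a, b)) fun p hp =>
    Finset.mem_filter.mpr ⟨(block_mem hp).1, (block_mem hp).2.1⟩
  have e : ∀ m : ℕ, (((2 ^ m - 1 : ℕ) : ℝ) + 1) = 2 ^ m := fun m => by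
    rw [Nat.cast_sub Nat.one_le_two_pow]; push_cast; ring
  rw [e, e] at h
  convert h using 1
  rw [mul_pow, ← pow_mul, ← pow_mul, mul_comm a, mul_comm b, pow_mul, pow_mul, one_div, inv_pow,
    inv_pow, div_eq_mul_inv, mul_inv]
  norm_num

/-- The part supported on differences inside the enlargement does not depend on the block, so the
geometric weights simply sum up. The three other parts grow with the stopping generations but are
truncated at the scale of the block, and the weights convert each truncation into the compensating
factor. -/
lemma sum_majorant_le {n : ℕ} {κ : ℝ} {b : X → Y → ℝ} (hP : P.depth ≤ n) (hQ : Q.depth ≤ n)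
    (hb : BMOData P Q n κ b) (A : Set (X × Y)) (N : ℕ) :
    ∑ a₁ ∈ Finset.range N, ∑ a₂ ∈ Finset.range N, ((1 / 4 : ℝ) ^ a₁ * (1 / 4) ^ a₂) *
      ∑ x, ∑ y, (ind ((x, y) ∈ A) *
        majorant P Q n κ A (enl P (1 / 256) A) b (2 ^ (a₁ + 1)) (2 ^ (a₂ + 1)) x y) ^ 2
      ≤ 2 ^ 31 * κ ^ 2 * size A := by
  set B := enl P (1 / 256) A with hB
  have hsA := size_nonneg A
  set m : ℝ := ∑ x, ∑ y, MS P Q (fun x y => |projOn P Q n B b x y|) x y ^ 2 with hm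
  set t : ℕ → ℕ → ℝ := fun a₁ a₂ => ∑ x, ∑ y, ind ((x, y) ∈ A) *
    ((ind (stopX P A x y + 1 < 2 ^ (a₁ + 1)) * (stopX P A x y + 1) ^ 2) *
          (ind (stopY Q A x y + 1 < 2 ^ (a₂ + 1)) * (stopY Q A x y + 1) ^ 2)) with ht
  set u : ℕ → ℝ := fun a => ∑ x, ∑ y, truncHalf P Q A B b (2 ^ (a + 1)) x y ^ 2 with hu
  set v : ℕ → ℝ := fun a => ∑ y, ∑ x,
    truncHalf Q P (swapSet A) (swapSet B) (fun y x => b x y) (2 ^ (a + 1)) y x ^ 2 with hv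
  have hsq : ∀ a₁ a₂, ∑ x, ∑ y, (ind ((x, y) ∈ A) *
        majorant P Q n κ A B b (2 ^ (a₁ + 1)) (2 ^ (a₂ + 1)) x y) ^ 2
      ≤ 4 * (κ ^ 2 * t a₁ a₂ + 64 * m + 4 * u a₁ + 4 * v a₂) := by
    intro a₁ a₂
    refine (Finset.sum_le_sum fun x _ => Finset.sum_le_sum fun y _ =>
      majorant_sq_le n b _ _ x y).trans ?_
    simp only [← Finset.mul_sum, Finset.sum_add_distrib]
    have h1 := sum_M2_sq_le Q (fun x y => |truncHalf P Q A B b (2 ^ (a₁ + 1)) x y|)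
    have h2 := sum_M1_sq_le P (fun x y =>
      |truncHalf Q P (swapSet A) (swapSet B) (fun y x => b x y) (2 ^ (a₂ + 1)) y x|)
    simp only [sq_abs] at h1 h2
    have h3 : ∑ x, ∑ y, truncHalf Q P (swapSet A) (swapSet B) (fun y x => b x y)
        (2 ^ (a₂ + 1)) y x ^ 2 = v a₂ := Finset.sum_comm
    rw [h3] at h2
    linarith
  -- The strong maximal function contributes `2 ^ 4`, and the enlargement at level `1 / 256`
  -- contributes `4 * 256 ^ 2 = 2 ^ 18`.
  have hm_le : m ≤ 2 ^ 22 * κ ^ 2 * size A := by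
    have h1 := sum_MS_sq_le P Q (fun x y => |projOn P Q n B b x y|)
    simp only [sq_abs] at h1
    rw [sum_sq_projOn P Q hP hQ] at h1
    have h2 := hb.sum_le B
    have h3 := size_enl_le P (δ := 1 / 256) (by norm_num) A
    have h4 := mul_le_mul_of_nonneg_left h3 (sq_nonneg κ)
    norm_num at h4
    rw [← hB] at h4
    linarith
  have hm0 : 0 ≤ m := Finset.sum_nonneg fun _ _ => Finset.sum_nonneg fun _ _ => sq_nonneg _
  have hu_le : ∑ a ∈ Finset.range N, (1 / 4 : ℝ) ^ a * u a ≤ 16 / 3 * κ ^ 2 * size A :=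
    sum_truncHalf_le b hb.snd_le N
  have hv_le : ∑ a ∈ Finset.range N, (1 / 4 : ℝ) ^ a * v a ≤ 16 / 3 * κ ^ 2 * size A := by
    have := sum_truncHalf_le (P := Q) (Q := P) (A := swapSet A) (B := swapSet B)
      (fun y x => b x y) (K := κ ^ 2) (fun i q x y => hb.fst_le i q x y) N
    rwa [size_swapSet] at this
  have hu0 : ∀ a, 0 ≤ u a := fun _ =>
    Finset.sum_nonneg fun _ _ => Finset.sum_nonneg fun _ _ => sq_nonneg _
  have hv0 : ∀ a, 0 ≤ v a := fun _ =>
    Finset.sum_nonneg fun _ _ => Finset.sum_nonneg fun _ _ => sq_nonneg _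
  -- At each point the sums over the two block indices factorize, and each cancels the square of one
  -- stopping generation, leaving `(16 / 3) ^ 2`.
  have ht_le : ∑ a₁ ∈ Finset.range N, ∑ a₂ ∈ Finset.range N,
      ((1 / 4 : ℝ) ^ a₁ * (1 / 4) ^ a₂) * t a₁ a₂ ≤ 256 / 9 * size A := by
    have e : ∑ a₁ ∈ Finset.range N, ∑ a₂ ∈ Finset.range N,
      ((1 / 4 : ℝ) ^ a₁ * (1 / 4) ^ a₂) * t a₁ a₂
        = ∑ x, ∑ y, ind ((x, y) ∈ A) *
          (((∑ a ∈ Finset.range N, (1 / 4 : ℝ) ^ a * ind (stopX P A x y + 1 < 2 ^ (a + 1)))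
              * (stopX P A x y + 1) ^ 2) *
          ((∑ a ∈ Finset.range N, (1 / 4 : ℝ) ^ a * ind (stopY Q A x y + 1 < 2 ^ (a + 1)))
              * (stopY Q A x y + 1) ^ 2)) := by
      have e1 : ∀ x y, ind ((x, y) ∈ A) *
          (((∑ a ∈ Finset.range N, (1 / 4 : ℝ) ^ a * ind (stopX P A x y + 1 < 2 ^ (a + 1)))
              * (stopX P A x y + 1) ^ 2) *
          ((∑ a ∈ Finset.range N, (1 / 4 : ℝ) ^ a * ind (stopY Q A x y + 1 < 2 ^ (a + 1)))
              * (stopY Q A x y + 1) ^ 2))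
          = ∑ a₁ ∈ Finset.range N, ∑ a₂ ∈ Finset.range N, ((1 / 4 : ℝ) ^ a₁ * (1 / 4) ^ a₂) *
            (ind ((x, y) ∈ A) *
      ((ind (stopX P A x y + 1 < 2 ^ (a₁ + 1)) * (stopX P A x y + 1) ^ 2) *
          (ind (stopY Q A x y + 1 < 2 ^ (a₂ + 1)) * (stopY Q A x y + 1) ^ 2))) := by
        intro x y
        rw [mul_mul_mul_comm, Finset.sum_mul_sum, Finset.sum_mul, Finset.mul_sum]
        refine Finset.sum_congr rfl fun a₁ _ => ?_
        rw [Finset.sum_mul, Finset.mul_sum]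
        exact Finset.sum_congr rfl fun a₂ _ => by ring
      simp only [e1, ht, Finset.mul_sum]
      symm
      calc _ = ∑ x, ∑ a₁ ∈ Finset.range N, ∑ y, ∑ a₂ ∈ Finset.range N, _ :=
            Finset.sum_congr rfl fun x _ => Finset.sum_comm
        _ = ∑ a₁ ∈ Finset.range N, ∑ x, ∑ y, ∑ a₂ ∈ Finset.range N, _ := Finset.sum_comm
        _ = ∑ a₁ ∈ Finset.range N, ∑ x, ∑ a₂ ∈ Finset.range N, ∑ y, _ :=
            Finset.sum_congr rfl fun _ _ => Finset.sum_congr rfl fun x _ => Finset.sum_comm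
        _ = _ := Finset.sum_congr rfl fun _ _ => Finset.sum_comm
    rw [e, size, Finset.mul_sum]
    refine Finset.sum_le_sum fun x _ => ?_
    rw [Finset.mul_sum]
    refine Finset.sum_le_sum fun y _ => ?_
    rw [mul_comm (256 / 9 : ℝ)]
    refine mul_le_mul_of_nonneg_left ?_ (ind_nonneg _)
    have h1 := sum_quarter_pow_mul_sq_le N (stopX P A x y)
    have h2 := sum_quarter_pow_mul_sq_le N (stopY Q A x y)
    rw [le_div_iff₀ (by positivity)] at h1 h2
    calc _ ≤ (16 / 3 : ℝ) * (16 / 3) := mul_le_mul h1 h2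
          (mul_nonneg (Finset.sum_nonneg fun _ _ => mul_nonneg (by positivity) (ind_nonneg _))
            (by positivity)) (by norm_num)
      _ = _ := by norm_num
  have hg := sum_quarter_pow_le' N
  have hg0 : 0 ≤ ∑ a ∈ Finset.range N, (1 / 4 : ℝ) ^ a := Finset.sum_nonneg fun _ _ => by positivity
  calc _ ≤ ∑ a₁ ∈ Finset.range N, ∑ a₂ ∈ Finset.range N, ((1 / 4 : ℝ) ^ a₁ * (1 / 4) ^ a₂) *
        (4 * (κ ^ 2 * t a₁ a₂ + 64 * m + 4 * u a₁ + 4 * v a₂)) :=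
        Finset.sum_le_sum fun a₁ _ => Finset.sum_le_sum fun a₂ _ =>
          mul_le_mul_of_nonneg_left (hsq a₁ a₂) (by positivity)
    _ = 4 * κ ^ 2 * (∑ a₁ ∈ Finset.range N, ∑ a₂ ∈ Finset.range N,
          ((1 / 4 : ℝ) ^ a₁ * (1 / 4) ^ a₂) * t a₁ a₂)
        + 256 * m * ((∑ a ∈ Finset.range N, (1 / 4 : ℝ) ^ a) * ∑ a ∈ Finset.range N, (1 / 4 : ℝ) ^ a)
        + 16 * ((∑ a ∈ Finset.range N, (1 / 4 : ℝ) ^ a * u a) * ∑ a ∈ Finset.range N, (1 / 4 : ℝ) ^ a)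
        + 16 * ((∑ a ∈ Finset.range N, (1 / 4 : ℝ) ^ a)
          * ∑ a ∈ Finset.range N, (1 / 4 : ℝ) ^ a * v a) := by
        simp only [Finset.sum_mul_sum]
        simp only [Finset.mul_sum, ← Finset.sum_add_distrib]
        exact Finset.sum_congr rfl fun _ _ => Finset.sum_congr rfl fun _ _ => by ring
    _ ≤ 4 * κ ^ 2 * (256 / 9 * size A) + 256 * (2 ^ 22 * κ ^ 2 * size A) * (4 / 3 * (4 / 3))
        + 16 * (16 / 3 * κ ^ 2 * size A * (4 / 3)) + 16 * (4 / 3 * (16 / 3 * κ ^ 2 * size A)) := by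
        have hu1 : 0 ≤ ∑ a ∈ Finset.range N, (1 / 4 : ℝ) ^ a * u a :=
          Finset.sum_nonneg fun a _ => mul_nonneg (by positivity) (hu0 a)
        have hv1 : 0 ≤ ∑ a ∈ Finset.range N, (1 / 4 : ℝ) ^ a * v a :=
          Finset.sum_nonneg fun a _ => mul_nonneg (by positivity) (hv0 a)
        gcongr
    _ ≤ _ := by
        have : 0 ≤ κ ^ 2 * size A := mul_nonneg (sq_nonneg _) hsA
        nlinarith

/-- The Carleson measure estimate behind the boundedness of the paraproduct on BMO. -/
theorem sum_mul_EE_sq_le {n : ℕ} {κ Λ : ℝ} {b : X → Y → ℝ} (hP : P.depth ≤ n) (hQ : Q.depth ≤ n)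
    (hb : BMOData P Q n κ b) {s : Finset (ℕ × ℕ)} (hs : ∀ p ∈ s, p.1 ≤ n ∧ p.2 ≤ n)
    (hΛ : 0 ≤ Λ) {ν : ℕ → ℕ → X → Y → ℝ} (hν : ∀ i j x y, 0 ≤ ν i j x y)
    (htail : ∀ k₁ k₂ : ℕ, Carl P Q (s.filter fun p => k₁ ≤ p.1 ∧ k₂ ≤ p.2)
      (Λ / (((k₁ + 1) * (k₂ + 1)) ^ 2)) ν) (A : Set (X × Y)) :
    ∑ x, ∑ y, ∑ p ∈ s, ind (Sub P Q p.1 p.2 x y A) *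
      (ν p.1 p.2 x y * EE P Q p.1 p.2 b x y ^ 2) ≤ 2 ^ 38 * Λ * κ ^ 2 * size A := by
  set T : Set (X × Y) → ℝ := fun A => ∑ x, ∑ y, ∑ p ∈ s, ind (Sub P Q p.1 p.2 x y A) *
      (ν p.1 p.2 x y * EE P Q p.1 p.2 b x y ^ 2) with hT
  have hnn : ∀ (p : ℕ × ℕ) x y, 0 ≤ ν p.1 p.2 x y * EE P Q p.1 p.2 b x y ^ 2 := fun p x y =>
    mul_nonneg (hν _ _ _ _) (sq_nonneg _)
  -- Rectangles inside the hull of the bad set are left to the iteration; the others, marked by `G`,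
  -- are estimated directly.
  have hstep : ∀ A, T A ≤ T (badHull P Q (1 / 256) A) + 2 ^ 37 * Λ * κ ^ 2 * size A := by
    intro A
    set G : ℕ × ℕ → X → Y → Prop := fun p x y => Sub P Q p.1 p.2 x y A ∧
      ¬ Sub P Q p.1 p.2 x y (badHull P Q (1 / 256) A) with hG
    have h1 : T A ≤ T (badHull P Q (1 / 256) A) + ∑ x, ∑ y, ∑ p ∈ s, ind (G p x y) *
        (ν p.1 p.2 x y * EE P Q p.1 p.2 b x y ^ 2) := by
      simp only [hT, ← Finset.sum_add_distrib]
      refine Finset.sum_le_sum fun x _ => Finset.sum_le_sum fun y _ => Finset.sum_le_sum fun p _ => ?_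
      rw [← add_mul]
      refine mul_le_mul_of_nonneg_right ?_ (hnn p x y)
      by_cases hA : Sub P Q p.1 p.2 x y A
      · by_cases hE : Sub P Q p.1 p.2 x y (badHull P Q (1 / 256) A)
        · rw [ind_of hA, ind_of hE]; linarith [ind_nonneg (G p x y)]
        · rw [ind_of hA, ind_of (show G p x y from ⟨hA, hE⟩)]
          linarith [ind_nonneg (Sub P Q p.1 p.2 x y (badHull P Q (1 / 256) A))]
      · rw [ind_of_not hA]; exact add_nonneg (ind_nonneg _) (ind_nonneg _)
    refine h1.trans (add_le_add le_rfl ?_)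
    set h : ℕ → ℕ → X → Y → ℝ := fun a₁ a₂ x y => ind ((x, y) ∈ A \ bad P Q (1 / 256) A) *
      majorant P Q n κ A (enl P (1 / 256) A) b (2 ^ (a₁ + 1)) (2 ^ (a₂ + 1)) x y with hh
    have hmaj0 : ∀ a₁ a₂ x y, 0 ≤ majorant P Q n κ A (enl P (1 / 256) A) b
      (2 ^ (a₁ + 1)) (2 ^ (a₂ + 1)) x y := fun a₁ a₂ x y => majorant_nonneg P Q hb.nonneg _ _ _ _ _ _ _
    -- The mean of `b` is constant on the rectangle and below the majorant at its good points, which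
    -- make up at least half of the rectangle.
    have hpt : ∀ a₁ a₂, ∀ p ∈ block s (a₁, a₂), ∀ x y, G p x y →
        |EE P Q p.1 p.2 b x y| ≤ 2 * EE P Q p.1 p.2 (h a₁ a₂) x y := by
      intro a₁ a₂ p hp x y hGp
      obtain ⟨hps, -, hc1, hc2⟩ := block_mem hp
      have hhalf := half_le_EE_good P Q hGp.1 hGp.2
      have hle : EE P Q p.1 p.2 (fun x' y' => |EE P Q p.1 p.2 b x y| *
          ind ((x', y') ∈ A \ bad P Q (1 / 256) A)) x y ≤ EE P Q p.1 p.2 (h a₁ a₂) x y := by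
        refine EE_mono P Q fun x' hx y' hy => ?_
        rw [mul_comm]
        by_cases hz : (x', y') ∈ A \ bad P Q (1 / 256) A
        · simp only [hh]
          rw [ind_of hz, one_mul, one_mul, ← EE_eq_of_mem P Q hx hy]
          exact abs_EE_le_majorant P Q hb.abs_le (hs p hps).1 (hs p hps).2 hc1 hc2
            (hGp.1.of_mem hx hy) hz.2
        · simp only [hh]
          rw [ind_of_not hz, zero_mul, zero_mul]
      rw [EE_const_mul] at hle
      nlinarith [abs_nonneg (EE P Q p.1 p.2 b x y)]
    have hblock : ∀ a₁ a₂, ∑ x, ∑ y, ∑ p ∈ block s (a₁, a₂), ind (G p x y) *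
        (ν p.1 p.2 x y * EE P Q p.1 p.2 b x y ^ 2)
        ≤ 64 * Λ * (((1 / 4 : ℝ) ^ a₁ * (1 / 4) ^ a₂) * ∑ x, ∑ y, (ind ((x, y) ∈ A) *
        majorant P Q n κ A (enl P (1 / 256) A) b (2 ^ (a₁ + 1)) (2 ^ (a₂ + 1)) x y) ^ 2) := by
      intro a₁ a₂
      -- The constant 64 is 16 from the embedding times 4 from squaring the factor 2 above.
      have h2 := (Carl.block_of_tail hν htail a₁ a₂).embed (by positivity) hν (h a₁ a₂)
      calc _ ≤ ∑ x, ∑ y, ∑ p ∈ block s (a₁, a₂), 4 *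
            (ν p.1 p.2 x y * EE P Q p.1 p.2 (h a₁ a₂) x y ^ 2) := by
            refine Finset.sum_le_sum fun x _ => Finset.sum_le_sum fun y _ =>
              Finset.sum_le_sum fun p hp => ?_
            by_cases hGp : G p x y
            · rw [ind_of hGp, one_mul, mul_left_comm]
              refine mul_le_mul_of_nonneg_left ?_ (hν _ _ _ _)
              rw [← sq_abs]
              have := pow_le_pow_left₀ (abs_nonneg _) (hpt a₁ a₂ p hp x y hGp) 2
              rw [mul_pow] at this
              linarith
            · rw [ind_of_not hGp, zero_mul]
              exact mul_nonneg (by norm_num) (mul_nonneg (hν _ _ _ _) (sq_nonneg _))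
        _ ≤ 4 * (16 * (Λ * ((1 / 4) ^ a₁ * (1 / 4) ^ a₂)) * ∑ x, ∑ y, h a₁ a₂ x y ^ 2) := by
            simp only [← Finset.mul_sum]; linarith
        _ ≤ 4 * (16 * (Λ * ((1 / 4) ^ a₁ * (1 / 4) ^ a₂)) * ∑ x, ∑ y, (ind ((x, y) ∈ A) *
        majorant P Q n κ A (enl P (1 / 256) A) b (2 ^ (a₁ + 1)) (2 ^ (a₂ + 1)) x y) ^ 2) := by
            refine mul_le_mul_of_nonneg_left (mul_le_mul_of_nonneg_left ?_ (by positivity))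
              (by norm_num)
            refine Finset.sum_le_sum fun x _ => Finset.sum_le_sum fun y _ => ?_
            refine pow_le_pow_left₀ (mul_nonneg (ind_nonneg _) (hmaj0 _ _ _ _)) ?_ 2
            exact mul_le_mul_of_nonneg_right (ind_mono fun hz => hz.1) (hmaj0 _ _ _ _)
        _ = _ := by ring
    calc _ = ∑ a₁ ∈ Finset.range (n + 1), ∑ a₂ ∈ Finset.range (n + 1), ∑ x, ∑ y,
          ∑ p ∈ block s (a₁, a₂), ind (G p x y) * (ν p.1 p.2 x y * EE P Q p.1 p.2 b x y ^ 2) := by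
          simp only [sum_block hs]
          calc _ = ∑ x, ∑ a₁ ∈ Finset.range (n + 1), ∑ y, ∑ a₂ ∈ Finset.range (n + 1), _ :=
                Finset.sum_congr rfl fun x _ => Finset.sum_comm
            _ = ∑ a₁ ∈ Finset.range (n + 1), ∑ x, ∑ y, ∑ a₂ ∈ Finset.range (n + 1), _ :=
                Finset.sum_comm
            _ = ∑ a₁ ∈ Finset.range (n + 1), ∑ x, ∑ a₂ ∈ Finset.range (n + 1), ∑ y, _ :=
                Finset.sum_congr rfl fun _ _ => Finset.sum_congr rfl fun x _ => Finset.sum_comm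
            _ = _ := Finset.sum_congr rfl fun _ _ => Finset.sum_comm
      _ ≤ ∑ a₁ ∈ Finset.range (n + 1), ∑ a₂ ∈ Finset.range (n + 1), 64 * Λ *
          (((1 / 4 : ℝ) ^ a₁ * (1 / 4) ^ a₂) * ∑ x, ∑ y, (ind ((x, y) ∈ A) *
        majorant P Q n κ A (enl P (1 / 256) A) b (2 ^ (a₁ + 1)) (2 ^ (a₂ + 1)) x y) ^ 2) :=
          Finset.sum_le_sum fun a₁ _ => Finset.sum_le_sum fun a₂ _ => hblock a₁ a₂
      _ ≤ 64 * Λ * (2 ^ 31 * κ ^ 2 * size A) := by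
          simp only [← Finset.mul_sum]
          exact mul_le_mul_of_nonneg_left (sum_majorant_le hP hQ hb A (n + 1)) (by positivity)
      _ = _ := by ring
  have hempty : T ∅ ≤ 0 := by
    refine le_of_eq (Finset.sum_eq_zero fun x _ => Finset.sum_eq_zero fun y _ =>
      Finset.sum_eq_zero fun p _ => ?_)
    rw [ind_of_not fun h => h.mem, zero_mul]
  -- The level `1 / 256` gives the hull at most `64 / 256` of the size. The error is linear in the
  -- size, truncated at zero to be nonnegative on all reals.
  have := le_of_exceptional T (badHull P Q (1 / 256))
    (fun A => (size_badHull_le P Q (by norm_num) A).trans (by linarith))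
    hempty (fun t => max t 0) (fun t => le_max_right _ _)
    (fun s t h => max_le_max_right 0 h)
    (fun t => by rcases le_total t 0 with h | h
                 · rw [max_eq_right h, max_eq_right (by linarith)]; simp
                 · rw [max_eq_left h, max_eq_left (by linarith)]; linarith)
    (2 ^ 37 * Λ * κ ^ 2) (by positivity)
    (fun A => by rw [max_eq_left (size_nonneg A)]; exact hstep A) A
  rw [max_eq_left (size_nonneg A)] at this
  linarith

end CellFiltration

end

end DyadicParaproduct

/-! ### Duality for Carleson families and the bilinear estimate for mixed paraproducts. -/

namespace DyadicParaproduct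

noncomputable section

namespace CellFiltration

variable {X Y : Type*} [Fintype X] [Fintype Y]

/-- Martingale differences have constant modulus on the cells of the preceding generation. -/
def Dyadic (P : CellFiltration X) : Prop :=
  ∀ (i : ℕ) (u : X → ℝ) (x x' : X), x' ∈ P.cell i x → |P.D (i + 1) u x'| = |P.D (i + 1) u x|

variable (P : CellFiltration X) (Q : CellFiltration Y)

/-- Jensen's inequality for the convex function `t⁻²`, obtained by averaging its tangent line at the
mean `m`. -/
lemma inv_sq_EE_le {i j : ℕ} {x : X} {y : Y} {g : X → Y → ℝ}
    (hg : ∀ x' ∈ P.cell i x, ∀ y' ∈ Q.cell j y, 0 < g x' y') :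
    (EE P Q i j g x y)⁻¹ ^ 2 ≤ EE P Q i j (fun x y => (g x y)⁻¹ ^ 2) x y := by
  set m := EE P Q i j g x y with hm
  have hm0 : 0 < m := by
    have : ∀ x' ∈ P.cell i x, 0 < E2 Q j g x' y := fun x' hx =>
      div_pos (Finset.sum_pos (fun y' hy => hg x' hx y' hy) ⟨y, Q.mem_cell j y⟩) (Q.card_cell_pos j y)
    exact div_pos (Finset.sum_pos this ⟨x, P.mem_cell i x⟩) (P.card_cell_pos i x)
  have h := EE_mono P Q (i := i) (j := j) (x := x) (y := y)
    (f := fun x y => 3 * m⁻¹ ^ 2 + (-2 * m⁻¹ ^ 3) * g x y) (g := fun x y => (g x y)⁻¹ ^ 2)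
    fun x' hx y' hy => by
      have h1 := hg x' hx y' hy
      have h2 : 0 ≤ (g x' y' - m) ^ 2 * (2 * g x' y' + m) := by positivity
      have e : (g x' y')⁻¹ ^ 2 - (3 * m⁻¹ ^ 2 + (-2 * m⁻¹ ^ 3) * g x' y')
          = (g x' y' - m) ^ 2 * (2 * g x' y' + m) / (g x' y' ^ 2 * m ^ 3) := by
        field_simp; ring
      have h3 : 0 ≤ (g x' y' - m) ^ 2 * (2 * g x' y' + m) / (g x' y' ^ 2 * m ^ 3) := by positivity
      linarith
  rw [EE_add P Q i j (fun _ _ => 3 * m⁻¹ ^ 2), EE_const, EE_const_mul, ← hm] at h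
  refine le_trans (le_of_eq ?_) h
  field_simp; ring

lemma sum_EE (i j : ℕ) (f : X → Y → ℝ) : ∑ x, ∑ y, EE P Q i j f x y = ∑ x, ∑ y, f x y := by
  unfold EE
  calc _ = ∑ y, ∑ x, E1 P i (E2 Q j f) x y := Finset.sum_comm
    _ = ∑ y, ∑ x, E2 Q j f x y := Finset.sum_congr rfl fun y _ => P.sum_E i _
    _ = ∑ x, ∑ y, E2 Q j f x y := Finset.sum_comm
    _ = _ := Finset.sum_congr rfl fun x _ => Q.sum_E j _

variable {P Q}

lemma sum_sum_sum_mul_le {ι : Type*} (s : Finset ι) (f g : X → Y → ι → ℝ) :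
    ∑ x, ∑ y, ∑ p ∈ s, f x y p * g x y p
      ≤ √(∑ x, ∑ y, ∑ p ∈ s, f x y p ^ 2) * √(∑ x, ∑ y, ∑ p ∈ s, g x y p ^ 2) := by
  have e : ∀ F : X → Y → ι → ℝ, ∑ x, ∑ y, ∑ p ∈ s, F x y p
      = ∑ z ∈ Finset.univ ×ˢ (Finset.univ ×ˢ s), F z.1 z.2.1 z.2.2 := fun F => by
    simp only [Finset.sum_product]
  rw [e (fun x y p => f x y p * g x y p), e (fun x y p => f x y p ^ 2), e (fun x y p => g x y p ^ 2)]
  exact Real.sum_mul_le_sqrt_mul_sqrt _ _ _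

/-- Duality of Carleson families with functions having an integrable square function. -/
lemma Carl.sum_mul_le {s : Finset (ℕ × ℕ)} {K : ℝ} {n a : ℕ → ℕ → X → Y → ℝ}
    (h : Carl P Q s K fun i j x y => n i j x y ^ 2) (hK : 0 ≤ K)
    (ha : ∀ i j x y, ∀ x' ∈ P.cell i x, ∀ y' ∈ Q.cell j y, a i j x' y' = a i j x y) :
    ∑ x, ∑ y, ∑ p ∈ s, n p.1 p.2 x y * a p.1 p.2 x y
      ≤ 4 * √K * ∑ x, ∑ y, √(∑ p ∈ s, a p.1 p.2 x y ^ 2) := by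
  set S : X → Y → ℝ := fun x y => √(∑ p ∈ s, a p.1 p.2 x y ^ 2) with hS
  have hS0 : ∀ x y, 0 ≤ S x y := fun x y => Real.sqrt_nonneg _
  -- Each product is split as `n * E g` times `a / E g`. With this weight the Carleson embedding
  -- bounds the first square sum by `16 K ∑ S`, and Jensen's inequality bounds the second one by `∑
  -- S² / g² = ∑ S`.
  set g : X → Y → ℝ := fun x y => √(S x y) with hg
  have hg2 : ∀ x y, g x y ^ 2 = S x y := fun x y => Real.sq_sqrt (hS0 x y)
  have hSpos : ∀ p ∈ s, ∀ x y, a p.1 p.2 x y ≠ 0 → 0 < S x y := fun p hp x y hne => by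
    refine Real.sqrt_pos.mpr (lt_of_lt_of_le (sq_pos_of_ne_zero hne) ?_)
    exact Finset.single_le_sum (f := fun p : ℕ × ℕ => a p.1 p.2 x y ^ 2)
      (fun _ _ => sq_nonneg _) hp
  have hpos : ∀ p ∈ s, ∀ x y, a p.1 p.2 x y ≠ 0 →
      ∀ x' ∈ P.cell p.1 x, ∀ y' ∈ Q.cell p.2 y, 0 < g x' y' := fun p hp x y hne x' hx y' hy =>
    Real.sqrt_pos.mpr (hSpos p hp x' y' (by rwa [ha _ _ _ _ x' hx y' hy]))
  have hu : ∀ p ∈ s, ∀ x y, a p.1 p.2 x y ≠ 0 → EE P Q p.1 p.2 g x y ≠ 0 :=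
    fun p hp x y hne => by
      have h1 := inv_sq_EE_le P Q (hpos p hp x y hne)
      refine ne_of_gt (div_pos (Finset.sum_pos (fun x' hx => div_pos (Finset.sum_pos
        (fun y' hy => hpos p hp x y hne x' hx y' hy) ⟨y, Q.mem_cell _ y⟩) (Q.card_cell_pos _ y))
        ⟨x, P.mem_cell _ x⟩) (P.card_cell_pos _ x))
  have e : ∑ x, ∑ y, ∑ p ∈ s, n p.1 p.2 x y * a p.1 p.2 x y
      = ∑ x, ∑ y, ∑ p ∈ s, (n p.1 p.2 x y * EE P Q p.1 p.2 g x y) *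
        (a p.1 p.2 x y * (EE P Q p.1 p.2 g x y)⁻¹) := by
    refine Finset.sum_congr rfl fun x _ => Finset.sum_congr rfl fun y _ =>
      Finset.sum_congr rfl fun p hp => ?_
    by_cases hne : a p.1 p.2 x y = 0
    · rw [hne]; ring
    · have := hu p hp x y hne
      field_simp
  have h1 : ∑ x, ∑ y, ∑ p ∈ s, (n p.1 p.2 x y * EE P Q p.1 p.2 g x y) ^ 2
      ≤ 16 * K * ∑ x, ∑ y, S x y := by
    have := h.embed hK (fun _ _ _ _ => sq_nonneg _) g
    simpa only [hg2, mul_pow] using this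
  have h2 : ∑ x, ∑ y, ∑ p ∈ s, (a p.1 p.2 x y * (EE P Q p.1 p.2 g x y)⁻¹) ^ 2
      ≤ ∑ x, ∑ y, S x y := by
    have h3 : ∀ p ∈ s, ∀ x y, (a p.1 p.2 x y * (EE P Q p.1 p.2 g x y)⁻¹) ^ 2
        ≤ EE P Q p.1 p.2 (fun x y => a p.1 p.2 x y ^ 2 * (g x y)⁻¹ ^ 2) x y := by
      intro p hp x y
      have e1 : EE P Q p.1 p.2 (fun x y => a p.1 p.2 x y ^ 2 * (g x y)⁻¹ ^ 2) x y
          = a p.1 p.2 x y ^ 2 * EE P Q p.1 p.2 (fun x y => (g x y)⁻¹ ^ 2) x y := by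
        rw [← EE_const_mul]
        exact P.E_congr fun x' hx => Q.E_congr fun y' hy => by
          simp only [ha _ _ _ _ x' hx y' hy]
      rw [e1, mul_pow]
      by_cases hne : a p.1 p.2 x y = 0
      · rw [hne]; simp
      · exact mul_le_mul_of_nonneg_left (inv_sq_EE_le P Q (hpos p hp x y hne)) (sq_nonneg _)
    calc _ ≤ ∑ x, ∑ y, ∑ p ∈ s,
          EE P Q p.1 p.2 (fun x y => a p.1 p.2 x y ^ 2 * (g x y)⁻¹ ^ 2) x y :=
          Finset.sum_le_sum fun x _ => Finset.sum_le_sum fun y _ =>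
            Finset.sum_le_sum fun p hp => h3 p hp x y
      _ = ∑ p ∈ s, ∑ x, ∑ y,
          EE P Q p.1 p.2 (fun x y => a p.1 p.2 x y ^ 2 * (g x y)⁻¹ ^ 2) x y := by
          rw [Finset.sum_congr rfl fun x _ => Finset.sum_comm, Finset.sum_comm]
      _ = ∑ p ∈ s, ∑ x, ∑ y, a p.1 p.2 x y ^ 2 * (g x y)⁻¹ ^ 2 :=
          Finset.sum_congr rfl fun p _ => sum_EE P Q _ _ _
      _ = ∑ x, ∑ y, ∑ p ∈ s, a p.1 p.2 x y ^ 2 * (g x y)⁻¹ ^ 2 := by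
          rw [Finset.sum_comm]
          exact Finset.sum_congr rfl fun x _ => Finset.sum_comm
      _ ≤ _ := by
          refine Finset.sum_le_sum fun x _ => Finset.sum_le_sum fun y _ => ?_
          rw [← Finset.sum_mul, inv_pow, hg2]
          have hs : ∑ p ∈ s, a p.1 p.2 x y ^ 2 = S x y ^ 2 :=
            (Real.sq_sqrt (Finset.sum_nonneg fun _ _ => sq_nonneg _)).symm
          rw [hs]
          rcases eq_or_ne (S x y) 0 with h0 | h0
          · rw [h0]; simp
          · rw [sq, mul_assoc, mul_inv_cancel₀ h0, mul_one]
  have hV0 : 0 ≤ ∑ x, ∑ y, S x y := Finset.sum_nonneg fun _ _ => Finset.sum_nonneg fun _ _ => hS0 _ _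
  rw [e]
  refine (sum_sum_sum_mul_le s _ _).trans ?_
  refine (mul_le_mul (Real.sqrt_le_sqrt h1) (Real.sqrt_le_sqrt h2) (Real.sqrt_nonneg _)
    (Real.sqrt_nonneg _)).trans (le_of_eq ?_)
  rw [mul_assoc, Real.sqrt_mul (by norm_num), Real.sqrt_mul hK, mul_assoc, mul_assoc,
    Real.mul_self_sqrt hV0, show (16 : ℝ) = 4 ^ 2 by norm_num, Real.sqrt_sq (by norm_num)]
  ring

variable (P Q)

/-- The pointwise majorant for the averages in the first variable of a martingale difference in
the second variable. -/
def colMaj (n : ℕ) (A B : Set (X × Y)) (b : X → Y → ℝ) (c j : ℕ) (x : X) (y : Y) : ℝ :=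
  ind ((x, y) ∈ A) * (ind (stopK P Q A B x y + 1 < c) * (ind (stopY Q A x y ≤ j) *
      |E1 P (stopK P Q A B x y) (D2 Q (j + 1) b) x y|)
    + 2 * M1 P (fun x y => |D2 Q (j + 1) (projOn P Q n B b) x y|) x y)

lemma colMaj_nonneg (n : ℕ) (A B : Set (X × Y)) (b : X → Y → ℝ) (c j : ℕ) (x : X) (y : Y) :
    0 ≤ colMaj P Q n A B b c j x y :=
  mul_nonneg (ind_nonneg _) (add_nonneg (mul_nonneg (ind_nonneg _) (mul_nonneg (ind_nonneg _)
    (abs_nonneg _))) (mul_nonneg (by norm_num) (M1_nonneg P (fun _ _ => abs_nonneg _) x y)))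

lemma abs_E1_le_M1 (i : ℕ) (f : X → Y → ℝ) (x : X) (y : Y) :
    |E1 P i f x y| ≤ M1 P (fun x y => |f x y|) x y :=
  (P.abs_E_le _ _ _).trans (P.E_le_M _ _ _)

lemma abs_E2_le_M2 (j : ℕ) (f : X → Y → ℝ) (x : X) (y : Y) :
    |E2 Q j f x y| ≤ M2 Q (fun x y => |f x y|) x y :=
  (Q.abs_E_le _ _ _).trans (Q.E_le_M _ _ _)

variable {P Q}

/-- At a good point the first-variable generation can be lowered from `i` to `k` inside the
enlargement. The differences met on the way coincide with those of the projection of `b`, which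
costs two maximal functions; what remains is the coefficient at generation `k`. -/
lemma abs_E1_D2_le_colMaj {n : ℕ} {δ : ℝ} {A : Set (X × Y)} {b : X → Y → ℝ} {i j c : ℕ}
    (hi : i ≤ n) (hj : j < n) (hc : i + 1 < c) {x : X} {y : Y} (hA : Sub P Q i j x y A)
    (hbad : (x, y) ∉ bad P Q δ A) :
    |E1 P i (D2 Q (j + 1) b) x y| ≤ colMaj P Q n A (enl P δ A) b c j x y := by
  set B := enl P δ A with hB
  have hxy : (x, y) ∈ A := hA.mem
  have hpq : Sub P Q (stopX P A x y) (stopY Q A x y) x y B := by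
    by_contra h; exact hbad ⟨hxy, h⟩
  have hpi : stopX P A x y ≤ i := stop_le (C := P) (S := {x' | (x', y) ∈ A})
    fun z hz => hA z hz y (Q.mem_cell j y)
  have hqj : stopY Q A x y ≤ j := stop_le (C := Q) (S := {y' | (x, y') ∈ A})
    fun z hz => hA x (P.mem_cell i x) z hz
  have hkB : Sub P Q (stopK P Q A B x y) (stopY Q A x y) x y B := stopK_spec hpq
  have hkp : stopK P Q A B x y ≤ stopX P A x y := stopK_le hpq
  rw [colMaj, ind_of hxy, one_mul, ind_of (by omega : stopK P Q A B x y + 1 < c), ind_of hqj,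
    one_mul, one_mul]
  set k := stopK P Q A B x y with hk
  have e : ∀ f : X → Y → ℝ, E1 P i (D2 Q (j + 1) f) x y - E1 P k (D2 Q (j + 1) f) x y
      = ∑ i' ∈ Finset.Ico k i, D1 P (i' + 1) (D2 Q (j + 1) f) x y := fun f =>
    (P.sum_Ico_D (hkp.trans hpi) _ _).symm
  have e2 : E1 P i (D2 Q (j + 1) b) x y - E1 P k (D2 Q (j + 1) b) x y
      = E1 P i (D2 Q (j + 1) (projOn P Q n B b)) x y
        - E1 P k (D2 Q (j + 1) (projOn P Q n B b)) x y := by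
    rw [e, e]
    refine Finset.sum_congr rfl fun i' hi' => ?_
    rw [Finset.mem_Ico] at hi'
    rw [D1_D2_projOn P Q (by omega) hj, ind_of (hkB.anti hi'.1 hqj), one_mul]
  have h1 := abs_E1_le_M1 P i (D2 Q (j + 1) (projOn P Q n B b)) x y
  have h2 := abs_E1_le_M1 P k (D2 Q (j + 1) (projOn P Q n B b)) x y
  rw [abs_le] at h1 h2
  have h3 := abs_le.mp (le_refl |E1 P k (D2 Q (j + 1) b) x y|)
  rw [abs_le]
  constructor <;> linarith [h1.1, h1.2, h2.1, h2.2, h3.1, h3.2]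

lemma abs_D2_eq_of_mem (hQ : Q.Dyadic) {j : ℕ} {y y' : Y} (hy : y' ∈ Q.cell j y)
    (f : X → Y → ℝ) (x : X) : |D2 Q (j + 1) f x y'| = |D2 Q (j + 1) f x y| :=
  hQ j (f x) y y' hy

lemma abs_D1_eq_of_mem (hP : P.Dyadic) {i : ℕ} {x x' : X} (hx : x' ∈ P.cell i x)
    (f : X → Y → ℝ) (y : Y) : |D1 P (i + 1) f x' y| = |D1 P (i + 1) f x y| :=
  hP i (fun x => f x y) x x' hx

/-- The difference changes sign between the two halves of a cell of generation `j`, but its modulus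
does not change. -/
lemma abs_E1_D2_eq_of_mem (hQ : Q.Dyadic) {i j : ℕ} {x x' : X} {y y' : Y} (hx : x' ∈ P.cell i x)
    (hy : y' ∈ Q.cell j y) (b : X → Y → ℝ) :
    |E1 P i (D2 Q (j + 1) b) x' y'| = |E1 P i (D2 Q (j + 1) b) x y| := by
  rw [E1_D2, abs_D2_eq_of_mem hQ hy, ← E1_D2]
  unfold E1; rw [P.E_eq_of_mem hx]

lemma abs_D1_E2_eq_of_mem (hP : P.Dyadic) {i j : ℕ} {x x' : X} {y y' : Y} (hx : x' ∈ P.cell i x)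
    (hy : y' ∈ Q.cell j y) (b : X → Y → ℝ) :
    |D1 P (i + 1) (E2 Q j b) x' y'| = |D1 P (i + 1) (E2 Q j b) x y| := by
  rw [abs_D1_eq_of_mem hP hx, D1_E2, D1_E2]
  unfold E2; rw [Q.E_eq_of_mem hy]

/-- The cell of generation `j` lies in the maximal vertical segment, along which the stopping
generations are constant, and moduli of differences are constant on it. -/
lemma colMaj_eq_of_mem (hQ : Q.Dyadic) {n : ℕ} {A B : Set (X × Y)} {b : X → Y → ℝ} {i j c : ℕ}
    {x : X} {y y' : Y} (hA : Sub P Q i j x y A) (hy : y' ∈ Q.cell j y) :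
    colMaj P Q n A B b c j x y' = colMaj P Q n A B b c j x y := by
  have hxy : (x, y) ∈ A := hA.mem
  have hqj : stopY Q A x y ≤ j := stop_le (C := Q) (S := {y' | (x, y') ∈ A})
    fun z hz => hA x (P.mem_cell i x) z hz
  have hy2 := Q.cell_anti hqj y hy
  unfold colMaj
  rw [ind_of hxy, ind_of (show (x, y') ∈ A from hA x (P.mem_cell i x) y' hy),
    stopK_eq_of_mem hxy hy2, stopY_eq_of_mem hxy hy2,
    abs_E1_D2_eq_of_mem hQ (P.mem_cell _ x) hy]
  unfold M1
  simp only [abs_D2_eq_of_mem hQ hy]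

/-- Both sides of the good-point bound are constant along vertical cells, so it holds on a whole
column of the rectangle as soon as the column has one good point. The proportion of such columns is
at least that of good points, hence at least one half, and averaging in the first variable alone
suffices. -/
lemma abs_E1_D2_le_two_mul_M1 (hQ : Q.Dyadic) {n : ℕ} {δ : ℝ} {A : Set (X × Y)} {b : X → Y → ℝ}
    {i j c : ℕ} (hi : i ≤ n) (hj : j < n) (hc : i + 1 < c) {x : X} {y : Y}
    (hA : Sub P Q i j x y A) (hE : ¬ Sub P Q i j x y (badHull P Q δ A)) :
    |E1 P i (D2 Q (j + 1) b) x y|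
      ≤ 2 * M1 P (fun x y => colMaj P Q n A (enl P δ A) b c j x y) x y := by
  have hhalf := half_le_EE_good P Q hA hE
  set t := |E1 P i (D2 Q (j + 1) b) x y| with ht
  have ht0 : 0 ≤ t := abs_nonneg _
  have h1 : t * EE P Q i j (fun x y => ind ((x, y) ∈ A \ bad P Q δ A)) x y
      ≤ M1 P (fun x y => colMaj P Q n A (enl P δ A) b c j x y) x y := by
    rw [EE, E1, ← P.E_const_mul]
    refine le_trans (P.E_mono fun x' hx => ?_) (P.E_le_M i _ x)
    by_cases hex : ∃ y' ∈ Q.cell j y, (x', y') ∉ bad P Q δ A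
    · obtain ⟨y', hy, hb⟩ := hex
      have h2 := abs_E1_D2_le_colMaj (b := b) hi hj hc (hA.of_mem hx hy) hb
      rw [abs_E1_D2_eq_of_mem hQ hx hy, colMaj_eq_of_mem hQ (hA.of_mem hx (Q.mem_cell j y)) hy] at h2
      have h3 : E2 Q j (fun x y => ind ((x, y) ∈ A \ bad P Q δ A)) x' y ≤ 1 := by
        rw [← Q.E_const j 1 y]
        exact Q.E_mono fun _ _ => ind_le_one _
      exact (mul_le_of_le_one_right ht0 h3).trans h2
    · push Not at hex
      have h3 : E2 Q j (fun x y => ind ((x, y) ∈ A \ bad P Q δ A)) x' y = 0 := by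
        rw [← Q.E_const j 0 y]
        exact Q.E_congr fun y' hy => ind_of_not fun h => h.2 (hex y' hy)
      rw [h3, mul_zero]
      exact colMaj_nonneg _ _ _ _ _ _ _ _ _ _
  nlinarith

/-- By orthogonality on each maximal vertical segment, the sum over `j` of the squared differences
equals the square sum of `halfLocal`, so the two left sides agree. -/
lemma sum_stopK_sq_le {n : ℕ} (hQn : Q.depth ≤ n) {A B : Set (X × Y)} (b : X → Y → ℝ) {K : ℝ}
    (hb : ∀ (i q : ℕ) (x : X) (y : Y), ∑ y' ∈ Q.cell q y,
      (D1 P i b x y' - E2 Q q (D1 P i b) x y') ^ 2 ≤ K * (Q.cell q y).card) :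
    ∑ x, ∑ y, ind ((x, y) ∈ A) * ((∑ j ∈ Finset.range n, ind (stopY Q A x y ≤ j) *
      E1 P (stopK P Q A B x y) (D2 Q (j + 1) b) x y ^ 2) / ((stopK P Q A B x y : ℝ) + 1) ^ 2)
      ≤ K * size A := by
  refine le_trans (le_of_eq (Finset.sum_congr rfl fun x _ => ?_))
    (sum_halfLocal_le (A := A) (B := B) b hb)
  have h1 := sum_ind_mul_E_stopIdx (C := Q) {y' | (x, y') ∈ A}
    (fun y => halfLocal P Q A B b x y ^ 2 / ((stopK P Q A B x y : ℝ) + 1) ^ 2)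
  have h2 := sum_ind_mul_E_stopIdx (C := Q) {y' | (x, y') ∈ A}
    (fun y => (∑ j ∈ Finset.range n, ind (stopY Q A x y ≤ j) *
      E1 P (stopK P Q A B x y) (D2 Q (j + 1) b) x y ^ 2) / ((stopK P Q A B x y : ℝ) + 1) ^ 2)
  refine h2.symm.trans (Eq.trans ?_ h1)
  refine Finset.sum_congr rfl fun y _ => ?_
  by_cases hA : (x, y) ∈ A
  swap
  · rw [ind_of_not (show ¬ y ∈ {y' | (x, y') ∈ A} from hA), zero_mul, zero_mul]
  congr 1
  change Q.E (stopY Q A x y) _ y = Q.E (stopY Q A x y) _ y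
  set q := stopY Q A x y with hq
  set k := stopK P Q A B x y with hk
  have e1 : ∀ y' ∈ Q.cell q y, (∑ j ∈ Finset.range n, ind (stopY Q A x y' ≤ j) *
      E1 P (stopK P Q A B x y') (D2 Q (j + 1) b) x y' ^ 2) / ((stopK P Q A B x y' : ℝ) + 1) ^ 2
      = (∑ j ∈ Finset.Ico q n, Q.D (j + 1) (E1 P k b x) y' ^ 2) / ((k : ℝ) + 1) ^ 2 := by
    intro y' hy
    rw [stopK_eq_of_mem hA hy, stopY_eq_of_mem hA hy, ← hk, ← hq]
    congr 1
    rw [← Finset.sum_subset (s₁ := Finset.Ico q n)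
      (fun j hj => Finset.mem_range.mpr (Finset.mem_Ico.mp hj).2)]
    · refine Finset.sum_congr rfl fun j hj => ?_
      rw [ind_of (Finset.mem_Ico.mp hj).1, one_mul, E1_D2]; rfl
    · intro j hj hj'
      rw [Finset.mem_range] at hj
      rw [Finset.mem_Ico] at hj'
      rw [ind_of_not (by omega), zero_mul]
  have e2 : ∀ y' ∈ Q.cell q y, halfLocal P Q A B b x y' ^ 2 / ((stopK P Q A B x y' : ℝ) + 1) ^ 2
      = (E1 P k b x y' - Q.E q (E1 P k b x) y') ^ 2 / ((k : ℝ) + 1) ^ 2 := by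
    intro y' hy
    rw [halfLocal, stopK_eq_of_mem hA hy, stopY_eq_of_mem hA hy, ← hk, ← hq, EE, EE_comm]; rfl
  rw [Q.E_congr e1, Q.E_congr e2]
  unfold E
  congr 1
  rw [← Finset.sum_div, ← Finset.sum_div]
  congr 1
  rw [Finset.sum_comm]
  by_cases hqn : q ≤ n
  · exact (Q.sum_sq_sub_E (Q.cell q y) hqn hQn
      (fun y' hy => by rw [Q.cell_eq q y y' hy]) (E1 P k b x)).symm
  · rw [Finset.Ico_eq_empty (by omega)]
    rw [Finset.sum_empty]
    refine (Finset.sum_eq_zero fun y' _ => ?_).symm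
    have := Q.E_of_depth_le (i := q) (by omega) (E1 P k b x) y'
    unfold E at this
    rw [this, sub_self, sq, zero_mul]

lemma sum_sum_sum_comm {ι : Type*} (s : Finset ι) (f : ι → X → Y → ℝ) :
    ∑ p ∈ s, ∑ x, ∑ y, f p x y = ∑ x, ∑ y, ∑ p ∈ s, f p x y := by
  rw [Finset.sum_comm]
  exact Finset.sum_congr rfl fun x _ => Finset.sum_comm

lemma sum_D2_sq_le {n : ℕ} (hQn : Q.depth ≤ n) (f : X → Y → ℝ) :
    ∑ j ∈ Finset.range n, ∑ x, ∑ y, D2 Q (j + 1) f x y ^ 2 ≤ ∑ x, ∑ y, f x y ^ 2 := by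
  rw [Finset.sum_comm]
  refine Finset.sum_le_sum fun x _ => ?_
  rw [Q.sum_sq_D hQn (f x), Finset.sum_range_succ']
  exact le_add_of_nonneg_right (Finset.sum_nonneg fun _ _ => sq_nonneg _)

lemma sum_D1_sq_le {n : ℕ} (hPn : P.depth ≤ n) (f : X → Y → ℝ) :
    ∑ i ∈ Finset.range n, ∑ x, ∑ y, D1 P (i + 1) f x y ^ 2 ≤ ∑ x, ∑ y, f x y ^ 2 := by
  rw [Finset.sum_comm (f := fun x y => f x y ^ 2),
    Finset.sum_congr rfl fun i _ => Finset.sum_comm (f := fun x y => D1 P (i + 1) f x y ^ 2)]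
  exact sum_D2_sq_le (Q := P) hPn fun y x => f x y

/-- The coarse part is summed against the truncation as before. For the projected part, the
differences in the second variable are orthogonal, so all `j` together cost one `L²` norm of the
projection, which the BMO condition on the enlargement bounds. -/
lemma sum_colMaj_sq_le {n : ℕ} {κ : ℝ} {b : X → Y → ℝ} (hP : P.depth ≤ n) (hQ : Q.depth ≤ n)
    (hb : BMOData P Q n κ b) (A : Set (X × Y)) (N : ℕ) :
    ∑ a ∈ Finset.range N, (1 / 4 : ℝ) ^ a * ∑ j ∈ Finset.range n,
      ∑ x, ∑ y, colMaj P Q n A (enl P (1 / 256) A) b (2 ^ (a + 1)) j x y ^ 2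
      ≤ 2 ^ 24 * κ ^ 2 * size A := by
  set B := enl P (1 / 256) A with hB
  set u : ℕ → ℝ := fun a => ∑ x, ∑ y, ∑ j ∈ Finset.range n, ind ((x, y) ∈ A) *
    (ind (stopK P Q A B x y + 1 < 2 ^ (a + 1)) * (ind (stopY Q A x y ≤ j) *
      E1 P (stopK P Q A B x y) (D2 Q (j + 1) b) x y ^ 2)) with hu
  set m : ℝ := ∑ j ∈ Finset.range n, ∑ x, ∑ y,
    M1 P (fun x y => |D2 Q (j + 1) (projOn P Q n B b) x y|) x y ^ 2 with hm
  have hsA := size_nonneg A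
  have h1 : ∀ a, ∑ j ∈ Finset.range n, ∑ x, ∑ y, colMaj P Q n A B b (2 ^ (a + 1)) j x y ^ 2
      ≤ 2 * u a + 8 * m := by
    intro a
    rw [hu, hm]
    simp only
    rw [← sum_sum_sum_comm]
    simp only [Finset.mul_sum, ← Finset.sum_add_distrib]
    refine Finset.sum_le_sum fun j _ => Finset.sum_le_sum fun x _ => Finset.sum_le_sum fun y _ => ?_
    unfold colMaj
    have e1 := ind_sq ((x, y) ∈ A)
    have e2 := ind_sq (stopK P Q A B x y + 1 < 2 ^ (a + 1))
    have e3 := ind_sq (stopY Q A x y ≤ j)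
    rw [mul_pow, e1]
    have hA1 := ind_le_one ((x, y) ∈ A)
    have hA0 := ind_nonneg ((x, y) ∈ A)
    rw [← sq_abs (E1 P (stopK P Q A B x y) (D2 Q (j + 1) b) x y)]
    generalize ind (stopK P Q A B x y + 1 < 2 ^ (a + 1)) = s at *
    generalize ind (stopY Q A x y ≤ j) = t at *
    generalize |E1 P (stopK P Q A B x y) (D2 Q (j + 1) b) x y| = r
    generalize M1 P (fun x y => |D2 Q (j + 1) (projOn P Q n B b) x y|) x y = v
    generalize ind ((x, y) ∈ A) = w at *
    have h0 : (s * (t * r)) ^ 2 = s * (t * r ^ 2) := by rw [mul_pow, mul_pow, e2, e3]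
    have h2 : (s * (t * r) + 2 * v) ^ 2 ≤ 2 * (s * (t * r ^ 2)) + 8 * v ^ 2 := by
      rw [← h0]; nlinarith [sq_nonneg (s * (t * r) - 2 * v)]
    have h3 : w * (8 * v ^ 2) ≤ 8 * v ^ 2 := mul_le_of_le_one_left (by positivity) hA1
    nlinarith [mul_le_mul_of_nonneg_left h2 hA0]
  have hu_le : ∑ a ∈ Finset.range N, (1 / 4 : ℝ) ^ a * u a ≤ 16 / 3 * (κ ^ 2 * size A) := by
    have h2 := sum_stopK_sq_le (P := P) hQ (A := A) (B := B) b hb.snd_le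
    refine le_trans ?_ (mul_le_mul_of_nonneg_left h2 (by norm_num))
    simp only [hu, Finset.mul_sum]
    rw [sum_sum_sum_comm]
    refine Finset.sum_le_sum fun x _ => Finset.sum_le_sum fun y _ => ?_
    have h3 := sum_quarter_pow_mul_sq_le N (stopK P Q A B x y)
    have h4 : 0 ≤ ind ((x, y) ∈ A) * (∑ j ∈ Finset.range n, ind (stopY Q A x y ≤ j) *
      E1 P (stopK P Q A B x y) (D2 Q (j + 1) b) x y ^ 2) :=
      mul_nonneg (ind_nonneg _) (Finset.sum_nonneg fun _ _ => mul_nonneg (ind_nonneg _) (sq_nonneg _))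
    have h5 := mul_le_mul_of_nonneg_left h3 h4
    refine le_trans (le_of_eq ?_) (h5.trans (le_of_eq (by ring)))
    rw [Finset.mul_sum]
    refine Finset.sum_congr rfl fun a _ => ?_
    rw [Finset.mul_sum, Finset.sum_mul]
    exact Finset.sum_congr rfl fun j _ => by ring
  have hm_le : m ≤ 4 * (2 ^ 18 * (κ ^ 2 * size A)) := by
    have h2 : m ≤ 4 * ∑ j ∈ Finset.range n, ∑ x, ∑ y, D2 Q (j + 1) (projOn P Q n B b) x y ^ 2 := by
      rw [Finset.mul_sum]
      refine Finset.sum_le_sum fun j _ => ?_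
      have := sum_M1_sq_le P (fun x y => |D2 Q (j + 1) (projOn P Q n B b) x y|)
      simpa only [sq_abs] using this
    have h3 := sum_D2_sq_le hQ (projOn P Q n B b)
    rw [sum_sq_projOn P Q hP hQ] at h3
    have h4 := hb.sum_le B
    have h5 := mul_le_mul_of_nonneg_left (size_enl_le P (δ := 1 / 256) (by norm_num) A)
      (sq_nonneg κ)
    norm_num at h5
    rw [← hB] at h5
    linarith
  have hm0 : 0 ≤ m := Finset.sum_nonneg fun _ _ => Finset.sum_nonneg fun _ _ =>
    Finset.sum_nonneg fun _ _ => sq_nonneg _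
  clear_value m u
  calc _ ≤ ∑ a ∈ Finset.range N, (1 / 4 : ℝ) ^ a * (2 * u a + 8 * m) :=
        Finset.sum_le_sum fun a _ => mul_le_mul_of_nonneg_left (h1 a) (by positivity)
    _ = 2 * ∑ a ∈ Finset.range N, (1 / 4 : ℝ) ^ a * u a
        + 8 * m * ∑ a ∈ Finset.range N, (1 / 4 : ℝ) ^ a := by
        rw [Finset.mul_sum, Finset.mul_sum, ← Finset.sum_add_distrib]
        exact Finset.sum_congr rfl fun _ _ => by ring
    _ ≤ 2 * (16 / 3 * (κ ^ 2 * size A)) + 8 * m * (4 / 3) := by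
        have := sum_quarter_pow_le' N
        gcongr
    _ ≤ _ := by nlinarith [mul_nonneg (sq_nonneg κ) hsA]

/-- The bilinear estimate behind the boundedness of the mixed paraproducts on BMO. -/
theorem sum_mul_abs_mul_abs_le {n : ℕ} {κ Λ : ℝ} {b : X → Y → ℝ} (hP : P.depth ≤ n)
    (hQ : Q.depth ≤ n) (hPd : P.Dyadic) (hQd : Q.Dyadic) (hb : BMOData P Q n κ b)
    {s : Finset (ℕ × ℕ)} (hs : ∀ p ∈ s, p.1 < n ∧ p.2 < n)
    (hΛ : 0 ≤ Λ) {ν : ℕ → ℕ → X → Y → ℝ} (hν : ∀ i j x y, 0 ≤ ν i j x y)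
    (htail : ∀ k : ℕ, Carl P Q (s.filter fun p => k ≤ p.1)
      (Λ ^ 2 / (k + 1) ^ 2) fun i j x y => ν i j x y ^ 2) (f : X → Y → ℝ) (A : Set (X × Y)) :
    ∑ x, ∑ y, ∑ p ∈ s, ind (Sub P Q p.1 p.2 x y A) * (ν p.1 p.2 x y *
      (|E1 P p.1 (D2 Q (p.2 + 1) b) x y| * |D1 P (p.1 + 1) (E2 Q p.2 f) x y|))
      ≤ 2 ^ 19 * Λ * κ * √(∑ x, ∑ y, f x y ^ 2) * √(size A) := by
  set F := √(∑ x, ∑ y, f x y ^ 2) with hF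
  have hκ := hb.nonneg
  set T : Set (X × Y) → ℝ := fun A => ∑ x, ∑ y, ∑ p ∈ s, ind (Sub P Q p.1 p.2 x y A) *
    (ν p.1 p.2 x y *
      (|E1 P p.1 (D2 Q (p.2 + 1) b) x y| * |D1 P (p.1 + 1) (E2 Q p.2 f) x y|)) with hT
  have hnn : ∀ (p : ℕ × ℕ) x y, 0 ≤ ν p.1 p.2 x y *
      (|E1 P p.1 (D2 Q (p.2 + 1) b) x y| * |D1 P (p.1 + 1) (E2 Q p.2 f) x y|) := fun p x y =>
    mul_nonneg (hν _ _ _ _) (mul_nonneg (abs_nonneg _) (abs_nonneg _))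
  have hstep : ∀ A, T A ≤ T (badHull P Q (1 / 256) A) + 2 ^ 18 * Λ * κ * F * √(size A) := by
    intro A
    set G : ℕ → ℕ → X → Y → Prop := fun i j x y => Sub P Q i j x y A ∧
      ¬ Sub P Q i j x y (badHull P Q (1 / 256) A) with hG
    -- These coefficients are constant on rectangles, as the duality lemma requires.
    set c : ℕ → ℕ → X → Y → ℝ := fun i j x y => ind (G i j x y) *
      (|E1 P i (D2 Q (j + 1) b) x y| * |D1 P (i + 1) (E2 Q j f) x y|) with hc
    have h1 : T A ≤ T (badHull P Q (1 / 256) A) + ∑ x, ∑ y, ∑ p ∈ s,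
        ν p.1 p.2 x y * c p.1 p.2 x y := by
      simp only [hT, ← Finset.sum_add_distrib]
      refine Finset.sum_le_sum fun x _ => Finset.sum_le_sum fun y _ => Finset.sum_le_sum fun p _ => ?_
      simp only [hc]
      rw [mul_left_comm (ν p.1 p.2 x y) (ind _), ← add_mul]
      refine mul_le_mul_of_nonneg_right ?_ (hnn p x y)
      by_cases hA : Sub P Q p.1 p.2 x y A
      · by_cases hE : Sub P Q p.1 p.2 x y (badHull P Q (1 / 256) A)
        · rw [ind_of hA, ind_of hE]; linarith [ind_nonneg (G p.1 p.2 x y)]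
        · rw [ind_of hA, ind_of (show G p.1 p.2 x y from ⟨hA, hE⟩)]
          linarith [ind_nonneg (Sub P Q p.1 p.2 x y (badHull P Q (1 / 256) A))]
      · rw [ind_of_not hA]; exact add_nonneg (ind_nonneg _) (ind_nonneg _)
    refine h1.trans (add_le_add le_rfl ?_)
    have hcm : ∀ i j x y, ∀ x' ∈ P.cell i x, ∀ y' ∈ Q.cell j y, c i j x' y' = c i j x y := by
      intro i j x y x' hx y' hy
      simp only [hc, hG]
      rw [abs_E1_D2_eq_of_mem hQd hx hy, abs_D1_E2_eq_of_mem hPd hx hy]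
      simp only [sub_iff_of_mem hx hy]
    -- Blocks are needed only in the first variable, the one in which the symbol decays.
    set blk : ℕ → Finset (ℕ × ℕ) := fun a => s.filter fun p => Nat.log 2 (p.1 + 1) = a with hblk
    have hblk_mem : ∀ a, ∀ p ∈ blk a, p.1 < n ∧ p.2 < n ∧ 2 ^ a - 1 ≤ p.1 ∧ p.1 + 1 < 2 ^ (a + 1) := by
      intro a p hp
      rw [hblk, Finset.mem_filter] at hp
      have e1 : 2 ^ a ≤ p.1 + 1 := hp.2 ▸ Nat.pow_log_le_self 2 (by omega)
      exact ⟨(hs p hp.1).1, (hs p hp.1).2, by omega,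
        hp.2 ▸ Nat.lt_pow_succ_log_self (by norm_num) _⟩
    set V : ℕ → ℝ := fun a => ∑ x, ∑ y, ∑ j ∈ Finset.range n,
      colMaj P Q n A (enl P (1 / 256) A) b (2 ^ (a + 1)) j x y ^ 2 with hV
    set W : ℕ → ℝ := fun a => ∑ i ∈ (Finset.range n).filter (fun i => Nat.log 2 (i + 1) = a),
      ∑ x, ∑ y, D1 P (i + 1) f x y ^ 2 with hW
    have hV0 : ∀ a, 0 ≤ V a := fun a => Finset.sum_nonneg fun _ _ => Finset.sum_nonneg fun _ _ =>
      Finset.sum_nonneg fun _ _ => sq_nonneg _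
    have hW0 : ∀ a, 0 ≤ W a := fun a => Finset.sum_nonneg fun _ _ => Finset.sum_nonneg fun _ _ =>
      Finset.sum_nonneg fun _ _ => sq_nonneg _
    have hblock : ∀ a, ∑ x, ∑ y, ∑ p ∈ blk a, ν p.1 p.2 x y * c p.1 p.2 x y
        ≤ 32 * Λ * (√((1 / 4) ^ a * V a) * √(W a)) := by
      intro a
      set f1 : ℕ → X → Y → ℝ := fun j => M1 P (colMaj P Q n A (enl P (1 / 256) A) b (2 ^ (a + 1)) j)
        with hf1
      set f2 : ℕ → X → Y → ℝ := fun i => M2 Q (fun x y => |D1 P (i + 1) f x y|) with hf2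
      have hCarl : Carl P Q (blk a) (Λ ^ 2 * (1 / 4) ^ a) fun i j x y => ν i j x y ^ 2 := by
        have h := (htail (2 ^ a - 1)).mono (fun _ _ _ _ => sq_nonneg _) (t := blk a) fun p hp =>
          Finset.mem_filter.mpr ⟨(Finset.mem_filter.mp hp).1, (hblk_mem a p hp).2.2.1⟩
        convert h using 1
        rw [Nat.cast_sub Nat.one_le_two_pow]
        push_cast
        rw [sub_add_cancel, ← pow_mul, mul_comm a, pow_mul, show (1 : ℝ) / 4 = (2 ^ 2)⁻¹ by norm_num,
          inv_pow, div_eq_mul_inv]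
      have h2 := hCarl.sum_mul_le (by positivity) hcm
      -- The factor from `b` is dominated by a function of `j` only and the factor from `f` by a
      -- function of `i` only, so the square function factorizes.
      have hS : ∀ x y, √(∑ p ∈ blk a, c p.1 p.2 x y ^ 2)
          ≤ 2 * (√(∑ j ∈ Finset.range n, f1 j x y ^ 2) *
            √(∑ i ∈ (Finset.range n).filter (fun i => Nat.log 2 (i + 1) = a), f2 i x y ^ 2)) := by
        intro x y
        rw [← Real.sqrt_mul (Finset.sum_nonneg fun _ _ => sq_nonneg _),
          show (2 : ℝ) = √(2 ^ 2) from (Real.sqrt_sq (by norm_num)).symm,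
          ← Real.sqrt_mul (by norm_num)]
        refine Real.sqrt_le_sqrt ?_
        rw [mul_comm (∑ j ∈ Finset.range n, f1 j x y ^ 2), Finset.sum_mul_sum, ← Finset.sum_product',
          Finset.mul_sum]
        have hsub : blk a ⊆ ((Finset.range n).filter (fun i => Nat.log 2 (i + 1) = a)) ×ˢ
            Finset.range n := fun p hp => by
          have h3 := hblk_mem a p hp
          rw [Finset.mem_product, Finset.mem_filter, Finset.mem_range, Finset.mem_range]
          exact ⟨⟨h3.1, (Finset.mem_filter.mp hp).2⟩, h3.2.1⟩
        refine le_trans (Finset.sum_le_sum fun p hp => ?_)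
          (Finset.sum_le_sum_of_subset_of_nonneg hsub fun _ _ _ => by positivity)
        obtain ⟨h4, h5, -, h6⟩ := hblk_mem a p hp
        simp only [hc]
        rw [mul_pow, ind_sq]
        by_cases hGp : G p.1 p.2 x y
        · have h7 := abs_E1_D2_le_two_mul_M1 (b := b) hQd h4.le h5 h6 hGp.1 hGp.2
          have h8 : |D1 P (p.1 + 1) (E2 Q p.2 f) x y| ≤ f2 p.1 x y := by
            rw [D1_E2]; exact abs_E2_le_M2 Q _ _ _ _
          rw [ind_of hGp, one_mul]
          have h9 := mul_le_mul h7 h8 (abs_nonneg _) ((abs_nonneg _).trans h7)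
          refine (pow_le_pow_left₀ (mul_nonneg (abs_nonneg _) (abs_nonneg _)) h9 2).trans
            (le_of_eq ?_)
          simp only [hf1]
          ring
        · rw [ind_of_not hGp, zero_mul]; positivity
      have h3 : ∑ x, ∑ y, √(∑ p ∈ blk a, c p.1 p.2 x y ^ 2) ≤ 2 * (√(4 * V a) * √(4 * W a)) := by
        refine (Finset.sum_le_sum fun x _ => Finset.sum_le_sum fun y _ => hS x y).trans ?_
        simp only [← Finset.mul_sum]
        refine mul_le_mul_of_nonneg_left ?_ (by norm_num)
        have h4 := sum_sum_sum_mul_le ({()} : Finset Unit)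
          (fun x y _ => √(∑ j ∈ Finset.range n, f1 j x y ^ 2))
          (fun x y _ => √(∑ i ∈ (Finset.range n).filter (fun i => Nat.log 2 (i + 1) = a),
            f2 i x y ^ 2))
        simp only [Finset.sum_singleton] at h4
        refine h4.trans (mul_le_mul (Real.sqrt_le_sqrt ?_) (Real.sqrt_le_sqrt ?_)
          (Real.sqrt_nonneg _) (Real.sqrt_nonneg _))
        · simp only [Real.sq_sqrt (Finset.sum_nonneg fun _ _ => sq_nonneg _), hV]
          rw [← sum_sum_sum_comm, ← sum_sum_sum_comm, Finset.mul_sum]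
          exact Finset.sum_le_sum fun j _ => sum_M1_sq_le P _
        · simp only [Real.sq_sqrt (Finset.sum_nonneg fun _ _ => sq_nonneg _), hW]
          rw [← sum_sum_sum_comm, Finset.mul_sum]
          refine Finset.sum_le_sum fun i _ => ?_
          have := sum_M2_sq_le Q (fun x y => |D1 P (i + 1) f x y|)
          simpa only [sq_abs] using this
      refine h2.trans ((mul_le_mul_of_nonneg_left h3 (by positivity)).trans (le_of_eq ?_))
      have h4 : √(4 : ℝ) = 2 := by
        rw [show (4 : ℝ) = 2 ^ 2 by norm_num, Real.sqrt_sq (by norm_num)]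
      rw [Real.sqrt_mul (show (0 : ℝ) ≤ 4 by norm_num), Real.sqrt_mul (show (0 : ℝ) ≤ 4 by norm_num),
        Real.sqrt_mul (sq_nonneg Λ), Real.sqrt_sq hΛ,
        Real.sqrt_mul (show (0 : ℝ) ≤ (1 / 4) ^ a by positivity), h4]
      ring
    calc _ = ∑ a ∈ Finset.range (n + 1), ∑ x, ∑ y, ∑ p ∈ blk a, ν p.1 p.2 x y * c p.1 p.2 x y := by
          rw [sum_sum_sum_comm]
          refine Finset.sum_congr rfl fun x _ => Finset.sum_congr rfl fun y _ => ?_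
          refine (Finset.sum_fiberwise_of_maps_to (fun p hp => ?_) _).symm
          have := Nat.log_lt_of_lt_pow (b := 2) (x := p.1 + 1) (y := p.1 + 1) (by omega)
            Nat.lt_two_pow_self
          have := (hs p hp).1
          exact Finset.mem_range.mpr (by omega)
      _ ≤ ∑ a ∈ Finset.range (n + 1), 32 * Λ * (√((1 / 4) ^ a * V a) * √(W a)) :=
          Finset.sum_le_sum fun a _ => hblock a
      -- The Cauchy–Schwarz inequality over the blocks: the decay is spent on `b`, while the blocks
      -- of `f` are disjoint and add up to at most its `L²` norm.
      _ ≤ 32 * Λ * (√(∑ a ∈ Finset.range (n + 1), (1 / 4) ^ a * V a)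
          * √(∑ a ∈ Finset.range (n + 1), W a)) := by
          rw [← Finset.mul_sum]
          exact mul_le_mul_of_nonneg_left (Real.sum_sqrt_mul_sqrt_le _
            (fun a => mul_nonneg (by positivity) (hV0 a)) hW0) (by positivity)
      _ ≤ 32 * Λ * (√(2 ^ 24 * κ ^ 2 * size A) * F) := by
          refine mul_le_mul_of_nonneg_left ?_ (by positivity)
          refine mul_le_mul (Real.sqrt_le_sqrt ?_) (Real.sqrt_le_sqrt ?_) (Real.sqrt_nonneg _)
            (Real.sqrt_nonneg _)
          · have := sum_colMaj_sq_le hP hQ hb A (n + 1)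
            simp only [hV]
            refine le_trans (le_of_eq (Finset.sum_congr rfl fun a _ => ?_)) this
            rw [sum_sum_sum_comm]
          · refine le_trans (le_of_eq ?_) (sum_D1_sq_le hP f)
            refine Finset.sum_fiberwise_of_maps_to (fun i hi => ?_) _
            have := Nat.log_lt_of_lt_pow (b := 2) (x := i + 1) (y := i + 1) (by omega)
              Nat.lt_two_pow_self
            rw [Finset.mem_range] at hi ⊢
            omega
      _ = 32 * 2 ^ 12 * Λ * κ * F * √(size A) := by
          rw [Real.sqrt_mul (by positivity), Real.sqrt_mul (by norm_num), Real.sqrt_sq hκ,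
            show (2 ^ 24 : ℝ) = (2 ^ 12) ^ 2 by norm_num, Real.sqrt_sq (by norm_num)]
          ring
      _ ≤ _ := by
          have : 0 ≤ Λ * κ * F * √(size A) := by positivity
          nlinarith
  have hempty : T ∅ ≤ 0 := by
    refine le_of_eq (Finset.sum_eq_zero fun x _ => Finset.sum_eq_zero fun y _ =>
      Finset.sum_eq_zero fun p _ => ?_)
    rw [ind_of_not fun h => h.mem, zero_mul]
  -- Here the error is of order `√(size A)`, which halves when the size is divided by four.
  have := le_of_exceptional T (badHull P Q (1 / 256))
    (fun A => (size_badHull_le P Q (by norm_num) A).trans (by linarith))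
    hempty (fun t => √t) Real.sqrt_nonneg
    (fun s t h => Real.sqrt_le_sqrt h)
    (fun t => by
      rw [Real.sqrt_div' _ (by norm_num), show (4 : ℝ) = 2 ^ 2 by norm_num,
        Real.sqrt_sq (by norm_num)])
    (2 ^ 18 * Λ * κ * F) (by positivity) hstep A
  linarith

end CellFiltration

end

end DyadicParaproduct

/-! ### A function supported in a set is controlled by its differences nearby. -/

namespace DyadicParaproduct

noncomputable section

namespace CellFiltration

variable {X Y : Type*} [Fintype X] [Fintype Y]

/-- Cells are at most twice as large as those of the next generation. -/
def Doubling (C : CellFiltration X) : Prop :=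
  ∀ (i : ℕ) (x : X), ((C.cell i x).card : ℝ) ≤ 2 * (C.cell (i + 1) x).card

/-- The parent of a maximal cell of the level set contains a point with maximal function at most
`δ`, so the density of `T` in the parent is at most `δ`; doubling loses a factor 2. Cells of
generation 0 have no parent, which is why `h0` is assumed. -/
lemma E_ind_stopIdx_le {C : CellFiltration X} (hC : C.Doubling) {δ : ℝ} (T : Set X)
    (h0 : ∀ x, C.E 0 (fun z => ind (z ∈ T)) x ≤ 2 * δ) (x : X) :
    C.E (C.stopIdx {z | δ < C.M (fun z => ind (z ∈ T)) z} x) (fun z => ind (z ∈ T)) x ≤ 2 * δ := by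
  set S : Set X := {z | δ < C.M (fun z => ind (z ∈ T)) z} with hS
  rcases Nat.eq_zero_or_pos (C.stopIdx S x) with h | h
  · rw [h]; exact h0 x
  · obtain ⟨m, hm⟩ := Nat.exists_eq_add_of_lt h
    rw [zero_add] at hm
    have hnot : ¬ ∀ z ∈ C.cell m x, z ∈ S := fun hall => by
      have := stop_le hall; omega
    push Not at hnot
    obtain ⟨z, hz, hzS⟩ := hnot
    have h1 : C.E m (fun z => ind (z ∈ T)) x ≤ δ := by
      rw [← C.E_eq_of_mem hz]
      exact (C.E_le_M m _ z).trans (not_lt.mp hzS)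
    rw [hm]
    unfold E at h1 ⊢
    rw [div_le_iff₀ (C.card_cell_pos _ _)] at h1 ⊢
    have h2 : ∑ y ∈ C.cell (m + 1) x, ind (y ∈ T) ≤ ∑ y ∈ C.cell m x, ind (y ∈ T) :=
      Finset.sum_le_sum_of_subset_of_nonneg (C.cell_succ m x) fun _ _ _ => ind_nonneg _
    have h3 := hC m x
    have hδ : 0 ≤ δ := by
      by_contra hneg
      have h4 : 0 ≤ ∑ y ∈ C.cell m x, ind (y ∈ T) := Finset.sum_nonneg fun _ _ => ind_nonneg _
      nlinarith [C.card_cell_pos m x]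
    nlinarith

/-- A function without martingale differences in the enlargement of `T` is small on `T`. -/
lemma sum_ind_mul_sq_le {C : CellFiltration X} (hC : C.Doubling) {δ : ℝ} (hδ : δ < 1) (T : Set X)
    (h0 : ∀ x, C.E 0 (fun z => ind (z ∈ T)) x ≤ 2 * δ) (u : X → ℝ)
    (hu : ∀ j x, (∀ z ∈ C.cell j x, δ < C.M (fun z => ind (z ∈ T)) z) → C.D (j + 1) u x = 0) :
    ∑ x, ind (x ∈ T) * u x ^ 2 ≤ 2 * δ * ∑ x, u x ^ 2 := by
  set S : Set X := {z | δ < C.M (fun z => ind (z ∈ T)) z} with hS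
  have hTS : ∀ x ∈ T, x ∈ S := fun x hx => by
    have := C.le_M (fun z => ind (z ∈ T)) x
    simp only [ind_of hx] at this
    exact lt_of_lt_of_le hδ this
  rcases isEmpty_or_nonempty X with hX | ⟨⟨x₀⟩⟩
  · simp
  have hδ0 : 0 ≤ 2 * δ := (C.E_nonneg fun _ _ => ind_nonneg _).trans (h0 x₀)
  have h1 : ∀ x ∈ T, u x = C.E (C.stopIdx S x) u x := by
    intro x hx
    rcases le_total C.depth (C.stopIdx S x) with h | h
    · exact (C.E_of_depth_le h u x).symm
    · have h2 := C.sum_Ico_D h u x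
      rw [C.E_of_depth_le le_rfl, Finset.sum_eq_zero] at h2
      · linarith
      · intro j hj
        refine hu j x fun z hz => ?_
        exact stop_spec (C := C) (hTS x hx) z (C.cell_anti (Finset.mem_Ico.mp hj).1 x hz)
  set τ := C.stopIdx S with hτ
  -- Averaging over the stopping cells is self-adjoint on `S`; it moves the average from `u ^ 2` to
  -- the indicator of `T`, where the density bound applies.
  have h2 : ∀ f g : X → ℝ, ∑ x, ind (x ∈ S) * (f x * C.E (τ x) g x)
      = ∑ x, ind (x ∈ S) * (C.E (τ x) f x * C.E (τ x) g x) := by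
    intro f g
    rw [← sum_ind_mul_E_stopIdx S (fun x => f x * C.E (τ x) g x)]
    refine Finset.sum_congr rfl fun x _ => ?_
    by_cases hx : x ∈ S
    · congr 1
      rw [C.E_congr (g := fun z => C.E (τ x) g x * f z) fun z hz => ?_, C.E_const_mul, mul_comm]
      rw [hτ, stop_eq_of_mem hx hz, C.E_eq_of_mem hz, mul_comm]
    · rw [ind_of_not hx, zero_mul, zero_mul]
  calc ∑ x, ind (x ∈ T) * u x ^ 2
      ≤ ∑ x, ind (x ∈ S) * (ind (x ∈ T) * C.E (τ x) (fun y => u y ^ 2) x) := by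
        refine Finset.sum_le_sum fun x _ => ?_
        by_cases hx : x ∈ T
        · rw [ind_of hx, ind_of (hTS x hx), one_mul, one_mul, one_mul, h1 x hx]
          exact C.E_sq_le _ _ _
        · rw [ind_of_not hx, zero_mul, zero_mul, mul_zero]
    _ = ∑ x, ind (x ∈ S) * (u x ^ 2 * C.E (τ x) (fun z => ind (z ∈ T)) x) := by
        rw [h2 (fun x => ind (x ∈ T)), h2 (fun x => u x ^ 2)]
        exact Finset.sum_congr rfl fun x _ => by ring
    _ ≤ ∑ x, u x ^ 2 * (2 * δ) := by
        refine Finset.sum_le_sum fun x _ => ?_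
        have h3 := mul_le_mul_of_nonneg_left (E_ind_stopIdx_le hC T h0 x) (sq_nonneg (u x))
        refine le_trans ?_ h3
        exact mul_le_of_le_one_left (mul_nonneg (sq_nonneg _)
          (C.E_nonneg fun _ _ => ind_nonneg _)) (ind_le_one _)
    _ = _ := by rw [← Finset.sum_mul, mul_comm]

variable {P : CellFiltration X} {Q : CellFiltration Y}

/-- The part of the martingale difference expansion of `v` in the first variable over the segments
contained in `A`. -/
def rowProj (P : CellFiltration X) (n : ℕ) (A : Set (X × Y)) (v : X → Y → ℝ) (x : X) (y : Y) : ℝ :=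
  ∑ i ∈ Finset.range n, ind (∀ z ∈ P.cell i x, (z, y) ∈ A) * D1 P (i + 1) v x y

lemma isDiff_rowProj (i : ℕ) (A : Set (X × Y)) (v : X → Y → ℝ) (y : Y) :
    P.IsDiff i fun x => ind (∀ z ∈ P.cell i x, (z, y) ∈ A) * D1 P (i + 1) v x y :=
  (P.isDiff_D i fun x => v x y).mul (g := fun x => ind (∀ z ∈ P.cell i x, (z, y) ∈ A))
    fun x x' hx => by simp only [P.cell_eq i x x' hx]

lemma D1_succ_rowProj {n i : ℕ} (hi : i < n) (A : Set (X × Y)) (v : X → Y → ℝ) (x : X) (y : Y) :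
    D1 P (i + 1) (rowProj P n A v) x y
      = ind (∀ z ∈ P.cell i x, (z, y) ∈ A) * D1 P (i + 1) v x y := by
  have e : (fun x' => rowProj P n A v x' y) = fun x => ∑ i ∈ Finset.range n,
    ind (∀ z ∈ P.cell i x, (z, y) ∈ A) * D1 P (i + 1) v x y := rfl
  rw [D1, e, P.D_sum, Finset.sum_eq_single i]
  · exact (isDiff_rowProj i A v y).D_succ_self x
  · exact fun i' _ hne => (isDiff_rowProj i' A v y).D_of_ne (by omega) x
  · exact fun h => absurd (Finset.mem_range.mpr hi) h

lemma D1_zero_rowProj (n : ℕ) (A : Set (X × Y)) (v : X → Y → ℝ) (x : X) (y : Y) :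
    D1 P 0 (rowProj P n A v) x y = 0 := by
  have e : (fun x' => rowProj P n A v x' y) = fun x => ∑ i ∈ Finset.range n,
    ind (∀ z ∈ P.cell i x, (z, y) ∈ A) * D1 P (i + 1) v x y := rfl
  rw [D1, e, P.D_sum]
  exact Finset.sum_eq_zero fun i _ => (isDiff_rowProj i A v y).D_of_ne (by omega) x

/-- The second enlargement of a set. -/
def enlTwice (P : CellFiltration X) (Q : CellFiltration Y) (δ : ℝ) (A : Set (X × Y)) : Set (X × Y) :=
  swapSet (enl Q δ (swapSet (enl P δ A)))

lemma size_enlTwice_le {δ : ℝ} (hδ : 0 < δ) (A : Set (X × Y)) :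
    size (enlTwice P Q δ A) ≤ (4 / δ ^ 2) ^ 2 * size A := by
  have h1 := size_enl_le P hδ A
  have h2 := size_enl_le Q hδ (swapSet (enl P δ A))
  rw [size_swapSet] at h2
  have h3 : (0 : ℝ) ≤ 4 / δ ^ 2 := by positivity
  calc size (enlTwice P Q δ A) = size (enl Q δ (swapSet (enl P δ A))) := size_swapSet _
    _ ≤ 4 / δ ^ 2 * (4 / δ ^ 2 * size A) := h2.trans (mul_le_mul_of_nonneg_left h1 h3)
    _ = _ := by ring

lemma sum_sq_eq_D1 {n : ℕ} (hP : P.depth ≤ n) (f : X → Y → ℝ) :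
    ∑ x, ∑ y, f x y ^ 2 = ∑ x, ∑ y, D1 P 0 f x y ^ 2
      + ∑ i ∈ Finset.range n, ∑ x, ∑ y, D1 P (i + 1) f x y ^ 2 := by
  have h : ∀ y, ∑ x, f x y ^ 2 = _ := fun y => P.sum_sq_D hP fun x => f x y
  rw [Finset.sum_comm, Finset.sum_congr rfl fun y _ => h y, Finset.sum_comm, Finset.sum_range_succ',
    add_comm]
  congr 1
  · exact Finset.sum_comm
  · exact Finset.sum_congr rfl fun i _ => Finset.sum_comm

/-- A function without martingale differences in the twofold enlargement of `A` is small on `A`. -/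
lemma sum_sum_ind_mul_sq_le {n : ℕ} (hP : P.depth ≤ n) (hQ : Q.depth ≤ n) (hPc : P.Doubling)
    (hQc : Q.Doubling) {δ : ℝ} (hδ0 : 0 < δ) (hδ : δ < 1) {A : Set (X × Y)} {X₀ : Set X} {Y₀ : Set Y}
    (hX₀ : ∀ x, P.E 0 (fun z => ind (z ∈ X₀)) x ≤ 2 * δ)
    (hY₀ : ∀ y, Q.E 0 (fun z => ind (z ∈ Y₀)) y ≤ 2 * δ)
    (hA : ∀ z ∈ A, z.1 ∈ X₀ ∧ z.2 ∈ Y₀) (v : X → Y → ℝ)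
    (hv : ∀ i < n, ∀ j < n, ∀ x y, Sub P Q i j x y (enlTwice P Q δ A) →
      D1 P (i + 1) (D2 Q (j + 1) v) x y = 0) :
    ∑ x, ∑ y, ind ((x, y) ∈ A) * v x y ^ 2 ≤ 8 * δ * ∑ x, ∑ y, v x y ^ 2 := by
  set B := enl P δ A with hB
  -- The function is split in the first variable: `α` collects the differences over horizontal
  -- segments in `B`, and `β` has none of them.
  set α := rowProj P n B v with hα
  set β : X → Y → ℝ := fun x y => v x y - α x y with hβ
  have hBY : ∀ x y, (x, y) ∈ B → y ∈ Y₀ := by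
    intro x y hxy
    by_contra hy
    have h1 : ∀ x', ind ((x', y) ∈ A) = 0 := fun x' => ind_of_not fun h => hy (hA _ h).2
    have h2 : δ < P.M (fun x' => ind ((x', y) ∈ A)) x := hxy
    obtain ⟨i, hi⟩ := P.exists_M (fun x' => ind ((x', y) ∈ A)) x
    rw [hi, P.E_congr (g := fun _ => 0) fun x' _ => h1 x', P.E_const] at h2
    exact lt_asymm h2 hδ0
  have hD1α : ∀ i < n, ∀ x y, D1 P (i + 1) α x y
      = ind (∀ z ∈ P.cell i x, (z, y) ∈ B) * D1 P (i + 1) v x y := fun i hi x y =>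
    D1_succ_rowProj hi B v x y
  have hD1β : ∀ i x y, D1 P i β x y = D1 P i v x y - D1 P i α x y := fun i x y =>
    P.D_sub i (fun x => v x y) (fun x => α x y) x
  -- The one-variable lemma on every row: `β` has no differences on segments in the enlargement of
  -- the row of `A`.
  have hβ_le : ∑ x, ∑ y, ind ((x, y) ∈ A) * β x y ^ 2 ≤ 2 * δ * ∑ x, ∑ y, β x y ^ 2 := by
    rw [Finset.sum_comm, Finset.sum_comm (f := fun x y => β x y ^ 2), Finset.mul_sum]
    refine Finset.sum_le_sum fun y _ => ?_
    refine sum_ind_mul_sq_le hPc hδ {x | (x, y) ∈ A} (fun x => ?_) (fun x => β x y) ?_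
    · exact (P.E_mono fun x' _ => ind_mono fun h => (hA _ h).1).trans (hX₀ x)
    · intro i x hx
      rcases lt_or_ge i n with hi | hi
      · have h1 := hD1β (i + 1) x y
        rw [hD1α i hi, ind_of (show ∀ z ∈ P.cell i x, (z, y) ∈ B from hx), one_mul, sub_self] at h1
        exact h1
      · rw [P.D_succ, P.E_of_depth_le (by omega), P.E_of_depth_le (by omega), sub_self]
  -- The one-variable lemma on columns. For a cell `I` of generation `i`, let `T` be the set of
  -- heights at which it lies in `B`. A vertical cell in the enlargement of `T` spans with `I` a
  -- rectangle in the second enlargement, where `v` has no differences.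
  have hα_le : ∑ x, ∑ y, α x y ^ 2 ≤ 2 * δ * ∑ x, ∑ y, v x y ^ 2 := by
    have h1 := sum_sq_eq_D1 hP α
    simp only [hα, D1_zero_rowProj] at h1
    rw [h1]
    have h2 : ∀ i ∈ Finset.range n, ∑ x, ∑ y, D1 P (i + 1) (rowProj P n B v) x y ^ 2
        ≤ 2 * δ * ∑ x, ∑ y, D1 P (i + 1) v x y ^ 2 := by
      intro i hi
      rw [Finset.mem_range] at hi
      rw [Finset.mul_sum]
      refine Finset.sum_le_sum fun x _ => ?_
      refine le_trans (le_of_eq (Finset.sum_congr rfl fun y _ => ?_))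
        (sum_ind_mul_sq_le hQc hδ {y | ∀ z ∈ P.cell i x, (z, y) ∈ B} (fun y => ?_)
          (fun y => D1 P (i + 1) v x y) ?_)
      · rw [D1_succ_rowProj hi, mul_pow, ind_sq]; rfl
      · exact (Q.E_mono fun y' _ => ind_mono fun h => hBY x y' (h x (P.mem_cell i x))).trans (hY₀ y)
      · intro j y hy
        rcases lt_or_ge j n with hj | hj
        · refine (D1_D2 P Q (i + 1) (j + 1) v x y).symm.trans ?_
          refine hv i hi j hj x y fun x' hx y' hy' => ?_
          refine lt_of_lt_of_le (hy y' hy') ?_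
          exact Q.M_le_M (fun y'' => ind_mono fun h => h x' hx) y'
        · rw [Q.D_succ, Q.E_of_depth_le (by omega), Q.E_of_depth_le (by omega), sub_self]
    have h3 := sum_D1_sq_le hP v
    have h4 := Finset.sum_le_sum h2
    rw [← Finset.mul_sum] at h4
    have h5 := mul_le_mul_of_nonneg_left h3 (show 0 ≤ 2 * δ by positivity)
    simp only [ne_eq, OfNat.ofNat_ne_zero, not_false_eq_true, zero_pow, Finset.sum_const_zero, zero_add]
    exact h4.trans h5
  have hβv : ∑ x, ∑ y, β x y ^ 2 ≤ ∑ x, ∑ y, v x y ^ 2 := by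
    rw [sum_sq_eq_D1 hP β, sum_sq_eq_D1 hP v]
    refine add_le_add (le_of_eq ?_) (Finset.sum_le_sum fun i hi => Finset.sum_le_sum fun x _ =>
      Finset.sum_le_sum fun y _ => ?_)
    · simp only [hD1β, hα, D1_zero_rowProj, sub_zero]
    · rw [hD1β, hD1α i (Finset.mem_range.mp hi)]
      have h1 := ind_sq (∀ z ∈ P.cell i x, (z, y) ∈ B)
      have h2 := ind_nonneg (∀ z ∈ P.cell i x, (z, y) ∈ B)
      generalize ind (∀ z ∈ P.cell i x, (z, y) ∈ B) = t at *
      nlinarith [mul_nonneg h2 (sq_nonneg (D1 P (i + 1) v x y))]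
  have hpt : ∑ x, ∑ y, ind ((x, y) ∈ A) * v x y ^ 2
      ≤ 2 * ∑ x, ∑ y, α x y ^ 2 + 2 * ∑ x, ∑ y, ind ((x, y) ∈ A) * β x y ^ 2 := by
    simp only [Finset.mul_sum, ← Finset.sum_add_distrib]
    refine Finset.sum_le_sum fun x _ => Finset.sum_le_sum fun y _ => ?_
    have e : v x y = α x y + β x y := by simp only [hβ]; ring
    rw [e]
    have h1 := ind_nonneg ((x, y) ∈ A)
    have h2 := ind_le_one ((x, y) ∈ A)
    generalize ind ((x, y) ∈ A) = t at *
    nlinarith [sq_nonneg (α x y - β x y), mul_nonneg h1 (sq_nonneg (α x y - β x y)),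
      mul_nonneg (sub_nonneg.mpr h2) (sq_nonneg (α x y))]
  have h5 := mul_le_mul_of_nonneg_left hβv (show 0 ≤ 2 * δ by positivity)
  linarith

/-- A function supported in `A` is controlled by its martingale differences in an enlargement of
`A`. -/
theorem sum_sq_le_of_support {n : ℕ} (hP : P.depth ≤ n) (hQ : Q.depth ≤ n) (hPc : P.Doubling)
    (hQc : Q.Doubling) {A : Set (X × Y)} {X₀ : Set X} {Y₀ : Set Y}
    (hX₀ : ∀ x, P.E 0 (fun z => ind (z ∈ X₀)) x ≤ 1 / 8)
    (hY₀ : ∀ y, Q.E 0 (fun z => ind (z ∈ Y₀)) y ≤ 1 / 8)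
    (hA : ∀ z ∈ A, z.1 ∈ X₀ ∧ z.2 ∈ Y₀) (w : X → Y → ℝ) (hw : ∀ x y, (x, y) ∉ A → w x y = 0) :
    ∃ B : Set (X × Y), size B ≤ 2 ^ 20 * size A ∧ ∑ x, ∑ y, w x y ^ 2
      ≤ 2 * ∑ i ∈ Finset.range n, ∑ j ∈ Finset.range n,
        ∑ x, ∑ y, ind (Sub P Q i j x y B) * D1 P (i + 1) (D2 Q (j + 1) w) x y ^ 2 := by
  -- With this level the previous lemma has constant `8 / 16 = 1 / 2`, and the enlargement costs `(4
  -- * 16 ^ 2) ^ 2 = 2 ^ 20`.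
  set B := enlTwice P Q (1 / 16) A with hB
  refine ⟨B, (size_enlTwice_le (by norm_num) A).trans (by norm_num), ?_⟩
  rw [← sum_sq_projOn P Q hP hQ]
  set p := projOn P Q n B w with hp
  set v : X → Y → ℝ := fun x y => w x y - p x y with hv
  have hDv : ∀ k l x y, D1 P k (D2 Q l v) x y = D1 P k (D2 Q l w) x y - D1 P k (D2 Q l p) x y := by
    intro k l x y
    have e : D2 Q l v = fun x y => D2 Q l w x y - D2 Q l p x y :=
      funext fun x => funext fun y => Q.D_sub l (w x) (p x) y
    rw [e]
    exact P.D_sub k (fun x => D2 Q l w x y) (fun x => D2 Q l p x y) x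
  have h1 : ∑ x, ∑ y, ind ((x, y) ∈ A) * v x y ^ 2 ≤ 1 / 2 * ∑ x, ∑ y, v x y ^ 2 := by
    have := sum_sum_ind_mul_sq_le hP hQ hPc hQc (δ := 1 / 16) (by norm_num) (by norm_num)
      (fun x => (hX₀ x).trans (by norm_num)) (fun y => (hY₀ y).trans (by norm_num)) hA v
      fun i hi j hj x y hsub => by
        rw [hDv, hp, D1_D2_projOn P Q hi hj, ind_of hsub, one_mul, sub_self]
    linarith
  have h2 : ∑ x, ∑ y, w x y ^ 2 = ∑ x, ∑ y, v x y ^ 2 + ∑ x, ∑ y, p x y ^ 2 := by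
    rw [sum_sq_D1_D2 P Q hP hQ w, sum_sq_D1_D2 P Q hP hQ v, sum_sq_D1_D2 P Q hP hQ p]
    simp only [← Finset.sum_add_distrib]
    refine Finset.sum_congr rfl fun k hk => Finset.sum_congr rfl fun l hl =>
      Finset.sum_congr rfl fun x _ => Finset.sum_congr rfl fun y _ => ?_
    rw [hDv]
    rw [Finset.mem_range] at hk hl
    have hzero : D1 P k (D2 Q l p) x y = 0 ∨ D1 P k (D2 Q l p) x y = D1 P k (D2 Q l w) x y := by
      cases l with
      | zero =>
        left
        rw [show D2 Q 0 p = fun _ _ => 0 from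
          funext fun x => funext fun y => D2_zero_projOn P Q n B w x y]
        cases k with
        | zero => exact P.E_const 0 0 x
        | succ k => rw [D1, P.D_succ, P.E_const, P.E_const, sub_self]
      | succ l =>
        cases k with
        | zero => left; exact D1_zero_D2_projOn P Q (by omega) B w x y
        | succ k =>
          rw [hp, D1_D2_projOn P Q (by omega) (by omega)]
          by_cases hs : Sub P Q k l x y B
          · right; rw [ind_of hs, one_mul]
          · left; rw [ind_of_not hs, zero_mul]
    rcases hzero with h | h <;> rw [h] <;> ring
  have h3 : ∑ x, ∑ y, w x y ^ 2 = ∑ x, ∑ y, v x y ^ 2 + 2 * ∑ x, ∑ y, v x y * p x y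
      + ∑ x, ∑ y, p x y ^ 2 := by
    simp only [Finset.mul_sum, ← Finset.sum_add_distrib]
    refine Finset.sum_congr rfl fun x _ => Finset.sum_congr rfl fun y _ => ?_
    simp only [hv]; ring
  have h4 : ∑ x, ∑ y, v x y * w x y = ∑ x, ∑ y, v x y ^ 2 := by
    have : ∑ x, ∑ y, v x y * w x y = ∑ x, ∑ y, v x y ^ 2 + ∑ x, ∑ y, v x y * p x y := by
      simp only [← Finset.sum_add_distrib]
      refine Finset.sum_congr rfl fun x _ => Finset.sum_congr rfl fun y _ => ?_
      simp only [hv]; ring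
    linarith
  -- Since `v` is orthogonal to `p`, the sum of `v * w` is the square sum of `v`; and since `w`
  -- lives on `A`, only the small part of `v` on `A` enters. Absorption then bounds the square sum
  -- of `v` by half of that of `w`.
  have h5 : 2 * ∑ x, ∑ y, v x y * w x y
      ≤ 2 * ∑ x, ∑ y, ind ((x, y) ∈ A) * v x y ^ 2 + 1 / 2 * ∑ x, ∑ y, w x y ^ 2 := by
    simp only [Finset.mul_sum, ← Finset.sum_add_distrib]
    refine Finset.sum_le_sum fun x _ => Finset.sum_le_sum fun y _ => ?_
    by_cases hxy : (x, y) ∈ A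
    · rw [ind_of hxy]; nlinarith [sq_nonneg (2 * v x y - w x y)]
    · rw [hw x y hxy, ind_of_not hxy]; simp
  linarith

end CellFiltration

end

end DyadicParaproduct

/-! ### Dyadic intervals and one-dimensional Haar functions. -/

namespace DyadicParaproduct

noncomputable section

namespace DyadicInterval

lemma length_pos (I : DyadicInterval) : 0 < I.length := by unfold length; positivity

lemma length_leftHalf (I : DyadicInterval) : I.leftHalf.length = I.length / 2 := by
  simp only [length, leftHalf]
  rw [neg_add, zpow_add₀ (by norm_num), zpow_neg_one, div_eq_mul_inv]

lemma length_rightHalf (I : DyadicInterval) : I.rightHalf.length = I.length / 2 :=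
  I.length_leftHalf

lemma mem_toSet_iff (I : DyadicInterval) (x : ℝ) : x ∈ I.toSet ↔ ⌊x * 2 ^ I.1⌋ = I.2 := by
  have h : (0 : ℝ) < 2 ^ I.1 := by positivity
  rw [toSet, length, zpow_neg, Set.mem_Ico, Int.floor_eq_iff, ← div_eq_mul_inv, ← div_eq_mul_inv,
    div_le_iff₀ h, lt_div_iff₀ h]

/-- The coarser floor is the integer quotient of the finer one by a power of two; this is the
nesting of dyadic intervals. -/
lemma floor_eq_of_le {k i : ℤ} (h : i ≤ k) {x y : ℝ} (hxy : ⌊x * 2 ^ k⌋ = ⌊y * 2 ^ k⌋) :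
    ⌊x * 2 ^ i⌋ = ⌊y * 2 ^ i⌋ := by
  obtain ⟨d, rfl⟩ := Int.le.dest h
  have e : ∀ z : ℝ, ⌊z * 2 ^ i⌋ = ⌊z * 2 ^ (i + d)⌋ / ((2 ^ d : ℕ) : ℤ) := fun z => by
    rw [← Int.floor_div_natCast]
    congr 1
    rw [zpow_add₀ (by norm_num)]
    push_cast
    rw [zpow_natCast]
    field_simp
  rw [e, e, hxy]

lemma toSet_nonempty (I : DyadicInterval) : (I.2 : ℝ) * I.length ∈ I.toSet := by
  refine ⟨le_rfl, ?_⟩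
  nlinarith [I.length_pos]

lemma subset_of_mem {I K : DyadicInterval} (h : I.1 ≤ K.1) {x : ℝ} (hI : x ∈ I.toSet)
    (hK : x ∈ K.toSet) : K.toSet ⊆ I.toSet := by
  intro y hy
  rw [mem_toSet_iff] at *
  rw [← hI]
  exact floor_eq_of_le h (hy.trans hK.symm)

lemma eq_of_mem {I K : DyadicInterval} (h : I.1 = K.1) {x : ℝ} (hI : x ∈ I.toSet)
    (hK : x ∈ K.toSet) : I = K := by
  rw [mem_toSet_iff] at *
  refine Prod.ext h ?_
  rw [← hI, ← hK, h]

lemma measurableSet_toSet (I : DyadicInterval) : MeasurableSet I.toSet := measurableSet_Ico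

lemma volume_toSet (I : DyadicInterval) : volume I.toSet = ENNReal.ofReal I.length := by
  rw [toSet, Real.volume_Ico]; congr 1; ring

lemma mem_halves (I : DyadicInterval) (x : ℝ) :
    x ∈ I.toSet ↔ x ∈ I.leftHalf.toSet ∨ x ∈ I.rightHalf.toSet := by
  simp only [mem_toSet_iff, leftHalf, rightHalf]
  have e : ⌊x * 2 ^ I.1⌋ = ⌊x * 2 ^ (I.1 + 1)⌋ / 2 := by
    have := Int.floor_div_natCast (x * 2 ^ (I.1 + 1)) 2
    push_cast at this
    rw [← this]
    congr 1
    rw [zpow_add₀ (by norm_num), zpow_one]; ring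
  rw [e]; omega

lemma not_mem_both (I : DyadicInterval) (x : ℝ) :
    ¬ (x ∈ I.leftHalf.toSet ∧ x ∈ I.rightHalf.toSet) := by
  simp only [mem_toSet_iff, leftHalf, rightHalf]
  omega

lemma leftHalf_subset (I : DyadicInterval) : I.leftHalf.toSet ⊆ I.toSet :=
  fun _ h => (I.mem_halves _).mpr (Or.inl h)

lemma rightHalf_subset (I : DyadicInterval) : I.rightHalf.toSet ⊆ I.toSet :=
  fun _ h => (I.mem_halves _).mpr (Or.inr h)

lemma indicator_halves (I : DyadicInterval) (x : ℝ) : I.toSet.indicator (1 : ℝ → ℝ) x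
    = I.leftHalf.toSet.indicator 1 x + I.rightHalf.toSet.indicator 1 x := by
  have h1 := I.mem_halves x
  have h2 := I.not_mem_both x
  by_cases hl : x ∈ I.leftHalf.toSet <;> by_cases hr : x ∈ I.rightHalf.toSet <;>
    simp_all [Set.indicator]

lemma haarType_zero (I : DyadicInterval) (x : ℝ) : haarType 0 I x = I.haar x := by simp [haarType]

lemma haarType_one (I : DyadicInterval) (x : ℝ) :
    haarType 1 I x = I.length⁻¹ * I.toSet.indicator 1 x := by
  have hs : (√I.length)⁻¹ * (√I.length)⁻¹ = I.length⁻¹ := by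
    rw [← mul_inv, Real.mul_self_sqrt I.length_pos.le]
  have h1 := I.not_mem_both x
  rw [indicator_halves]
  simp only [haarType, haar, one_ne_zero, if_false, abs_mul, abs_inv, abs_of_nonneg (Real.sqrt_nonneg _)]
  rw [← mul_assoc, hs]
  congr 1
  by_cases hl : x ∈ I.leftHalf.toSet <;> by_cases hr : x ∈ I.rightHalf.toSet <;>
    simp_all [Set.indicator]

lemma haarType_one_halves (I : DyadicInterval) (x : ℝ) : haarType 1 I x
    = (haarType 1 I.leftHalf x + haarType 1 I.rightHalf x) / 2 := by
  rw [haarType_one, haarType_one, haarType_one, length_leftHalf, length_rightHalf, indicator_halves]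
  have := I.length_pos.ne'
  field_simp

/-- Writing Haar functions through normalized indicators of the halves reduces measurability,
integrability and all pairings to means. -/
lemma haarType_zero_halves (I : DyadicInterval) (x : ℝ) : haarType 0 I x
    = √I.length / 2 * (haarType 1 I.rightHalf x - haarType 1 I.leftHalf x) := by
  rw [haarType_zero, haarType_one, haarType_one, length_leftHalf, length_rightHalf, haar]
  have h := I.length_pos
  have h2 : √I.length ≠ 0 := (Real.sqrt_pos.mpr h).ne'
  have e : I.length = √I.length * √I.length := (Real.mul_self_sqrt h.le).symm
  rw [show (I.length / 2)⁻¹ = 2 * (√I.length)⁻¹ * (√I.length)⁻¹ by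
    rw [inv_div, mul_assoc, ← mul_inv, ← e]; ring]
  field_simp

lemma measurable_haarType (e : Fin 2) (I : DyadicInterval) : Measurable (haarType e I) := by
  have h1 : ∀ K : DyadicInterval, Measurable (haarType 1 K) := fun K => by
    have : haarType 1 K = fun x => K.length⁻¹ * K.toSet.indicator 1 x := funext K.haarType_one
    rw [this]
    exact (measurable_one.indicator K.measurableSet_toSet).const_mul _
  fin_cases e
  · have : haarType 0 I = fun x => √I.length / 2 * (haarType 1 I.rightHalf x - haarType 1 I.leftHalf x) :=
      funext I.haarType_zero_halves
    change Measurable (haarType 0 I)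
    rw [this]
    exact ((h1 _).sub (h1 _)).const_mul _
  · exact h1 I

lemma haarType_eq_zero (e : Fin 2) (I : DyadicInterval) {x : ℝ} (hx : x ∉ I.toSet) :
    haarType e I x = 0 := by
  have hl : x ∉ I.leftHalf.toSet := fun h => hx (I.leftHalf_subset h)
  have hr : x ∉ I.rightHalf.toSet := fun h => hx (I.rightHalf_subset h)
  fin_cases e <;> simp [haarType, haar, hl, hr]

lemma haarType_sq (I : DyadicInterval) (x : ℝ) :
    haarType 0 I x * haarType 0 I x = I.length⁻¹ * I.toSet.indicator 1 x := by
  have hs : (√I.length)⁻¹ * (√I.length)⁻¹ = I.length⁻¹ := by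
    rw [← mul_inv, Real.mul_self_sqrt I.length_pos.le]
  have h1 := I.not_mem_both x
  rw [haarType_zero, indicator_halves, haar, mul_mul_mul_comm, hs]
  congr 1
  by_cases hl : x ∈ I.leftHalf.toSet <;> by_cases hr : x ∈ I.rightHalf.toSet <;>
    simp_all [Set.indicator]

lemma abs_haarType_zero_le (I : DyadicInterval) (x : ℝ) : |haarType 0 I x| ≤ (√I.length)⁻¹ := by
  have h0 := I.length_pos
  refine abs_le_of_sq_le_sq ?_ (by positivity)
  rw [sq, haarType_sq, inv_pow, Real.sq_sqrt h0.le]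
  refine mul_le_of_le_one_right (by positivity) ?_
  by_cases h : x ∈ I.toSet <;> simp [h]

lemma abs_haarType_le (e : Fin 2) (I : DyadicInterval) (x : ℝ) :
    |haarType e I x| ≤ max (√I.length)⁻¹ I.length⁻¹ := by
  have h0 := I.length_pos
  fin_cases e
  · exact (I.abs_haarType_zero_le x).trans (le_max_left _ _)
  · refine le_trans ?_ (le_max_right _ _)
    change |haarType 1 I x| ≤ _
    rw [haarType_one, abs_mul, abs_of_pos (inv_pos.mpr h0)]
    refine mul_le_of_le_one_right (by positivity) ?_
    by_cases h : x ∈ I.toSet <;> simp [h]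

lemma integral_indicator_toSet (I : DyadicInterval) :
    ∫ x, I.toSet.indicator (1 : ℝ → ℝ) x = I.length := by
  rw [integral_indicator_one I.measurableSet_toSet, Measure.real, volume_toSet,
    ENNReal.toReal_ofReal I.length_pos.le]

lemma integrable_indicator_toSet (I : DyadicInterval) :
    Integrable (I.toSet.indicator (1 : ℝ → ℝ)) := by
  refine (integrable_indicator_iff I.measurableSet_toSet).mpr ?_
  exact integrableOn_const (by rw [volume_toSet]; exact ENNReal.ofReal_ne_top)

lemma integrable_haarType (e : Fin 2) (I : DyadicInterval) : Integrable (haarType e I) := by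
  have h1 : ∀ K : DyadicInterval, Integrable (haarType 1 K) := fun K => by
    have : haarType 1 K = fun x => K.length⁻¹ * K.toSet.indicator 1 x := funext K.haarType_one
    rw [this]
    exact K.integrable_indicator_toSet.const_mul _
  fin_cases e
  · have : haarType 0 I = fun x => √I.length / 2 * (haarType 1 I.rightHalf x - haarType 1 I.leftHalf x) :=
      funext I.haarType_zero_halves
    change Integrable (haarType 0 I)
    rw [this]
    exact ((h1 _).sub (h1 _)).const_mul _
  · exact h1 I

lemma integral_haarType_one (I : DyadicInterval) : ∫ x, haarType 1 I x = 1 := by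
  simp_rw [haarType_one]
  rw [integral_const_mul, integral_indicator_toSet, inv_mul_cancel₀ I.length_pos.ne']

lemma integral_haarType_zero (I : DyadicInterval) : ∫ x, haarType 0 I x = 0 := by
  simp_rw [haarType_zero_halves]
  rw [integral_const_mul, integral_sub (integrable_haarType _ _) (integrable_haarType _ _),
    integral_haarType_one, integral_haarType_one, sub_self, mul_zero]

/-- The inner products of one-dimensional Haar functions. -/
def ip (e : Fin 2) (I : DyadicInterval) (e' : Fin 2) (K : DyadicInterval) : ℝ :=
  ∫ x, haarType e I x * haarType e' K x

lemma ip_comm (e : Fin 2) (I : DyadicInterval) (e' : Fin 2) (K : DyadicInterval) :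
    ip e I e' K = ip e' K e I := by simp only [ip, mul_comm]

lemma ip_of_const {e e' : Fin 2} {I K : DyadicInterval} {c : ℝ}
    (h : ∀ x ∈ I.toSet, haarType e' K x = c) : ip e I e' K = c * ∫ x, haarType e I x := by
  rw [ip, ← integral_const_mul]
  congr 1; ext x
  by_cases hx : x ∈ I.toSet
  · rw [h x hx, mul_comm]
  · rw [haarType_eq_zero e I hx]; ring

/-- A strictly finer interval lies in one half of `K` or misses `K`. -/
lemma haarType_zero_const {I K : DyadicInterval} (h : K.1 < I.1) {x y : ℝ} (hx : x ∈ I.toSet)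
    (hy : y ∈ I.toSet) : haarType 0 K x = haarType 0 K y := by
  have key : ∀ L : DyadicInterval, L.1 ≤ I.1 → (L.toSet.indicator (1 : ℝ → ℝ) x
      = L.toSet.indicator 1 y) := by
    intro L hL
    have : x ∈ L.toSet ↔ y ∈ L.toSet :=
      ⟨fun h => subset_of_mem hL h hx hy, fun h => subset_of_mem hL h hy hx⟩
    by_cases h : x ∈ L.toSet
    · simp [h, this.mp h]
    · simp [h, this.not.mp h]
  rw [haarType_zero, haarType_zero, haar, haar, key K.leftHalf (by change K.1 + 1 ≤ I.1; omega),
    key K.rightHalf (by change K.1 + 1 ≤ I.1; omega)]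

lemma haarType_one_const {I K : DyadicInterval} (h : K.1 ≤ I.1) {x y : ℝ} (hx : x ∈ I.toSet)
    (hy : y ∈ I.toSet) : haarType 1 K x = haarType 1 K y := by
  have : x ∈ K.toSet ↔ y ∈ K.toSet :=
    ⟨fun h' => subset_of_mem h h' hx hy, fun h' => subset_of_mem h h' hy hx⟩
  rw [haarType_one, haarType_one]
  by_cases h : x ∈ K.toSet
  · simp [h, this.mp h]
  · simp [h, this.not.mp h]

lemma ip_zero_zero_self (I : DyadicInterval) : ip 0 I 0 I = 1 := by
  simp_rw [ip, haarType_sq]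
  rw [integral_const_mul, integral_indicator_toSet, inv_mul_cancel₀ I.length_pos.ne']

lemma ip_zero_of_lt {I K : DyadicInterval} (h : K.1 < I.1) : ip 0 I 0 K = 0 := by
  rw [ip_of_const fun x hx => haarType_zero_const h hx I.toSet_nonempty, integral_haarType_zero,
    mul_zero]

lemma ip_zero_zero_of_ne {I K : DyadicInterval} (h : I ≠ K) : ip 0 I 0 K = 0 := by
  rcases lt_trichotomy I.1 K.1 with h1 | h1 | h1
  · rw [ip_comm]; exact ip_zero_of_lt h1
  · rw [ip_of_const (c := 0), zero_mul]
    exact fun x hx => haarType_eq_zero _ _ fun hx' => h (eq_of_mem h1 hx hx')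
  · exact ip_zero_of_lt h1

lemma ip_one_zero_of_le {I K : DyadicInterval} (h : I.1 ≤ K.1) : ip 1 I 0 K = 0 := by
  rw [ip_comm, ip_of_const fun x hx => haarType_one_const h hx K.toSet_nonempty,
    integral_haarType_zero, mul_zero]

lemma ip_one_zero_of_lt {I K : DyadicInterval} (h : K.1 < I.1) :
    ip 1 I 0 K = haarType 0 K (I.2 * I.length) := by
  rw [ip_of_const fun x hx => haarType_zero_const h hx I.toSet_nonempty, integral_haarType_one,
    mul_one]

/-- If `I` is not strictly finer, the mean-zero function on `K` is integrated against a constant; if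
it is, only intervals `K` containing `I` meet it. -/
lemma ip_one_zero_ne_zero {I K : DyadicInterval} (h : ip 1 I 0 K ≠ 0) :
    K.1 < I.1 ∧ I.toSet ⊆ K.toSet := by
  have h1 : K.1 < I.1 := by
    by_contra h'; exact h (ip_one_zero_of_le (not_lt.mp h'))
  refine ⟨h1, ?_⟩
  rw [ip_one_zero_of_lt h1] at h
  have h2 : (I.2 * I.length : ℝ) ∈ K.toSet := by
    by_contra h'; exact h (haarType_eq_zero _ _ h')
  exact subset_of_mem h1.le h2 I.toSet_nonempty

lemma abs_ip_one_zero_le (I K : DyadicInterval) : |ip 1 I 0 K| ≤ (√K.length)⁻¹ := by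
  rcases lt_or_ge K.1 I.1 with h | h
  · rw [ip_one_zero_of_lt h]; exact abs_haarType_zero_le _ _
  · rw [ip_one_zero_of_le h, abs_zero]; positivity

lemma ip_zero_zero_ne_zero {I K : DyadicInterval} (h : ip 0 I 0 K ≠ 0) : I = K := by
  by_contra h'; exact h (ip_zero_zero_of_ne h')

lemma ip_one_one_of_subset {I K : DyadicInterval} (h : I.toSet ⊆ K.toSet) :
    ip 1 I 1 K = K.length⁻¹ := by
  rw [ip_of_const (c := K.length⁻¹), integral_haarType_one, mul_one]
  intro x hx
  rw [haarType_one, Set.indicator_of_mem (h hx)]; simp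

lemma ip_one_one_ne_zero {I K : DyadicInterval} (hg : K.1 ≤ I.1) (h : ip 1 I 1 K ≠ 0) :
    I.toSet ⊆ K.toSet := by
  by_contra hn
  refine h ?_
  rw [ip_of_const (c := 0), zero_mul]
  exact fun x hx => haarType_eq_zero _ _ fun hx' => hn (subset_of_mem hg hx' hx)

end DyadicInterval

end

end DyadicParaproduct

/-! ### The binary tree as a finite model of the dyadic intervals below a root. -/

namespace DyadicParaproduct

noncomputable section

open CellFiltration DyadicInterval

/-- The filtration of the binary tree of height `N`. -/
def tree (N : ℕ) : CellFiltration (Fin N → Bool) where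
  cell i x := Finset.univ.filter fun y => ∀ k : Fin N, (k : ℕ) < i → y k = x k
  mem_cell i x := by simp
  cell_eq i x y h := by
    rw [Finset.mem_filter] at h
    refine Finset.filter_congr fun z _ => forall_congr' fun k => ?_
    refine imp_congr_right fun hk => ?_
    rw [h.2 k hk]
  cell_succ i x := fun y hy => by
    rw [Finset.mem_filter] at hy ⊢
    exact ⟨hy.1, fun k hk => hy.2 k (by omega)⟩
  depth := N
  cell_depth x := by
    ext y
    simp only [Finset.mem_filter, Finset.mem_univ, true_and, Finset.mem_singleton]
    exact ⟨fun h => funext fun k => h k k.2, fun h k _ => by rw [h]⟩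

lemma depth_tree (N : ℕ) : (tree N).depth = N := rfl

lemma mem_cell_tree {N i : ℕ} {x y : Fin N → Bool} :
    y ∈ (tree N).cell i x ↔ ∀ k : Fin N, (k : ℕ) < i → y k = x k := by
  simp [tree]

/-- Changing the coordinate `i`. -/
def flipAt {N : ℕ} (i : Fin N) (x : Fin N → Bool) : Fin N → Bool := Function.update x i (!x i)

lemma flipAt_flipAt {N : ℕ} (i : Fin N) (x : Fin N → Bool) : flipAt i (flipAt i x) = x := by
  ext k; by_cases h : k = i
  · subst h; simp [flipAt]
  · simp [flipAt, h]

lemma flipAt_mem {N : ℕ} (i : Fin N) {x y : Fin N → Bool} (h : y ∈ (tree N).cell i x) :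
    flipAt i y ∈ (tree N).cell i x := by
  rw [mem_cell_tree] at *
  intro k hk
  have : k ≠ i := fun h => by subst h; exact lt_irrefl _ hk
  simp [flipAt, this, h k hk]

lemma mem_or_flip_mem {N : ℕ} (i : Fin N) {x y : Fin N → Bool} (h : y ∈ (tree N).cell i x) :
    (y ∈ (tree N).cell (i + 1) x ∧ flipAt i y ∈ (tree N).cell (i + 1) (flipAt i x)) ∨
      (y ∈ (tree N).cell (i + 1) (flipAt i x) ∧ flipAt i y ∈ (tree N).cell (i + 1) x) := by
  have key : ∀ u v : Fin N → Bool, (∀ k : Fin N, (k : ℕ) < i → u k = v k) → u i = v i →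
      u ∈ (tree N).cell (i + 1) v := by
    intro u v h1 h2
    rw [mem_cell_tree]
    intro k hk
    rcases Nat.lt_succ_iff_lt_or_eq.mp hk with h | h
    · exact h1 k h
    · rw [Fin.ext h]; exact h2
  rw [mem_cell_tree] at h
  have hne : ∀ k : Fin N, (k : ℕ) < i → k ≠ i := fun k hk h => by subst h; exact lt_irrefl _ hk
  by_cases hi : y i = x i
  · left
    refine ⟨key _ _ h hi, key _ _ (fun k hk => ?_) ?_⟩
    · simp [flipAt, hne k hk, h k hk]
    · simp [flipAt, hi]
  · right
    have hi' : y i = !x i := by cases hx : x i <;> cases hy : y i <;> simp_all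
    refine ⟨key _ _ (fun k hk => ?_) ?_, key _ _ (fun k hk => ?_) ?_⟩
    · simp [flipAt, hne k hk, h k hk]
    · simp [flipAt, hi']
    · simp [flipAt, hne k hk, h k hk]
    · simp [flipAt, hi']

lemma sum_flipAt {N : ℕ} (i : Fin N) (x : Fin N → Bool) (g : (Fin N → Bool) → ℝ) :
    ∑ y ∈ (tree N).cell i x, g (flipAt i y) = ∑ y ∈ (tree N).cell i x, g y :=
  Finset.sum_bij' (fun y _ => flipAt i y) (fun y _ => flipAt i y) (fun _ h => flipAt_mem i h)
    (fun _ h => flipAt_mem i h) (fun y _ => flipAt_flipAt i y) (fun y _ => flipAt_flipAt i y)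
    fun _ _ => rfl

/-- Flipping the coordinate `i` exchanges the two halves of the cell, so every point together with
its flip contributes the same sum. -/
lemma E_tree_of_const {N : ℕ} (i : Fin N) {h : (Fin N → Bool) → ℝ}
    (hh : ∀ x, ∀ y ∈ (tree N).cell (i + 1) x, h y = h x) (x : Fin N → Bool) :
    (tree N).E i h x = (h x + h (flipAt i x)) / 2 := by
  have h1 : ∑ y ∈ (tree N).cell i x, (h y + h (flipAt i y))
      = ∑ _y ∈ (tree N).cell i x, (h x + h (flipAt i x)) := by
    refine Finset.sum_congr rfl fun y hy => ?_
    rcases mem_or_flip_mem i hy with ⟨h1, h2⟩ | ⟨h1, h2⟩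
    · rw [hh _ _ h1, hh _ _ h2]
    · rw [hh _ _ h1, hh _ _ h2, add_comm]
  rw [Finset.sum_add_distrib, sum_flipAt, Finset.sum_const, nsmul_eq_mul] at h1
  have h2 := (tree N).card_cell_pos i x
  rw [E, div_eq_div_iff h2.ne' (by norm_num)]
  linarith

lemma E_tree_succ {N : ℕ} (i : Fin N) (u : (Fin N → Bool) → ℝ) (x : Fin N → Bool) :
    (tree N).E i u x = ((tree N).E (i + 1) u x + (tree N).E (i + 1) u (flipAt i x)) / 2 := by
  rw [← (tree N).E_E_of_le (Nat.le_succ i) u x]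
  exact E_tree_of_const i (fun x y hy => (tree N).E_eq_of_mem hy u) x

/-- The difference is half of the value on one half of the cell minus the value on the other one,
and flipping only changes its sign. -/
lemma dyadic_tree (N : ℕ) : (tree N).Dyadic := by
  intro i u x x' hx
  rcases lt_or_ge i N with hi | hi
  · have e : ∀ z, (tree N).D (i + 1) u z
        = ((tree N).E (i + 1) u z - (tree N).E (i + 1) u (flipAt ⟨i, hi⟩ z)) / 2 := fun z => by
      rw [D_succ]
      have := E_tree_succ ⟨i, hi⟩ u z
      simp only at this
      rw [this]; ring
    rw [e, e]
    rcases mem_or_flip_mem ⟨i, hi⟩ hx with ⟨h1, h2⟩ | ⟨h1, h2⟩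
    · rw [(tree N).E_eq_of_mem h1, (tree N).E_eq_of_mem h2]
    · rw [(tree N).E_eq_of_mem h1, (tree N).E_eq_of_mem h2, ← abs_neg]
      congr 1; ring
  · rw [D_succ, D_succ, E_of_depth_le _ (by rw [depth_tree]; omega),
      E_of_depth_le _ (by rw [depth_tree]; omega), E_of_depth_le _ (by rw [depth_tree]; omega),
      E_of_depth_le _ (by rw [depth_tree]; omega), sub_self, sub_self]

lemma card_cell_tree_succ {N : ℕ} (i : Fin N) (x : Fin N → Bool) :
    (((tree N).cell i x).card : ℝ) = 2 * ((tree N).cell (i + 1) x).card := by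
  have h1 := E_tree_of_const i (h := fun y => ind (y ∈ (tree N).cell (i + 1) x))
    (fun z y hy => by
      congr 1
      rw [(tree N).mem_cell_comm, (tree N).cell_eq _ _ _ hy, ← (tree N).mem_cell_comm]) x
  have h2 : flipAt i x ∉ (tree N).cell (i + 1) x := fun h => by
    rw [mem_cell_tree] at h
    have := h i (by omega)
    simp [flipAt] at this
  simp only [ind_of ((tree N).mem_cell (i + 1) x), ind_of_not h2, add_zero] at h1
  have h3 := (tree N).card_cell_pos i x
  have h4 : ∑ y ∈ (tree N).cell i x, ind (y ∈ (tree N).cell (i + 1) x)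
      = ((tree N).cell (i + 1) x).card := by
    rw [← Finset.sum_subset ((tree N).cell_succ i x)]
    · rw [Finset.sum_congr rfl fun y hy => ind_of hy]; simp
    · exact fun y _ hy => ind_of_not hy
  rw [E, h4, div_eq_div_iff h3.ne' (by norm_num)] at h1
  linarith

lemma doubling_tree (N : ℕ) : (tree N).Doubling := by
  intro i x
  rcases lt_or_ge i N with hi | hi
  · exact (card_cell_tree_succ ⟨i, hi⟩ x).le
  · rw [cell_of_depth_le _ (by rw [depth_tree]; omega), cell_of_depth_le _ (by rw [depth_tree]; omega)]
    simp

lemma card_cell_tree {N i : ℕ} (hi : i ≤ N) (x : Fin N → Bool) :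
    (((tree N).cell i x).card : ℝ) = 2 ^ N / 2 ^ i := by
  induction hi using Nat.decreasingInduction with
  | self => rw [cell_of_depth_le _ (by rw [depth_tree])]; simp
  | of_succ k hk ih =>
    have := card_cell_tree_succ ⟨k, hk⟩ x
    simp only at this
    rw [this, ih, pow_succ]
    field_simp

/-- The dyadic interval of generation `r + i` attached to a point of the binary tree, the root
being `[0, 2⁻ʳ)`. -/
def node (r : ℤ) {N : ℕ} (x : Fin N → Bool) : ℕ → DyadicInterval
  | 0 => (r, 0)
  | i + 1 => if h : i < N then
      (if x ⟨i, h⟩ then (node r x i).rightHalf else (node r x i).leftHalf) else node r x i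

variable {r : ℤ} {N : ℕ}

lemma node_succ (i : Fin N) (x : Fin N → Bool) : node r x (i + 1)
    = if x i then (node r x i).rightHalf else (node r x i).leftHalf := by
  rw [node, dif_pos i.2]

lemma gen_node {i : ℕ} (hi : i ≤ N) (x : Fin N → Bool) : (node r x i).1 = r + i := by
  induction i with
  | zero => simp [node]
  | succ i ih =>
    have h1 := ih (by omega)
    have h2 := node_succ (r := r) ⟨i, hi⟩ x
    simp only at h2
    rw [h2]
    split_ifs
    · change (node r x i).1 + 1 = _; rw [h1]; push_cast; ring
    · change (node r x i).1 + 1 = _; rw [h1]; push_cast; ring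

lemma node_eq_of_mem {i : ℕ} {x y : Fin N → Bool} (h : y ∈ (tree N).cell i x) :
    node r y i = node r x i := by
  induction i with
  | zero => rfl
  | succ i ih =>
    have h1 := ih ((tree N).cell_succ i x h)
    unfold node
    split_ifs with hi hy hx hx
    · rw [h1]
    · rw [mem_cell_tree] at h; rw [h ⟨i, hi⟩ (by simp)] at hy; exact absurd hy hx
    · rw [mem_cell_tree] at h; rw [h ⟨i, hi⟩ (by simp)] at hy; exact absurd hx hy
    · rw [h1]
    · rw [h1]

lemma node_succ_subset (x : Fin N → Bool) (i : ℕ) : (node r x (i + 1)).toSet ⊆ (node r x i).toSet := by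
  rw [node]
  split_ifs
  · exact rightHalf_subset _
  · exact leftHalf_subset _
  · exact subset_rfl

lemma node_subset (x : Fin N → Bool) {i j : ℕ} (h : i ≤ j) :
    (node r x j).toSet ⊆ (node r x i).toSet := by
  induction h with
  | refl => exact subset_rfl
  | step _ ih => exact (node_succ_subset x _).trans ih

/-- Equal nodes have equal parents, and the two halves of a parent are distinct, so the coordinates
agree step by step. -/
lemma mem_of_node_eq {i : ℕ} (hi : i ≤ N) {x y : Fin N → Bool} (h : node r y i = node r x i) :
    y ∈ (tree N).cell i x := by
  induction i with
  | zero => rw [mem_cell_tree]; intro k hk; omega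
  | succ i ih =>
    have hi' : i ≤ N := by omega
    have h0 : node r y i = node r x i := by
      have h1 := node_subset (r := r) y (Nat.le_succ i) (toSet_nonempty _)
      have h2 := node_subset (r := r) x (Nat.le_succ i) (toSet_nonempty _)
      rw [h] at h1
      exact eq_of_mem ((gen_node hi' y).trans (gen_node hi' x).symm) h1 h2
    have h1 := ih hi' h0
    have h2 := node_succ (r := r) ⟨i, hi⟩ x
    have h3 := node_succ (r := r) ⟨i, hi⟩ y
    simp only at h2 h3
    rw [h2, h3, h0] at h
    rw [mem_cell_tree] at h1 ⊢
    intro k hk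
    rcases Nat.lt_succ_iff_lt_or_eq.mp hk with h' | h'
    · exact h1 k h'
    · obtain rfl : k = ⟨i, hi⟩ := Fin.ext h'
      cases hx : x ⟨i, hi⟩ <;> cases hy : y ⟨i, hi⟩ <;>
        simp [hx, hy, leftHalf, rightHalf] at h ⊢

lemma node_eq_iff {i : ℕ} (hi : i ≤ N) {x y : Fin N → Bool} :
    node r y i = node r x i ↔ y ∈ (tree N).cell i x := ⟨mem_of_node_eq hi, node_eq_of_mem⟩

lemma exists_node {i : ℕ} (hi : i ≤ N) {I : DyadicInterval} (hg : I.1 = r + i)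
    (hI : I.toSet ⊆ toSet (r, 0)) : ∃ x : Fin N → Bool, node r x i = I := by
  induction i generalizing I with
  | zero =>
    refine ⟨fun _ => false, ?_⟩
    exact (eq_of_mem (by simpa using hg) I.toSet_nonempty (hI I.toSet_nonempty)).symm
  | succ i ih =>
    -- The parent of `I`, by integer division.
    set K : DyadicInterval := (r + i, I.2 / 2) with hK
    have hIK : I = K.leftHalf ∨ I = K.rightHalf := by
      rcases Int.even_or_odd' I.2 with ⟨c, hc | hc⟩
      · left; refine Prod.ext ?_ ?_
        · change I.1 = r + i + 1; rw [hg]; push_cast; ring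
        · change I.2 = 2 * (I.2 / 2); omega
      · right; refine Prod.ext ?_ ?_
        · change I.1 = r + i + 1; rw [hg]; push_cast; ring
        · change I.2 = 2 * (I.2 / 2) + 1; omega
    have hsub : I.toSet ⊆ K.toSet := by
      rcases hIK with h | h
      · rw [h]; exact leftHalf_subset _
      · rw [h]; exact rightHalf_subset _
    have hKr : K.toSet ⊆ toSet (r, 0) :=
      subset_of_mem (by simp [hK]) (hI I.toSet_nonempty) (hsub I.toSet_nonempty)
    obtain ⟨x, hx⟩ := ih (by omega) rfl hKr
    have hex : ∀ b : Bool, ∃ y : Fin N → Bool, node r y i = K ∧ y ⟨i, hi⟩ = b := fun b => by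
      refine ⟨Function.update x ⟨i, hi⟩ b, ?_, by simp⟩
      rw [← hx]
      refine node_eq_of_mem (mem_cell_tree.mpr fun k hk => ?_)
      have : k ≠ ⟨i, hi⟩ := fun h => by subst h; exact lt_irrefl _ hk
      simp [this]
    rcases hIK with h | h
    · obtain ⟨y, hy, hb⟩ := hex false
      refine ⟨y, ?_⟩
      have := node_succ (r := r) ⟨i, hi⟩ y
      simp only at this
      rw [this, hb, hy, h]; simp
    · obtain ⟨y, hy, hb⟩ := hex true
      refine ⟨y, ?_⟩
      have := node_succ (r := r) ⟨i, hi⟩ y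
      simp only at this
      rw [this, hb, hy, h]; simp

lemma node_subset_root (x : Fin N → Bool) (i : ℕ) : (node r x i).toSet ⊆ toSet (r, 0) :=
  node_subset x (Nat.zero_le i)

lemma exists_leaf {i : ℕ} (hi : i ≤ N) (x : Fin N → Bool) {t : ℝ} (ht : t ∈ (node r x i).toSet) :
    ∃ y ∈ (tree N).cell i x, t ∈ (node r y N).toSet := by
  set I : DyadicInterval := (r + N, ⌊t * 2 ^ (r + N : ℤ)⌋) with hI
  have htI : t ∈ I.toSet := (mem_toSet_iff _ _).mpr rfl
  have hsub : I.toSet ⊆ (node r x i).toSet := by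
    refine subset_of_mem ?_ ht htI
    rw [gen_node hi]; simp only [hI]; omega
  obtain ⟨y, hy⟩ := exists_node (r := r) le_rfl (I := I) rfl (hsub.trans (node_subset_root x i))
  refine ⟨y, mem_of_node_eq (r := r) hi ?_, by rw [hy]; exact htI⟩
  have h1 : t ∈ (node r y i).toSet := node_subset y hi (by rw [hy]; exact htI)
  exact eq_of_mem ((gen_node hi y).trans (gen_node hi x).symm) h1 ht

lemma leaf_eq_of_mem {x y : Fin N → Bool} {t : ℝ} (hx : t ∈ (node r x N).toSet)
    (hy : t ∈ (node r y N).toSet) : x = y := by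
  have h := eq_of_mem ((gen_node le_rfl x).trans (gen_node le_rfl y).symm) hx hy
  have := mem_of_node_eq le_rfl h
  rw [mem_cell_tree] at this
  exact funext fun k => this k k.2

lemma length_node {i : ℕ} (hi : i ≤ N) (x : Fin N → Bool) :
    (node r x i).length = 2 ^ (-r) / 2 ^ i := by
  rw [length, gen_node hi, neg_add, zpow_add₀ (by norm_num), zpow_neg 2 (i : ℤ), zpow_natCast]
  rfl

/-- A function on dyadic intervals whose value at an interval is the mean of the values at its
halves. -/
def IsMart (g : DyadicInterval → ℝ) : Prop := ∀ I, g I = (g I.leftHalf + g I.rightHalf) / 2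

/-- The averaging property of `g` matches the averaging over the two children, by descent from the
leaves. -/
lemma E_node {g : DyadicInterval → ℝ} (hg : IsMart g) {i : ℕ} (hi : i ≤ N) (x : Fin N → Bool) :
    (tree N).E i (fun x => g (node r x N)) x = g (node r x i) := by
  induction hi using Nat.decreasingInduction generalizing x with
  | self => exact E_of_depth_le _ (by rw [depth_tree]) _ _
  | of_succ k hk ih =>
    have h1 := E_tree_succ ⟨k, hk⟩ (fun x => g (node r x N)) x
    simp only at h1
    rw [h1, ih, ih, hg (node r x k)]
    have h2 := node_succ (r := r) ⟨k, hk⟩ x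
    have h3 := node_succ (r := r) ⟨k, hk⟩ (flipAt ⟨k, hk⟩ x)
    simp only at h2 h3
    have h4 : node r (flipAt ⟨k, hk⟩ x) k = node r x k :=
      node_eq_of_mem (flipAt_mem ⟨k, hk⟩ ((tree N).mem_cell k x))
    rw [h2, h3, h4]
    cases hx : x ⟨k, hk⟩ <;> simp [flipAt, hx, add_comm]

/-- The sign attached to a step in the binary tree. -/
def sgn (i : Fin N) (x : Fin N → Bool) : ℝ := if x i then 1 else -1

lemma abs_sgn (i : Fin N) (x : Fin N → Bool) : |sgn i x| = 1 := by
  unfold sgn; split_ifs <;> simp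

lemma D_node {g : DyadicInterval → ℝ} (hg : IsMart g) (i : Fin N) (x : Fin N → Bool) :
    (tree N).D (i + 1) (fun x => g (node r x N)) x
      = sgn i x * ((g (node r x i).rightHalf - g (node r x i).leftHalf) / 2) := by
  rw [D_succ, E_node hg (by omega), E_node hg (by omega), node_succ, hg (node r x i), sgn]
  split_ifs <;> ring

/-- An interval of generation `k` is the node of `2 ^ N / 2 ^ k` points, so the weights count it
exactly once. This turns sums over intervals into sums over points and generations. -/
lemma sum_ind_node_eq {k : ℕ} (hk : k < N) (z : Fin N → Bool) :
    ∑ x : Fin N → Bool, ∑ i ∈ Finset.range N,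
      ind (node r x i = node r z k) * ((2 : ℝ) ^ i / 2 ^ N) = 1 := by
  rw [Finset.sum_comm, Finset.sum_eq_single k]
  · rw [← Finset.sum_mul]
    have : ∑ x : Fin N → Bool, ind (node r x k = node r z k) = ((tree N).cell k z).card := by
      simp only [node_eq_iff hk.le]
      rw [← Finset.sum_subset (Finset.subset_univ ((tree N).cell k z))]
      · rw [Finset.sum_congr rfl fun y hy => ind_of hy]; simp
      · exact fun y _ hy => ind_of_not hy
    rw [this, card_cell_tree hk.le]
    field_simp
  · intro i hi hne
    rw [Finset.mem_range] at hi
    refine Finset.sum_eq_zero fun x _ => ?_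
    rw [ind_of_not, zero_mul]
    intro h
    have h1 := gen_node (r := r) hi.le x
    rw [h, gen_node hk.le] at h1
    omega
  · exact fun h => absurd (Finset.mem_range.mpr hk) h

end

end DyadicParaproduct

/-! ### One-variable consequences of the two-parameter Carleson condition. -/

namespace DyadicParaproduct

noncomputable section

namespace CellFiltration

variable {X Y : Type*} [Fintype X] [Fintype Y] {P : CellFiltration X} {Q : CellFiltration Y}

lemma sum_ind_mem (s : Finset X) (f : X → ℝ) : ∑ x, ind (x ∈ s) * f x = ∑ x ∈ s, f x := by
  rw [← Finset.sum_subset (Finset.subset_univ s) fun x _ hx => by rw [ind_of_not hx, zero_mul]]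
  exact Finset.sum_congr rfl fun x hx => by rw [ind_of hx, one_mul]

lemma sum_sum_ind_prod (s : Finset X) (t : Finset Y) (f : X → Y → ℝ) :
    ∑ x, ∑ y, ind (x ∈ s ∧ y ∈ t) * f x y = ∑ x ∈ s, ∑ y ∈ t, f x y := by
  rw [← sum_ind_mem s fun x => ∑ y ∈ t, f x y]
  refine Finset.sum_congr rfl fun x _ => ?_
  rw [← sum_ind_mem t fun y => f x y, Finset.mul_sum]
  exact Finset.sum_congr rfl fun y _ => by rw [ind_and, mul_assoc]

/-- The modulus of the difference is constant over the cell of generation `i`, so summing over that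
cell merely multiplies by its size; the result is bounded by the Carleson condition for a single
rectangle. -/
lemma sum_sq_sub_E2_le {n : ℕ} {κ : ℝ} {b : X → Y → ℝ} (hP : P.depth ≤ n) (hQ : Q.depth ≤ n)
    (hPd : P.Dyadic)
    (hb : ∀ A : Set (X × Y), ∑ i ∈ Finset.range n, ∑ j ∈ Finset.range n,
      ∑ x, ∑ y, ind (Sub P Q i j x y A) * D1 P (i + 1) (D2 Q (j + 1) b) x y ^ 2 ≤ κ ^ 2 * size A)
    (i q : ℕ) (x : X) (y : Y) : ∑ y' ∈ Q.cell q y,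
      (D1 P (i + 1) b x y' - E2 Q q (D1 P (i + 1) b) x y') ^ 2 ≤ κ ^ 2 * (Q.cell q y).card := by
  have hpos : 0 ≤ κ ^ 2 * (Q.cell q y).card := mul_nonneg (sq_nonneg _) (Nat.cast_nonneg _)
  rcases lt_or_ge i n with hi | hi
  swap
  · refine le_trans (le_of_eq (Finset.sum_eq_zero fun y' _ => ?_)) hpos
    have h0 : ∀ y'', D1 P (i + 1) b x y'' = 0 := fun y'' => by
      rw [D1, P.D_succ, P.E_of_depth_le (by omega), P.E_of_depth_le (by omega), sub_self]
    have h1 : E2 Q q (D1 P (i + 1) b) x y' = 0 := by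
      rw [E2, Q.E_congr (g := fun _ => 0) fun y'' _ => h0 y'', Q.E_const]
    rw [h0, h1, sub_self, sq, zero_mul]
  rcases le_total q n with hq | hq
  swap
  · refine le_trans (le_of_eq (Finset.sum_eq_zero fun y' _ => ?_)) hpos
    rw [E2, Q.E_of_depth_le (by omega), sub_self, sq, zero_mul]
  have h1 := Q.sum_sq_sub_E (Q.cell q y) hq hQ (fun y' hy => by rw [Q.cell_eq q y y' hy])
    (D1 P (i + 1) b x)
  change ∑ y' ∈ Q.cell q y, (D1 P (i + 1) b x y' - Q.E q (D1 P (i + 1) b x) y') ^ 2 ≤ _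
  rw [h1]
  have hcard := P.card_cell_pos i x
  set A : Set (X × Y) := {z | z.1 ∈ P.cell i x ∧ z.2 ∈ Q.cell q y} with hA
  have hsize : size A = (P.cell i x).card * (Q.cell q y).card := by
    have := sum_sum_ind_prod (P.cell i x) (Q.cell q y) fun _ _ => 1
    simp only [mul_one, Finset.sum_const, nsmul_eq_mul, mul_one] at this
    exact this
  have h2 : (P.cell i x).card * ∑ j ∈ Finset.Ico q n, ∑ y' ∈ Q.cell q y,
      Q.D (j + 1) (D1 P (i + 1) b x) y' ^ 2
      = ∑ j ∈ Finset.Ico q n, ∑ x' ∈ P.cell i x, ∑ y' ∈ Q.cell q y,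
        D1 P (i + 1) (D2 Q (j + 1) b) x' y' ^ 2 := by
    rw [Finset.mul_sum]
    refine Finset.sum_congr rfl fun j _ => ?_
    rw [← nsmul_eq_mul, ← Finset.sum_const]
    refine Finset.sum_congr rfl fun x' hx => Finset.sum_congr rfl fun y' _ => ?_
    rw [← sq_abs (D1 P (i + 1) (D2 Q (j + 1) b) x' y'), abs_D1_eq_of_mem hPd hx, sq_abs, D1_D2]
    rfl
  have h3 : ∑ j ∈ Finset.Ico q n, ∑ x' ∈ P.cell i x, ∑ y' ∈ Q.cell q y,
        D1 P (i + 1) (D2 Q (j + 1) b) x' y' ^ 2 ≤ κ ^ 2 * size A := by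
    refine le_trans ?_ (hb A)
    refine le_trans ?_ (Finset.single_le_sum (f := fun i => ∑ j ∈ Finset.range n,
      ∑ x, ∑ y, ind (Sub P Q i j x y A) * D1 P (i + 1) (D2 Q (j + 1) b) x y ^ 2)
      (fun _ _ => Finset.sum_nonneg fun _ _ => Finset.sum_nonneg fun _ _ => Finset.sum_nonneg
        fun _ _ => mul_nonneg (ind_nonneg _) (sq_nonneg _)) (Finset.mem_range.mpr hi))
    refine le_trans (Finset.sum_le_sum fun j hj => ?_) (Finset.sum_le_sum_of_subset_of_nonneg
      (s := Finset.Ico q n) (fun j hj => Finset.mem_range.mpr (Finset.mem_Ico.mp hj).2)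
      fun _ _ _ => Finset.sum_nonneg fun _ _ => Finset.sum_nonneg
        fun _ _ => mul_nonneg (ind_nonneg _) (sq_nonneg _))
    rw [← sum_sum_ind_prod]
    refine Finset.sum_le_sum fun x' _ => Finset.sum_le_sum fun y' _ =>
      mul_le_mul_of_nonneg_right (ind_mono fun h => ?_) (sq_nonneg _)
    intro x'' hx y'' hy
    refine ⟨?_, ?_⟩
    · rw [← P.cell_eq i x x' h.1]; exact hx
    · rw [← Q.cell_eq q y y' h.2]; exact Q.cell_anti (Finset.mem_Ico.mp hj).1 y' hy
  rw [← h2, hsize] at h3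
  refine le_of_mul_le_mul_left (h3.trans (le_of_eq ?_)) hcard
  ring

/-- The oscillation bound on a cell of generation `j` contains the term of generation `j`, whose
modulus is constant there. -/
lemma abs_D1_D2_le {n : ℕ} {κ : ℝ} {b : X → Y → ℝ} (hκ : 0 ≤ κ) (hQ : Q.depth ≤ n)
    (hQd : Q.Dyadic) {i : ℕ} (hb : ∀ (q : ℕ) (x : X) (y : Y), ∑ y' ∈ Q.cell q y,
      (D1 P i b x y' - E2 Q q (D1 P i b) x y') ^ 2 ≤ κ ^ 2 * (Q.cell q y).card) (j : ℕ) (x : X)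
    (y : Y) : |D1 P i (D2 Q (j + 1) b) x y| ≤ κ := by
  rcases lt_or_ge j n with hj | hj
  swap
  · rw [D1_D2, D2, Q.D_succ, Q.E_of_depth_le (by omega), Q.E_of_depth_le (by omega), sub_self,
      abs_zero]
    exact hκ
  have h1 := hb j x y
  have h2 := Q.sum_sq_sub_E (Q.cell j y) hj.le hQ (fun y' hy => by rw [Q.cell_eq j y y' hy])
    (D1 P i b x)
  change ∑ y' ∈ Q.cell j y, (D1 P i b x y' - Q.E j (D1 P i b x) y') ^ 2 ≤ _ at h1
  rw [h2] at h1
  have h3 := (Finset.single_le_sum (f := fun j' => ∑ y' ∈ Q.cell j y,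
    Q.D (j' + 1) (D1 P i b x) y' ^ 2) (fun _ _ => Finset.sum_nonneg fun _ _ => sq_nonneg _)
    (Finset.mem_Ico.mpr ⟨le_rfl, hj⟩)).trans h1
  have h4 : ∑ y' ∈ Q.cell j y, Q.D (j + 1) (D1 P i b x) y' ^ 2
      = (Q.cell j y).card * D1 P i (D2 Q (j + 1) b) x y ^ 2 := by
    rw [← nsmul_eq_mul, ← Finset.sum_const]
    refine Finset.sum_congr rfl fun y' hy => ?_
    rw [D1_D2, ← sq_abs, hQd j _ y y' hy, sq_abs]; rfl
  rw [h4, mul_comm] at h3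
  exact abs_le_of_sq_le_sq (le_of_mul_le_mul_right h3 (Q.card_cell_pos j y)) hκ

lemma EE_eq_sum (i j : ℕ) (b : X → Y → ℝ) (x : X) (y : Y) : EE P Q i j b x y
    = ∑ i' ∈ Finset.range (i + 1), ∑ j' ∈ Finset.range (j + 1), D1 P i' (D2 Q j' b) x y := by
  have h2 : ∀ x', ∑ j' ∈ Finset.range (j + 1), D2 Q j' b x' y = E2 Q j b x' y := fun x' =>
    Q.sum_D j (b x') y
  have h3 : ∀ i', ∑ j' ∈ Finset.range (j + 1), D1 P i' (D2 Q j' b) x y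
      = P.D i' (fun x' => E2 Q j b x' y) x := fun i' => by
    rw [← P.D_congr_fun h2, P.D_sum]; rfl
  simp only [h3]
  exact (P.sum_D i _ x).symm

/-- The size conditions follow from those for the second differences and for the averages over
the largest cells. -/
lemma BMOData.of_dyadic {n : ℕ} {κ : ℝ} {b : X → Y → ℝ} (hκ : 0 ≤ κ) (hP : P.depth ≤ n)
    (hQ : Q.depth ≤ n) (hPd : P.Dyadic) (hQd : Q.Dyadic)
    (hb : ∀ A : Set (X × Y), ∑ i ∈ Finset.range n, ∑ j ∈ Finset.range n,
      ∑ x, ∑ y, ind (Sub P Q i j x y A) * D1 P (i + 1) (D2 Q (j + 1) b) x y ^ 2 ≤ κ ^ 2 * size A)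
    (h01 : ∀ (q : ℕ) (x : X) (y : Y), ∑ y' ∈ Q.cell q y,
      (D1 P 0 b x y' - E2 Q q (D1 P 0 b) x y') ^ 2 ≤ κ ^ 2 * (Q.cell q y).card)
    (h10 : ∀ (p : ℕ) (y : Y) (x : X), ∑ x' ∈ P.cell p x,
      (D2 Q 0 b x' y - E1 P p (D2 Q 0 b) x' y) ^ 2 ≤ κ ^ 2 * (P.cell p x).card)
    (h00 : ∀ x y, |EE P Q 0 0 b x y| ≤ κ) : BMOData P Q n κ b := by
  have hsnd : ∀ (i q : ℕ) (x : X) (y : Y), ∑ y' ∈ Q.cell q y,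
    (D1 P i b x y' - E2 Q q (D1 P i b) x y') ^ 2 ≤ κ ^ 2 * (Q.cell q y).card := by
    intro i
    cases i with
    | zero => exact h01
    | succ i => exact sum_sq_sub_E2_le hP hQ hPd hb i
  have hb' : ∀ A : Set (Y × X), ∑ j ∈ Finset.range n, ∑ i ∈ Finset.range n,
      ∑ y, ∑ x, ind (Sub Q P j i y x A) * D1 Q (j + 1) (D2 P (i + 1) fun y x => b x y) y x ^ 2
        ≤ κ ^ 2 * size A := by
    intro A
    have h := hb (swapSet A)
    rw [size_swapSet] at h
    refine le_trans (le_of_eq ?_) h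
    rw [Finset.sum_comm]
    refine Finset.sum_congr rfl fun i _ => Finset.sum_congr rfl fun j _ => ?_
    rw [Finset.sum_comm]
    refine Finset.sum_congr rfl fun x _ => Finset.sum_congr rfl fun y _ => ?_
    congr 2
    · exact propext ⟨fun h => h.swap, fun h => h.swap⟩
    · exact (D1_D2 P Q (i + 1) (j + 1) b x y).symm
  have hfst : ∀ (j p : ℕ) (y : Y) (x : X), ∑ x' ∈ P.cell p x,
    (D2 Q j b x' y - E1 P p (D2 Q j b) x' y) ^ 2 ≤ κ ^ 2 * (P.cell p x).card := by
    intro j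
    cases j with
    | zero => exact h10
    | succ j => exact sum_sq_sub_E2_le (P := Q) (Q := P) hQ hP hQd hb' j
  refine ⟨hκ, fun i j x y => ?_, hb, hsnd, hfst⟩
  have hD : ∀ i j, |D1 P i (D2 Q j b) x y| ≤ κ := by
    intro i j
    cases j with
    | succ j => exact abs_D1_D2_le hκ hQ hQd (hsnd i) j x y
    | zero =>
      cases i with
      | zero => exact h00 x y
      | succ i =>
        rw [D1_D2]
        exact abs_D1_D2_le (P := Q) (Q := P) (b := fun y x => b x y) hκ hP hPd (hfst 0) i y x
  -- The mean is a sum of `(i + 1) * (j + 1)` differences, each bounded by `κ`.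
  rw [EE_eq_sum]
  refine (Finset.abs_sum_le_sum_abs _ _).trans ?_
  refine (Finset.sum_le_sum fun i' _ => (Finset.abs_sum_le_sum_abs _ _).trans
    (Finset.sum_le_sum fun j' _ => hD i' j')).trans (le_of_eq ?_)
  simp only [Finset.sum_const, Finset.card_range, nsmul_eq_mul]
  push_cast; ring

end CellFiltration

end

end DyadicParaproduct

/-! ### Transfer of Carleson conditions between the plane and the trees. -/

namespace DyadicParaproduct

noncomputable section

open CellFiltration DyadicInterval

namespace DyadicRect

/-- The area of a dyadic rectangle. -/
def area (R : DyadicRect) : ℝ := R.1.length * R.2.length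

lemma area_pos (R : DyadicRect) : 0 < area R := mul_pos R.1.length_pos R.2.length_pos

lemma measurableSet_toSet (R : DyadicRect) : MeasurableSet (toSet R) :=
  (DyadicInterval.measurableSet_toSet _).prod (DyadicInterval.measurableSet_toSet _)

lemma volume_toSet (R : DyadicRect) : volume (toSet R) = ENNReal.ofReal (area R) := by
  rw [toSet, Measure.volume_eq_prod, Measure.prod_prod, DyadicInterval.volume_toSet,
    DyadicInterval.volume_toSet, ← ENNReal.ofReal_mul R.1.length_pos.le]
  rfl

lemma volume_toSet_lt_top (R : DyadicRect) : volume (toSet R) < ∞ := by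
  rw [volume_toSet]; exact ENNReal.ofReal_lt_top

lemma toReal_volume_toSet (R : DyadicRect) : (volume (toSet R)).toReal = area R := by
  rw [volume_toSet, ENNReal.toReal_ofReal (area_pos R).le]

lemma toSet_nonempty (R : DyadicRect) : (toSet R).Nonempty :=
  ⟨(_, _), R.1.toSet_nonempty, R.2.toSet_nonempty⟩

lemma subset_iff {R S : DyadicRect} :
    toSet R ⊆ toSet S ↔ R.1.toSet ⊆ S.1.toSet ∧ R.2.toSet ⊆ S.2.toSet := by
  rw [toSet, toSet, Set.prod_subset_prod_iff]
  refine ⟨fun h => ?_, Or.inl⟩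
  rcases h with h | h | h
  · exact h
  · exact absurd R.1.toSet_nonempty (by rw [h]; simp)
  · exact absurd R.2.toSet_nonempty (by rw [h]; simp)

end DyadicRect

/-- The Carleson condition for a family of numbers indexed by the dyadic rectangles. -/
def SeqCarl (c : DyadicRect → ℝ) (K : ℝ) : Prop :=
  ∀ E : Set (ℝ × ℝ), MeasurableSet E → volume E < ∞ → ∀ 𝓖 : Finset DyadicRect,
    (∀ R ∈ 𝓖, R.toSet ⊆ E) → ∑ R ∈ 𝓖, c R ≤ K * (volume E).toReal

variable {r : ℤ} {N : ℕ}

/-- The rectangles of generation at most `N` attached to the points of two binary trees. -/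
def nodes (r : ℤ) {N : ℕ} (x y : Fin N → Bool) (i j : ℕ) : DyadicRect := (node r x i, node r y j)

/-- The area of the smallest rectangles. -/
def leafArea (r : ℤ) (N : ℕ) : ℝ := (2 ^ (-r) / 2 ^ N) ^ 2

lemma leafArea_pos (r : ℤ) (N : ℕ) : 0 < leafArea r N := by unfold leafArea; positivity

lemma area_nodes {i j : ℕ} (hi : i ≤ N) (hj : j ≤ N) (x y : Fin N → Bool) :
    (nodes r x y i j).area = 2 ^ (-r) / 2 ^ i * (2 ^ (-r) / 2 ^ j) := by
  rw [DyadicRect.area, nodes, length_node hi, length_node hj]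

lemma area_leaf (x y : Fin N → Bool) : (nodes r x y N N).area = leafArea r N := by
  rw [area_nodes le_rfl le_rfl, leafArea, sq]

lemma inv_area_nodes {i j : ℕ} (hi : i ≤ N) (hj : j ≤ N) (x y : Fin N → Bool) :
    ((2 : ℝ) ^ i / 2 ^ N) * (2 ^ j / 2 ^ N) = leafArea r N / (nodes r x y i j).area := by
  rw [area_nodes hi hj, leafArea]
  have : (2 : ℝ) ^ (-r) ≠ 0 := by positivity
  field_simp

/-- The weights make every rectangle count once; they equal the area of a leaf divided by the area
of the rectangle, so a sum over rectangles becomes a sum of densities over leaves. -/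
lemma sum_eq_sum_nodes (c : DyadicRect → ℝ) {𝓖 : Finset DyadicRect}
    (h𝓖 : ∀ R ∈ 𝓖, ∃ i < N, ∃ j < N, ∃ x y : Fin N → Bool, R = nodes r x y i j) :
    ∑ R ∈ 𝓖, c R = ∑ x : Fin N → Bool, ∑ y : Fin N → Bool, ∑ p ∈ Finset.range N ×ˢ Finset.range N,
      ind (nodes r x y p.1 p.2 ∈ 𝓖) *
        (c (nodes r x y p.1 p.2) * (2 ^ p.1 / 2 ^ N * (2 ^ p.2 / 2 ^ N))) := by
  classical
  have h1 : ∀ R ∈ 𝓖, c R = ∑ x : Fin N → Bool, ∑ y : Fin N → Bool,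
      ∑ p ∈ Finset.range N ×ˢ Finset.range N, ind (nodes r x y p.1 p.2 = R) *
        (c R * (2 ^ p.1 / 2 ^ N * (2 ^ p.2 / 2 ^ N))) := by
    intro R hR
    obtain ⟨i, hi, j, hj, x₀, y₀, rfl⟩ := h𝓖 R hR
    have e1 := sum_ind_node_eq (r := r) hi x₀
    have e2 := sum_ind_node_eq (r := r) hj y₀
    calc c (nodes r x₀ y₀ i j) = c (nodes r x₀ y₀ i j) *
        ((∑ x : Fin N → Bool, ∑ i' ∈ Finset.range N,
          ind (node r x i' = node r x₀ i) * ((2 : ℝ) ^ i' / 2 ^ N)) *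
        (∑ x : Fin N → Bool, ∑ i' ∈ Finset.range N,
          ind (node r x i' = node r y₀ j) * ((2 : ℝ) ^ i' / 2 ^ N))) := by
          rw [e1, e2, mul_one, mul_one]
      _ = _ := by
        rw [Finset.sum_mul_sum, Finset.mul_sum]
        refine Finset.sum_congr rfl fun x _ => ?_
        rw [Finset.mul_sum]
        refine Finset.sum_congr rfl fun y _ => ?_
        rw [Finset.sum_mul_sum, ← Finset.sum_product', Finset.mul_sum]
        refine Finset.sum_congr rfl fun p _ => ?_
        have : ind (nodes r x y p.1 p.2 = nodes r x₀ y₀ i j)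
            = ind (node r x p.1 = node r x₀ i) * ind (node r y p.2 = node r y₀ j) := by
          rw [← ind_and]; congr 1
          simp [nodes]
        rw [this]; ring
  rw [Finset.sum_congr rfl h1, sum_sum_sum_comm]
  refine Finset.sum_congr rfl fun x _ => Finset.sum_congr rfl fun y _ => ?_
  rw [Finset.sum_comm]
  refine Finset.sum_congr rfl fun p _ => ?_
  by_cases h : nodes r x y p.1 p.2 ∈ 𝓖
  · rw [Finset.sum_eq_single (nodes r x y p.1 p.2), ind_of rfl, ind_of h]
    · exact fun R _ hne => by rw [ind_of_not (Ne.symm hne), zero_mul]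
    · exact fun h' => absurd h h'
  · rw [ind_of_not h, zero_mul]
    exact Finset.sum_eq_zero fun R hR => by
      rw [ind_of_not (fun he : nodes r x y p.1 p.2 = R => h (he ▸ hR)), zero_mul]

lemma leaf_subset {x y x' y' : Fin N → Bool} {i j : ℕ} (hi : i ≤ N) (hj : j ≤ N)
    (hx : x' ∈ (tree N).cell i x) (hy : y' ∈ (tree N).cell j y) :
    (nodes r x' y' N N).toSet ⊆ (nodes r x y i j).toSet := by
  rw [DyadicRect.subset_iff]
  refine ⟨?_, ?_⟩
  · have := node_subset (r := r) x' hi; rwa [node_eq_of_mem hx] at this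
  · have := node_subset (r := r) y' hj; rwa [node_eq_of_mem hy] at this

lemma pairwise_disjoint_leaf : Pairwise (Function.onFun Disjoint
    fun z : (Fin N → Bool) × (Fin N → Bool) => (nodes r z.1 z.2 N N).toSet) := by
  intro z w hzw
  rw [Function.onFun, Set.disjoint_left]
  intro p hp hp'
  exact hzw (Prod.ext (leaf_eq_of_mem hp.1 hp'.1) (leaf_eq_of_mem hp.2 hp'.2))

lemma size_eq_card {X Y : Type*} [Fintype X] [Fintype Y] (A : Set (X × Y)) [DecidablePred (· ∈ A)] :
    size A = (Finset.univ.filter (· ∈ A)).card := by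
  rw [size, ← Finset.sum_product' (f := fun x y => ind ((x, y) ∈ A)), Finset.univ_product_univ,
    Finset.card_filter]
  push_cast
  refine Finset.sum_congr rfl fun z _ => ?_
  by_cases h : z ∈ A
  · rw [if_pos h]; exact ind_of h
  · rw [if_neg h]; exact ind_of_not h

/-- The union of the leaves indexed by `A`. -/
def leafUnion (r : ℤ) {N : ℕ} (A : Set ((Fin N → Bool) × (Fin N → Bool))) : Set (ℝ × ℝ) :=
  ⋃ z ∈ A, (nodes r z.1 z.2 N N).toSet

lemma measurableSet_leafUnion (A : Set ((Fin N → Bool) × (Fin N → Bool))) :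
    MeasurableSet (leafUnion r A) :=
  A.toFinite.measurableSet_biUnion fun _ _ => DyadicRect.measurableSet_toSet _

lemma volume_leafUnion (A : Set ((Fin N → Bool) × (Fin N → Bool))) :
    volume (leafUnion r A) = ENNReal.ofReal (size A * leafArea r N) := by
  classical
  have e : leafUnion r A = ⋃ z ∈ Finset.univ.filter (· ∈ A), (nodes r z.1 z.2 N N).toSet := by
    simp [leafUnion]
  rw [e, measure_biUnion_finset (fun z _ w _ h => pairwise_disjoint_leaf h)
    fun _ _ => DyadicRect.measurableSet_toSet _]
  simp only [DyadicRect.volume_toSet, area_leaf]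
  rw [Finset.sum_const, nsmul_eq_mul, size_eq_card, ENNReal.ofReal_mul (Nat.cast_nonneg _),
    ENNReal.ofReal_natCast]

lemma toReal_volume_leafUnion (A : Set ((Fin N → Bool) × (Fin N → Bool))) :
    (volume (leafUnion r A)).toReal = size A * leafArea r N := by
  rw [volume_leafUnion, ENNReal.toReal_ofReal (mul_nonneg (size_nonneg A) (leafArea_pos r N).le)]

lemma nodes_subset_leafUnion {A : Set ((Fin N → Bool) × (Fin N → Bool))} {x y : Fin N → Bool}
    {i j : ℕ} (hi : i ≤ N) (hj : j ≤ N) (h : Sub (tree N) (tree N) i j x y A) :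
    (nodes r x y i j).toSet ⊆ leafUnion r A := by
  rintro ⟨s, t⟩ ⟨hs, ht⟩
  obtain ⟨x', hx, hs'⟩ := exists_leaf hi x hs
  obtain ⟨y', hy, ht'⟩ := exists_leaf hj y ht
  exact Set.mem_biUnion (h x' hx y' hy) ⟨hs', ht'⟩

/-- The leaves contained in a subset of the plane. -/
def leavesIn (r : ℤ) (N : ℕ) (E : Set (ℝ × ℝ)) : Set ((Fin N → Bool) × (Fin N → Bool)) :=
  {z | (nodes r z.1 z.2 N N).toSet ⊆ E}

/-- Distinct leaves are disjoint sets of equal area. -/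
lemma size_leavesIn_le {E : Set (ℝ × ℝ)} (hE : volume E < ∞) :
    size (leavesIn r N E) * leafArea r N ≤ (volume E).toReal := by
  rw [← toReal_volume_leafUnion]
  exact ENNReal.toReal_mono hE.ne (measure_mono (Set.iUnion₂_subset fun z hz => hz))

lemma sub_leavesIn {E : Set (ℝ × ℝ)} {x y : Fin N → Bool} {i j : ℕ} (hi : i ≤ N) (hj : j ≤ N)
    (h : (nodes r x y i j).toSet ⊆ E) : Sub (tree N) (tree N) i j x y (leavesIn r N E) :=
  fun _ hx _ hy => (leaf_subset hi hj hx hy).trans h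

/-- A set of points is replaced by the union of the corresponding leaves, which contains the
rectangle of a node as soon as its discrete cell lies in the set. Such unions are not open, which is
why `SeqCarl` admits measurable sets. -/
lemma carl_of_seqCarl {c : DyadicRect → ℝ} {K : ℝ} (hc : ∀ R, 0 ≤ c R) (h : SeqCarl c K)
    {s : Finset (ℕ × ℕ)} (hs : ∀ p ∈ s, p.1 < N ∧ p.2 < N) :
    Carl (tree N) (tree N) s K fun i j x y => c (nodes r x y i j) / (nodes r x y i j).area := by
  classical
  intro A
  set 𝓖 : Finset DyadicRect := (((Finset.univ : Finset (Fin N → Bool)) ×ˢ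
    ((Finset.univ : Finset (Fin N → Bool)) ×ˢ s)).filter fun q =>
      Sub (tree N) (tree N) q.2.2.1 q.2.2.2 q.1 q.2.1 A).image
        fun q => nodes r q.1 q.2.1 q.2.2.1 q.2.2.2 with h𝓖
  have h1 : ∑ R ∈ 𝓖, c R ≤ K * (size A * leafArea r N) := by
    rw [← toReal_volume_leafUnion]
    refine h _ (measurableSet_leafUnion A) (by rw [volume_leafUnion]; exact ENNReal.ofReal_lt_top)
      𝓖 fun R hR => ?_
    rw [h𝓖, Finset.mem_image] at hR
    obtain ⟨q, hq, rfl⟩ := hR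
    rw [Finset.mem_filter, Finset.mem_product, Finset.mem_product] at hq
    have := hs _ hq.1.2.2
    exact nodes_subset_leafUnion this.1.le this.2.le hq.2
  rw [sum_eq_sum_nodes (r := r) (N := N)] at h1
  swap
  · intro R hR
    rw [h𝓖, Finset.mem_image] at hR
    obtain ⟨q, hq, rfl⟩ := hR
    rw [Finset.mem_filter, Finset.mem_product, Finset.mem_product] at hq
    have := hs _ hq.1.2.2
    exact ⟨_, this.1, _, this.2, _, _, rfl⟩
  have hμ := leafArea_pos r N
  have h2 : leafArea r N * ∑ x : Fin N → Bool, ∑ y : Fin N → Bool, ∑ p ∈ s,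
      ind (Sub (tree N) (tree N) p.1 p.2 x y A) *
        (c (nodes r x y p.1 p.2) / (nodes r x y p.1 p.2).area) ≤ K * (size A * leafArea r N) := by
    refine le_trans ?_ h1
    simp only [Finset.mul_sum]
    refine Finset.sum_le_sum fun x _ => Finset.sum_le_sum fun y _ => ?_
    have hsub : s ⊆ Finset.range N ×ˢ Finset.range N := fun p hp => by
      rw [Finset.mem_product, Finset.mem_range, Finset.mem_range]; exact hs p hp
    refine le_trans (Finset.sum_le_sum fun p hp => ?_)
      (Finset.sum_le_sum_of_subset_of_nonneg hsub fun _ _ _ =>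
        mul_nonneg (ind_nonneg _) (mul_nonneg (hc _) (by positivity)))
    rw [inv_area_nodes (r := r) (hs p hp).1.le (hs p hp).2.le x y]
    have h3 : ind (Sub (tree N) (tree N) p.1 p.2 x y A) ≤ ind (nodes r x y p.1 p.2 ∈ 𝓖) :=
      ind_mono fun h' => by
        rw [h𝓖, Finset.mem_image]
        exact ⟨(x, y, p), by simp [hp, h'], rfl⟩
    have h4 : 0 ≤ c (nodes r x y p.1 p.2) * (leafArea r N / (nodes r x y p.1 p.2).area) :=
      mul_nonneg (hc _) (div_nonneg hμ.le (DyadicRect.area_pos _).le)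
    refine le_trans (le_of_eq ?_) (mul_le_mul_of_nonneg_right h3 h4)
    ring
  have h5 : leafArea r N * _ ≤ leafArea r N * (K * size A) := h2.trans (le_of_eq (by ring))
  exact le_of_mul_le_mul_left h5 hμ

/-- The converse transfer: a rectangle in `E` has all its leaves in `E`. -/
lemma sum_le_of_subset {c : DyadicRect → ℝ} (hc : ∀ R, 0 ≤ c R) {E : Set (ℝ × ℝ)}
    {𝓖 : Finset DyadicRect} (hE : ∀ R ∈ 𝓖, R.toSet ⊆ E)
    (h𝓖 : ∀ R ∈ 𝓖, ∃ i < N, ∃ j < N, ∃ x y : Fin N → Bool, R = nodes r x y i j) :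
    ∑ R ∈ 𝓖, c R ≤ leafArea r N * ∑ x : Fin N → Bool, ∑ y : Fin N → Bool,
      ∑ p ∈ Finset.range N ×ˢ Finset.range N,
        ind (Sub (tree N) (tree N) p.1 p.2 x y (leavesIn r N E)) *
          (c (nodes r x y p.1 p.2) / (nodes r x y p.1 p.2).area) := by
  rw [sum_eq_sum_nodes c h𝓖]
  simp only [Finset.mul_sum]
  refine Finset.sum_le_sum fun x _ => Finset.sum_le_sum fun y _ => Finset.sum_le_sum fun p hp => ?_
  rw [Finset.mem_product, Finset.mem_range, Finset.mem_range] at hp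
  rw [inv_area_nodes (r := r) hp.1.le hp.2.le x y]
  have h3 : ind (nodes r x y p.1 p.2 ∈ 𝓖)
      ≤ ind (Sub (tree N) (tree N) p.1 p.2 x y (leavesIn r N E)) :=
    ind_mono fun h => sub_leavesIn hp.1.le hp.2.le (hE _ h)
  have h4 : 0 ≤ c (nodes r x y p.1 p.2) * (leafArea r N / (nodes r x y p.1 p.2).area) :=
    mul_nonneg (hc _) (div_nonneg (leafArea_pos r N).le (DyadicRect.area_pos _).le)
  refine (mul_le_mul_of_nonneg_right h3 h4).trans (le_of_eq ?_)
  ring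

/-- The rectangles in the root square with bounded generations are attached to points of the
trees. -/
lemma exists_nodes {R : DyadicRect} (h : R.toSet ⊆ DyadicRect.toSet ((r, 0), (r, 0)))
    (h1 : R.1.1 < r + N) (h2 : R.2.1 < r + N) :
    ∃ i < N, ∃ j < N, ∃ x y : Fin N → Bool, R = nodes r x y i j := by
  rw [DyadicRect.subset_iff] at h
  -- An interval inside the root is not longer than it, by comparison of measures.
  have hgen : ∀ I : DyadicInterval, I.toSet ⊆ toSet (r, 0) → r ≤ I.1 := fun I hI => by
    have e : I.toSet ⊆ toSet (r, 0) → volume I.toSet ≤ volume (toSet (r, 0)) :=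
      fun h => measure_mono h
    have := e hI
    rw [DyadicInterval.volume_toSet, DyadicInterval.volume_toSet,
      ENNReal.ofReal_le_ofReal_iff (length_pos _).le, length, length,
      zpow_le_zpow_iff_right₀ (by norm_num)] at this
    simp only at this
    omega
  have g1 := hgen _ h.1
  have g2 := hgen _ h.2
  obtain ⟨i, hi⟩ := Int.le.dest g1
  obtain ⟨j, hj⟩ := Int.le.dest g2
  obtain ⟨x, hx⟩ := exists_node (N := N) (i := i) (by omega) hi.symm h.1
  obtain ⟨y, hy⟩ := exists_node (N := N) (i := j) (by omega) hj.symm h.2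
  exact ⟨i, by omega, j, by omega, x, y, by rw [nodes, hx, hy]⟩

end

end DyadicParaproduct

/-! ### Means over rectangles as martingales on the trees. -/

namespace DyadicParaproduct

noncomputable section

open CellFiltration DyadicInterval

variable {r : ℤ} {N : ℕ}

/-- A function of dyadic rectangles which has the averaging property in each variable. -/
structure BiMart (G : DyadicRect → ℝ) : Prop where
  fst : ∀ J, IsMart fun I => G (I, J)
  snd : ∀ I, IsMart fun J => G (I, J)

/-- Half the difference of the values at the halves of the first side. -/
def dif1 (G : DyadicRect → ℝ) (R : DyadicRect) : ℝ :=
  (G (R.1.rightHalf, R.2) - G (R.1.leftHalf, R.2)) / 2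

/-- Half the difference of the values at the halves of the second side. -/
def dif2 (G : DyadicRect → ℝ) (R : DyadicRect) : ℝ :=
  (G (R.1, R.2.rightHalf) - G (R.1, R.2.leftHalf)) / 2

/-- The values at the leaves. -/
def disc (r : ℤ) (N : ℕ) (G : DyadicRect → ℝ) (x y : Fin N → Bool) : ℝ := G (nodes r x y N N)

lemma EE_disc {G : DyadicRect → ℝ} (hG : BiMart G) {i j : ℕ} (hi : i ≤ N) (hj : j ≤ N)
    (x y : Fin N → Bool) : EE (tree N) (tree N) i j (disc r N G) x y = G (nodes r x y i j) := by
  have h : ∀ x', E2 (tree N) j (disc r N G) x' y = G (node r x' N, node r y j) := fun x' =>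
    E_node (hG.snd (node r x' N)) hj y
  have h2 := E_node (r := r) (hG.fst (node r y j)) hi x
  rw [EE, E1, (tree N).E_congr fun x' _ => h x', h2, nodes]

lemma D2_disc {G : DyadicRect → ℝ} (hG : BiMart G) (j : Fin N) (x y : Fin N → Bool) :
    D2 (tree N) (j + 1) (disc r N G) x y = sgn j y * dif2 G (node r x N, node r y j) :=
  D_node (hG.snd (node r x N)) j y

lemma isMart_dif2_fst {G : DyadicRect → ℝ} (hG : BiMart G) (J : DyadicInterval) :
    IsMart fun I => dif2 G (I, J) := fun I => by
  simp only [dif2]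
  have h1 := hG.fst J.rightHalf I
  have h2 := hG.fst J.leftHalf I
  simp only at h1 h2
  rw [h1, h2]; ring

lemma isMart_dif1_snd {G : DyadicRect → ℝ} (hG : BiMart G) (I : DyadicInterval) :
    IsMart fun J => dif1 G (I, J) := fun J => by
  simp only [dif1]
  have h1 := hG.snd I.rightHalf J
  have h2 := hG.snd I.leftHalf J
  simp only at h1 h2
  rw [h1, h2]; ring

/-- Moduli are compared because a difference on the tree carries the sign of the step, which is not
determined by the rectangle. -/
lemma abs_E1_D2_disc {G : DyadicRect → ℝ} (hG : BiMart G) {i j : ℕ} (hi : i ≤ N) (hj : j < N)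
    (x y : Fin N → Bool) : |E1 (tree N) i (D2 (tree N) (j + 1) (disc r N G)) x y|
      = |dif2 G (nodes r x y i j)| := by
  have h : ∀ x', D2 (tree N) (j + 1) (disc r N G) x' y
      = sgn ⟨j, hj⟩ y * dif2 G (node r x' N, node r y j) := fun x' => D2_disc hG ⟨j, hj⟩ x' y
  rw [E1, (tree N).E_congr fun x' _ => h x', E_const_mul,
    E_node (isMart_dif2_fst hG (node r y j)) hi, abs_mul, abs_sgn, one_mul, nodes]

lemma abs_D1_E2_disc {G : DyadicRect → ℝ} (hG : BiMart G) {i j : ℕ} (hi : i < N) (hj : j ≤ N)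
    (x y : Fin N → Bool) : |D1 (tree N) (i + 1) (E2 (tree N) j (disc r N G)) x y|
      = |dif1 G (nodes r x y i j)| := by
  have h : ∀ y', D1 (tree N) (i + 1) (disc r N G) x y'
      = sgn ⟨i, hi⟩ x * dif1 G (node r x i, node r y' N) := fun y' =>
    D_node (hG.fst (node r y' N)) ⟨i, hi⟩ x
  rw [D1_E2, E2, (tree N).E_congr fun y' _ => h y', E_const_mul,
    E_node (isMart_dif1_snd hG (node r x i)) hj, abs_mul, abs_sgn, one_mul, nodes]

lemma abs_D1_D2_disc {G : DyadicRect → ℝ} (hG : BiMart G) {i j : ℕ} (hi : i < N) (hj : j < N)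
    (x y : Fin N → Bool) : |D1 (tree N) (i + 1) (D2 (tree N) (j + 1) (disc r N G)) x y|
      = |dif1 (dif2 G) (nodes r x y i j)| := by
  have h : ∀ x', D2 (tree N) (j + 1) (disc r N G) x' y
      = sgn ⟨j, hj⟩ y * dif2 G (node r x' N, node r y j) := fun x' => D2_disc hG ⟨j, hj⟩ x' y
  have h2 := D_node (r := r) (isMart_dif2_fst hG (node r y j)) ⟨i, hi⟩ x
  have h3 : D1 (tree N) (i + 1) (D2 (tree N) (j + 1) (disc r N G)) x y
      = sgn ⟨j, hj⟩ y * (tree N).D (i + 1) (fun x' => dif2 G (node r x' N, node r y j)) x := by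
    rw [D1, (tree N).D_congr_fun h, D_succ, D_succ, E_const_mul, E_const_mul]; ring
  simp only at h2
  rw [h3, h2, abs_mul, abs_mul, abs_sgn, abs_sgn, one_mul, one_mul]
  rfl

lemma sum_eq_sum_node (c : DyadicInterval → ℝ) {𝓙 : Finset DyadicInterval}
    (h𝓙 : ∀ J ∈ 𝓙, ∃ j < N, ∃ y : Fin N → Bool, J = node r y j) :
    ∑ J ∈ 𝓙, c J = ∑ y : Fin N → Bool, ∑ j ∈ Finset.range N,
      ind (node r y j ∈ 𝓙) * (c (node r y j) * (2 ^ j / 2 ^ N)) := by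
  classical
  have h1 : ∀ J ∈ 𝓙, c J = ∑ y : Fin N → Bool, ∑ j ∈ Finset.range N, ind (node r y j = J) *
        (c J * (2 ^ j / 2 ^ N)) := by
    intro J hJ
    obtain ⟨j, hj, y₀, rfl⟩ := h𝓙 J hJ
    conv_lhs => rw [← mul_one (c _), ← sum_ind_node_eq (r := r) hj y₀]
    simp only [Finset.mul_sum]
    exact Finset.sum_congr rfl fun _ _ => Finset.sum_congr rfl fun _ _ => by ring
  rw [Finset.sum_congr rfl h1, Finset.sum_comm]
  refine Finset.sum_congr rfl fun y _ => ?_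
  rw [Finset.sum_comm]
  refine Finset.sum_congr rfl fun j _ => ?_
  by_cases h : node r y j ∈ 𝓙
  · rw [Finset.sum_eq_single (node r y j), ind_of rfl, ind_of h]
    · exact fun J _ hne => by rw [ind_of_not (Ne.symm hne), zero_mul]
    · exact fun h' => absurd h h'
  · rw [ind_of_not h, zero_mul]
    exact Finset.sum_eq_zero fun J hJ => by
      rw [ind_of_not (fun he : node r y j = J => h (he ▸ hJ)), zero_mul]

/-- The one-dimensional Carleson condition. -/
def IntervalCarl (c : DyadicInterval → ℝ) (K : ℝ) : Prop :=
  ∀ (L : DyadicInterval) (𝓙 : Finset DyadicInterval), (∀ J ∈ 𝓙, J.toSet ⊆ L.toSet) →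
    ∑ J ∈ 𝓙, c J ≤ K * L.length

/-- The Carleson condition is applied to all nodes below the given one, with lengths converted into
numbers of leaves. -/
lemma sum_cell_le_of_intervalCarl {f : DyadicInterval → ℝ} {K : ℝ}
    (hf : IntervalCarl (fun J => J.length * f J ^ 2) K) {q : ℕ} (hq : q ≤ N) (y : Fin N → Bool) :
    ∑ j ∈ Finset.Ico q N, ∑ y' ∈ (tree N).cell q y, f (node r y' j) ^ 2
      ≤ K * ((tree N).cell q y).card := by
  classical
  set 𝓙 : Finset DyadicInterval := ((Finset.Ico q N) ×ˢ ((tree N).cell q y)).image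
    fun p => node r p.2 p.1 with h𝓙
  have h1 := hf (node r y q) 𝓙 fun J hJ => by
    rw [h𝓙, Finset.mem_image] at hJ
    obtain ⟨p, hp, rfl⟩ := hJ
    rw [Finset.mem_product, Finset.mem_Ico] at hp
    rw [← node_eq_of_mem hp.2]
    exact node_subset p.2 hp.1.1
  rw [sum_eq_sum_node (r := r) (N := N)] at h1
  swap
  · intro J hJ
    rw [h𝓙, Finset.mem_image] at hJ
    obtain ⟨p, hp, rfl⟩ := hJ
    rw [Finset.mem_product, Finset.mem_Ico] at hp
    exact ⟨_, hp.1.2, _, rfl⟩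
  have hpos : (0 : ℝ) < 2 ^ (-r) / 2 ^ N := by positivity
  have h2 : 2 ^ (-r) / 2 ^ N * ∑ j ∈ Finset.Ico q N, ∑ y' ∈ (tree N).cell q y, f (node r y' j) ^ 2
      ≤ K * (node r y q).length := by
    refine le_trans ?_ h1
    rw [Finset.sum_comm, Finset.mul_sum]
    refine le_trans (Finset.sum_le_sum fun y' hy => ?_) (Finset.sum_le_sum_of_subset_of_nonneg
      (Finset.subset_univ ((tree N).cell q y)) fun y' _ _ => Finset.sum_nonneg fun j _ =>
        mul_nonneg (ind_nonneg _) (mul_nonneg (mul_nonneg (length_pos _).le (sq_nonneg _))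
          (by positivity)))
    rw [Finset.mul_sum]
    refine le_trans (Finset.sum_le_sum fun j hj => ?_) (Finset.sum_le_sum_of_subset_of_nonneg
      (s := Finset.Ico q N) (fun j hj => Finset.mem_range.mpr (Finset.mem_Ico.mp hj).2)
        fun j _ _ => mul_nonneg (ind_nonneg _) (mul_nonneg (mul_nonneg (length_pos _).le
          (sq_nonneg _)) (by positivity)))
    rw [ind_of, length_node (Finset.mem_Ico.mp hj).2.le]
    · refine le_of_eq ?_
      field_simp
    · rw [h𝓙, Finset.mem_image]
      exact ⟨(j, y'), by rw [Finset.mem_product]; exact ⟨hj, hy⟩, rfl⟩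
  rw [length_node hq] at h2
  rw [card_cell_tree hq]
  refine le_of_mul_le_mul_left (h2.trans (le_of_eq ?_)) hpos
  field_simp

/-- The size conditions for the averages of a function in product BMO over the rectangles in the
unit square. -/
structure RectBMO (K : ℝ) (G : DyadicRect → ℝ) : Prop where
  nonneg : 0 ≤ K
  mart : BiMart G
  carl : SeqCarl (fun R => R.area * dif1 (dif2 G) R ^ 2) (K ^ 2)
  snd : IntervalCarl (fun J => J.length * dif2 G ((0, 0), J) ^ 2) (K ^ 2)
  fst : IntervalCarl (fun I => I.length * dif1 G (I, (0, 0)) ^ 2) (K ^ 2)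
  root : |G ((0, 0), (0, 0))| ≤ K

lemma RectBMO.bmoData {K : ℝ} {G : DyadicRect → ℝ} (h : RectBMO K G) (N : ℕ) :
    BMOData (tree N) (tree N) N K (disc 0 N G) := by
  have hN : (tree N).depth ≤ N := le_of_eq (depth_tree N)
  have hzero : ∀ u : Fin N → Bool, node 0 u 0 = ((0, 0) : DyadicInterval) := fun u => rfl
  refine BMOData.of_dyadic h.nonneg hN hN (dyadic_tree N) (dyadic_tree N) ?_ ?_ ?_ ?_
  · intro A
    have h1 := carl_of_seqCarl (r := 0) (N := N) (fun R => mul_nonneg R.area_pos.le (sq_nonneg _))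
      h.carl (s := Finset.range N ×ˢ Finset.range N) (fun p hp => by
        rw [Finset.mem_product, Finset.mem_range, Finset.mem_range] at hp; exact hp) A
    refine le_trans (le_of_eq ?_) h1
    rw [← sum_sum_sum_comm, Finset.sum_product]
    refine Finset.sum_congr rfl fun i hi => Finset.sum_congr rfl fun j hj =>
      Finset.sum_congr rfl fun x _ => Finset.sum_congr rfl fun y _ => ?_
    rw [← sq_abs, abs_D1_D2_disc h.mart (Finset.mem_range.mp hi) (Finset.mem_range.mp hj), sq_abs]
    dsimp only
    rw [mul_div_cancel_left₀ _ (DyadicRect.area_pos _).ne']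
  · intro q x y
    rcases le_total q N with hq | hq
    swap
    · refine le_trans (le_of_eq (Finset.sum_eq_zero fun y' _ => ?_))
        (mul_nonneg (sq_nonneg K) (Nat.cast_nonneg _))
      rw [E2, E_of_depth_le _ (hN.trans hq), sub_self, sq, zero_mul]
    have h1 := (tree N).sum_sq_sub_E ((tree N).cell q y) hq hN
      (fun y' hy => by rw [(tree N).cell_eq q y y' hy]) (D1 (tree N) 0 (disc 0 N G) x)
    change ∑ y' ∈ (tree N).cell q y, (D1 (tree N) 0 (disc 0 N G) x y'
      - (tree N).E q (D1 (tree N) 0 (disc 0 N G) x) y') ^ 2 ≤ _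
    rw [h1]
    refine le_trans (le_of_eq ?_) (sum_cell_le_of_intervalCarl (r := 0) h.snd hq y)
    refine Finset.sum_congr rfl fun j hj => Finset.sum_congr rfl fun y' _ => ?_
    have e : (tree N).D (j + 1) (D1 (tree N) 0 (disc 0 N G) x) y'
        = E1 (tree N) 0 (D2 (tree N) (j + 1) (disc 0 N G)) x y' :=
      (E1_D2 (tree N) (tree N) 0 (j + 1) (disc 0 N G) x y').symm
    rw [e, ← sq_abs, abs_E1_D2_disc h.mart (Nat.zero_le N) (Finset.mem_Ico.mp hj).2, sq_abs, nodes,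
      hzero]
  · intro p y x
    rcases le_total p N with hp | hp
    swap
    · refine le_trans (le_of_eq (Finset.sum_eq_zero fun x' _ => ?_))
        (mul_nonneg (sq_nonneg K) (Nat.cast_nonneg _))
      rw [E1, E_of_depth_le _ (hN.trans hp), sub_self, sq, zero_mul]
    have h1 := (tree N).sum_sq_sub_E ((tree N).cell p x) hp hN
      (fun y' hy => by rw [(tree N).cell_eq p x y' hy]) (fun x' => D2 (tree N) 0 (disc 0 N G) x' y)
    change ∑ x' ∈ (tree N).cell p x, (D2 (tree N) 0 (disc 0 N G) x' y
      - (tree N).E p (fun x' => D2 (tree N) 0 (disc 0 N G) x' y) x') ^ 2 ≤ _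
    rw [h1]
    refine le_trans (le_of_eq ?_) (sum_cell_le_of_intervalCarl (r := 0) h.fst hp x)
    refine Finset.sum_congr rfl fun i hi => Finset.sum_congr rfl fun x' _ => ?_
    have e : (tree N).D (i + 1) (fun x' => D2 (tree N) 0 (disc 0 N G) x' y) x'
        = D1 (tree N) (i + 1) (E2 (tree N) 0 (disc 0 N G)) x' y := rfl
    rw [e, ← sq_abs, abs_D1_E2_disc h.mart (Finset.mem_Ico.mp hi).2 (Nat.zero_le N), sq_abs, nodes,
      hzero]
  · intro x y
    rw [EE_disc h.mart (Nat.zero_le N) (Nat.zero_le N), nodes, hzero, hzero]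
    exact h.root

/-- The restriction of a family to the rectangles of generation at least `k`. -/
def tailSeq (k : ℕ × ℕ) (c : DyadicRect → ℝ) (R : DyadicRect) : ℝ :=
  ind ((k.1 : ℤ) ≤ R.1.1 ∧ (k.2 : ℤ) ≤ R.2.1) * c R

/-- A condition on the generations of the rectangles. -/
def UnitRect (N : ℕ) (R : DyadicRect) : Prop :=
  R.toSet ⊆ DyadicRect.toSet ((0, 0), (0, 0)) ∧ R.1.1 < N ∧ R.2.1 < N

lemma UnitRect.exists_nodes {R : DyadicRect} (h : UnitRect N R) :
    ∃ i < N, ∃ j < N, ∃ x y : Fin N → Bool, R = nodes 0 x y i j :=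
  DyadicParaproduct.exists_nodes h.1 (by simpa using h.2.1) (by simpa using h.2.2)

/-- With root of generation 0, generations on the trees are those of the intervals, so the indicator
in `tailSeq` equals 1 on the tail. -/
lemma carl_tail {c : DyadicRect → ℝ} (hc : ∀ R, 0 ≤ c R) {K : ℝ} {k : ℕ × ℕ}
    (h : SeqCarl (tailSeq k c) K) : Carl (tree N) (tree N)
      ((Finset.range N ×ˢ Finset.range N).filter fun p => k.1 ≤ p.1 ∧ k.2 ≤ p.2) K
      fun i j x y => c (nodes 0 x y i j) / (nodes 0 x y i j).area := by
  have hs : ∀ p ∈ (Finset.range N ×ˢ Finset.range N).filter fun p => k.1 ≤ p.1 ∧ k.2 ≤ p.2,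
      p.1 < N ∧ p.2 < N := fun p hp => by
    rw [Finset.mem_filter, Finset.mem_product, Finset.mem_range, Finset.mem_range] at hp
    exact hp.1
  intro A
  refine le_trans (le_of_eq ?_) (carl_of_seqCarl (r := 0) (N := N)
    (fun R => mul_nonneg (ind_nonneg _) (hc R)) h hs A)
  refine Finset.sum_congr rfl fun x _ => Finset.sum_congr rfl fun y _ =>
    Finset.sum_congr rfl fun p hp => ?_
  have h1 := hs p hp
  rw [Finset.mem_filter] at hp
  have h2 : (k.1 : ℤ) ≤ (nodes 0 x y p.1 p.2).1.1 ∧ (k.2 : ℤ) ≤ (nodes 0 x y p.1 p.2).2.1 := by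
    rw [nodes, gen_node h1.1.le, gen_node h1.2.le]
    exact ⟨by simpa using hp.2.1, by simpa using hp.2.2⟩
  simp only
  rw [ind_of h2, one_mul]

/-- The Carleson embedding theorem for dyadic rectangles. -/
lemma sum_mul_sq_le_of_seqCarl {c : DyadicRect → ℝ} (hc : ∀ R, 0 ≤ c R) {K : ℝ} (hK : 0 ≤ K)
    (h : SeqCarl c K) {G : DyadicRect → ℝ} (hG : BiMart G) {𝓖 : Finset DyadicRect}
    (h𝓖 : ∀ R ∈ 𝓖, UnitRect N R) :
    ∑ R ∈ 𝓖, c R * G R ^ 2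
      ≤ 16 * K * (leafArea 0 N * ∑ x, ∑ y, disc 0 N G x y ^ 2) := by
  have hs : ∀ p ∈ Finset.range N ×ˢ Finset.range N, p.1 < N ∧ p.2 < N := fun p hp => by
    rw [Finset.mem_product, Finset.mem_range, Finset.mem_range] at hp; exact hp
  have h1 := (carl_of_seqCarl (r := 0) hc h hs).embed hK
    (fun i j x y => div_nonneg (hc _) (DyadicRect.area_pos _).le) (disc 0 N G)
  refine (sum_le_of_subset (r := 0) (c := fun R => c R * G R ^ 2)
    (fun R => mul_nonneg (hc R) (sq_nonneg _)) (E := Set.univ) (fun R _ => Set.subset_univ _)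
    fun R hR => (h𝓖 R hR).exists_nodes).trans ?_
  have h2 := mul_le_mul_of_nonneg_left h1 (leafArea_pos 0 N).le
  refine le_trans (mul_le_mul_of_nonneg_left ?_ (leafArea_pos 0 N).le)
    (h2.trans (le_of_eq (by ring)))
  refine Finset.sum_le_sum fun x _ => Finset.sum_le_sum fun y _ => Finset.sum_le_sum fun p hp => ?_
  rw [EE_disc hG (hs p hp).1.le (hs p hp).2.le, mul_div_right_comm]
  exact mul_le_of_le_one_left (mul_nonneg (div_nonneg (hc _) (DyadicRect.area_pos _).le)
    (sq_nonneg _)) (ind_le_one _)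

/-- The Carleson condition for the paraproduct with a symbol in LMO. -/
lemma RectBMO.sum_mul_sq_le {κ Λ : ℝ} {G : DyadicRect → ℝ} (hG : RectBMO κ G) (hΛ : 0 ≤ Λ)
    {c : DyadicRect → ℝ} (hc : ∀ R, 0 ≤ c R)
    (htail : ∀ k : ℕ × ℕ, SeqCarl (tailSeq k c) (Λ / ((k.1 + 1) * (k.2 + 1)) ^ 2))
    {E : Set (ℝ × ℝ)} (hE : volume E < ∞) {𝓖 : Finset DyadicRect} (h𝓖 : ∀ R ∈ 𝓖, UnitRect N R)
    (h𝓖E : ∀ R ∈ 𝓖, R.toSet ⊆ E) :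
    ∑ R ∈ 𝓖, c R * G R ^ 2 ≤ 2 ^ 38 * Λ * κ ^ 2 * (volume E).toReal := by
  have hN : (tree N).depth ≤ N := le_of_eq (depth_tree N)
  have hs : ∀ p ∈ Finset.range N ×ˢ Finset.range N, p.1 < N ∧ p.2 < N := fun p hp => by
    rw [Finset.mem_product, Finset.mem_range, Finset.mem_range] at hp; exact hp
  have h0 : ∀ k₁ k₂ : ℕ, Carl (tree N) (tree N)
      ((Finset.range N ×ˢ Finset.range N).filter fun p => k₁ ≤ p.1 ∧ k₂ ≤ p.2)
      (Λ / ((k₁ + 1) * (k₂ + 1)) ^ 2)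
      fun i j x y => c (nodes 0 x y i j) / (nodes 0 x y i j).area := fun k₁ k₂ =>
    carl_tail (k := (k₁, k₂)) hc (htail (k₁, k₂))
  have hν : ∀ (i j : ℕ) (x y : Fin N → Bool), 0 ≤ c (nodes 0 x y i j) / (nodes 0 x y i j).area :=
    fun i j x y => div_nonneg (hc _) (DyadicRect.area_pos _).le
  have h1 := sum_mul_EE_sq_le hN hN (hG.bmoData N) (fun p hp => ⟨(hs p hp).1.le, (hs p hp).2.le⟩)
    hΛ hν h0 (leavesIn 0 N E)
  refine (sum_le_of_subset (r := 0) (c := fun R => c R * G R ^ 2)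
    (fun R => mul_nonneg (hc R) (sq_nonneg _)) h𝓖E fun R hR => (h𝓖 R hR).exists_nodes).trans ?_
  have hsize := size_leavesIn_le (r := 0) (N := N) hE
  have h3 : leafArea 0 N * (2 ^ 38 * Λ * κ ^ 2 * size (leavesIn 0 N E))
      ≤ 2 ^ 38 * Λ * κ ^ 2 * (volume E).toReal := by
    rw [mul_left_comm, mul_comm (leafArea 0 N)]
    exact mul_le_mul_of_nonneg_left hsize (mul_nonneg (mul_nonneg (by positivity) hΛ) (sq_nonneg κ))
  refine le_trans (mul_le_mul_of_nonneg_left ?_ (leafArea_pos 0 N).le) h3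
  refine le_trans (le_of_eq ?_) h1
  refine Finset.sum_congr rfl fun x _ => Finset.sum_congr rfl fun y _ =>
    Finset.sum_congr rfl fun p hp => ?_
  rw [EE_disc hG.mart (hs p hp).1.le (hs p hp).2.le, mul_div_right_comm]

end

end DyadicParaproduct

/-! ### The mixed estimate in the plane, exchange of variables, functions with small support. -/

namespace DyadicParaproduct

noncomputable section

open CellFiltration DyadicInterval

variable {N : ℕ}

/-- The estimate for the paraproduct of mixed type. -/
lemma RectBMO.sum_mul_abs_mul_abs_le {κ Λ : ℝ} {G : DyadicRect → ℝ} (hG : RectBMO κ G) (hΛ : 0 ≤ Λ)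
    {n : DyadicRect → ℝ} (hn : ∀ R, 0 ≤ n R)
    (htail : ∀ k : ℕ, SeqCarl (tailSeq (k, 0) fun R => n R ^ 2) (Λ ^ 2 / (k + 1) ^ 2))
    {F : DyadicRect → ℝ} (hF : BiMart F) {E : Set (ℝ × ℝ)} (hE : volume E < ∞)
    {𝓖 : Finset DyadicRect} (h𝓖 : ∀ R ∈ 𝓖, UnitRect N R) (h𝓖E : ∀ R ∈ 𝓖, R.toSet ⊆ E) :
    ∑ R ∈ 𝓖, n R * (√R.area * (|dif2 G R| * |dif1 F R|))
      ≤ 2 ^ 19 * Λ * κ * √(leafArea 0 N * ∑ x, ∑ y, disc 0 N F x y ^ 2) * √(volume E).toReal := by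
  have hN : (tree N).depth ≤ N := le_of_eq (depth_tree N)
  have hs : ∀ p ∈ Finset.range N ×ˢ Finset.range N, p.1 < N ∧ p.2 < N := fun p hp => by
    rw [Finset.mem_product, Finset.mem_range, Finset.mem_range] at hp; exact hp
  have h0 : ∀ k : ℕ, Carl (tree N) (tree N)
      ((Finset.range N ×ˢ Finset.range N).filter fun p => k ≤ p.1) (Λ ^ 2 / (k + 1) ^ 2)
      fun i j x y => (n (nodes 0 x y i j) / √(nodes 0 x y i j).area) ^ 2 := fun k => by
    have h := carl_tail (N := N) (k := (k, 0)) (fun R => sq_nonneg (n R)) (htail k)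
    simp only [zero_le, and_true] at h
    -- The discrete density is the coefficient divided by the square root of the area, so that its
    -- square is the Carleson density.
    simpa only [div_pow, Real.sq_sqrt (DyadicRect.area_pos _).le] using h
  have h1 := CellFiltration.sum_mul_abs_mul_abs_le hN hN (dyadic_tree N) (dyadic_tree N)
    (hG.bmoData N) hs hΛ (fun i j x y => div_nonneg (hn _) (Real.sqrt_nonneg _)) h0 (disc 0 N F)
    (leavesIn 0 N E)
  refine (sum_le_of_subset (r := 0)
    (c := fun R => n R * (√R.area * (|dif2 G R| * |dif1 F R|)))
    (fun R => mul_nonneg (hn R) (mul_nonneg (Real.sqrt_nonneg _) (by positivity))) h𝓖E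
    fun R hR => (h𝓖 R hR).exists_nodes).trans ?_
  have hsize := size_leavesIn_le (r := 0) (N := N) hE
  set S := ∑ x, ∑ y, disc 0 N F x y ^ 2 with hS
  have hL := (leafArea_pos 0 N).le
  have h3 : leafArea 0 N * (2 ^ 19 * Λ * κ * √S * √(size (leavesIn 0 N E)))
      ≤ 2 ^ 19 * Λ * κ * √(leafArea 0 N * S) * √(volume E).toReal := by
    have e : leafArea 0 N * (2 ^ 19 * Λ * κ * √S * √(size (leavesIn 0 N E)))
        = 2 ^ 19 * Λ * κ * √(leafArea 0 N * S) * √(size (leavesIn 0 N E) * leafArea 0 N) := by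
      rw [Real.sqrt_mul hL, Real.sqrt_mul (size_nonneg _)]
      linear_combination (-(2 ^ 19 * Λ * κ * √S * √(size (leavesIn 0 N E)))) * Real.mul_self_sqrt hL
    rw [e]
    exact mul_le_mul_of_nonneg_left (Real.sqrt_le_sqrt hsize) (mul_nonneg (mul_nonneg
      (mul_nonneg (by positivity) hΛ) hG.nonneg) (Real.sqrt_nonneg _))
  refine le_trans (mul_le_mul_of_nonneg_left ?_ hL) h3
  refine le_trans (le_of_eq ?_) h1
  refine Finset.sum_congr rfl fun x _ => Finset.sum_congr rfl fun y _ =>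
    Finset.sum_congr rfl fun p hp => ?_
  rw [abs_E1_D2_disc hG.mart (hs p hp).1.le (hs p hp).2,
    abs_D1_E2_disc hF (hs p hp).1 (hs p hp).2.le]
  congr 1
  have h5 := (nodes 0 x y p.1 p.2).area_pos
  have h6 := Real.sqrt_pos.mpr h5
  rw [div_eq_iff h5.ne']
  have h7 := Real.mul_self_sqrt h5.le
  set a := √(nodes 0 x y p.1 p.2).area with ha
  rw [← h7]
  field_simp

/-- Interchange of the two variables. -/
def swapRect (R : DyadicRect) : DyadicRect := (R.2, R.1)

lemma swapRect_injective : Function.Injective swapRect := fun _ _ h => Prod.swap_injective h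

lemma toSet_swapRect (R : DyadicRect) : (swapRect R).toSet = Prod.swap ⁻¹' R.toSet := by
  ext x; simp [swapRect, DyadicRect.toSet, and_comm]

lemma area_swapRect (R : DyadicRect) : (swapRect R).area = R.area := mul_comm _ _

lemma BiMart.swap {G : DyadicRect → ℝ} (h : BiMart G) : BiMart fun R => G (swapRect R) :=
  ⟨h.snd, h.fst⟩

lemma volume_swap_preimage (E : Set (ℝ × ℝ)) :
    volume (Prod.swap ⁻¹' E) = volume E :=
  MeasurePreserving.measure_preimage_equiv (f := (MeasurableEquiv.prodComm : ℝ × ℝ ≃ᵐ ℝ × ℝ))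
    Measure.measurePreserving_swap E

lemma SeqCarl.swap {c : DyadicRect → ℝ} {K : ℝ} (h : SeqCarl c K) :
    SeqCarl (fun R => c (swapRect R)) K := by
  classical
  intro E hE hv 𝓖 h𝓖
  have h1 := h (Prod.swap ⁻¹' E) (measurable_swap hE) (by rwa [volume_swap_preimage])
    (𝓖.image swapRect) fun R hR => by
      obtain ⟨S, hS, rfl⟩ := Finset.mem_image.mp hR
      rw [toSet_swapRect]
      exact Set.preimage_mono (h𝓖 S hS)
  rwa [volume_swap_preimage, Finset.sum_image fun _ _ _ _ h => swapRect_injective h] at h1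

lemma RectBMO.swap {K : ℝ} {G : DyadicRect → ℝ} (h : RectBMO K G) :
    RectBMO K fun R => G (swapRect R) where
  nonneg := h.nonneg
  mart := h.mart.swap
  carl := by
    convert h.carl.swap using 2 with R
    rw [area_swapRect]
    congr 2
    simp only [dif1, dif2, swapRect]
    ring
  snd := h.fst
  fst := h.snd
  root := h.root

lemma UnitRect.swap {R : DyadicRect} (h : UnitRect N R) : UnitRect N (swapRect R) := by
  refine ⟨?_, h.2.2, h.2.1⟩
  have := h.1
  rw [DyadicRect.subset_iff] at this ⊢
  exact this.symm

/-- The other mixed type follows from the first one after exchanging the variables in all data. -/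
lemma RectBMO.sum_mul_abs_mul_abs_le' {κ Λ : ℝ} {G : DyadicRect → ℝ} (hG : RectBMO κ G) (hΛ : 0 ≤ Λ)
    {n : DyadicRect → ℝ} (hn : ∀ R, 0 ≤ n R)
    (htail : ∀ k : ℕ, SeqCarl (tailSeq (0, k) fun R => n R ^ 2) (Λ ^ 2 / (k + 1) ^ 2))
    {F : DyadicRect → ℝ} (hF : BiMart F) {E : Set (ℝ × ℝ)} (hE : volume E < ∞)
    {𝓖 : Finset DyadicRect} (h𝓖 : ∀ R ∈ 𝓖, UnitRect N R) (h𝓖E : ∀ R ∈ 𝓖, R.toSet ⊆ E) :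
    ∑ R ∈ 𝓖, n R * (√R.area * (|dif1 G R| * |dif2 F R|))
      ≤ 2 ^ 19 * Λ * κ * √(leafArea 0 N * ∑ x, ∑ y, disc 0 N F x y ^ 2) * √(volume E).toReal := by
  classical
  have h := hG.swap.sum_mul_abs_mul_abs_le (N := N) (n := fun R => n (swapRect R)) hΛ
    (fun R => hn _) (fun k => by
      convert (htail k).swap using 2 with R
      simp only [tailSeq, swapRect, and_comm]) hF.swap
    (E := Prod.swap ⁻¹' E) (by rwa [volume_swap_preimage]) (𝓖 := 𝓖.image swapRect)
    (fun R hR => by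
      obtain ⟨S, hS, rfl⟩ := Finset.mem_image.mp hR
      exact (h𝓖 S hS).swap)
    (fun R hR => by
      obtain ⟨S, hS, rfl⟩ := Finset.mem_image.mp hR
      rw [toSet_swapRect]
      exact Set.preimage_mono (h𝓖E S hS))
  rw [volume_swap_preimage, Finset.sum_image fun _ _ _ _ h => swapRect_injective h,
    Finset.sum_comm] at h
  exact (Finset.sum_congr rfl fun R _ => by rw [area_swapRect]; rfl).trans_le h

lemma node_false (r : ℤ) {i : ℕ} (hi : i ≤ N) : node r (fun _ : Fin N => false) i = (r + i, 0) := by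
  induction i with
  | zero => simp [node]
  | succ i ih =>
    have h := node_succ (r := r) ⟨i, hi⟩ (fun _ : Fin N => false)
    rw [if_neg (by simp)] at h
    simp only at h
    rw [h, ih (by omega), leftHalf]
    push_cast
    simp [add_assoc]

/-- A function supported in a subset of the unit square is controlled by its Haar coefficients. -/
lemma sum_disc_sq_le {F : DyadicRect → ℝ} (hF : BiMart F) {K : ℝ} (hK : 0 ≤ K)
    (hc : SeqCarl (fun R => R.area * dif1 (dif2 F) R ^ 2) K) {E : Set (ℝ × ℝ)}
    (hE : E ⊆ DyadicRect.toSet ((0, 0), (0, 0))) (hN : 3 ≤ N)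
    (hsupp : ∀ x y : Fin N → Bool, F (nodes (-3) x y N N) ≠ 0 → (nodes (-3) x y N N).toSet ⊆ E) :
    leafArea (-3) N * ∑ x, ∑ y, disc (-3) N F x y ^ 2 ≤ 2 ^ 21 * K * (volume E).toReal := by
  have hd : (tree N).depth ≤ N := le_of_eq (depth_tree N)
  set x₀ : Fin N → Bool := fun _ => false with hx₀
  have hroot : node (-3) x₀ 3 = (0, 0) := by simpa using node_false (N := N) (-3) hN
  have hEv : volume E < ∞ := (measure_mono hE).trans_lt (DyadicRect.volume_toSet_lt_top _)
  -- The root has length 8 while the support lies over the unit interval, so its density 1/8 is the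
  -- one required for cells without a parent.
  have hX₀ : ∀ x, (tree N).E 0 (fun z => ind (z ∈ ((tree N).cell 3 x₀ : Set (Fin N → Bool)))) x
      ≤ 1 / 8 := fun x => by
    classical
    have e : (tree N).cell 0 x = Finset.univ := by
      ext z; simp only [Finset.mem_univ, iff_true, mem_cell_tree]; intro k hk; omega
    have e2 : ∑ z, ind (z ∈ ((tree N).cell 3 x₀ : Set (Fin N → Bool)))
        = ((tree N).cell 3 x₀).card := by
      simp only [ind, Finset.mem_coe, Finset.sum_boole]
      congr 2; ext; simp
    rw [CellFiltration.E, e, e2, card_cell_tree hN, ← e, card_cell_tree (Nat.zero_le N)]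
    have : (0 : ℝ) < 2 ^ N := by positivity
    rw [div_div_div_eq, div_le_div_iff₀ (by positivity) (by norm_num)]
    nlinarith
  have hmem : ∀ z : Fin N → Bool, ∀ t ∈ (node (-3) z N).toSet, t ∈ toSet (0, 0) →
      z ∈ ((tree N).cell 3 x₀ : Set (Fin N → Bool)) := fun z t ht ht0 => by
    rw [← hroot] at ht0
    obtain ⟨y, hy, hty⟩ := exists_leaf hN x₀ ht0
    rw [leaf_eq_of_mem ht hty]
    exact hy
  obtain ⟨B, hB, hw⟩ := sum_sq_le_of_support hd hd (doubling_tree N) (doubling_tree N)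
    (A := leavesIn (-3) N E) hX₀ hX₀ (fun z hz => by
      obtain ⟨p, hp⟩ := (nodes (-3) z.1 z.2 N N).toSet_nonempty
      have hp0 := hE (hz hp)
      exact ⟨hmem _ _ hp.1 hp0.1, hmem _ _ hp.2 hp0.2⟩) (disc (-3) N F) (fun x y hxy => by
        by_contra h0; exact hxy (hsupp x y h0))
  have hs : ∀ p ∈ Finset.range N ×ˢ Finset.range N, p.1 < N ∧ p.2 < N := fun p hp => by
    rw [Finset.mem_product, Finset.mem_range, Finset.mem_range] at hp; exact hp
  have h1 := carl_of_seqCarl (r := -3) (N := N)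
    (fun R => mul_nonneg R.area_pos.le (sq_nonneg _)) hc hs B
  have h2 : ∑ i ∈ Finset.range N, ∑ j ∈ Finset.range N, ∑ x, ∑ y,
      ind (Sub (tree N) (tree N) i j x y B) *
        D1 (tree N) (i + 1) (D2 (tree N) (j + 1) (disc (-3) N F)) x y ^ 2 ≤ K * size B := by
    refine le_trans (le_of_eq ?_) h1
    rw [← sum_sum_sum_comm, Finset.sum_product]
    refine Finset.sum_congr rfl fun i hi => Finset.sum_congr rfl fun j hj =>
      Finset.sum_congr rfl fun x _ => Finset.sum_congr rfl fun y _ => ?_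
    rw [← sq_abs, abs_D1_D2_disc hF (Finset.mem_range.mp hi) (Finset.mem_range.mp hj), sq_abs]
    dsimp only
    rw [mul_div_cancel_left₀ _ (DyadicRect.area_pos _).ne']
  have hsize := size_leavesIn_le (r := -3) (N := N) hEv
  have hL := leafArea_pos (-3) N
  calc leafArea (-3) N * ∑ x, ∑ y, disc (-3) N F x y ^ 2
      ≤ leafArea (-3) N * (2 * (K * size B)) :=
        mul_le_mul_of_nonneg_left (hw.trans (mul_le_mul_of_nonneg_left h2 (by norm_num))) hL.le
    _ ≤ leafArea (-3) N * (2 * (K * (2 ^ 20 * size (leavesIn (-3) N E)))) := by gcongr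
    _ = 2 ^ 21 * K * (size (leavesIn (-3) N E) * leafArea (-3) N) := by ring
    _ ≤ _ := mul_le_mul_of_nonneg_left hsize (by positivity)

end

end DyadicParaproduct

/-! ### Pairings with Haar functions expressed through means. -/

namespace DyadicParaproduct

noncomputable section

open CellFiltration DyadicInterval

variable {𝕜 : Type*} [RCLike 𝕜]

namespace DyadicRect

lemma measurable_haarType (e : Fin 2 × Fin 2) (R : DyadicRect) : Measurable (haarType e R) :=
  ((DyadicInterval.measurable_haarType _ _).comp measurable_fst).mul
    ((DyadicInterval.measurable_haarType _ _).comp measurable_snd)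

lemma haarType_eq_zero (e : Fin 2 × Fin 2) (R : DyadicRect) {x : ℝ × ℝ} (hx : x ∉ R.toSet) :
    haarType e R x = 0 := by
  rw [toSet, Set.mem_prod, not_and_or] at hx
  rcases hx with h | h
  · rw [haarType, DyadicInterval.haarType_eq_zero _ _ h, zero_mul]
  · rw [haarType, DyadicInterval.haarType_eq_zero _ _ h, mul_zero]

lemma exists_abs_haarType_le (e : Fin 2 × Fin 2) (R : DyadicRect) :
    ∃ C, ∀ x, |haarType e R x| ≤ C := by
  refine ⟨max (√R.1.length)⁻¹ R.1.length⁻¹ * max (√R.2.length)⁻¹ R.2.length⁻¹, fun x => ?_⟩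
  rw [haarType, abs_mul]
  exact mul_le_mul (abs_haarType_le _ _ _) (abs_haarType_le _ _ _) (abs_nonneg _)
    ((abs_nonneg _).trans (abs_haarType_le e.1 R.1 x.1))

end DyadicRect

/-- Integrability over dyadic rectangles. -/
def RectIntegrable (f : ℝ × ℝ → 𝕜) : Prop := ∀ R : DyadicRect, IntegrableOn f R.toSet

lemma RectIntegrable.of_memLp_restrict {f : ℝ × ℝ → 𝕜}
    (h : ∀ K : Set (ℝ × ℝ), IsCompact K → MemLp f 2 (volume.restrict K)) : RectIntegrable f := by
  intro R
  set K : Set (ℝ × ℝ) := Set.Icc (R.1.2 * R.1.length) ((R.1.2 + 1) * R.1.length) ×ˢ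
    Set.Icc (R.2.2 * R.2.length) ((R.2.2 + 1) * R.2.length) with hK
  have hc : IsCompact K := isCompact_Icc.prod isCompact_Icc
  have : IsFiniteMeasure (volume.restrict K) := ⟨by
    rw [Measure.restrict_apply_univ]; exact hc.measure_lt_top⟩
  have h1 : IntegrableOn f K := (h K hc).integrable (by norm_num)
  exact h1.mono_set (Set.prod_mono Set.Ico_subset_Icc_self Set.Ico_subset_Icc_self)

lemma MemBMO.rectIntegrable {f : ℝ × ℝ → 𝕜} (h : MemBMO f) : RectIntegrable f :=
  .of_memLp_restrict h.1

lemma RectIntegrable.of_memLp {f : ℝ × ℝ → 𝕜} (h : MemLp f 2 volume) : RectIntegrable f :=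
  .of_memLp_restrict fun _ _ => h.restrict _

lemma RectIntegrable.integrable_mul {f : ℝ × ℝ → 𝕜} (h : RectIntegrable f) (e : Fin 2 × Fin 2)
    (R : DyadicRect) : Integrable fun x => f x * ((R.haarType e x : ℝ) : 𝕜) := by
  obtain ⟨C, hC⟩ := R.exists_abs_haarType_le e
  have h1 : IntegrableOn (fun x => f x * ((R.haarType e x : ℝ) : 𝕜)) R.toSet :=
    Integrable.mul_bdd (c := C) (h R)
      (RCLike.measurable_ofReal.comp (R.measurable_haarType e)).aestronglyMeasurable
      (Filter.Eventually.of_forall fun x => by simpa using hC x)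
  exact (integrableOn_iff_integrable_of_support_subset fun x hx => by
    by_contra hn
    exact hx (by simp only [R.haarType_eq_zero e hn, RCLike.ofReal_zero, mul_zero])).mp h1

lemma pairing_one_fst {f : ℝ × ℝ → 𝕜} (h : RectIntegrable f) (e : Fin 2) (I J : DyadicInterval) :
    pairing (1, e) f (I, J) = (2⁻¹ : ℝ) •
      (pairing (1, e) f (I.leftHalf, J) + pairing (1, e) f (I.rightHalf, J)) := by
  simp only [pairing]
  rw [← integral_add (h.integrable_mul _ _) (h.integrable_mul _ _), ← integral_smul]
  congr 1; ext x
  simp only [DyadicRect.haarType]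
  rw [haarType_one_halves, RCLike.real_smul_eq_coe_mul]
  push_cast
  ring

lemma pairing_one_snd {f : ℝ × ℝ → 𝕜} (h : RectIntegrable f) (e : Fin 2) (I J : DyadicInterval) :
    pairing (e, 1) f (I, J) = (2⁻¹ : ℝ) •
      (pairing (e, 1) f (I, J.leftHalf) + pairing (e, 1) f (I, J.rightHalf)) := by
  simp only [pairing]
  rw [← integral_add (h.integrable_mul _ _) (h.integrable_mul _ _), ← integral_smul]
  congr 1; ext x
  simp only [DyadicRect.haarType]
  rw [haarType_one_halves, RCLike.real_smul_eq_coe_mul]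
  push_cast
  ring

lemma pairing_zero_fst {f : ℝ × ℝ → 𝕜} (h : RectIntegrable f) (e : Fin 2) (I J : DyadicInterval) :
    pairing (0, e) f (I, J) = (√I.length / 2) •
      (pairing (1, e) f (I.rightHalf, J) - pairing (1, e) f (I.leftHalf, J)) := by
  simp only [pairing]
  rw [← integral_sub (h.integrable_mul _ _) (h.integrable_mul _ _), ← integral_smul]
  congr 1; ext x
  simp only [DyadicRect.haarType]
  rw [haarType_zero_halves, RCLike.real_smul_eq_coe_mul]
  push_cast
  ring

lemma pairing_zero_snd {f : ℝ × ℝ → 𝕜} (h : RectIntegrable f) (e : Fin 2) (I J : DyadicInterval) :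
    pairing (e, 0) f (I, J) = (√J.length / 2) •
      (pairing (e, 1) f (I, J.rightHalf) - pairing (e, 1) f (I, J.leftHalf)) := by
  simp only [pairing]
  rw [← integral_sub (h.integrable_mul _ _) (h.integrable_mul _ _), ← integral_smul]
  congr 1; ext x
  simp only [DyadicRect.haarType]
  rw [haarType_zero_halves, RCLike.real_smul_eq_coe_mul]
  push_cast
  ring

/-- A real linear functional of the means over dyadic rectangles. -/
def means (ℓ : 𝕜 →L[ℝ] ℝ) (f : ℝ × ℝ → 𝕜) (R : DyadicRect) : ℝ := ℓ (pairing (1, 1) f R)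

lemma biMart_means (ℓ : 𝕜 →L[ℝ] ℝ) {f : ℝ × ℝ → 𝕜} (h : RectIntegrable f) :
    BiMart (means ℓ f) where
  fst J I := by
    simp only [means]
    rw [pairing_one_fst h, map_smul, map_add, smul_eq_mul]; ring
  snd I J := by
    simp only [means]
    rw [pairing_one_snd h, map_smul, map_add, smul_eq_mul]; ring

lemma map_pairing_zero_one (ℓ : 𝕜 →L[ℝ] ℝ) {f : ℝ × ℝ → 𝕜} (h : RectIntegrable f)
    (R : DyadicRect) : ℓ (pairing (0, 1) f R) = √R.1.length * dif1 (means ℓ f) R := by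
  rw [← Prod.mk.eta (p := R), pairing_zero_fst h, map_smul, map_sub, smul_eq_mul]
  simp only [dif1, means]
  ring

lemma map_pairing_one_zero (ℓ : 𝕜 →L[ℝ] ℝ) {f : ℝ × ℝ → 𝕜} (h : RectIntegrable f)
    (R : DyadicRect) : ℓ (pairing (1, 0) f R) = √R.2.length * dif2 (means ℓ f) R := by
  rw [← Prod.mk.eta (p := R), pairing_zero_snd h, map_smul, map_sub, smul_eq_mul]
  simp only [dif2, means]
  ring

/-- Composing with a real linear functional reduces real or complex values to the real-valued finite
model; the square root of the area is the normalization of the Haar function. -/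
lemma map_haarCoeff (ℓ : 𝕜 →L[ℝ] ℝ) {f : ℝ × ℝ → 𝕜} (h : RectIntegrable f)
    (R : DyadicRect) : ℓ (haarCoeff f R) = √R.area * dif1 (dif2 (means ℓ f)) R := by
  rw [haarCoeff, ← Prod.mk.eta (p := R), pairing_zero_fst h, map_smul, map_sub, smul_eq_mul,
    map_pairing_one_zero ℓ h, map_pairing_one_zero ℓ h, DyadicRect.area,
    Real.sqrt_mul R.1.length_pos.le]
  simp only [dif1]
  ring

lemma area_mul_sq_le (ℓ : 𝕜 →L[ℝ] ℝ) (hℓ : ∀ z, |ℓ z| ≤ ‖z‖) {f : ℝ × ℝ → 𝕜}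
    (h : RectIntegrable f) (R : DyadicRect) :
    R.area * dif1 (dif2 (means ℓ f)) R ^ 2 ≤ ‖haarCoeff f R‖ ^ 2 := by
  have h1 : R.area * dif1 (dif2 (means ℓ f)) R ^ 2 = |ℓ (haarCoeff f R)| ^ 2 := by
    rw [sq_abs, map_haarCoeff ℓ h, mul_pow, Real.sq_sqrt R.area_pos.le]
  rw [h1]
  exact pow_le_pow_left₀ (abs_nonneg _) (hℓ _) 2

lemma SeqCarl.mono {c d : DyadicRect → ℝ} {K : ℝ} (h : SeqCarl d K) (hcd : ∀ R, c R ≤ d R) :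
    SeqCarl c K := fun E hE hv 𝓖 h𝓖 =>
  (Finset.sum_le_sum fun R _ => hcd R).trans (h E hE hv 𝓖 h𝓖)

lemma SeqCarl.mono_const {c : DyadicRect → ℝ} {K L : ℝ} (h : SeqCarl c K) (hKL : K ≤ L) :
    SeqCarl c L := fun E hE hv 𝓖 h𝓖 =>
  (h E hE hv 𝓖 h𝓖).trans (mul_le_mul_of_nonneg_right hKL ENNReal.toReal_nonneg)

/-- A function supported in the unit square has vanishing pairings with rectangles disjoint from
its interior. -/
lemma pairing_eq_zero_of_disjoint {f : ℝ × ℝ → 𝕜} (hf : SupportedInUnitSquare f)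
    (e : Fin 2 × Fin 2) {R : DyadicRect}
    (h : ∀ x ∈ R.toSet, x ∉ DyadicRect.toSet ((0, 0), (0, 0))) : pairing e f R = 0 := by
  -- The closed square and the half-open dyadic one differ by a null set.
  have hnull : ∀ᵐ x : ℝ × ℝ, x.1 ≠ 1 ∧ x.2 ≠ 1 := by
    have h1 : ∀ᵐ s : ℝ, s ≠ 1 := by simp [ae_iff, measure_singleton]
    exact (Measure.quasiMeasurePreserving_fst.ae h1).and (Measure.quasiMeasurePreserving_snd.ae h1)
  refine integral_eq_zero_of_ae ?_
  filter_upwards [hf, hnull] with x hx hx1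
  by_cases hxR : x ∈ R.toSet
  · rw [hx, zero_mul]; rfl
    intro hsq
    refine h x hxR ?_
    simp only [DyadicRect.toSet, DyadicInterval.toSet, DyadicInterval.length, Set.mem_prod,
      Set.mem_Icc, Set.mem_Ico] at hsq ⊢
    norm_num
    exact ⟨⟨hsq.1.1, lt_of_le_of_ne hsq.1.2 hx1.1⟩, hsq.2.1, lt_of_le_of_ne hsq.2.2 hx1.2⟩
  · rw [R.haarType_eq_zero e hxR]; simp

lemma not_mem_both_unit {x : ℝ} (h : x ∈ toSet (0, 1)) : x ∉ toSet (0, 0) := by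
  rw [mem_toSet_iff] at *
  simp only [zpow_zero, mul_one] at *
  omega

/-- Membership in BMO gives the size conditions for the means. -/
lemma rectBMO_means (ℓ : 𝕜 →L[ℝ] ℝ) (hℓ : ∀ z, |ℓ z| ≤ ‖z‖) {b : ℝ × ℝ → 𝕜}
    (hb : RectIntegrable b) (hs : SupportedInUnitSquare b) {B : ℝ} (hB : 0 ≤ B)
    (hc : SeqCarl (fun R => ‖haarCoeff b R‖ ^ 2) (B ^ 2)) : RectBMO (4 * B) (means ℓ b) := by
  have hlen : DyadicInterval.length (-1, 0) = 2 := by simp [DyadicInterval.length]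
  -- The means over the neighbouring interval `[1, 2)` vanish by the support condition. Hence the
  -- Haar coefficients on `[0, 2)` already contain those of the averages over `[0, 1)`, and no
  -- separate hypothesis on them is needed.
  have hm1 : ∀ J, dif1 (dif2 (means ℓ b)) ((-1, 0), J) = - dif2 (means ℓ b) ((0, 0), J) / 2 := by
    intro J
    have h0 : ∀ K, means ℓ b ((0, 1), K) = 0 := fun K => by
      rw [means, pairing_eq_zero_of_disjoint hs _ fun x hx hx' => not_mem_both_unit hx.1 hx'.1,
        map_zero]
    simp only [dif1, dif2, DyadicInterval.rightHalf, DyadicInterval.leftHalf] at *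
    norm_num
    rw [h0, h0]; ring
  have hm2 : ∀ I, dif1 (dif2 (means ℓ b)) (I, (-1, 0)) = - dif1 (means ℓ b) (I, (0, 0)) / 2 := by
    intro I
    have h0 : ∀ K, means ℓ b (K, (0, 1)) = 0 := fun K => by
      rw [means, pairing_eq_zero_of_disjoint hs _ fun x hx hx' => not_mem_both_unit hx.2 hx'.2,
        map_zero]
    simp only [dif1, dif2, DyadicInterval.rightHalf, DyadicInterval.leftHalf] at *
    norm_num
    rw [h0, h0]; ring
  have hcarl : SeqCarl (fun R => R.area * dif1 (dif2 (means ℓ b)) R ^ 2) (B ^ 2) :=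
    hc.mono fun R => area_mul_sq_le ℓ hℓ hb R
  have hBB : B ^ 2 ≤ (4 * B) ^ 2 := by nlinarith [sq_nonneg B]
  refine ⟨by positivity, biMart_means ℓ hb, hcarl.mono_const hBB, ?_, ?_, ?_⟩
  · classical
    intro L 𝓙 h𝓙
    have h1 := hcarl (DyadicRect.toSet ((-1, 0), L)) (DyadicRect.measurableSet_toSet _)
      (DyadicRect.volume_toSet_lt_top _)
      (𝓙.image fun J => (((-1, 0), J) : DyadicRect)) fun R hR => by
        obtain ⟨J, hJ, rfl⟩ := Finset.mem_image.mp hR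
        exact Set.prod_mono subset_rfl (h𝓙 J hJ)
    rw [Finset.sum_image fun _ _ _ _ h => (Prod.mk.inj h).2, DyadicRect.toReal_volume_toSet,
      DyadicRect.area, hlen] at h1
    have h2 : ∑ J ∈ 𝓙, J.length * dif2 (means ℓ b) ((0, 0), J) ^ 2
        ≤ 2 * (B ^ 2 * (2 * L.length)) := by
      refine le_trans (le_of_eq ?_) (mul_le_mul_of_nonneg_left h1 (by norm_num))
      rw [Finset.mul_sum]
      exact Finset.sum_congr rfl fun J _ => by rw [hm1, DyadicRect.area, hlen]; ring
    refine h2.trans ?_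
    nlinarith [mul_nonneg (sq_nonneg B) L.length_pos.le]
  · classical
    intro L 𝓙 h𝓙
    have h1 := hcarl (DyadicRect.toSet (L, (-1, 0))) (DyadicRect.measurableSet_toSet _)
      (DyadicRect.volume_toSet_lt_top _)
      (𝓙.image fun J => ((J, (-1, 0)) : DyadicRect)) fun R hR => by
        obtain ⟨J, hJ, rfl⟩ := Finset.mem_image.mp hR
        exact Set.prod_mono (h𝓙 J hJ) subset_rfl
    rw [Finset.sum_image fun _ _ _ _ h => (Prod.mk.inj h).1, DyadicRect.toReal_volume_toSet,
      DyadicRect.area, hlen] at h1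
    have h2 : ∑ J ∈ 𝓙, J.length * dif1 (means ℓ b) (J, (0, 0)) ^ 2
        ≤ 2 * (B ^ 2 * (L.length * 2)) := by
      refine le_trans (le_of_eq ?_) (mul_le_mul_of_nonneg_left h1 (by norm_num))
      rw [Finset.mul_sum]
      exact Finset.sum_congr rfl fun J _ => by rw [hm2, DyadicRect.area, hlen]; ring
    refine h2.trans ?_
    nlinarith [mul_nonneg (sq_nonneg B) L.length_pos.le]
  · have h1 := hcarl (DyadicRect.toSet ((-1, 0), (-1, 0))) (DyadicRect.measurableSet_toSet _)
      (DyadicRect.volume_toSet_lt_top _) {((-1, 0), (-1, 0))} fun R hR => by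
        rw [Finset.mem_singleton.mp hR]
    rw [Finset.sum_singleton, DyadicRect.toReal_volume_toSet, DyadicRect.area, hlen, hm1] at h1
    have h3 : dif2 (means ℓ b) ((0, 0), (-1, 0)) = - means ℓ b ((0, 0), (0, 0)) / 2 := by
      have h0 : means ℓ b ((0, 0), (0, 1)) = 0 := by
        rw [means, pairing_eq_zero_of_disjoint hs _ fun x hx hx' => not_mem_both_unit hx.2 hx'.2,
          map_zero]
      simp only [dif2, DyadicInterval.rightHalf, DyadicInterval.leftHalf]
      norm_num
      rw [h0]
    rw [h3] at h1
    -- The second difference over the square of side 2 is a quarter of the mean `m`, so `4 * (m / 4)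
    -- ^ 2 ≤ 4 * B ^ 2`; this is the source of the factor 4.
    refine abs_le_of_sq_le_sq ?_ (by positivity)
    nlinarith

end

end DyadicParaproduct

/-! ### Haar functions in L², and the BMO norm as a Carleson condition. -/

namespace DyadicParaproduct

noncomputable section

open CellFiltration DyadicInterval

variable {𝕜 : Type*} [RCLike 𝕜]

lemma integral_ofReal_haarType_mul (e e' : Fin 2 × Fin 2) (S R : DyadicRect) :
    ∫ x, ((S.haarType e x : ℝ) : 𝕜) * ((R.haarType e' x : ℝ) : 𝕜)
      = ((ip e.1 S.1 e'.1 R.1 * ip e.2 S.2 e'.2 R.2 : ℝ) : 𝕜) := by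
  have h1 : ∀ x : ℝ × ℝ, ((S.haarType e x : ℝ) : 𝕜) * ((R.haarType e' x : ℝ) : 𝕜)
      = ((haarType e.1 S.1 x.1 * haarType e'.1 R.1 x.1 *
        (haarType e.2 S.2 x.2 * haarType e'.2 R.2 x.2) : ℝ) : 𝕜) := fun x => by
    simp only [DyadicRect.haarType]; push_cast; ring
  simp_rw [h1]
  rw [integral_ofReal, Measure.volume_eq_prod,
    integral_prod_mul (fun s => haarType e.1 S.1 s * haarType e'.1 R.1 s)
      (fun t => haarType e.2 S.2 t * haarType e'.2 R.2 t)]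
  rfl

lemma pairing_haarType (e e' : Fin 2 × Fin 2) (S R : DyadicRect) :
    pairing e' (fun x => ((S.haarType e x : ℝ) : 𝕜)) R
      = ((ip e.1 S.1 e'.1 R.1 * ip e.2 S.2 e'.2 R.2 : ℝ) : 𝕜) :=
  integral_ofReal_haarType_mul e e' S R

variable (𝕜) in
lemma memLp_haarType (e : Fin 2 × Fin 2) (S : DyadicRect) :
    MemLp (fun x => ((S.haarType e x : ℝ) : 𝕜)) 2 volume := by
  obtain ⟨C, hC⟩ := S.exists_abs_haarType_le e
  have h0 : (fun x => ((S.haarType e x : ℝ) : 𝕜))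
      = S.toSet.indicator fun x => ((S.haarType e x : ℝ) : 𝕜) := by
    symm
    rw [Set.indicator_eq_self]
    intro x hx
    by_contra hn
    exact hx (by simp only [S.haarType_eq_zero e hn, RCLike.ofReal_zero])
  rw [h0, memLp_indicator_iff_restrict S.measurableSet_toSet]
  have : IsFiniteMeasure (volume.restrict S.toSet) := ⟨by
    rw [Measure.restrict_apply_univ]; exact S.volume_toSet_lt_top⟩
  exact MemLp.of_bound (RCLike.measurable_ofReal.comp
    (S.measurable_haarType e)).aestronglyMeasurable C
      (Filter.Eventually.of_forall fun x => by simpa using hC x)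

variable (𝕜) in
/-- A Haar function as an element of `L²`. -/
def haarLp (e : Fin 2 × Fin 2) (S : DyadicRect) : Lp 𝕜 2 (volume : Measure (ℝ × ℝ)) :=
  (memLp_haarType 𝕜 e S).toLp _

lemma inner_haarLp (e : Fin 2 × Fin 2) (S : DyadicRect)
    (g : Lp 𝕜 2 (volume : Measure (ℝ × ℝ))) : inner 𝕜 (haarLp 𝕜 e S) g = pairing e g S := by
  rw [L2.inner_def, pairing]
  refine integral_congr_ae ?_
  filter_upwards [(memLp_haarType 𝕜 e S).coeFn_toLp] with x hx
  rw [haarLp, hx, RCLike.inner_apply, RCLike.conj_ofReal]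

lemma pairing_congr_ae {f g : ℝ × ℝ → 𝕜} (h : f =ᵐ[volume] g) (e : Fin 2 × Fin 2)
    (R : DyadicRect) : pairing e f R = pairing e g R := by
  refine integral_congr_ae ?_
  filter_upwards [h] with x hx
  rw [hx]

lemma inner_haarLp_haarLp (e e' : Fin 2 × Fin 2) (S R : DyadicRect) :
    inner 𝕜 (haarLp 𝕜 e S) (haarLp 𝕜 e' R)
      = ((ip e'.1 R.1 e.1 S.1 * ip e'.2 R.2 e.2 S.2 : ℝ) : 𝕜) := by
  rw [inner_haarLp, ← pairing_haarType]
  exact pairing_congr_ae (memLp_haarType 𝕜 e' R).coeFn_toLp _ _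

lemma orthonormal_haarLp : Orthonormal 𝕜 (haarLp 𝕜 (0, 0)) := by
  classical
  rw [orthonormal_iff_ite]
  intro S R
  rw [inner_haarLp_haarLp]
  split_ifs with h
  · rw [h, ip_zero_zero_self, ip_zero_zero_self]; simp
  · have : S.1 ≠ R.1 ∨ S.2 ≠ R.2 := by
      by_contra hn; push Not at hn; exact h (Prod.ext hn.1 hn.2)
    rcases this with h1 | h1
    · rw [ip_zero_zero_of_ne h1.symm]; simp
    · rw [ip_zero_zero_of_ne h1.symm (I := R.2)]; simp

/-- Riesz–Fischer theorem for the Haar functions. -/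
lemma exists_memLp_haarCoeff {γ : DyadicRect → 𝕜} (h : Summable fun Q => ‖γ Q‖ ^ 2) :
    ∃ g : ℝ × ℝ → 𝕜, MemLp g 2 volume ∧ ∀ Q, haarCoeff g Q = γ Q := by
  classical
  have hs : Summable fun Q => γ Q • haarLp 𝕜 (0, 0) Q := by
    have h1 := (orthonormal_haarLp (𝕜 := 𝕜)).orthogonalFamily.summable_iff_norm_sq_summable γ
    simp only [LinearIsometry.toSpanSingleton_apply] at h1
    exact h1.mpr h
  refine ⟨(∑' Q, γ Q • haarLp 𝕜 (0, 0) Q : Lp 𝕜 2 (volume : Measure (ℝ × ℝ))), Lp.memLp _,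
    fun Q => ?_⟩
  have h2 := hs.hasSum.mapL (innerSL 𝕜 (haarLp 𝕜 (0, 0) Q))
  have h3 : ∀ R, innerSL 𝕜 (haarLp 𝕜 (0, 0) Q) (γ R • haarLp 𝕜 (0, 0) R)
      = if R = Q then γ Q else 0 := fun R => by
    rw [innerSL_apply_apply, inner_smul_right, orthonormal_iff_ite.mp orthonormal_haarLp Q R]
    by_cases hRQ : R = Q
    · rw [if_pos hRQ, if_pos hRQ.symm, hRQ, mul_one]
    · rw [if_neg hRQ, if_neg (Ne.symm hRQ), mul_zero]
  simp only [h3] at h2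
  rw [haarCoeff, ← inner_haarLp, ← innerSL_apply_apply (𝕜 := 𝕜), h2.unique (hasSum_ite_eq Q (γ Q))]

/-- A finite Haar series. -/
def haarSum (𝓠 : Finset DyadicRect) (c : DyadicRect → 𝕜) (x : ℝ × ℝ) : 𝕜 :=
  ∑ Q ∈ 𝓠, c Q * ((Q.haarType (0, 0) x : ℝ) : 𝕜)

lemma memLp_haarSum (𝓠 : Finset DyadicRect) (c : DyadicRect → 𝕜) :
    MemLp (haarSum 𝓠 c) 2 volume :=
  memLp_finsetSum _ fun Q _ => (memLp_haarType 𝕜 (0, 0) Q).const_mul (c Q)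

lemma pairing_finset_sum {ι : Type*} {e' : Fin 2 × Fin 2} (s : Finset ι) (c : ι → 𝕜)
    (Q : ι → DyadicRect) (e : Fin 2 × Fin 2) (R : DyadicRect) :
    pairing e (fun x => ∑ i ∈ s, c i * (((Q i).haarType e' x : ℝ) : 𝕜)) R
      = ∑ i ∈ s, c i * ((ip e'.1 (Q i).1 e.1 R.1 * ip e'.2 (Q i).2 e.2 R.2 : ℝ) : 𝕜) := by
  simp only [pairing, Finset.sum_mul]
  have hi : ∀ i, Integrable fun x =>
      c i * (((Q i).haarType e' x : ℝ) : 𝕜) * ((R.haarType e x : ℝ) : 𝕜) := fun i =>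
    (RectIntegrable.of_memLp ((memLp_haarType 𝕜 e' (Q i)).const_mul (c i))).integrable_mul e R
  rw [integral_finsetSum _ fun i _ => hi i]
  refine Finset.sum_congr rfl fun i _ => ?_
  rw [← integral_ofReal_haarType_mul, ← integral_const_mul]
  simp only [mul_assoc]

lemma haarSum_toLp (𝓠 : Finset DyadicRect) (c : DyadicRect → 𝕜) :
    ∃ g : Lp 𝕜 2 (volume : Measure (ℝ × ℝ)), g =ᵐ[volume] haarSum 𝓠 c ∧
      ‖g‖ ^ 2 = ∑ Q ∈ 𝓠, ‖c Q‖ ^ 2 := by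
  refine ⟨∑ Q ∈ 𝓠, c Q • haarLp 𝕜 (0, 0) Q, ?_, ?_⟩
  · have h1 : ∀ Q ∈ 𝓠, (c Q • haarLp 𝕜 (0, 0) Q : Lp 𝕜 2 (volume : Measure (ℝ × ℝ)))
        =ᵐ[volume] fun x => c Q * ((Q.haarType (0, 0) x : ℝ) : 𝕜) := fun Q _ => by
      filter_upwards [Lp.coeFn_smul (c Q) (haarLp 𝕜 (0, 0) Q),
        (memLp_haarType 𝕜 (0, 0) Q).coeFn_toLp] with x hx hx2
      rw [hx, Pi.smul_apply, haarLp, hx2, smul_eq_mul]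
    have h2 : ∀ᵐ x, ∀ Q ∈ 𝓠, (c Q • haarLp 𝕜 (0, 0) Q : Lp 𝕜 2 (volume : Measure (ℝ × ℝ))) x
        = c Q * ((Q.haarType (0, 0) x : ℝ) : 𝕜) := (Finset.eventually_all 𝓠).mpr h1
    filter_upwards [Lp.coeFn_finsetSum 𝓠 fun Q => c Q • haarLp 𝕜 (0, 0) Q, h2] with x hx hx2
    rw [hx, Finset.sum_apply, haarSum]
    exact Finset.sum_congr rfl hx2
  · have h := (orthonormal_haarLp (𝕜 := 𝕜)).inner_sum c c 𝓠
    rw [inner_self_eq_norm_sq_to_K] at h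
    have h2 : ∀ Q, (starRingEnd 𝕜) (c Q) * c Q = ((‖c Q‖ ^ 2 : ℝ) : 𝕜) := fun Q => by
      rw [RCLike.conj_mul]; push_cast; rfl
    simp only [h2] at h
    exact_mod_cast h

/-- Bessel's inequality for the averages over the leaves. -/
lemma leafArea_mul_sum_disc_le (ℓ : 𝕜 →L[ℝ] ℝ) (hℓ : ∀ z, |ℓ z| ≤ ‖z‖) (r : ℤ) (N : ℕ)
    (𝓠 : Finset DyadicRect) (c : DyadicRect → 𝕜) :
    leafArea r N * ∑ x, ∑ y, disc r N (means ℓ (haarSum 𝓠 c)) x y ^ 2 ≤ ∑ Q ∈ 𝓠, ‖c Q‖ ^ 2 := by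
  classical
  obtain ⟨g, hg, hnorm⟩ := haarSum_toLp 𝓠 c
  rw [← hnorm]
  set s : ℝ := √(leafArea r N) with hs
  have hL := leafArea_pos r N
  have hss : s * s = leafArea r N := Real.mul_self_sqrt hL.le
  -- The normalized indicators of the leaves are disjointly supported, and multiplication by the
  -- square root of the leaf area gives them norm one.
  have ho : Orthonormal 𝕜 fun z : (Fin N → Bool) × (Fin N → Bool) =>
      (s : 𝕜) • haarLp 𝕜 (1, 1) (nodes r z.1 z.2 N N) := by
    rw [orthonormal_iff_ite]
    rintro ⟨x, y⟩ ⟨x', y'⟩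
    rw [inner_smul_left, inner_smul_right, inner_haarLp_haarLp, RCLike.conj_ofReal]
    have hle : ∀ u v : Fin N → Bool, (node r u N).1 ≤ (node r v N).1 := fun u v =>
      ((gen_node le_rfl u).trans (gen_node le_rfl v).symm).le
    have hne : ∀ u v : Fin N → Bool, u ≠ v → ip 1 (node r v N) 1 (node r u N) = 0 := by
      intro u v huv
      by_contra h0
      have h1 := ip_one_one_ne_zero (hle u v) h0
      exact huv (leaf_eq_of_mem (h1 (node r v N).toSet_nonempty) (node r v N).toSet_nonempty)
    split_ifs with h
    · cases h
      simp only [nodes]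
      rw [ip_one_one_of_subset subset_rfl, ip_one_one_of_subset subset_rfl]
      have h3 := area_leaf (r := r) x y
      rw [DyadicRect.area] at h3
      simp only [nodes] at h3
      have h4 : s * (s * ((node r x N).length⁻¹ * (node r y N).length⁻¹)) = 1 := by
        rw [← mul_assoc, hss, ← h3, ← mul_inv, mul_inv_cancel₀]
        rw [h3]; exact hL.ne'
      exact_mod_cast congrArg (fun t : ℝ => (t : 𝕜)) h4
    · have : x ≠ x' ∨ y ≠ y' := by
        by_contra hn; push Not at hn; exact h (Prod.ext hn.1 hn.2)
      simp only [nodes]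
      rcases this with h1 | h1
      · rw [hne x x' h1]; simp
      · rw [hne y y' h1]; simp
  have hB := ho.sum_inner_products_le (x := g) (s := Finset.univ)
  refine le_trans ?_ hB
  rw [← Finset.univ_product_univ, Finset.sum_product, Finset.mul_sum]
  refine Finset.sum_le_sum fun x _ => ?_
  rw [Finset.mul_sum]
  refine Finset.sum_le_sum fun y _ => ?_
  rw [inner_smul_left, inner_haarLp, norm_mul, mul_pow, RCLike.conj_ofReal, RCLike.norm_ofReal,
    sq_abs, sq s, hss, pairing_congr_ae hg]
  refine mul_le_mul_of_nonneg_left ?_ hL.le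
  rw [disc, means, ← sq_abs]
  exact pow_le_pow_left₀ (abs_nonneg _) (hℓ _) 2

/-- Outer regularity extends the condition from open sets to measurable sets of finite measure. -/
lemma seqCarl_of_seqBMONorm_le {c : DyadicRect → 𝕜} {K : ℝ≥0} (h : seqBMONorm c ≤ K) :
    SeqCarl (fun R => ‖c R‖ ^ 2) ((K : ℝ) ^ 2) := by
  classical
  intro E hE hv 𝓖 h𝓖
  rcases 𝓖.eq_empty_or_nonempty with rfl | ⟨R₀, hR₀⟩
  · simp only [Finset.sum_empty]; positivity
  have key : ∀ ε : ℝ≥0, 0 < ε → ∑ R ∈ 𝓖, ‖c R‖ₑ ^ 2 ≤ (K : ℝ≥0∞) ^ 2 * (volume E + ε) := by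
    intro ε hε
    obtain ⟨Ω, hEΩ, hΩ, hvΩ⟩ := E.exists_isOpen_le_add volume
      (ε := ε) (by exact_mod_cast hε.ne')
    have hΩt : volume Ω < ∞ := hvΩ.trans_lt (ENNReal.add_lt_top.mpr ⟨hv, ENNReal.coe_lt_top⟩)
    have hΩ0 : 0 < volume Ω := by
      refine lt_of_lt_of_le ?_ (measure_mono ((h𝓖 R₀ hR₀).trans hEΩ))
      rw [DyadicRect.volume_toSet]
      exact ENNReal.ofReal_pos.mpr R₀.area_pos
    have h1 : (volume Ω)⁻¹ * ∑' R : {R : DyadicRect // R.toSet ⊆ Ω}, ‖c R.1‖ₑ ^ 2 ≤ (K : ℝ≥0∞) ^ 2 := by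
      have h2 : (seqBMONorm c) ^ 2 ≤ (K : ℝ≥0∞) ^ 2 := pow_le_pow_left' h 2
      rw [seqBMONorm, ← ENNReal.rpow_natCast, ← ENNReal.rpow_mul] at h2
      norm_num at h2
      exact h2 Ω hΩ hΩ0 hΩt
    rw [mul_comm, ← div_eq_mul_inv, ENNReal.div_le_iff hΩ0.ne' hΩt.ne] at h1
    calc ∑ R ∈ 𝓖, ‖c R‖ₑ ^ 2
        = ∑ R ∈ 𝓖.subtype (fun R => R.toSet ⊆ Ω), ‖c R.1‖ₑ ^ 2 := by
          rw [Finset.sum_subtype_eq_sum_filter (f := fun R => ‖c R‖ₑ ^ 2), Finset.filter_true_of_mem]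
          exact fun R hR => (h𝓖 R hR).trans hEΩ
      _ ≤ _ := ENNReal.sum_le_tsum _
      _ ≤ _ := h1
      _ ≤ _ := by gcongr
  have h2 : ∑ R ∈ 𝓖, ‖c R‖ₑ ^ 2 ≤ (K : ℝ≥0∞) ^ 2 * volume E := by
    refine ENNReal.le_of_forall_pos_le_add fun ε hε _ => ?_
    have hK : 0 < K ^ 2 + 1 := by positivity
    -- The excess measure is chosen so that `K ^ 2` times it is at most `ε`; the added 1 covers `K =
    -- 0`.
    refine (key (ε / (K ^ 2 + 1)) (by positivity)).trans ?_
    rw [mul_add]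
    gcongr
    have : K ^ 2 * (ε / (K ^ 2 + 1)) ≤ ε := by
      rw [mul_div_assoc', div_le_iff₀ hK, mul_comm]
      exact mul_le_mul_of_nonneg_left (le_add_of_nonneg_right zero_le_one) ε.2
    exact_mod_cast this
  have h3 := ENNReal.toReal_mono (ENNReal.mul_ne_top (by finiteness) hv.ne) h2
  rw [ENNReal.toReal_mul, ENNReal.toReal_sum (fun _ _ => by finiteness)] at h3
  simpa using h3

lemma seqBMONorm_le_of_seqCarl {c : DyadicRect → 𝕜} {K : ℝ≥0}
    (h : SeqCarl (fun R => ‖c R‖ ^ 2) ((K : ℝ) ^ 2)) : seqBMONorm c ≤ K := by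
  classical
  have h1 : ∀ (Ω : Set (ℝ × ℝ)), IsOpen Ω → 0 < volume Ω → volume Ω < ∞ →
      (volume Ω)⁻¹ * ∑' R : {R : DyadicRect // R.toSet ⊆ Ω}, ‖c R.1‖ₑ ^ 2 ≤ (K : ℝ≥0∞) ^ 2 := by
    intro Ω hΩ h0 hv
    rw [mul_comm, ← div_eq_mul_inv, ENNReal.div_le_iff h0.ne' hv.ne, ENNReal.tsum_eq_iSup_sum]
    refine iSup_le fun s => ?_
    have h2 := h Ω hΩ.measurableSet hv (s.image Subtype.val) fun R hR => by
      obtain ⟨S, _, rfl⟩ := Finset.mem_image.mp hR; exact S.2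
    rw [Finset.sum_image fun _ _ _ _ h => Subtype.val_injective h] at h2
    rw [← ENNReal.toReal_le_toReal (ENNReal.sum_ne_top.mpr fun _ _ => by finiteness)
        (ENNReal.mul_ne_top (by finiteness) hv.ne),
      ENNReal.toReal_mul, ENNReal.toReal_sum (fun _ _ => by finiteness)]
    simpa using h2
  have h2 : (⨆ (Ω : Set (ℝ × ℝ)) (_ : IsOpen Ω) (_ : 0 < volume Ω) (_ : volume Ω < ∞),
    (volume Ω)⁻¹ * ∑' R : {R : DyadicRect // R.toSet ⊆ Ω}, ‖c R.1‖ₑ ^ 2) ≤ (K : ℝ≥0∞) ^ 2 :=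
    iSup_le fun Ω => iSup_le fun a => iSup_le fun b => iSup_le fun d => h1 Ω a b d
  rw [seqBMONorm]
  refine (ENNReal.rpow_le_rpow h2 (by norm_num)).trans (le_of_eq ?_)
  rw [← ENNReal.rpow_natCast, ← ENNReal.rpow_mul]
  norm_num

end

end DyadicParaproduct

/-! ### From a bilinear estimate to the paraproduct. -/

namespace DyadicParaproduct

noncomputable section

open CellFiltration DyadicInterval

variable {𝕜 : Type*} [RCLike 𝕜]

/-- The unit square. -/
abbrev unitRect : DyadicRect := ((0, 0), (0, 0))

lemma area_unitRect : unitRect.area = 1 := by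
  simp [DyadicRect.area, DyadicInterval.length]

lemma subset_or_disjoint_unit {I : DyadicInterval} (h : 0 ≤ I.1) :
    I.toSet ⊆ toSet (0, 0) ∨ ∀ x ∈ I.toSet, x ∉ toSet (0, 0) := by
  by_cases hx : ∃ x ∈ I.toSet, x ∈ toSet (0, 0)
  · obtain ⟨x, hxI, hx0⟩ := hx
    exact Or.inl (subset_of_mem h hx0 hxI)
  · push Not at hx; exact Or.inr hx

lemma haarType_zero_const_Icc {K : DyadicInterval} (hK : K.1 < 0) :
    ∃ c : ℝ, ∀ᵐ x : ℝ, x ∈ Set.Icc (0 : ℝ) 1 → haarType 0 K x = c := by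
  refine ⟨haarType 0 K 0, ?_⟩
  have h1 : ∀ᵐ s : ℝ, s ≠ 1 := by simp [ae_iff, measure_singleton]
  filter_upwards [h1] with x hx hx2
  have hu : ∀ y, 0 ≤ y → y < 1 → y ∈ toSet (0, 0) := fun y h0 h1 => by
    simp [toSet, DyadicInterval.length, h0, h1]
  exact haarType_zero_const (I := (0, 0)) hK (hu x hx2.1 (lt_of_le_of_ne hx2.2 hx))
    (hu 0 le_rfl one_pos)

/-- The Haar coefficients of a function in `L²₀` live on rectangles in the unit square. -/
lemma MemL20Unit.subset_of_haarCoeff_ne_zero {φ : ℝ × ℝ → 𝕜} (h : MemL20Unit φ) {R : DyadicRect}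
    (hR : haarCoeff φ R ≠ 0) : R.toSet ⊆ unitRect.toSet := by
  obtain ⟨h2, hs, hv1, hv2⟩ := h
  have hi := (RectIntegrable.of_memLp h2).integrable_mul (0, 0) R
  by_contra hn
  refine hR ?_
  -- On a side longer than 1 the Haar function is almost everywhere constant on the unit interval,
  -- and the vanishing integral of the function in that variable kills the coefficient.
  rcases lt_or_ge R.1.1 0 with hI | hI
  · obtain ⟨c, hc⟩ := haarType_zero_const_Icc hI
    rw [haarCoeff, pairing, Measure.volume_eq_prod, integral_prod_symm _ hi]
    refine integral_eq_zero_of_ae ?_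
    have hs' : ∀ᵐ t : ℝ, ∀ᵐ s : ℝ, (s, t) ∉ Set.Icc (0 : ℝ) 1 ×ˢ Set.Icc (0 : ℝ) 1 → φ (s, t) = 0 := by
      have := (Measure.measurePreserving_swap (μ := (volume : Measure ℝ))
        (ν := (volume : Measure ℝ))).quasiMeasurePreserving.ae hs
      exact Measure.ae_ae_of_ae_prod this
    filter_upwards [hs', hv2] with t ht ht2
    have e : ∀ᵐ s : ℝ, φ (s, t) * ((R.haarType (0, 0) (s, t) : ℝ) : 𝕜)
        = φ (s, t) * ((c * haarType 0 R.2 t : ℝ) : 𝕜) := by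
      filter_upwards [ht, hc] with s hs1 hs2
      by_cases hmem : (s, t) ∈ Set.Icc (0 : ℝ) 1 ×ˢ Set.Icc (0 : ℝ) 1
      · rw [DyadicRect.haarType, hs2 hmem.1]
      · rw [hs1 hmem, zero_mul, zero_mul]
    simp only [Pi.zero_apply]
    rw [integral_congr_ae e, integral_mul_const, ht2, zero_mul]
  rcases lt_or_ge R.2.1 0 with hJ | hJ
  · obtain ⟨c, hc⟩ := haarType_zero_const_Icc hJ
    rw [haarCoeff, pairing, Measure.volume_eq_prod, integral_prod _ hi]
    refine integral_eq_zero_of_ae ?_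
    have hs' : ∀ᵐ s : ℝ, ∀ᵐ t : ℝ, (s, t) ∉ Set.Icc (0 : ℝ) 1 ×ˢ Set.Icc (0 : ℝ) 1 → φ (s, t) = 0 :=
      Measure.ae_ae_of_ae_prod hs
    filter_upwards [hs', hv1] with s ht ht2
    have e : ∀ᵐ t : ℝ, φ (s, t) * ((R.haarType (0, 0) (s, t) : ℝ) : 𝕜)
        = φ (s, t) * ((haarType 0 R.1 s * c : ℝ) : 𝕜) := by
      filter_upwards [ht, hc] with t hs1 hs2
      by_cases hmem : (s, t) ∈ Set.Icc (0 : ℝ) 1 ×ˢ Set.Icc (0 : ℝ) 1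
      · rw [DyadicRect.haarType, hs2 hmem.2]
      · rw [hs1 hmem, zero_mul, zero_mul]
    simp only [Pi.zero_apply]
    rw [integral_congr_ae e, integral_mul_const, ht2, zero_mul]
  refine pairing_eq_zero_of_disjoint hs _ fun x hx hx' => ?_
  rcases subset_or_disjoint_unit hI with h1 | h1
  · rcases subset_or_disjoint_unit hJ with h3 | h3
    · exact hn (DyadicRect.subset_iff.mpr ⟨h1, h3⟩)
    · exact h3 _ hx.2 hx'.2
  · exact h1 _ hx.1 hx'.1

lemma exists_unitRect {𝓖 : Finset DyadicRect} (h : ∀ R ∈ 𝓖, R.toSet ⊆ unitRect.toSet) :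
    ∃ N, ∀ R ∈ 𝓖, UnitRect N R := by
  refine ⟨(𝓖.sup fun R => max R.1.1.toNat R.2.1.toNat) + 1, fun R hR => ⟨h R hR, ?_⟩⟩
  have := Finset.le_sup (f := fun R : DyadicRect => max R.1.1.toNat R.2.1.toNat) hR
  omega

lemma ip_zero_right_ne_zero {e : Fin 2} {I K : DyadicInterval} (h : ip e I 0 K ≠ 0) :
    I.toSet ⊆ K.toSet := by
  fin_cases e
  · rw [ip_zero_zero_ne_zero h]
  · exact (ip_one_zero_ne_zero h).2

lemma pairing_haarSum (𝓠 : Finset DyadicRect) (c : DyadicRect → 𝕜) (β : Fin 2 × Fin 2)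
    (R : DyadicRect) : pairing β (haarSum 𝓠 c) R
      = ∑ Q ∈ 𝓠, c Q * haarCoeff (fun x => ((R.haarType β x : ℝ) : 𝕜)) Q := by
  refine (pairing_finset_sum 𝓠 c (fun Q => Q) β R).trans (Finset.sum_congr rfl fun Q _ => ?_)
  rw [haarCoeff, pairing_haarType, ip_comm, ip_comm _ Q.2]

lemma le_sq_of_le_mul_sqrt {S a : ℝ} (hS : 0 ≤ S) (h : S ≤ a * √S) : S ≤ a ^ 2 := by
  rcases hS.eq_or_lt with h0 | h0
  · rw [← h0]; positivity
  · have h1 := Real.sqrt_pos.mpr h0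
    have h2 : √S ≤ a := by
      refine le_of_mul_le_mul_right ?_ h1
      rwa [Real.mul_self_sqrt hS]
    calc S = √S ^ 2 := (Real.sq_sqrt hS).symm
      _ ≤ a ^ 2 := pow_le_pow_left₀ h1.le h2 2

/-- A bilinear estimate implies the existence of the paraproduct and its bound. -/
lemma exists_isParaproduct {β : Fin 2 × Fin 2} {φ b : ℝ × ℝ → 𝕜} {M : ℝ≥0}
    (hφ : ∀ R, haarCoeff φ R ≠ 0 → R.toSet ⊆ unitRect.toSet)
    (h : ∀ E : Set (ℝ × ℝ), MeasurableSet E → volume E < ∞ → ∀ 𝓖 : Finset DyadicRect,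
      (∀ R ∈ 𝓖, R.toSet ⊆ E) → (∀ R ∈ 𝓖, R.toSet ⊆ unitRect.toSet) →
      ∀ (𝓠 : Finset DyadicRect) (c : DyadicRect → 𝕜),
      ∑ R ∈ 𝓖, ‖haarCoeff φ R‖ * ‖pairing (dualType β) b R‖ * ‖pairing β (haarSum 𝓠 c) R‖
        ≤ M * √(volume E).toReal * √(∑ Q ∈ 𝓠, ‖c Q‖ ^ 2)) :
    ∃ g : ℝ × ℝ → 𝕜, IsParaproduct β φ b g ∧ MemBMO g ∧ bmoNorm g ≤ M := by
  classical
  set a : DyadicRect → 𝕜 := fun R => haarCoeff φ R * pairing (dualType β) b R with ha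
  set p : DyadicRect → DyadicRect → 𝕜 := fun R Q =>
    haarCoeff (fun x => ((R.haarType β x : ℝ) : 𝕜)) Q with hp
  have hpsub : ∀ R Q, p R Q ≠ 0 → R.toSet ⊆ Q.toSet := fun R Q hRQ => by
    simp only [hp, haarCoeff] at hRQ
    rw [pairing_haarType] at hRQ
    have h1 : ip β.1 R.1 0 Q.1 * ip β.2 R.2 0 Q.2 ≠ 0 := fun h0 => hRQ (by rw [h0]; simp)
    exact DyadicRect.subset_iff.mpr ⟨ip_zero_right_ne_zero (left_ne_zero_of_mul h1),
      ip_zero_right_ne_zero (right_ne_zero_of_mul h1)⟩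
  have hasub : ∀ R, a R ≠ 0 → R.toSet ⊆ unitRect.toSet := fun R hR =>
    hφ R (left_ne_zero_of_mul hR)
  have key : ∀ E : Set (ℝ × ℝ), MeasurableSet E → volume E < ∞ → ∀ 𝓖 𝓠 : Finset DyadicRect,
      (∀ R ∈ 𝓖, ∀ Q ∈ 𝓠, a R ≠ 0 → p R Q ≠ 0 → R.toSet ⊆ E) → ∀ c : DyadicRect → 𝕜,
      ∑ R ∈ 𝓖, ‖a R‖ * ‖∑ Q ∈ 𝓠, c Q * p R Q‖
        ≤ M * √(volume E).toReal * √(∑ Q ∈ 𝓠, ‖c Q‖ ^ 2) := by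
    intro E hE hv 𝓖 𝓠 hsub c
    have hterm : ∀ R, ‖a R‖ * ‖∑ Q ∈ 𝓠, c Q * p R Q‖ ≠ 0 →
        a R ≠ 0 ∧ ∃ Q ∈ 𝓠, p R Q ≠ 0 := fun R hR => by
      refine ⟨norm_ne_zero_iff.mp (left_ne_zero_of_mul hR), ?_⟩
      obtain ⟨Q, hQ, hQ0⟩ := Finset.exists_ne_zero_of_sum_ne_zero
        (norm_ne_zero_iff.mp (right_ne_zero_of_mul hR))
      exact ⟨Q, hQ, right_ne_zero_of_mul hQ0⟩
    rw [← Finset.sum_filter_ne_zero]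
    refine le_trans (le_of_eq (Finset.sum_congr rfl fun R _ => ?_)) (h E hE hv
      (𝓖.filter fun R => ‖a R‖ * ‖∑ Q ∈ 𝓠, c Q * p R Q‖ ≠ 0) (fun R hR => ?_) (fun R hR => ?_) 𝓠 c)
    · rw [pairing_haarSum, ha, norm_mul]
    · rw [Finset.mem_filter] at hR
      obtain ⟨h1, Q, hQ, h2⟩ := hterm R hR.2
      exact hsub R hR.1 Q hQ h1 h2
    · exact hasub R (hterm R (Finset.mem_filter.mp hR).2).1
  -- Testing against a single Haar function bounds all partial sums of the moduli.
  have hsum : ∀ Q, Summable fun R => a R * p R Q := fun Q => by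
    refine Summable.of_norm (summable_of_sum_le (c := (M : ℝ)) (fun R => norm_nonneg _) fun 𝓖 => ?_)
    have h1 := key unitRect.toSet (DyadicRect.measurableSet_toSet _)
      (DyadicRect.volume_toSet_lt_top _) 𝓖 {Q} (fun R _ _ _ hR _ => hasub R hR) fun _ => 1
    rw [DyadicRect.toReal_volume_toSet, area_unitRect] at h1
    simpa using h1
  set γ : DyadicRect → 𝕜 := fun Q => ∑' R, a R * p R Q with hγ
  have hsq : ∀ E : Set (ℝ × ℝ), MeasurableSet E → volume E < ∞ → ∀ 𝓠 : Finset DyadicRect,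
      (∀ R, ∀ Q ∈ 𝓠, a R ≠ 0 → p R Q ≠ 0 → R.toSet ⊆ E) →
      ∑ Q ∈ 𝓠, ‖γ Q‖ ^ 2 ≤ (M : ℝ) ^ 2 * (volume E).toReal := by
    intro E hE hv 𝓠 hsub
    have hlim : Filter.Tendsto (fun 𝓖 : Finset DyadicRect => ∑ Q ∈ 𝓠, ‖∑ R ∈ 𝓖, a R * p R Q‖ ^ 2)
        Filter.atTop (nhds (∑ Q ∈ 𝓠, ‖γ Q‖ ^ 2)) :=
      tendsto_finsetSum _ fun Q _ => ((hsum Q).hasSum.norm).pow 2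
    refine le_of_tendsto' hlim fun 𝓖 => ?_
    set γ' : DyadicRect → 𝕜 := fun Q => ∑ R ∈ 𝓖, a R * p R Q with hγ'
    -- Duality: testing against the conjugates of the partial coefficients themselves gives their
    -- square sum on the left and its square root on the right.
    have h1 := key E hE hv 𝓖 𝓠 (fun R _ => hsub R) fun Q => (starRingEnd 𝕜) (γ' Q)
    simp only [RCLike.norm_conj] at h1
    have h2 : ((∑ Q ∈ 𝓠, ‖γ' Q‖ ^ 2 : ℝ) : 𝕜)
        = ∑ R ∈ 𝓖, a R * ∑ Q ∈ 𝓠, (starRingEnd 𝕜) (γ' Q) * p R Q := by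
      simp only [Finset.mul_sum]
      rw [Finset.sum_comm, RCLike.ofReal_sum]
      refine Finset.sum_congr rfl fun Q _ => ?_
      rw [RCLike.ofReal_pow, ← RCLike.conj_mul]
      conv_lhs => rw [hγ']
      simp only [Finset.mul_sum]
      exact Finset.sum_congr rfl fun R _ => by ring
    have h3 : ∑ Q ∈ 𝓠, ‖γ' Q‖ ^ 2
        ≤ ∑ R ∈ 𝓖, ‖a R‖ * ‖∑ Q ∈ 𝓠, (starRingEnd 𝕜) (γ' Q) * p R Q‖ := by
      have h0 : 0 ≤ ∑ Q ∈ 𝓠, ‖γ' Q‖ ^ 2 := Finset.sum_nonneg fun Q _ => sq_nonneg _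
      calc ∑ Q ∈ 𝓠, ‖γ' Q‖ ^ 2 = ‖((∑ Q ∈ 𝓠, ‖γ' Q‖ ^ 2 : ℝ) : 𝕜)‖ := by
            rw [RCLike.norm_ofReal, abs_of_nonneg h0]
        _ ≤ _ := by
            rw [h2]
            exact (norm_sum_le _ _).trans (le_of_eq (Finset.sum_congr rfl fun R _ => norm_mul _ _))
    refine (le_sq_of_le_mul_sqrt (Finset.sum_nonneg fun Q _ => sq_nonneg _) (h3.trans h1)).trans
      (le_of_eq ?_)
    rw [mul_pow, Real.sq_sqrt ENNReal.toReal_nonneg]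
  -- A rectangle `R` contributes to the coefficient at `Q` only if `R ⊆ Q`, so coefficients with `Q`
  -- in `E` involve only rectangles in `E`.
  have hcarl : SeqCarl (fun Q => ‖γ Q‖ ^ 2) ((M : ℝ) ^ 2) := fun E hE hv 𝓠 h𝓠 =>
    hsq E hE hv 𝓠 fun R Q hQ _ hp => (hpsub R Q hp).trans (h𝓠 Q hQ)
  have hγs : Summable fun Q => ‖γ Q‖ ^ 2 :=
    summable_of_sum_le (fun Q => sq_nonneg _) fun 𝓠 => hsq unitRect.toSet
      (DyadicRect.measurableSet_toSet _) (DyadicRect.volume_toSet_lt_top _) 𝓠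
      fun R _ _ hR _ => hasub R hR
  obtain ⟨g, hg, hgc⟩ := exists_memLp_haarCoeff hγs
  have hnorm : bmoNorm g ≤ M := by
    rw [bmoNorm, show haarCoeff g = γ from funext hgc]
    exact seqBMONorm_le_of_seqCarl hcarl
  refine ⟨g, ⟨hg, fun Q => ?_⟩, ⟨fun K _ => hg.restrict K, hnorm.trans_lt ENNReal.coe_lt_top⟩, hnorm⟩
  rw [hgc]
  exact (hsum Q).hasSum

end

end DyadicParaproduct

/-! ### The bilinear estimates of the four types and the upper bounds. -/

namespace DyadicParaproduct

noncomputable section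

open CellFiltration DyadicInterval

variable {𝕜 : Type*} [RCLike 𝕜]

lemma abs_reCLM_le (z : 𝕜) : |(RCLike.reCLM : 𝕜 →L[ℝ] ℝ) z| ≤ ‖z‖ := RCLike.abs_re_le_norm z

lemma abs_imCLM_le (z : 𝕜) : |(RCLike.imCLM : 𝕜 →L[ℝ] ℝ) z| ≤ ‖z‖ := RCLike.abs_im_le_norm z

lemma norm_pairing_sq (f : ℝ × ℝ → 𝕜) (R : DyadicRect) : ‖pairing (1, 1) f R‖ ^ 2
    = means RCLike.reCLM f R ^ 2 + means RCLike.imCLM f R ^ 2 := by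
  rw [RCLike.norm_sq_eq_def, means, means, RCLike.reCLM_apply, RCLike.imCLM_apply, sq, sq]

lemma norm_le_add (z : 𝕜) :
    ‖z‖ ≤ |(RCLike.reCLM : 𝕜 →L[ℝ] ℝ) z| + |(RCLike.imCLM : 𝕜 →L[ℝ] ℝ) z| := by
  refine abs_le_of_sq_le_sq' ?_ (by positivity) |>.2
  rw [RCLike.norm_sq_eq_def, RCLike.reCLM_apply, RCLike.imCLM_apply, add_sq, sq_abs, sq_abs]
  have : 0 ≤ |RCLike.re z| * |RCLike.im z| := by positivity
  nlinarith

lemma sum_norm_haarCoeff_haarSum_sq_le (𝓖 𝓠 : Finset DyadicRect) (c : DyadicRect → 𝕜) :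
    ∑ R ∈ 𝓖, ‖haarCoeff (haarSum 𝓠 c) R‖ ^ 2 ≤ ∑ Q ∈ 𝓠, ‖c Q‖ ^ 2 := by
  obtain ⟨g, hg, hnorm⟩ := haarSum_toLp 𝓠 c
  rw [← hnorm]
  refine le_trans (le_of_eq (Finset.sum_congr rfl fun R _ => ?_))
    ((orthonormal_haarLp (𝕜 := 𝕜)).sum_inner_products_le (x := g) (s := 𝓖))
  rw [inner_haarLp, pairing_congr_ae hg, haarCoeff]

section

variable {φ b : ℝ × ℝ → 𝕜} {B C : ℝ} {E : Set (ℝ × ℝ)} {𝓖 : Finset DyadicRect}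

/-- The bilinear estimate for the paraproduct of type `(0, 0)`. -/
lemma sum_zero_zero_le (hb : RectIntegrable b) (hs : SupportedInUnitSquare b) (hB : 0 ≤ B)
    (hbc : SeqCarl (fun R => ‖haarCoeff b R‖ ^ 2) (B ^ 2)) (hC : 0 ≤ C)
    (htail : ∀ k : ℕ × ℕ, SeqCarl (tailSeq k fun R => ‖haarCoeff φ R‖ ^ 2)
      (C ^ 2 / ((k.1 + 1) * (k.2 + 1)) ^ 2)) (hE : volume E < ∞)
    (h𝓖E : ∀ R ∈ 𝓖, R.toSet ⊆ E) (h𝓖 : ∀ R ∈ 𝓖, R.toSet ⊆ unitRect.toSet)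
    (𝓠 : Finset DyadicRect) (c : DyadicRect → 𝕜) :
    ∑ R ∈ 𝓖, ‖haarCoeff φ R‖ * ‖pairing (1, 1) b R‖ * ‖pairing (0, 0) (haarSum 𝓠 c) R‖
      ≤ 2 ^ 23 * C * B * √(volume E).toReal * √(∑ Q ∈ 𝓠, ‖c Q‖ ^ 2) := by
  obtain ⟨N, hN⟩ := exists_unitRect h𝓖
  have h1 : ∑ R ∈ 𝓖, (‖haarCoeff φ R‖ * ‖pairing (1, 1) b R‖) ^ 2
      ≤ (2 ^ 23 * C * B) ^ 2 * (volume E).toReal := by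
    have hre := (rectBMO_means RCLike.reCLM abs_reCLM_le hb hs hB hbc).sum_mul_sq_le
      (sq_nonneg C) (fun R => sq_nonneg _) htail hE hN h𝓖E
    have him := (rectBMO_means RCLike.imCLM abs_imCLM_le hb hs hB hbc).sum_mul_sq_le
      (sq_nonneg C) (fun R => sq_nonneg _) htail hE hN h𝓖E
    have e : ∑ R ∈ 𝓖, (‖haarCoeff φ R‖ * ‖pairing (1, 1) b R‖) ^ 2
        = ∑ R ∈ 𝓖, ‖haarCoeff φ R‖ ^ 2 * means RCLike.reCLM b R ^ 2
          + ∑ R ∈ 𝓖, ‖haarCoeff φ R‖ ^ 2 * means RCLike.imCLM b R ^ 2 := by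
      rw [← Finset.sum_add_distrib]
      exact Finset.sum_congr rfl fun R _ => by rw [mul_pow, norm_pairing_sq, mul_add]
    rw [e]
    -- The two parts together give `2 * 2 ^ 38 * 4 ^ 2 = 2 ^ 43`, which is below `(2 ^ 23) ^ 2`.
    refine (add_le_add hre him).trans ?_
    have : 0 ≤ (C * B) ^ 2 * (volume E).toReal := mul_nonneg (sq_nonneg _) ENNReal.toReal_nonneg
    nlinarith
  refine (Real.sum_mul_le_sqrt_mul_sqrt _ _ _).trans (mul_le_mul ?_
    (Real.sqrt_le_sqrt (sum_norm_haarCoeff_haarSum_sq_le _ _ _)) (Real.sqrt_nonneg _)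
      (by positivity))
  refine (Real.sqrt_le_sqrt h1).trans (le_of_eq ?_)
  rw [Real.sqrt_mul (sq_nonneg _), Real.sqrt_sq (by positivity)]

/-- The bilinear estimate for the paraproduct of type `(1, 1)`. -/
lemma sum_one_one_le (hB : 0 ≤ B)
    (hbc : SeqCarl (fun R => ‖haarCoeff b R‖ ^ 2) (B ^ 2)) (hC : 0 ≤ C)
    (hφ : SeqCarl (fun R => ‖haarCoeff φ R‖ ^ 2) (C ^ 2)) (hEm : MeasurableSet E)
    (hE : volume E < ∞)
    (h𝓖E : ∀ R ∈ 𝓖, R.toSet ⊆ E) (h𝓖 : ∀ R ∈ 𝓖, R.toSet ⊆ unitRect.toSet)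
    (𝓠 : Finset DyadicRect) (c : DyadicRect → 𝕜) :
    ∑ R ∈ 𝓖, ‖haarCoeff φ R‖ * ‖pairing (0, 0) b R‖ * ‖pairing (1, 1) (haarSum 𝓠 c) R‖
      ≤ 2 ^ 23 * C * B * √(volume E).toReal * √(∑ Q ∈ 𝓠, ‖c Q‖ ^ 2) := by
  obtain ⟨N, hN⟩ := exists_unitRect h𝓖
  have hv := RectIntegrable.of_memLp (memLp_haarSum 𝓠 c)
  set S := ∑ Q ∈ 𝓠, ‖c Q‖ ^ 2 with hS
  have hS0 : 0 ≤ S := Finset.sum_nonneg fun _ _ => sq_nonneg _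
  have h1 : ∑ R ∈ 𝓖, (‖haarCoeff φ R‖ * ‖pairing (1, 1) (haarSum 𝓠 c) R‖) ^ 2
      ≤ (2 ^ 23 * C) ^ 2 * S := by
    have hre := sum_mul_sq_le_of_seqCarl (fun R => sq_nonneg _) (sq_nonneg C) hφ
      (biMart_means RCLike.reCLM hv) hN
    have him := sum_mul_sq_le_of_seqCarl (fun R => sq_nonneg _) (sq_nonneg C) hφ
      (biMart_means RCLike.imCLM hv) hN
    have hre2 := leafArea_mul_sum_disc_le RCLike.reCLM abs_reCLM_le 0 N 𝓠 c
    have him2 := leafArea_mul_sum_disc_le RCLike.imCLM abs_imCLM_le 0 N 𝓠 c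
    have e : ∑ R ∈ 𝓖, (‖haarCoeff φ R‖ * ‖pairing (1, 1) (haarSum 𝓠 c) R‖) ^ 2
        = ∑ R ∈ 𝓖, ‖haarCoeff φ R‖ ^ 2 * means RCLike.reCLM (haarSum 𝓠 c) R ^ 2
          + ∑ R ∈ 𝓖, ‖haarCoeff φ R‖ ^ 2 * means RCLike.imCLM (haarSum 𝓠 c) R ^ 2 := by
      rw [← Finset.sum_add_distrib]
      exact Finset.sum_congr rfl fun R _ => by rw [mul_pow, norm_pairing_sq, mul_add]
    rw [e]
    refine (add_le_add (hre.trans (mul_le_mul_of_nonneg_left hre2 (by positivity)))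
      (him.trans (mul_le_mul_of_nonneg_left him2 (by positivity)))).trans ?_
    have : 0 ≤ C ^ 2 * S := mul_nonneg (sq_nonneg _) hS0
    rw [← hS]
    nlinarith
  -- The function `b` enters only through its Haar coefficients in `E`; the symbol is used as a
  -- Carleson family for the means of the test sum.
  have h2 := hbc E hEm hE 𝓖 h𝓖E
  have h3 : ∑ R ∈ 𝓖, ‖haarCoeff φ R‖ * ‖pairing (0, 0) b R‖ * ‖pairing (1, 1) (haarSum 𝓠 c) R‖
      ≤ √(∑ R ∈ 𝓖, (‖haarCoeff φ R‖ * ‖pairing (1, 1) (haarSum 𝓠 c) R‖) ^ 2) *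
        √(∑ R ∈ 𝓖, ‖haarCoeff b R‖ ^ 2) := by
    refine le_trans (le_of_eq (Finset.sum_congr rfl fun R _ => ?_))
      (Real.sum_mul_le_sqrt_mul_sqrt _ _ _)
    simp only [haarCoeff]; ring
  refine h3.trans ((mul_le_mul (Real.sqrt_le_sqrt h1) (Real.sqrt_le_sqrt h2) (Real.sqrt_nonneg _)
    (Real.sqrt_nonneg _)).trans (le_of_eq ?_))
  rw [Real.sqrt_mul (sq_nonneg _), Real.sqrt_mul (sq_nonneg _), Real.sqrt_sq (by positivity),
    Real.sqrt_sq hB]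
  ring

/-- A norm is at most the sum of the moduli of the real and imaginary parts, so the product of two
norms needs four real estimates. -/
lemma sum_mul_norm_mul_norm_le {ι : Type*} {s : Finset ι} {n : ι → ℝ} (hn : ∀ i ∈ s, 0 ≤ n i)
    {z w : ι → 𝕜} {T : ℝ}
    (h : ∀ ℓ ℓ' : 𝕜 →L[ℝ] ℝ, (∀ z, |ℓ z| ≤ ‖z‖) → (∀ z, |ℓ' z| ≤ ‖z‖) →
      ∑ i ∈ s, n i * (|ℓ (z i)| * |ℓ' (w i)|) ≤ T) :
    ∑ i ∈ s, n i * ‖z i‖ * ‖w i‖ ≤ 4 * T := by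
  have h1 := h RCLike.reCLM RCLike.reCLM abs_reCLM_le abs_reCLM_le
  have h2 := h RCLike.reCLM RCLike.imCLM abs_reCLM_le abs_imCLM_le
  have h3 := h RCLike.imCLM RCLike.reCLM abs_imCLM_le abs_reCLM_le
  have h4 := h RCLike.imCLM RCLike.imCLM abs_imCLM_le abs_imCLM_le
  have h5 : ∑ i ∈ s, n i * ‖z i‖ * ‖w i‖
      ≤ ∑ i ∈ s, n i * (|(RCLike.reCLM : 𝕜 →L[ℝ] ℝ) (z i)| * |(RCLike.reCLM : 𝕜 →L[ℝ] ℝ) (w i)|)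
      + ∑ i ∈ s, n i * (|(RCLike.reCLM : 𝕜 →L[ℝ] ℝ) (z i)| * |(RCLike.imCLM : 𝕜 →L[ℝ] ℝ) (w i)|)
      + ∑ i ∈ s, n i * (|(RCLike.imCLM : 𝕜 →L[ℝ] ℝ) (z i)| * |(RCLike.reCLM : 𝕜 →L[ℝ] ℝ) (w i)|)
      + ∑ i ∈ s, n i * (|(RCLike.imCLM : 𝕜 →L[ℝ] ℝ) (z i)| * |(RCLike.imCLM : 𝕜 →L[ℝ] ℝ) (w i)|) := by
    simp only [← Finset.sum_add_distrib]
    refine Finset.sum_le_sum fun i hi => ?_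
    rw [mul_assoc]
    refine (mul_le_mul_of_nonneg_left (mul_le_mul (norm_le_add (z i)) (norm_le_add (w i))
      (norm_nonneg _) (by positivity)) (hn i hi)).trans (le_of_eq (by ring))
  linarith

/-- The bilinear estimate for the paraproduct of type `(0, 1)`. -/
lemma sum_zero_one_le (hb : RectIntegrable b) (hs : SupportedInUnitSquare b) (hB : 0 ≤ B)
    (hbc : SeqCarl (fun R => ‖haarCoeff b R‖ ^ 2) (B ^ 2)) (hC : 0 ≤ C)
    (htail : ∀ k : ℕ, SeqCarl (tailSeq (k, 0) fun R => ‖haarCoeff φ R‖ ^ 2)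
      (C ^ 2 / (k + 1) ^ 2)) (hE : volume E < ∞)
    (h𝓖E : ∀ R ∈ 𝓖, R.toSet ⊆ E) (h𝓖 : ∀ R ∈ 𝓖, R.toSet ⊆ unitRect.toSet)
    (𝓠 : Finset DyadicRect) (c : DyadicRect → 𝕜) :
    ∑ R ∈ 𝓖, ‖haarCoeff φ R‖ * ‖pairing (1, 0) b R‖ * ‖pairing (0, 1) (haarSum 𝓠 c) R‖
      ≤ 2 ^ 23 * C * B * √(volume E).toReal * √(∑ Q ∈ 𝓠, ‖c Q‖ ^ 2) := by
  obtain ⟨N, hN⟩ := exists_unitRect h𝓖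
  have hv := RectIntegrable.of_memLp (memLp_haarSum 𝓠 c)
  set S := ∑ Q ∈ 𝓠, ‖c Q‖ ^ 2 with hS
  have key : ∀ ℓ ℓ' : 𝕜 →L[ℝ] ℝ, (∀ z, |ℓ z| ≤ ‖z‖) → (∀ z, |ℓ' z| ≤ ‖z‖) →
      ∑ R ∈ 𝓖, ‖haarCoeff φ R‖ * (|ℓ (pairing (1, 0) b R)| * |ℓ' (pairing (0, 1) (haarSum 𝓠 c) R)|)
        ≤ 2 ^ 21 * C * B * √(volume E).toReal * √S := by
    intro ℓ ℓ' hℓ hℓ'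
    have h1 := (rectBMO_means ℓ hℓ hb hs hB hbc).sum_mul_abs_mul_abs_le hC
      (fun R => norm_nonneg (haarCoeff φ R)) htail (biMart_means ℓ' hv) hE hN h𝓖E
    have h2 := Real.sqrt_le_sqrt (leafArea_mul_sum_disc_le ℓ' hℓ' 0 N 𝓠 c)
    refine le_trans (le_of_eq (Finset.sum_congr rfl fun R _ => ?_)) (h1.trans ?_)
    · rw [map_pairing_one_zero ℓ hb, map_pairing_zero_one ℓ' hv, abs_mul, abs_mul,
        abs_of_nonneg (Real.sqrt_nonneg _), abs_of_nonneg (Real.sqrt_nonneg _), DyadicRect.area,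
        Real.sqrt_mul R.1.length_pos.le]
      ring
    · calc _ ≤ 2 ^ 19 * C * (4 * B) * √S * √(volume E).toReal := by gcongr
        _ = _ := by ring
  refine (sum_mul_norm_mul_norm_le (fun R _ => norm_nonneg _) key).trans (le_of_eq ?_)
  ring

/-- The bilinear estimate for the paraproduct of type `(1, 0)`. -/
lemma sum_one_zero_le (hb : RectIntegrable b) (hs : SupportedInUnitSquare b) (hB : 0 ≤ B)
    (hbc : SeqCarl (fun R => ‖haarCoeff b R‖ ^ 2) (B ^ 2)) (hC : 0 ≤ C)
    (htail : ∀ k : ℕ, SeqCarl (tailSeq (0, k) fun R => ‖haarCoeff φ R‖ ^ 2)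
      (C ^ 2 / (k + 1) ^ 2)) (hE : volume E < ∞)
    (h𝓖E : ∀ R ∈ 𝓖, R.toSet ⊆ E) (h𝓖 : ∀ R ∈ 𝓖, R.toSet ⊆ unitRect.toSet)
    (𝓠 : Finset DyadicRect) (c : DyadicRect → 𝕜) :
    ∑ R ∈ 𝓖, ‖haarCoeff φ R‖ * ‖pairing (0, 1) b R‖ * ‖pairing (1, 0) (haarSum 𝓠 c) R‖
      ≤ 2 ^ 23 * C * B * √(volume E).toReal * √(∑ Q ∈ 𝓠, ‖c Q‖ ^ 2) := by
  obtain ⟨N, hN⟩ := exists_unitRect h𝓖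
  have hv := RectIntegrable.of_memLp (memLp_haarSum 𝓠 c)
  set S := ∑ Q ∈ 𝓠, ‖c Q‖ ^ 2 with hS
  have key : ∀ ℓ ℓ' : 𝕜 →L[ℝ] ℝ, (∀ z, |ℓ z| ≤ ‖z‖) → (∀ z, |ℓ' z| ≤ ‖z‖) →
      ∑ R ∈ 𝓖, ‖haarCoeff φ R‖ * (|ℓ (pairing (0, 1) b R)| * |ℓ' (pairing (1, 0) (haarSum 𝓠 c) R)|)
        ≤ 2 ^ 21 * C * B * √(volume E).toReal * √S := by
    intro ℓ ℓ' hℓ hℓ'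
    have h1 := (rectBMO_means ℓ hℓ hb hs hB hbc).sum_mul_abs_mul_abs_le' hC
      (fun R => norm_nonneg (haarCoeff φ R)) htail (biMart_means ℓ' hv) hE hN h𝓖E
    have h2 := Real.sqrt_le_sqrt (leafArea_mul_sum_disc_le ℓ' hℓ' 0 N 𝓠 c)
    refine le_trans (le_of_eq (Finset.sum_congr rfl fun R _ => ?_)) (h1.trans ?_)
    · rw [map_pairing_zero_one ℓ hb, map_pairing_one_zero ℓ' hv, abs_mul, abs_mul,
        abs_of_nonneg (Real.sqrt_nonneg _), abs_of_nonneg (Real.sqrt_nonneg _), DyadicRect.area,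
        Real.sqrt_mul R.1.length_pos.le]
      ring
    · calc _ ≤ 2 ^ 19 * C * (4 * B) * √S * √(volume E).toReal := by gcongr
        _ = _ := by ring
  refine (sum_mul_norm_mul_norm_le (fun R _ => norm_nonneg _) key).trans (le_of_eq ?_)
  ring

end

/-- The tail in both variables is part of the projection, which restricts the generations only in
the variables with `β_j = 0`. -/
lemma LMOBound.seqCarl_tailSeq {β : Fin 2 × Fin 2} {φ : ℝ × ℝ → 𝕜} {C : ℝ≥0}
    (h : LMOBound β φ C) (k : ℕ × ℕ) : SeqCarl (tailSeq k fun R => ‖haarCoeff φ R‖ ^ 2)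
      ((C / lmoWeight β k : ℝ≥0) ^ 2) := by
  refine (seqCarl_of_seqBMONorm_le (h k)).mono fun R => ?_
  by_cases hk : (k.1 : ℤ) ≤ R.1.1 ∧ (k.2 : ℤ) ≤ R.2.1
  · rw [tailSeq, ind_of hk, one_mul, projCoeff, if_pos ⟨fun _ => hk.1, fun _ => hk.2⟩]
  · rw [tailSeq, ind_of_not hk, zero_mul]; positivity

lemma lmoBound_one_one_iff {φ : ℝ × ℝ → 𝕜} {C : ℝ≥0} : LMOBound (1, 1) φ C ↔ bmoNorm φ ≤ C := by
  have h1 : ∀ k, projCoeff (1, 1) k φ = haarCoeff φ := fun k => by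
    ext R; simp [projCoeff]
  have h2 : ∀ k, lmoWeight (1, 1) k = 1 := fun k => by simp [lmoWeight]
  simp [LMOBound, h1, h2, bmoNorm]

/-- The upper bounds. -/
theorem LMOBound.paraproductBound {β : Fin 2 × Fin 2} {φ : ℝ × ℝ → 𝕜} (hφ : MemL20Unit φ)
    {C : ℝ≥0} (h : LMOBound β φ C) : ParaproductBound β φ (2 ^ 23 * C) := by
  intro b hb
  obtain ⟨B, hB⟩ : ∃ B : ℝ≥0, (B : ℝ≥0∞) = bmoNorm b := ⟨_, ENNReal.coe_toNNReal hb.1.2.ne⟩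
  rw [← hB, ← ENNReal.coe_mul]
  have hbc := seqCarl_of_seqBMONorm_le hB.symm.le
  have hbi := hb.1.rectIntegrable
  refine exists_isParaproduct (fun R => hφ.subset_of_haarCoeff_ne_zero)
    fun E hEm hE 𝓖 h𝓖E h𝓖 𝓠 c => ?_
  push_cast
  obtain ⟨β₁, β₂⟩ := β
  have ht := h.seqCarl_tailSeq
  fin_cases β₁ <;> fin_cases β₂
  · refine sum_zero_zero_le hbi hb.2 B.2 hbc C.2 (fun k => ?_) hE h𝓖E h𝓖 𝓠 c
    have := ht k
    simpa [lmoWeight, div_pow] using this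
  · refine sum_zero_one_le hbi hb.2 B.2 hbc C.2 (fun k => ?_) hE h𝓖E h𝓖 𝓠 c
    have := ht (k, 0)
    simpa [lmoWeight, div_pow] using this
  · refine sum_one_zero_le hbi hb.2 B.2 hbc C.2 (fun k => ?_) hE h𝓖E h𝓖 𝓠 c
    have := ht (0, k)
    simpa [lmoWeight, div_pow] using this
  · exact sum_one_one_le B.2 hbc C.2 (seqCarl_of_seqBMONorm_le (lmoBound_one_one_iff.mp h))
      hEm hE h𝓖E h𝓖 𝓠 c

end

end DyadicParaproduct

/-! ### Test functions and the necessity of the LMO condition. -/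

namespace DyadicParaproduct

noncomputable section

open CellFiltration DyadicInterval

variable {𝕜 : Type*} [RCLike 𝕜]

lemma sum_toReal_volume_le {ι : Type*} {s : Finset ι} {f : ι → Set (ℝ × ℝ)} {E : Set (ℝ × ℝ)}
    (hE : volume E < ∞) (hf : ∀ i ∈ s, MeasurableSet (f i)) (hsub : ∀ i ∈ s, f i ⊆ E)
    (hd : (s : Set ι).PairwiseDisjoint f) :
    ∑ i ∈ s, (volume (f i)).toReal ≤ (volume E).toReal := by
  rw [← ENNReal.toReal_sum fun i hi => ((measure_mono (hsub i hi)).trans_lt hE).ne,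
    ← measure_biUnion_finset hd hf]
  exact ENNReal.toReal_mono hE.ne (measure_mono (Set.iUnion₂_subset hsub))

namespace DyadicInterval

/-- The dyadic interval of generation `k` containing the left end point of `I`. -/
def anc (k : ℤ) (I : DyadicInterval) : DyadicInterval := (k, ⌊I.2 * I.length * 2 ^ k⌋)

lemma subset_anc {k : ℤ} {I : DyadicInterval} (h : k ≤ I.1) : I.toSet ⊆ (anc k I).toSet :=
  subset_of_mem (I := anc k I) h ((mem_toSet_iff _ _).mpr rfl) I.toSet_nonempty

lemma length_anc (k : ℕ) (I : DyadicInterval) : (anc k I).length = (2 ^ k)⁻¹ := by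
  rw [length, anc, zpow_neg, zpow_natCast]

/-- The half of `I` which does not contain `I₀`. -/
def sib (I₀ I : DyadicInterval) : DyadicInterval :=
  open Classical in if I₀.toSet ⊆ I.leftHalf.toSet then I.rightHalf else I.leftHalf

lemma gen_sib (I₀ I : DyadicInterval) : (sib I₀ I).1 = I.1 + 1 := by
  unfold sib; split_ifs <;> rfl

lemma length_sib (I₀ I : DyadicInterval) : (sib I₀ I).length = I.length / 2 := by
  unfold sib; split_ifs
  · exact length_rightHalf I
  · exact length_leftHalf I

lemma sib_subset (I₀ I : DyadicInterval) : (sib I₀ I).toSet ⊆ I.toSet := by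
  unfold sib; split_ifs
  · exact rightHalf_subset I
  · exact leftHalf_subset I

lemma not_subset_sib (I₀ I : DyadicInterval) : ¬ I₀.toSet ⊆ (sib I₀ I).toSet := by
  unfold sib; split_ifs with h
  · exact fun h' => I.not_mem_both _ ⟨h I₀.toSet_nonempty, h' I₀.toSet_nonempty⟩
  · exact h

/-- Two different ancestors of `I₀` are nested, and the smaller one lies in the half of the larger
one containing `I₀`, while the sibling is the other half. -/
lemma eq_of_mem_sib {I₀ I K : DyadicInterval} (hI : I₀.toSet ⊆ I.toSet) (hK : I₀.toSet ⊆ K.toSet)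
    {x : ℝ} (hxI : x ∈ (sib I₀ I).toSet) (hxK : x ∈ (sib I₀ K).toSet) : I = K := by
  rcases lt_trichotomy I.1 K.1 with h | h | h
  · refine absurd (hK.trans (subset_of_mem ?_ hxI (sib_subset _ _ hxK))) (not_subset_sib I₀ I)
    rw [gen_sib]; omega
  · exact eq_of_mem h (sib_subset _ _ hxI) (sib_subset _ _ hxK)
  · refine absurd (hI.trans (subset_of_mem ?_ hxK (sib_subset _ _ hxI))) (not_subset_sib I₀ K)
    rw [gen_sib]; omega

/-- The subtracted term makes the induction close. -/
lemma sum_ind_inv_two_pow_le (n : ℕ) (m : ℤ) (h : m + 1 ≤ n) :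
    ∑ j ∈ Finset.range n, ind (m < j) * ((2 : ℝ) ^ j)⁻¹ ≤ 2 ^ (-m) - 2 * (2 ^ n)⁻¹ := by
  induction n with
  | zero =>
    have : (2 : ℝ) ^ (1 : ℤ) ≤ 2 ^ (-m) := zpow_le_zpow_right₀ (by norm_num) (by push_cast at h; omega)
    simp at this ⊢
    linarith
  | succ n ih =>
    rcases eq_or_lt_of_le h with h1 | h1
    · rw [Finset.sum_eq_zero]
      · have : m = n := by push_cast at h1; omega
        rw [this, zpow_neg, zpow_natCast, pow_succ, mul_inv]
        linarith
      · intro j hj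
        rw [Finset.mem_range] at hj
        rw [ind_of_not (by push_cast at h1; omega), zero_mul]
    · rw [Finset.sum_range_succ]
      have h2 := ih (by push_cast at h1; omega)
      have h3 : ind (m < n) * ((2 : ℝ) ^ n)⁻¹ ≤ (2 ^ n)⁻¹ :=
        mul_le_of_le_one_left (by positivity) (ind_le_one _)
      rw [pow_succ, mul_inv]
      linarith

/-- The pairings of the sum of the indicators of the ancestors of generations `0, …, k` of `I₀`. -/
def stack (I₀ : DyadicInterval) (k : ℕ) (e : Fin 2) (I : DyadicInterval) : ℝ :=
  ∑ j ∈ Finset.range (k + 1), ((2 : ℝ) ^ j)⁻¹ * ip 1 (anc j I₀) e I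

lemma stack_one {I₀ I : DyadicInterval} {k : ℕ} (hk : I₀.1 = k) (h : I.toSet ⊆ I₀.toSet) :
    stack I₀ k 1 I = k + 1 := by
  have : ∀ j ∈ Finset.range (k + 1), ((2 : ℝ) ^ j)⁻¹ * ip 1 (anc j I₀) 1 I = 1 := fun j hj => by
    rw [Finset.mem_range] at hj
    rw [ip_comm, ip_one_one_of_subset (h.trans (subset_anc (by rw [hk]; omega))), length_anc,
      inv_inv, inv_mul_cancel₀ (by positivity)]
  rw [stack, Finset.sum_congr rfl this]
  simp

lemma subset_of_stack_ne_zero {I₀ I : DyadicInterval} {k : ℕ} (hk : I₀.1 = k)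
    (h : stack I₀ k 0 I ≠ 0) : I₀.toSet ⊆ I.toSet := by
  obtain ⟨j, hj, h1⟩ := Finset.exists_ne_zero_of_sum_ne_zero h
  rw [Finset.mem_range] at hj
  exact (subset_anc (by rw [hk]; omega)).trans (ip_one_zero_ne_zero (right_ne_zero_of_mul h1)).2

/-- Only ancestors strictly finer than `I` contribute, each at most its length divided by the square
root of the length of `I`. The lengths form a geometric series with sum at most the length of `I`.
-/
lemma stack_zero_sq_le (I₀ I : DyadicInterval) (k : ℕ) : stack I₀ k 0 I ^ 2 ≤ I.length := by
  have h1 : |stack I₀ k 0 I| ≤ (∑ j ∈ Finset.range (k + 1), ind (I.1 < j) * ((2 : ℝ) ^ j)⁻¹)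
      * (√I.length)⁻¹ := by
    rw [stack, Finset.sum_mul]
    refine (Finset.abs_sum_le_sum_abs _ _).trans (Finset.sum_le_sum fun j _ => ?_)
    by_cases h : ip 1 (anc j I₀) 0 I = 0
    · rw [h, mul_zero, abs_zero]
      exact mul_nonneg (mul_nonneg (ind_nonneg _) (by positivity)) (by positivity)
    · have h2 := (ip_one_zero_ne_zero h).1
      simp only [anc] at h2
      rw [ind_of h2, one_mul, abs_mul, abs_of_pos (by positivity)]
      exact mul_le_mul_of_nonneg_left (abs_ip_one_zero_le _ _) (by positivity)
  have h2 : ∑ j ∈ Finset.range (k + 1), ind (I.1 < j) * ((2 : ℝ) ^ j)⁻¹ ≤ I.length := by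
    rcases le_or_gt (I.1 + 1) (k + 1 : ℕ) with h | h
    · refine (sum_ind_inv_two_pow_le (k + 1) I.1 h).trans ?_
      rw [length]
      have : (0 : ℝ) ≤ 2 * (2 ^ (k + 1))⁻¹ := by positivity
      linarith
    · rw [Finset.sum_eq_zero]
      · exact I.length_pos.le
      · intro j hj
        rw [Finset.mem_range] at hj
        rw [ind_of_not (by push_cast at h; omega), zero_mul]
  have h3 := Real.sqrt_pos.mpr I.length_pos
  have h4 : |stack I₀ k 0 I| ≤ √I.length := by
    refine h1.trans ?_
    rw [← div_eq_mul_inv, div_le_iff₀ h3, Real.mul_self_sqrt I.length_pos.le]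
    exact h2
  calc stack I₀ k 0 I ^ 2 = |stack I₀ k 0 I| ^ 2 := (sq_abs _).symm
    _ ≤ √I.length ^ 2 := pow_le_pow_left₀ (abs_nonneg _) h4 2
    _ = I.length := Real.sq_sqrt I.length_pos.le

end DyadicInterval

lemma unit_subset_Icc : toSet (0, 0) ⊆ Set.Icc (0 : ℝ) 1 := by
  intro x hx
  simp only [toSet, DyadicInterval.length, Set.mem_Ico] at hx
  norm_num at hx
  exact ⟨hx.1, hx.2.le⟩

lemma haarType_eq_zero_of_not_mem {Q : DyadicRect} (hQ : Q.toSet ⊆ unitRect.toSet)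
    (e : Fin 2 × Fin 2) {x : ℝ × ℝ} (hx : x ∉ Set.Icc (0 : ℝ) 1 ×ˢ Set.Icc (0 : ℝ) 1) :
    Q.haarType e x = 0 :=
  Q.haarType_eq_zero e fun h => hx ⟨unit_subset_Icc (hQ h).1, unit_subset_Icc (hQ h).2⟩

/-- The test functions adapted to a dyadic rectangle: their means over the subrectangles are
large. -/
lemma exists_test_function (𝕜 : Type*) [RCLike 𝕜] {S : DyadicRect}
    (hS : S.toSet ⊆ unitRect.toSet) {k : ℕ × ℕ} (h1 : S.1.1 = k.1) (h2 : S.2.1 = k.2) : ∃ b : ℝ × ℝ → 𝕜, MemBMOUnit b ∧ bmoNorm b ≤ 2 ∧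
      ∀ R : DyadicRect, R.toSet ⊆ S.toSet →
        pairing (1, 1) b R = (((k.1 + 1) * (k.2 + 1) : ℝ) : 𝕜) := by
  classical
  set s := Finset.range (k.1 + 1) ×ˢ Finset.range (k.2 + 1) with hs
  set Q : ℕ × ℕ → DyadicRect := fun p => (anc p.1 S.1, anc p.2 S.2) with hQ
  set c : ℕ × ℕ → 𝕜 := fun p => ((((2 : ℝ) ^ p.1)⁻¹ * ((2 : ℝ) ^ p.2)⁻¹ : ℝ) : 𝕜) with hc
  set b : ℝ × ℝ → 𝕜 := fun x => ∑ p ∈ s, c p * (((Q p).haarType (1, 1) x : ℝ) : 𝕜) with hb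
  have hpair : ∀ e R, pairing e b R = ((stack S.1 k.1 e.1 R.1 * stack S.2 k.2 e.2 R.2 : ℝ) : 𝕜) := by
    intro e R
    rw [hb, pairing_finset_sum, stack, stack, Finset.sum_mul_sum, ← Finset.sum_product',
      RCLike.ofReal_sum]
    refine Finset.sum_congr rfl fun p _ => ?_
    rw [hc, ← RCLike.ofReal_mul]
    congr 1
    ring
  have hmem : MemLp b 2 volume :=
    memLp_finsetSum _ fun p _ => (memLp_haarType 𝕜 (1, 1) (Q p)).const_mul (c p)
  have hsub := DyadicRect.subset_iff.mp hS
  have hQu : ∀ p ∈ s, (Q p).toSet ⊆ unitRect.toSet := fun p hp => by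
    rw [hs, Finset.mem_product, Finset.mem_range, Finset.mem_range] at hp
    refine DyadicRect.subset_iff.mpr ⟨?_, ?_⟩
    · exact subset_of_mem (I := (0, 0)) (Int.natCast_nonneg _) (hsub.1 S.1.toSet_nonempty)
        (subset_anc (by rw [h1]; omega) S.1.toSet_nonempty)
    · exact subset_of_mem (I := (0, 0)) (Int.natCast_nonneg _) (hsub.2 S.2.toSet_nonempty)
        (subset_anc (by rw [h2]; omega) S.2.toSet_nonempty)
  -- Only rectangles whose sides contain those of `S` have nonzero coefficients, with square at most
  -- the area.
  have hnorm : bmoNorm b ≤ 2 := by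
    refine seqBMONorm_le_of_seqCarl (K := 2) fun E hE hv 𝓖 h𝓖 => ?_
    set 𝓗 := 𝓖.filter fun R => S.1.toSet ⊆ R.1.toSet ∧ S.2.toSet ⊆ R.2.toSet with h𝓗
    have hle : ∑ R ∈ 𝓖, ‖haarCoeff b R‖ ^ 2 ≤ ∑ R ∈ 𝓗, R.area := by
      rw [h𝓗, Finset.sum_filter]
      refine Finset.sum_le_sum fun R _ => ?_
      rw [haarCoeff, hpair, RCLike.norm_ofReal, sq_abs, mul_pow]
      split_ifs with h
      · exact mul_le_mul (stack_zero_sq_le _ _ _) (stack_zero_sq_le _ _ _) (sq_nonneg _)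
          R.1.length_pos.le
      · refine le_of_eq ?_
        by_contra hne
        have hne1 := left_ne_zero_of_mul hne
        have hne2 := right_ne_zero_of_mul hne
        exact h ⟨subset_of_stack_ne_zero h1 fun h0 => hne1 (by rw [h0]; ring),
          subset_of_stack_ne_zero h2 fun h0 => hne2 (by rw [h0]; ring)⟩
    -- The products of the halves not containing the sides of `S` are pairwise disjoint, lie in `E`
    -- and have a quarter of the area. Hence the areas sum to at most `4 |E|`, and the norm is at
    -- most 2.
    set f : DyadicRect → DyadicRect := fun R => (sib S.1 R.1, sib S.2 R.2) with hf
    have hvol := sum_toReal_volume_le (s := 𝓗) (f := fun R => (f R).toSet) hv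
      (fun R _ => DyadicRect.measurableSet_toSet _)
      (fun R hR => (DyadicRect.subset_iff.mpr ⟨sib_subset _ _, sib_subset _ _⟩).trans
        (h𝓖 R (Finset.mem_filter.mp hR).1)) (fun R hR R' hR' hne => by
          refine Set.disjoint_left.mpr fun x hx hx' => hne ?_
          have hR1 := (Finset.mem_filter.mp hR).2
          have hR2 := (Finset.mem_filter.mp hR').2
          exact Prod.ext (eq_of_mem_sib hR1.1 hR2.1 hx.1 hx'.1)
            (eq_of_mem_sib hR1.2 hR2.2 hx.2 hx'.2))
    have harea : ∀ R, (volume (f R).toSet).toReal = R.area / 4 := fun R => by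
      rw [DyadicRect.toReal_volume_toSet, DyadicRect.area, hf, length_sib, length_sib,
        DyadicRect.area]
      ring
    simp only [harea] at hvol
    rw [← Finset.sum_div] at hvol
    refine hle.trans ?_
    push_cast
    linarith
  refine ⟨b, ⟨⟨fun K _ => hmem.restrict K, hnorm.trans_lt (by norm_num)⟩, ?_⟩, hnorm,
    fun R hR => ?_⟩
  · refine Filter.Eventually.of_forall fun x hx => Finset.sum_eq_zero fun p hp => ?_
    rw [haarType_eq_zero_of_not_mem (hQu p hp) _ hx, RCLike.ofReal_zero, mul_zero]
  · have := DyadicRect.subset_iff.mp hR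
    rw [hpair, stack_one h1 this.1, stack_one h2 this.2]

/-- By orthonormality only the term `R = Q` of the series survives. -/
lemma IsParaproduct.haarCoeff_zero_zero {φ b g : ℝ × ℝ → 𝕜} (h : IsParaproduct (0, 0) φ b g)
    (Q : DyadicRect) : haarCoeff g Q = haarCoeff φ Q * pairing (1, 1) b Q := by
  have h1 := h.2 Q
  have h0 : ∀ R, R ≠ Q → haarCoeff φ R * pairing (dualType (0, 0)) b R *
      haarCoeff (fun x => ((R.haarType (0, 0) x : ℝ) : 𝕜)) Q = 0 := fun R hR => by
    rw [haarCoeff, haarCoeff, pairing_haarType]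
    have : R.1 ≠ Q.1 ∨ R.2 ≠ Q.2 := by
      by_contra hn; push Not at hn; exact hR (Prod.ext hn.1 hn.2)
    rcases this with h1 | h1
    · rw [ip_zero_zero_of_ne h1]; simp
    · rw [ip_zero_zero_of_ne (I := R.2) h1]; simp
  rw [h1.unique (hasSum_single Q h0), haarCoeff, haarCoeff, pairing_haarType, ip_zero_zero_self,
    ip_zero_zero_self]
  simp [dualType]

/-- On subrectangles of `S` the test function multiplies every coefficient of the symbol by the same
factor, which is divided out. -/
lemma ParaproductBound.sum_sq_le {φ : ℝ × ℝ → 𝕜} {D : ℝ≥0} (h : ParaproductBound (0, 0) φ D)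
    {S : DyadicRect} (hS : S.toSet ⊆ unitRect.toSet) {k : ℕ × ℕ} (h1 : S.1.1 = k.1)
    (h2 : S.2.1 = k.2) {E : Set (ℝ × ℝ)} (hE : MeasurableSet E) (hv : volume E < ∞)
    {𝓖 : Finset DyadicRect} (h𝓖 : ∀ R ∈ 𝓖, R.toSet ⊆ E) (h𝓖S : ∀ R ∈ 𝓖, R.toSet ⊆ S.toSet) :
    ∑ R ∈ 𝓖, ‖haarCoeff φ R‖ ^ 2
      ≤ (2 * D / ((k.1 + 1) * (k.2 + 1)) : ℝ) ^ 2 * (volume E).toReal := by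
  obtain ⟨b, hb, hb2, hbp⟩ := exists_test_function 𝕜 hS h1 h2
  obtain ⟨g, hg, -, hgb⟩ := h b hb
  have hw : (0 : ℝ) < (k.1 + 1) * (k.2 + 1) := by positivity
  have h3 : bmoNorm g ≤ ((D * 2 : ℝ≥0) : ℝ≥0∞) := by
    push_cast; exact hgb.trans (by gcongr)
  have h4 := seqCarl_of_seqBMONorm_le h3 E hE hv 𝓖 h𝓖
  have h5 : ∑ R ∈ 𝓖, ‖haarCoeff g R‖ ^ 2
      = (∑ R ∈ 𝓖, ‖haarCoeff φ R‖ ^ 2) * (((k.1 + 1) * (k.2 + 1) : ℝ)) ^ 2 := by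
    rw [Finset.sum_mul]
    refine Finset.sum_congr rfl fun R hR => ?_
    rw [hg.haarCoeff_zero_zero, hbp R (h𝓖S R hR), norm_mul, RCLike.norm_ofReal, mul_pow, sq_abs]
  simp only at h4
  rw [h5, ← le_div_iff₀ (by positivity)] at h4
  refine h4.trans (le_of_eq ?_)
  push_cast
  field_simp

/-- The necessity of the LMO condition. -/
theorem ParaproductBound.lmoBound {φ : ℝ × ℝ → 𝕜} (hφ : MemL20Unit φ) {D : ℝ≥0}
    (h : ParaproductBound (0, 0) φ D) : LMOBound (0, 0) φ (2 * D) := by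
  classical
  intro k
  refine seqBMONorm_le_of_seqCarl fun E hE hv 𝓖 h𝓖 => ?_
  have hw : ((2 * D / lmoWeight (0, 0) k : ℝ≥0) : ℝ) = 2 * D / ((k.1 + 1) * (k.2 + 1)) := by
    simp [lmoWeight]
  rw [hw]
  set 𝓗 := 𝓖.filter fun R => projCoeff (0, 0) k φ R ≠ 0 with h𝓗
  -- Rectangles are grouped by their ancestor of generation `k`. Ancestors of the same generation
  -- are disjoint, so the localized bounds on `E ∩ S` add up.
  set f : DyadicRect → DyadicRect := fun R => (anc k.1 R.1, anc k.2 R.2) with hf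
  have hH : ∀ R ∈ 𝓗, R.toSet ⊆ unitRect.toSet ∧ R.toSet ⊆ (f R).toSet ∧
      projCoeff (0, 0) k φ R = haarCoeff φ R := fun R hR => by
    have h0 := (Finset.mem_filter.mp hR).2
    rw [projCoeff] at h0 ⊢
    by_cases hk : ((0 : Fin 2) = 0 → (k.1 : ℤ) ≤ DyadicInterval.gen R.1) ∧
        ((0 : Fin 2) = 0 → (k.2 : ℤ) ≤ DyadicInterval.gen R.2)
    · rw [if_pos hk] at h0 ⊢
      exact ⟨hφ.subset_of_haarCoeff_ne_zero h0,
        DyadicRect.subset_iff.mpr ⟨subset_anc (hk.1 rfl), subset_anc (hk.2 rfl)⟩, rfl⟩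
    · rw [if_neg hk] at h0; exact absurd rfl h0
  have hfU : ∀ R ∈ 𝓗, (f R).toSet ⊆ unitRect.toSet := fun R hR => by
    obtain ⟨h1, h2, -⟩ := hH R hR
    obtain ⟨x, hx⟩ := R.toSet_nonempty
    exact DyadicRect.subset_iff.mpr
      ⟨subset_of_mem (I := (0, 0)) (Int.natCast_nonneg _) (h1 hx).1 (h2 hx).1,
        subset_of_mem (I := (0, 0)) (Int.natCast_nonneg _) (h1 hx).2 (h2 hx).2⟩
  have e1 : ∑ R ∈ 𝓖, ‖projCoeff (0, 0) k φ R‖ ^ 2 = ∑ R ∈ 𝓗, ‖haarCoeff φ R‖ ^ 2 := by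
    rw [h𝓗, ← Finset.sum_filter_add_sum_filter_not 𝓖 fun R => projCoeff (0, 0) k φ R ≠ 0,
      Finset.sum_eq_zero (s := 𝓖.filter fun R => ¬ projCoeff (0, 0) k φ R ≠ 0), add_zero]
    · exact Finset.sum_congr rfl fun R hR => by rw [(hH R hR).2.2]
    · intro R hR
      rw [not_ne_iff.mp (Finset.mem_filter.mp hR).2]; simp
  refine e1.trans_le ?_
  rw [← Finset.sum_fiberwise_of_maps_to (g := f) (t := 𝓗.image f)
    fun R hR => Finset.mem_image_of_mem f hR]
  have hvol := sum_toReal_volume_le (s := 𝓗.image f) (f := fun S => E ∩ S.toSet) hv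
    (fun S _ => hE.inter (DyadicRect.measurableSet_toSet S)) (fun S _ => Set.inter_subset_left)
    (fun S hS S' hS' hne => by
      obtain ⟨R, -, rfl⟩ := Finset.mem_image.mp hS
      obtain ⟨R', -, rfl⟩ := Finset.mem_image.mp hS'
      refine Set.disjoint_left.mpr fun x hx hx' => hne ?_
      exact Prod.ext (eq_of_mem rfl hx.2.1 hx'.2.1) (eq_of_mem rfl hx.2.2 hx'.2.2))
  refine (Finset.sum_le_sum fun S hS => ?_).trans
    ((Finset.mul_sum _ _ _).symm.trans_le (mul_le_mul_of_nonneg_left hvol (sq_nonneg _)))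
  obtain ⟨R₀, hR₀, rfl⟩ := Finset.mem_image.mp hS
  refine h.sum_sq_le (hfU R₀ hR₀) rfl rfl (hE.inter (DyadicRect.measurableSet_toSet _))
    ((measure_mono Set.inter_subset_left).trans_lt hv) (fun R hR => ?_) fun R hR => ?_
  all_goals
    rw [Finset.mem_filter] at hR
    have h3 := (hH R hR.1).2.1
    rw [hR.2] at h3
  · exact Set.subset_inter (h𝓖 R (Finset.mem_filter.mp hR.1).1) h3
  · exact h3

end

end DyadicParaproduct

/-! ### An extremal family, the necessity of the BMO condition, and operator norms. -/

namespace DyadicParaproduct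

noncomputable section

open CellFiltration DyadicInterval

variable {𝕜 : Type*} [RCLike 𝕜]

/-- A nonnegative combination of normalized indicators of rectangles, whose Haar coefficients
satisfy the Carleson condition, has a large support. -/
lemma sq_sum_le_of_seqCarl {𝓢 : Finset DyadicRect} (h𝓢 : ∀ R ∈ 𝓢, R.toSet ⊆ unitRect.toSet)
    (c : DyadicRect → ℝ) {K : ℝ} (hK : 0 ≤ K)
    (hc : SeqCarl (fun Q => ‖haarCoeff (fun x => ∑ R ∈ 𝓢, c R * R.haarType (1, 1) x) Q‖ ^ 2) K) :
    (∑ R ∈ 𝓢, c R) ^ 2 ≤ 2 ^ 21 * K * (volume (⋃ R ∈ 𝓢, R.toSet)).toReal ^ 2 := by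
  obtain ⟨N₀, hN₀⟩ := exists_unitRect h𝓢
  -- The root has generation -3, so the leaves have generation `N₀`, finer than every rectangle of
  -- the family, and each leaf lies inside or outside each of them.
  set N := N₀ + 3 with hN
  set U : Set (ℝ × ℝ) := ⋃ R ∈ 𝓢, R.toSet with hU
  set w : ℝ × ℝ → ℝ := fun x => ∑ R ∈ 𝓢, c R * R.haarType (1, 1) x with hw
  have hwi : RectIntegrable w := .of_memLp <|
    memLp_finsetSum _ fun R _ => (memLp_haarType ℝ (1, 1) R).const_mul (c R)
  set F := means (ContinuousLinearMap.id ℝ ℝ) w with hF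
  have hFM : BiMart F := biMart_means _ hwi
  have hFeq : ∀ Q, F Q = ∑ R ∈ 𝓢, c R * (ip 1 R.1 1 Q.1 * ip 1 R.2 1 Q.2) := fun Q =>
    pairing_finset_sum (𝕜 := ℝ) (e' := (1, 1)) 𝓢 c (fun R => R) (1, 1) Q
  have hcarl : SeqCarl (fun R => R.area * dif1 (dif2 F) R ^ 2) K :=
    hc.mono fun R => area_mul_sq_le _ (fun z => le_rfl) hwi R
  have hUsub : U ⊆ unitRect.toSet := Set.iUnion₂_subset h𝓢
  have hUv : volume U < ∞ := (measure_mono hUsub).trans_lt (DyadicRect.volume_toSet_lt_top _)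
  have hsupp : ∀ x y : Fin N → Bool, F (nodes (-3) x y N N) ≠ 0 →
      (nodes (-3) x y N N).toSet ⊆ U := fun x y hxy => by
    rw [hFeq] at hxy
    obtain ⟨R, hR, hR0⟩ := Finset.exists_ne_zero_of_sum_ne_zero hxy
    have h1 := right_ne_zero_of_mul hR0
    have hg := hN₀ R hR
    refine Set.Subset.trans (DyadicRect.subset_iff.mpr ⟨?_, ?_⟩)
      (Set.subset_biUnion_of_mem (u := fun R : DyadicRect => R.toSet) hR)
    · refine ip_one_one_ne_zero ?_ (by rw [ip_comm]; exact left_ne_zero_of_mul h1)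
      rw [nodes, gen_node le_rfl, hN]; push_cast; have := hg.2.1; omega
    · refine ip_one_one_ne_zero ?_ (by rw [ip_comm]; exact right_ne_zero_of_mul h1)
      rw [nodes, gen_node le_rfl, hN]; push_cast; have := hg.2.2; omega
  have hmain := sum_disc_sq_le hFM hK hcarl hUsub (N := N) (by omega) hsupp
  set G := disc (-3) N F with hG
  have hL := leafArea_pos (-3) N
  -- The root square has area 64, and every normalized indicator has integral 1.
  have hroot : F ((-3, 0), (-3, 0)) = (∑ R ∈ 𝓢, c R) / 64 := by
    rw [hFeq, Finset.sum_div]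
    refine Finset.sum_congr rfl fun R hR => ?_
    have hsub : ∀ I : DyadicInterval, I.toSet ⊆ toSet (0, 0) → I.toSet ⊆ toSet (-3, 0) :=
      fun I hI => hI.trans fun x hx => by
        simp only [toSet, DyadicInterval.length, Set.mem_Ico] at hx ⊢
        norm_num at hx ⊢
        exact ⟨hx.1, by linarith⟩
    have h := DyadicRect.subset_iff.mp (h𝓢 R hR)
    have hlen : DyadicInterval.length (-3, 0) = 8 := by norm_num [DyadicInterval.length]
    rw [ip_one_one_of_subset (hsub _ h.1), ip_one_one_of_subset (hsub _ h.2), hlen]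
    norm_num
    ring
  have hsum : leafArea (-3) N * ∑ x, ∑ y, G x y = ∑ R ∈ 𝓢, c R := by
    rw [← sum_EE (tree N) (tree N) 0 0 G]
    simp only [hG, EE_disc hFM (Nat.zero_le N) (Nat.zero_le N)]
    have : ∀ x y : Fin N → Bool, F (nodes (-3) x y 0 0) = (∑ R ∈ 𝓢, c R) / 64 := fun x y => hroot
    simp only [this, Finset.sum_const, Finset.card_univ, Fintype.card_fun, Fintype.card_bool,
      Fintype.card_fin, nsmul_eq_mul, leafArea]
    push_cast
    have h2 : (2 : ℝ) ^ N ≠ 0 := by positivity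
    field_simp
    norm_num
    ring
  -- The Cauchy–Schwarz inequality on the support.
  have hCS : (∑ x, ∑ y, G x y) ^ 2 ≤ size (leavesIn (-3) N U) * ∑ x, ∑ y, G x y ^ 2 := by
    have h1 : ∀ x y, G x y = ind ((x, y) ∈ leavesIn (-3) N U) * G x y := fun x y => by
      by_cases h : G x y = 0
      · rw [h, mul_zero]
      · rw [ind_of (show (x, y) ∈ leavesIn (-3) N U from hsupp x y h), one_mul]
    have h2 := Finset.sum_mul_sq_le_sq_mul_sq
      ((Finset.univ : Finset (Fin N → Bool)) ×ˢ (Finset.univ : Finset (Fin N → Bool)))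
      (fun z => ind (z ∈ leavesIn (-3) N U)) (fun z => G z.1 z.2)
    simp only [ind_sq] at h2
    rw [Finset.sum_product, Finset.sum_product, Finset.sum_product] at h2
    simp only [← h1] at h2
    exact h2
  have hsize := size_leavesIn_le (r := -3) (N := N) hUv
  have hA0 := size_nonneg (leavesIn (-3) N U)
  have hS0 : 0 ≤ ∑ x, ∑ y, G x y ^ 2 :=
    Finset.sum_nonneg fun _ _ => Finset.sum_nonneg fun _ _ => sq_nonneg _
  calc (∑ R ∈ 𝓢, c R) ^ 2 = leafArea (-3) N ^ 2 * (∑ x, ∑ y, G x y) ^ 2 := by rw [← hsum]; ring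
    _ ≤ leafArea (-3) N ^ 2 * (size (leavesIn (-3) N U) * ∑ x, ∑ y, G x y ^ 2) := by gcongr
    _ = (size (leavesIn (-3) N U) * leafArea (-3) N) * (leafArea (-3) N * ∑ x, ∑ y, G x y ^ 2) := by
        ring
    _ ≤ (volume U).toReal * (2 ^ 21 * K * (volume U).toReal) :=
        mul_le_mul hsize hmain (mul_nonneg hL.le hS0) ENNReal.toReal_nonneg
    _ = _ := by ring

lemma haarCoeff_haarSum (𝓠 : Finset DyadicRect) (c : DyadicRect → 𝕜) (R : DyadicRect) :
    haarCoeff (haarSum 𝓠 c) R = open Classical in if R ∈ 𝓠 then c R else 0 := by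
  classical
  have h1 : ∀ Q, c Q * ((ip 0 Q.1 0 R.1 * ip 0 Q.2 0 R.2 : ℝ) : 𝕜) = if R = Q then c Q else 0 := by
    intro Q
    split_ifs with h
    · rw [h, ip_zero_zero_self, ip_zero_zero_self]; simp
    · have : Q.1 ≠ R.1 ∨ Q.2 ≠ R.2 := by
        by_contra hn; push Not at hn; exact h (Prod.ext hn.1 hn.2).symm
      rcases this with h1 | h1
      · rw [ip_zero_zero_of_ne h1]; simp
      · rw [ip_zero_zero_of_ne (I := Q.2) h1]; simp
  refine (pairing_finset_sum 𝓠 c (fun Q => Q) (0, 0) R).trans ?_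
  simp only [h1]
  rw [Finset.sum_ite_eq]

/-- The test function made of the Haar coefficients of the symbol. -/
lemma ParaproductBound.sum_le_of_extremal {φ : ℝ × ℝ → 𝕜} {D : ℝ≥0}
    (h : ParaproductBound (1, 1) φ D) {𝓢 : Finset DyadicRect}
    (h𝓢 : ∀ R ∈ 𝓢, R.toSet ⊆ unitRect.toSet) {q : ℝ} (hq : 0 ≤ q)
    (hsub : ∀ 𝓣 ⊆ 𝓢, ∑ R ∈ 𝓣, ‖haarCoeff φ R‖ ^ 2 ≤ q * (volume (⋃ R ∈ 𝓣, R.toSet)).toReal) :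
    (∑ R ∈ 𝓢, ‖haarCoeff φ R‖ ^ 2) ^ 2
      ≤ 2 ^ 21 * (D ^ 2 * q) * (volume (⋃ R ∈ 𝓢, R.toSet)).toReal ^ 2 := by
  classical
  -- Conjugate coefficients turn the products with those of the symbol into the nonnegative numbers
  -- `‖haarCoeff φ R‖ ^ 2`, so no cancellation occurs in the image.
  set b : ℝ × ℝ → 𝕜 := haarSum 𝓢 fun R => (starRingEnd 𝕜) (haarCoeff φ R) with hb
  have hbc : ∀ R, haarCoeff b R = if R ∈ 𝓢 then (starRingEnd 𝕜) (haarCoeff φ R) else 0 := fun R => by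
    rw [hb, haarCoeff_haarSum]
  have hbcarl : SeqCarl (fun R => ‖haarCoeff b R‖ ^ 2) q := by
    intro E hE hv 𝓖 h𝓖
    have e : ∑ R ∈ 𝓖, ‖haarCoeff b R‖ ^ 2 = ∑ R ∈ 𝓖.filter (· ∈ 𝓢), ‖haarCoeff φ R‖ ^ 2 := by
      rw [Finset.sum_filter]
      refine Finset.sum_congr rfl fun R _ => ?_
      rw [hbc]
      split_ifs
      · rw [RCLike.norm_conj]
      · simp
    rw [e]
    refine (hsub _ fun R hR => (Finset.mem_filter.mp hR).2).trans (mul_le_mul_of_nonneg_left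
      (ENNReal.toReal_mono hv.ne (measure_mono (Set.iUnion₂_subset fun R hR => ?_))) hq)
    exact h𝓖 R (Finset.mem_filter.mp hR).1
  set B : ℝ≥0 := ⟨√q, Real.sqrt_nonneg q⟩ with hB
  have hB2 : (B : ℝ) ^ 2 = q := Real.sq_sqrt hq
  have hbn : bmoNorm b ≤ B := seqBMONorm_le_of_seqCarl (by rw [hB2]; exact hbcarl)
  have hbm : MemBMOUnit b := by
    refine ⟨⟨fun K _ => (memLp_haarSum _ _).restrict K, hbn.trans_lt ENNReal.coe_lt_top⟩, ?_⟩
    refine Filter.Eventually.of_forall fun x hx => Finset.sum_eq_zero fun R hR => ?_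
    rw [haarType_eq_zero_of_not_mem (h𝓢 R hR) _ hx, RCLike.ofReal_zero, mul_zero]
  obtain ⟨g, hg, -, hgb⟩ := h b hbm
  have hgn : bmoNorm g ≤ ((D * B : ℝ≥0) : ℝ≥0∞) := by push_cast; exact hgb.trans (by gcongr)
  have hgc := seqCarl_of_seqBMONorm_le hgn
  refine sq_sum_le_of_seqCarl h𝓢 _ (by positivity) ?_
  refine (hgc.mono_const (le_of_eq (by push_cast; rw [mul_pow, hB2]))).mono fun Q => le_of_eq ?_
  -- The function `b` has finitely many nonzero Haar coefficients, so the series is a finite sum.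
  have h1 := (hg.2 Q).unique (hasSum_sum_of_ne_finset_zero (s := 𝓢) fun R hR => by
    have h0 : pairing (dualType (1, 1)) b R = 0 := (hbc R).trans (if_neg hR)
    rw [h0, mul_zero, zero_mul])
  rw [h1]
  have h2 : ∑ R ∈ 𝓢, haarCoeff φ R * pairing (dualType (1, 1)) b R *
      haarCoeff (fun x => ((R.haarType (1, 1) x : ℝ) : 𝕜)) Q
      = ((haarCoeff (fun x => ∑ R ∈ 𝓢, ‖haarCoeff φ R‖ ^ 2 * R.haarType (1, 1) x) Q : ℝ) : 𝕜) := by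
    have h3 := pairing_finset_sum (𝕜 := ℝ) (e' := (1, 1)) 𝓢 (fun R => ‖haarCoeff φ R‖ ^ 2)
      (fun R => R) (0, 0) Q
    simp only [RCLike.ofReal_real_eq_id, id_eq] at h3
    rw [haarCoeff, h3, RCLike.ofReal_sum]
    refine Finset.sum_congr rfl fun R hR => ?_
    have h0 : pairing (dualType (1, 1)) b R = (starRingEnd 𝕜) (haarCoeff φ R) :=
      (hbc R).trans (if_pos hR)
    rw [h0, RCLike.mul_conj]
    simp only [haarCoeff]
    rw [pairing_haarType]
    push_cast
    rfl
  rw [h2, RCLike.norm_ofReal, Real.norm_eq_abs]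

/-- The necessity of the BMO condition. -/
theorem ParaproductBound.bmoNorm_le {φ : ℝ × ℝ → 𝕜} (hφ : MemL20Unit φ) {D : ℝ≥0}
    (h : ParaproductBound (1, 1) φ D) : bmoNorm φ ≤ ((2 ^ 11 * D : ℝ≥0) : ℝ≥0∞) := by
  classical
  refine seqBMONorm_le_of_seqCarl fun E hE hv 𝓖 h𝓖 => ?_
  set c : DyadicRect → ℝ := fun R => ‖haarCoeff φ R‖ ^ 2 with hc
  set v : Finset DyadicRect → ℝ := fun 𝓢 => (volume (⋃ R ∈ 𝓢, R.toSet)).toReal with hvdef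
  set 𝓕 := 𝓖.filter fun R => haarCoeff φ R ≠ 0 with h𝓕
  have h𝓕u : ∀ R ∈ 𝓕, R.toSet ⊆ unitRect.toSet := fun R hR =>
    hφ.subset_of_haarCoeff_ne_zero (Finset.mem_filter.mp hR).2
  -- The extremal family: by maximality every subfamily satisfies the Carleson bound with the same
  -- `q`, with equality for the family itself.
  obtain ⟨𝓢, h𝓢, hmax⟩ := Finset.exists_max_image 𝓕.powerset (fun 𝓢 => (∑ R ∈ 𝓢, c R) / v 𝓢)
    ⟨∅, Finset.empty_mem_powerset _⟩
  rw [Finset.mem_powerset] at h𝓢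
  set q := (∑ R ∈ 𝓢, c R) / v 𝓢 with hq
  have hq0 : 0 ≤ q := div_nonneg (Finset.sum_nonneg fun R _ => sq_nonneg _) ENNReal.toReal_nonneg
  have hvpos : ∀ 𝓣 ⊆ 𝓕, 𝓣.Nonempty → 0 < v 𝓣 := fun 𝓣 h𝓣 ⟨R, hR⟩ => by
    have h1 : volume (⋃ R ∈ 𝓣, R.toSet) < ∞ :=
      (measure_mono (Set.iUnion₂_subset fun R hR => h𝓕u R (h𝓣 hR))).trans_lt
        (DyadicRect.volume_toSet_lt_top _)
    have h2 := ENNReal.toReal_mono h1.ne (measure_mono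
      (Set.subset_biUnion_of_mem (u := fun R : DyadicRect => R.toSet) (s := (𝓣 : Set _)) hR))
    rw [DyadicRect.toReal_volume_toSet] at h2
    exact R.area_pos.trans_le h2
  have hle : ∀ 𝓣 ⊆ 𝓕, ∑ R ∈ 𝓣, c R ≤ q * v 𝓣 := fun 𝓣 h𝓣 => by
    rcases 𝓣.eq_empty_or_nonempty with rfl | hne
    · rw [Finset.sum_empty]; exact mul_nonneg hq0 ENNReal.toReal_nonneg
    · exact (div_le_iff₀ (hvpos 𝓣 h𝓣 hne)).mp (hmax 𝓣 (Finset.mem_powerset.mpr h𝓣))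
  have hqD : q ≤ 2 ^ 21 * (D : ℝ) ^ 2 := by
    rcases 𝓢.eq_empty_or_nonempty with h0 | hne
    · rw [hq, h0, Finset.sum_empty, zero_div]; positivity
    · have hpos := hvpos 𝓢 h𝓢 hne
      have h1 := h.sum_le_of_extremal (fun R hR => h𝓕u R (h𝓢 hR)) hq0
        (fun 𝓣 h𝓣 => hle 𝓣 (h𝓣.trans h𝓢))
      have h2 : ∑ R ∈ 𝓢, ‖haarCoeff φ R‖ ^ 2 = q * v 𝓢 := (div_mul_cancel₀ _ hpos.ne').symm
      rw [h2, mul_pow] at h1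
      -- The estimate for the extremal family reads `q ^ 2 ≤ 2 ^ 21 * (D ^ 2 * q)`, and one factor
      -- `q` cancels.
      have h3 := le_of_mul_le_mul_right h1 (by positivity)
      rcases hq0.eq_or_lt with hq1 | hq1
      · rw [← hq1]; positivity
      · refine le_of_mul_le_mul_right (le_trans (le_of_eq (sq q).symm) (h3.trans ?_)) hq1
        rw [mul_assoc]
  have e : ∑ R ∈ 𝓖, ‖haarCoeff φ R‖ ^ 2 = ∑ R ∈ 𝓕, c R := by
    rw [h𝓕, Finset.sum_filter]
    refine Finset.sum_congr rfl fun R _ => ?_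
    split_ifs with h0
    · rfl
    · rw [not_ne_iff.mp h0]; simp
  refine e.trans_le ((hle 𝓕 subset_rfl).trans (mul_le_mul ?_ ?_ ENNReal.toReal_nonneg
    (by positivity)))
  · refine hqD.trans ?_
    push_cast
    nlinarith [sq_nonneg (D : ℝ)]
  · exact ENNReal.toReal_mono hv.ne (measure_mono (Set.iUnion₂_subset fun R hR =>
      h𝓖 R (Finset.mem_filter.mp hR).1))

/-- The coefficients live on subrectangles of the unit square, whose generations are nonnegative, so
the restriction at level 0 is void. -/
lemma projCoeff_zero {β : Fin 2 × Fin 2} {φ : ℝ × ℝ → 𝕜} (hφ : MemL20Unit φ) :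
    projCoeff β (0, 0) φ = haarCoeff φ := by
  ext R
  rw [projCoeff]
  split_ifs with h
  · rfl
  · by_contra hne
    have hsub := hφ.subset_of_haarCoeff_ne_zero (Ne.symm hne)
    obtain ⟨i, hi, j, hj, x, y, hxy⟩ := exists_nodes (N := R.1.1.toNat + R.2.1.toNat + 1) hsub
      (by push_cast; omega) (by push_cast; omega)
    have h1 : R.1.1 = 0 + i := (congrArg (fun S : DyadicRect => S.1.1) hxy).trans (gen_node hi.le x)
    have h2 : R.2.1 = 0 + j := (congrArg (fun S : DyadicRect => S.2.1) hxy).trans (gen_node hj.le y)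
    exact h ⟨fun _ => by simp only [DyadicInterval.gen]; push_cast; omega,
      fun _ => by simp only [DyadicInterval.gen]; push_cast; omega⟩

/-- Dividing by the constant reduces the claim to each admissible `K` in the infimum; an empty
infimum is covered as well. -/
lemma paraproductNorm_le {β : Fin 2 × Fin 2} {φ : ℝ × ℝ → 𝕜} {C : ℝ≥0} (hC : C ≠ 0)
    (h : ∀ K, LMOBound β φ K → ParaproductBound β φ (C * K)) :
    paraproductNorm β φ ≤ C * lmoNorm β φ := by
  have hC' : (C : ℝ≥0∞) ≠ 0 := by simpa using hC
  rw [← ENNReal.div_le_iff' hC' ENNReal.coe_ne_top]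
  refine le_iInf₂ fun K hK => ?_
  rw [ENNReal.div_le_iff' hC' ENNReal.coe_ne_top, ← ENNReal.coe_mul]
  exact iInf₂_le (C * K) (h K hK)

lemma le_mul_paraproductNorm {β : Fin 2 × Fin 2} {φ : ℝ × ℝ → 𝕜} {C : ℝ≥0} (hC : C ≠ 0)
    {t : ℝ≥0∞} (h : ∀ K, ParaproductBound β φ K → t ≤ ((C * K : ℝ≥0) : ℝ≥0∞)) :
    t ≤ C * paraproductNorm β φ := by
  have hC' : (C : ℝ≥0∞) ≠ 0 := by simpa using hC
  rw [← ENNReal.div_le_iff' hC' ENNReal.coe_ne_top]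
  refine le_iInf₂ fun K hK => ?_
  rw [ENNReal.div_le_iff' hC' ENNReal.coe_ne_top, ← ENNReal.coe_mul]
  exact h K hK

lemma lmoNorm_one_one (φ : ℝ × ℝ → 𝕜) : lmoNorm (1, 1) φ = bmoNorm φ := by
  refine le_antisymm ?_ (le_iInf₂ fun C hC => lmoBound_one_one_iff.mp hC)
  rcases eq_or_ne (bmoNorm φ) ∞ with h | h
  · rw [h]; exact le_top
  · rw [← ENNReal.coe_toNNReal h]
    exact iInf₂_le _ (lmoBound_one_one_iff.mpr (ENNReal.coe_toNNReal h).ge)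

lemma MemL20Unit.memBMOUnit {φ : ℝ × ℝ → 𝕜} (hφ : MemL20Unit φ) (h : bmoNorm φ < ∞) :
    MemBMOUnit φ := ⟨⟨fun K _ => hφ.1.restrict K, h⟩, hφ.2.1⟩

end

end DyadicParaproduct

/-! ### The theorem. -/

theorem theorem5p1 {𝕜 : Type*} [RCLike 𝕜] :
    ∃ C : ℝ≥0, 0 < C ∧ ∀ φ : ℝ × ℝ → 𝕜, DyadicParaproduct.MemL20Unit φ →
      ((DyadicParaproduct.ParaproductBounded (0, 0) φ ↔ DyadicParaproduct.MemLMOUnit (0, 0) φ) ∧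
        DyadicParaproduct.paraproductNorm (0, 0) φ ≤ C * DyadicParaproduct.lmoNorm (0, 0) φ ∧
        DyadicParaproduct.lmoNorm (0, 0) φ ≤ C * DyadicParaproduct.paraproductNorm (0, 0) φ) ∧
      ((DyadicParaproduct.ParaproductBounded (1, 1) φ ↔ DyadicParaproduct.MemBMOUnit φ) ∧
        DyadicParaproduct.paraproductNorm (1, 1) φ ≤ C * DyadicParaproduct.bmoNorm φ ∧
        DyadicParaproduct.bmoNorm φ ≤ C * DyadicParaproduct.paraproductNorm (1, 1) φ) ∧
      (∀ β : Fin 2 × Fin 2, β ≠ (0, 0) → β ≠ (1, 1) →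
        DyadicParaproduct.MemLMOUnit β φ →
          DyadicParaproduct.ParaproductBounded β φ ∧
          DyadicParaproduct.paraproductNorm β φ ≤ C * DyadicParaproduct.lmoNorm β φ) := by
  -- The constant of the upper bounds; the lower bounds need only 2 and `2 ^ 11`.
  refine ⟨2 ^ 23, by positivity, fun φ hφ => ⟨⟨⟨?_, ?_⟩, ?_, ?_⟩, ⟨⟨?_, ?_⟩, ?_, ?_⟩, ?_⟩⟩
  · rintro ⟨D, hD⟩
    have h1 := hD.lmoBound hφ
    -- The case `k = (0, 0)` of the LMO bound is the BMO bound.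
    have h2 := h1 (0, 0)
    rw [DyadicParaproduct.projCoeff_zero hφ] at h2
    exact ⟨hφ.memBMOUnit (h2.trans_lt ENNReal.coe_lt_top), _, h1⟩
  · rintro ⟨-, K, hK⟩
    exact ⟨_, hK.paraproductBound hφ⟩
  · exact DyadicParaproduct.paraproductNorm_le (by positivity) fun K hK => hK.paraproductBound hφ
  · refine DyadicParaproduct.le_mul_paraproductNorm (by positivity) fun K hK => ?_
    refine (iInf₂_le _ (hK.lmoBound hφ)).trans (ENNReal.coe_le_coe.mpr ?_)
    gcongr
    norm_num
  · rintro ⟨D, hD⟩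
    exact hφ.memBMOUnit ((hD.bmoNorm_le hφ).trans_lt ENNReal.coe_lt_top)
  · intro h
    refine ⟨_, DyadicParaproduct.LMOBound.paraproductBound hφ
      (DyadicParaproduct.lmoBound_one_one_iff.mpr (ENNReal.coe_toNNReal h.1.2.ne).ge)⟩
  · rw [← DyadicParaproduct.lmoNorm_one_one]
    exact DyadicParaproduct.paraproductNorm_le (by positivity) fun K hK => hK.paraproductBound hφ
  · refine DyadicParaproduct.le_mul_paraproductNorm (by positivity) fun K hK => ?_
    refine (hK.bmoNorm_le hφ).trans (ENNReal.coe_le_coe.mpr ?_)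
    gcongr <;> norm_num
  · rintro β - - ⟨-, K, hK⟩
    exact ⟨⟨_, hK.paraproductBound hφ⟩,
      DyadicParaproduct.paraproductNorm_le (by positivity) fun K hK => hK.paraproductBound hφ⟩
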